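/- All manifolds are smooth, finite-dimensional, Hausdorff and second countable. A \emph{dg-manifold} is a $\mathbb Z$-graded manifold (a sheaf of graded-commutative real algebras on a manifold, locally isomorphic to smooth functions of coordinates $x\in U\subseteq\mathbb R^n$ and formal power series in finitely many graded-commuting coordinates of nonzero degrees) with a differential (a derivation of degree $1$ and square zero). Morphisms are morphisms of sheaves of graded algebras over continuous maps, commuting with the differentials. A \emph{dg-Lie groupoid} is a groupoid internal to dg-manifolds whose source and target maps are surjective submersions; with internal functors these form a category. Write $\mathsf s,\mathsf t,\mathsf e$ for source, target and identity, and $a\circ b$ for the composite, which is defined if $\mathsf s(a)=\mathsf t(b)$. For a manifold $M$ and a finite-dimensional Lie algebra $\mathfrak g$, the dg-manifold $T[1]M\times\mathfrak g[1]$ has the functions $\Omega^\bullet(M)\otimes\Lambda^\bullet\mathfrak g^*$ and the differential $\mathrm d_M\otimes\mathrm{id}+\mathrm{id}\otimes\mathrm d_{\mathrm{CE}(\mathfrak g)}$, the sum of the de Rham and the Chevalley--Eilenberg differential; its points are written $(\hat x,\nu)$ with $\hat x\in TM$, $\nu\in\mathfrak g$. Let $\mathsf G$ be a Lie group with Lie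 algebra $\mathfrak g$, let $\sigma:Y\to X$ be a surjective submersion, $Y^{[2]}=Y\times_XY$, and let $g:Y^{[2]}\to\mathsf G$ be the transition functions, subordinate to $\sigma$, of a principal $\mathsf G$-bundle $P$ over $X$, that is, a smooth map with $g_{y_1y_2}g_{y_2y_3}=g_{y_1y_3}$ whenever $\sigma(y_1)=\sigma(y_2)=\sigma(y_3)$. Consider the following. (a) The tangent \v{C}ech groupoid $T[1]\check{\mathscr C}(\sigma)=(T[1]Y^{[2]}\rightrightarrows T[1]Y)$ and the groupoid $T[1]\mathsf{BG}=(T[1]\mathsf G\rightrightarrows *)$, whose structure maps are the differentials of those of the \v{C}ech groupoid $(Y^{[2]}\rightrightarrows Y)$, with $\mathsf t(y_1,y_2)=y_1$, $\mathsf s(y_1,y_2)=y_2$, $(y_1,y_2)\circ(y_2,y_3)=(y_1,y_3)$, and of $\mathsf{BG}=(\mathsf G\rightrightarrows *)$, respectively. (b) The inner action groupoid $\mathscr A(\mathsf{BG})=(\mathfrak g[1]\times T[1]\mathsf G\rightrightarrows\mathfrak g[1])$ with $\mathsf t(\nu;h,\gamma)=\nu$, $\mathsf s(\nu;h,\gamma)=h^{-1}\nu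 h+h^{-1}\gamma$, $(\nu;h_1,\gamma_1)\circ(h_1^{-1}\nu h_1+h_1^{-1}\gamma_1;h_2,\gamma_2)=(\nu;h_1h_2,h_1\gamma_2+\gamma_1h_2)$, $\mathsf e(\nu)=(\nu;1,0)$, $(\nu;h,\gamma)^{-1}=(h^{-1}\nu h+h^{-1}\gamma;h^{-1},-h^{-1}\gamma h^{-1})$. (c) The resolved Atiyah algebroid $\mathscr R_\sigma(\mathfrak{at}(P))=(T[1]Y^{[2]}\times\mathfrak g[1]\rightrightarrows T[1]Y\times\mathfrak g[1])$ with, for $\nu'=g_{y_1y_2}^{-1}\nu g_{y_1y_2}+g_{y_1y_2}^{-1}\mathrm dg_{y_1y_2}$, $\mathsf t(\hat y_1,\hat y_2,\nu)=(\hat y_1,\nu)$, $\mathsf s(\hat y_1,\hat y_2,\nu)=(\hat y_2,\nu')$, $(\hat y_1,\hat y_2,\nu)\circ(\hat y_2,\hat y_3,\nu')=(\hat y_1,\hat y_3,\nu)$, $\mathsf e(\hat y,\nu)=(\hat y,\hat y,\nu)$, $(\hat y_1,\hat y_2,\nu)^{-1}=(\hat y_2,\hat y_1,\nu')$. Then these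 are dg-Lie groupoids, and the formulas $\rho:(\hat y,\nu)\mapsto\hat y$, $(\hat y_1,\hat y_2,\nu)\mapsto(\hat y_1,\hat y_2)$; $\hat g:(\hat y,\nu)\mapsto\nu$, $(\hat y_1,\hat y_2,\nu)\mapsto(\nu;g_{y_1y_2},\mathrm dg_{y_1y_2})$; $\varrho:\nu\mapsto *$, $(\nu;h,\gamma)\mapsto(h,\gamma)$; and $\mathrm dg:\hat y\mapsto *$, $(\hat y_1,\hat y_2)\mapsto(g_{y_1y_2},\mathrm dg_{y_1y_2})$ define functors of dg-Lie groupoids such that the square $$\begin{array}{ccc}\mathscr R_\sigma(\mathfrak{at}(P))&\xrightarrow{\ \hat g\ }&\mathscr A(\mathsf{BG})\\ {\scriptstyle\rho}\downarrow&&\downarrow{\scriptstyle\varrho}\\ T[1]\check{\mathscr C}(\sigma)&\xrightarrow{\ \mathrm dg\ }&T[1]\mathsf{BG}\end{array}$$ commutes and is a pullback in the category of dg-Lie groupoids. -/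

import Mathlib

open scoped Manifold ContDiff Topology
open TopologicalSpace

universe u

noncomputable section

namespace DGAtiyah

/-! ### Differential graded manifolds -/

/-- A topological space with a presheaf of real algebras, each with a family of "homogeneous"
subspaces indexed by `ℤ` and a linear operator `d`.  The laws that make this a differential graded
manifold are collected in `IsDGManifold`. -/
structure DGSpace where
  /-- the body -/
  body : Type u
  [top : TopologicalSpace body]
  /-- functions over an open subset of the body -/
  O : Opens body → Type u
  [ring : ∀ U, Ring (O U)]
  [alg : ∀ U, Algebra ℝ (O U)]
  /-- functions that are homogeneous of a given degree -/
  deg : ∀ U, ℤ → Submodule ℝ (O U)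
  /-- restriction -/
  res : ∀ {U V : Opens body}, V ≤ U → (O U →ₐ[ℝ] O V)
  res_self : ∀ {U : Opens body} (h : U ≤ U) (a : O U), res h a = a
  res_res : ∀ {U V W : Opens body} (h : V ≤ U) (h' : W ≤ V) (a : O U),
    res h' (res h a) = res (h'.trans h) a
  /-- the differential -/
  d : ∀ U, O U →ₗ[ℝ] O U

attribute [instance] DGSpace.top DGSpace.ring DGSpace.alg

section LocalModel

variable {m : ℕ}

/-- The monomial `ξ₁^α₁ ⋯ ξₘ^αₘ` in generators of degrees `w₁, …, wₘ` is not forced to vanish by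
graded commutativity: generators of odd degree occur at most once. -/
def Admissible (w : Fin m → ℤ) (α : Fin m →₀ ℕ) : Prop :=
  ∀ i, Odd (w i) → α i ≤ 1

/-- The degree of the monomial `ξ^α`. -/
def weight (w : Fin m → ℤ) (α : Fin m →₀ ℕ) : ℤ :=
  ∑ i, (α i : ℤ) * w i

/-- The Koszul sign in `ξ^α ξ^β = ± ξ^(α+β)`. -/
def koszulSign (w : Fin m → ℤ) (α β : Fin m →₀ ℕ) : ℝ :=
  (-1) ^ (∑ i, ∑ j ∈ Finset.univ.filter (· < i),
    (α i * (w i).natAbs) * (β j * (w j).natAbs))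

/-- Functions of degree `k` on the local model over the open set `U` of a coordinate patch `e`:
power series `∑ c_α ξ^α` of degree `k` in the generators `ξ₁, …, ξₘ`, with coefficients
that are smooth functions of the coordinates. -/
def modelSections {X : Type u} [TopologicalSpace X] {n : ℕ}
    (e : OpenPartialHomeomorph X (EuclideanSpace ℝ (Fin n))) (w : Fin m → ℤ)
    (U : Opens X) (k : ℤ) : Submodule ℝ ((Fin m →₀ ℕ) → U → ℝ) where
  carrier := {c | (∀ α, ∃ F : EuclideanSpace ℝ (Fin n) → ℝ,
      ContDiffOn ℝ ∞ F (e '' (U : Set X)) ∧ ∀ x : U, c α x = F (e x)) ∧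
    ∀ α, ¬ (Admissible w α ∧ weight w α = k) → c α = 0}
  add_mem' := by
    rintro a b ⟨ha, ha'⟩ ⟨hb, hb'⟩
    refine ⟨fun α => ?_, fun α h => by simp [ha' α h, hb' α h]⟩
    obtain ⟨F, hF, hF'⟩ := ha α
    obtain ⟨F₂, hF₂, hF₂'⟩ := hb α
    exact ⟨fun x => F x + F₂ x, hF.add hF₂, fun x => by simp [hF' x, hF₂' x]⟩
  zero_mem' := ⟨fun _ => ⟨fun _ => 0, contDiffOn_const, fun _ => rfl⟩, fun _ _ => rfl⟩
  smul_mem' := by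
    rintro r a ⟨ha, ha'⟩
    refine ⟨fun α => ?_, fun α h => by simp [ha' α h]⟩
    obtain ⟨F, hF, hF'⟩ := ha α
    exact ⟨fun x => r * F x, contDiffOn_const.mul hF, fun x => by simp [hF' x]⟩

end LocalModel

/-- Near `x`, the space with its sheaf of graded algebras is isomorphic to an open subset of some
`ℝⁿ` with the functions of the coordinates and of finitely many graded commuting generators
`ξ₁, …, ξₘ` of nonzero degrees. -/
def IsLocallyModelledAt (X : DGSpace.{u}) (x : X.body) : Prop :=
  ∃ (n m : ℕ) (e : OpenPartialHomeomorph X.body (EuclideanSpace ℝ (Fin n))) (w : Fin m → ℤ)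
    (Φ : ∀ U : Opens X.body, (U : Set X.body) ⊆ e.source → ∀ k : ℤ,
      X.deg U k ≃ₗ[ℝ] modelSections e w U k),
    x ∈ e.source ∧ (∀ i, w i ≠ 0) ∧
    (∀ (U V : Opens X.body) (hU : (U : Set X.body) ⊆ e.source)
      (hV : (V : Set X.body) ⊆ e.source) (h : V ≤ U) (k : ℤ) (a : X.deg U k) (b : X.deg V k),
      X.res h (a : X.O U) = b →
      ∀ α (y : V), (Φ V hV k b).1 α y = (Φ U hU k a).1 α ⟨y, h y.2⟩) ∧
    (∀ (U : Opens X.body) (hU : (U : Set X.body) ⊆ e.source) (k l : ℤ)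
      (a : X.deg U k) (b : X.deg U l) (c : X.deg U (k + l)),
      (a : X.O U) * b = c →
      ∀ α, Admissible w α → ∀ y : U, (Φ U hU (k + l) c).1 α y =
        ∑ p ∈ Finset.HasAntidiagonal.antidiagonal α,
          koszulSign w p.1 p.2 * (Φ U hU k a).1 p.1 y * (Φ U hU l b).1 p.2 y)

/-- Differential graded manifolds. -/
structure IsDGManifold (X : DGSpace.{u}) : Prop where
  t2 : T2Space X.body
  secondCountable : SecondCountableTopology X.body
  /-- `X.O U` is a graded-commutative algebra and restriction preserves degrees -/
  one_mem : ∀ U, (1 : X.O U) ∈ X.deg U 0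
  mul_mem : ∀ U k l (a b : X.O U), a ∈ X.deg U k → b ∈ X.deg U l → a * b ∈ X.deg U (k + l)
  isInternal : ∀ U, DirectSum.IsInternal (X.deg U)
  graded_comm : ∀ U k l (a b : X.O U), a ∈ X.deg U k → b ∈ X.deg U l →
    a * b = ((-1 : ℝ) ^ (k * l)) • (b * a)
  res_mem : ∀ {U V} (h : V ≤ U) k (a : X.O U), a ∈ X.deg U k → X.res h a ∈ X.deg V k
  /-- the functions of each degree form a sheaf -/
  glue : ∀ (k : ℤ) (ι : Type u) (W : ι → Opens X.body) (U : Opens X.body) (hU : U = ⨆ i, W i)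
    (s : ∀ i, X.O (W i)), (∀ i, s i ∈ X.deg (W i) k) →
    (∀ i j, X.res (inf_le_left : W i ⊓ W j ≤ W i) (s i) =
      X.res (inf_le_right : W i ⊓ W j ≤ W j) (s j)) →
    ∃! a : X.O U, a ∈ X.deg U k ∧
      ∀ i, X.res (show W i ≤ U from hU ▸ le_iSup W i) a = s i
  /-- the sheaf is locally isomorphic to the model -/
  locallyModelled : ∀ x, IsLocallyModelledAt X x
  /-- the operator `d` is a differential -/
  d_mem : ∀ U k (a : X.O U), a ∈ X.deg U k → X.d U a ∈ X.deg U (k + 1)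
  d_mul : ∀ U k (a b : X.O U), a ∈ X.deg U k →
    X.d U (a * b) = X.d U a * b + ((-1 : ℝ) ^ k) • (a * X.d U b)
  d_d : ∀ U (a : X.O U), X.d U (X.d U a) = 0
  res_d : ∀ {U V} (h : V ≤ U) (a : X.O U), X.res h (X.d U a) = X.d V (X.res h a)

/-- Morphisms (dg-maps): a continuous map of bodies with a morphism of sheaves of graded algebras
over it that commutes with the differentials.  `sharp V U h` is the pullback of functions over `V`,
restricted to an open subset `U` of the preimage of `V`. -/
@[ext]
structure DGHom (X Y : DGSpace.{u}) where
  base : C(X.body, Y.body)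
  sharp : ∀ (V : Opens Y.body) (U : Opens X.body), (∀ x ∈ U, base x ∈ V) → (Y.O V →ₐ[ℝ] X.O U)
  sharp_res : ∀ {V V' : Opens Y.body} {U U' : Opens X.body} (hV : V' ≤ V) (hU : U' ≤ U)
    (h : ∀ x ∈ U, base x ∈ V) (h' : ∀ x ∈ U', base x ∈ V') (a : Y.O V),
    X.res hU (sharp V U h a) = sharp V' U' h' (Y.res hV a)
  sharp_mem : ∀ V U h k (a : Y.O V), a ∈ Y.deg V k → sharp V U h a ∈ X.deg U k
  sharp_d : ∀ V U h (a : Y.O V), sharp V U h (Y.d V a) = X.d U (sharp V U h a)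

/-- Composition, in diagrammatic order. -/
def DGHom.comp {X Y Z : DGSpace.{u}} (φ : DGHom X Y) (ψ : DGHom Y Z) : DGHom X Z where
  base := ψ.base.comp φ.base
  sharp W U h := (φ.sharp (W.comap ψ.base) U h).comp
    (ψ.sharp W (W.comap ψ.base) fun _ hy => hy)
  sharp_res {W W' U U'} hW hU h h' a := by
    simp only [AlgHom.comp_apply]
    rw [φ.sharp_res (V' := W'.comap ψ.base) (fun x hx => hW hx) hU h h',
      ψ.sharp_res hW (fun x hx => hW hx) (fun _ hy => hy) (fun _ hy => hy)]
  sharp_mem _ _ _ k _ ha := φ.sharp_mem _ _ _ k _ (ψ.sharp_mem _ _ _ k _ ha)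
  sharp_d _ _ _ _ := (congrArg _ (ψ.sharp_d _ _ _ _)).trans (φ.sharp_d _ _ _ _)

/-- `DGHom.comp` as an infix, in diagrammatic order. -/
scoped infixr:80 " ⋙ᵈ " => DGHom.comp

/-- A square of morphisms that is a pullback in the category of dg-manifolds. -/
def IsPullback {P X Y Z : DGSpace.{u}} (p : DGHom P X) (q : DGHom P Y)
    (f : DGHom X Z) (g : DGHom Y Z) : Prop :=
  p ⋙ᵈ f = q ⋙ᵈ g ∧
  ∀ S : DGSpace.{u}, IsDGManifold S → ∀ (a : DGHom S X) (b : DGHom S Y), a ⋙ᵈ f = b ⋙ᵈ g →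
    ∃! c : DGHom S P, c ⋙ᵈ p = a ∧ c ⋙ᵈ q = b

/-- Tangent vectors of degree `k` at `x`: derivations of degree `k` from the germs of functions at
`x` to `ℝ`, along the evaluation `ev` at `x`.  (Only the values of `ev` in degree `0`
can be nonzero, so the Leibniz rule has no sign.) -/
structure TangentVector (X : DGSpace.{u}) (x : X.body) (k : ℤ) where
  ev : ∀ U : Opens X.body, x ∈ U → (X.O U →ₐ[ℝ] ℝ)
  ev_res : ∀ {U V : Opens X.body} (h : V ≤ U) (hU : x ∈ U) (hV : x ∈ V) (a : X.O U),
    ev V hV (X.res h a) = ev U hU a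
  ev_deg : ∀ U hU j (a : X.O U), a ∈ X.deg U j → j ≠ 0 → ev U hU a = 0
  vec : ∀ U : Opens X.body, x ∈ U → (X.O U →ₗ[ℝ] ℝ)
  vec_res : ∀ {U V : Opens X.body} (h : V ≤ U) (hU : x ∈ U) (hV : x ∈ V) (a : X.O U),
    vec V hV (X.res h a) = vec U hU a
  vec_deg : ∀ U hU j (a : X.O U), a ∈ X.deg U j → j ≠ -k → vec U hU a = 0
  vec_mul : ∀ U hU (a b : X.O U),
    vec U hU (a * b) = vec U hU a * ev U hU b + ev U hU a * vec U hU b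

/-- Surjective submersions: the map of bodies is surjective and the tangent map is surjective at
every point and in every degree. -/
def IsSurjectiveSubmersion {X Y : DGSpace.{u}} (φ : DGHom X Y) : Prop :=
  Function.Surjective φ.base ∧
  ∀ (x : X.body) (k : ℤ) (v : TangentVector Y (φ.base x) k), ∃ u : TangentVector X x k,
    ∀ (V : Opens Y.body) (hV : φ.base x ∈ V) (a : Y.O V),
      u.vec (V.comap φ.base) hV (φ.sharp V (V.comap φ.base) (fun _ h => h) a) = v.vec V hV a

/-! ### dg-Lie groupoids -/

/-- The data of a groupoid with objects `G₀`, morphisms `G₁` and composable pairs `G₂`: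
`fst` and `snd` send a composable pair `(a, b)` to `a` and `b`, and `mul` sends it to `a ∘ b`. -/
structure GroupoidData (G₀ G₁ G₂ : DGSpace.{u}) where
  src : DGHom G₁ G₀
  tgt : DGHom G₁ G₀
  one : DGHom G₀ G₁
  inv : DGHom G₁ G₁
  fst : DGHom G₂ G₁
  snd : DGHom G₂ G₁
  mul : DGHom G₂ G₁

/-- For generalized elements `a`, `b`, `c` of the space of morphisms: `a ∘ b` is defined and is
equal to `c`. -/
def GroupoidData.Comp {G₀ G₁ G₂ : DGSpace.{u}} (𝒢 : GroupoidData G₀ G₁ G₂) {S : DGSpace.{u}}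
    (a b c : DGHom S G₁) : Prop :=
  ∃ z : DGHom S G₂, z ⋙ᵈ 𝒢.fst = a ∧ z ⋙ᵈ 𝒢.snd = b ∧ z ⋙ᵈ 𝒢.mul = c

/-- dg-Lie groupoids: groupoids internal to dg-manifolds whose source and target maps are surjective
submersions.  The composite `a ∘ b` is defined when the source of `a` is the target of `b`.
The laws are stated on generalized elements. -/
structure DGLieGroupoid (G₀ G₁ G₂ : DGSpace.{u}) extends GroupoidData G₀ G₁ G₂ where
  isDGManifold₀ : IsDGManifold G₀
  isDGManifold₁ : IsDGManifold G₁
  isDGManifold₂ : IsDGManifold G₂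
  src_submersion : IsSurjectiveSubmersion src
  tgt_submersion : IsSurjectiveSubmersion tgt
  isPullback : IsPullback fst snd src tgt
  mul_tgt : mul ⋙ᵈ tgt = fst ⋙ᵈ tgt
  mul_src : mul ⋙ᵈ src = snd ⋙ᵈ src
  one_tgt : ∀ {S : DGSpace.{u}}, IsDGManifold S → ∀ x : DGHom S G₀, x ⋙ᵈ one ⋙ᵈ tgt = x
  one_src : ∀ {S : DGSpace.{u}}, IsDGManifold S → ∀ x : DGHom S G₀, x ⋙ᵈ one ⋙ᵈ src = x
  inv_tgt : inv ⋙ᵈ tgt = src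
  inv_src : inv ⋙ᵈ src = tgt
  one_mul : ∀ {S : DGSpace.{u}}, IsDGManifold S → ∀ a : DGHom S G₁,
    toGroupoidData.Comp (a ⋙ᵈ tgt ⋙ᵈ one) a a
  mul_one : ∀ {S : DGSpace.{u}}, IsDGManifold S → ∀ a : DGHom S G₁,
    toGroupoidData.Comp a (a ⋙ᵈ src ⋙ᵈ one) a
  mul_inv : ∀ {S : DGSpace.{u}}, IsDGManifold S → ∀ a : DGHom S G₁,
    toGroupoidData.Comp a (a ⋙ᵈ inv) (a ⋙ᵈ tgt ⋙ᵈ one)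
  inv_mul : ∀ {S : DGSpace.{u}}, IsDGManifold S → ∀ a : DGHom S G₁,
    toGroupoidData.Comp (a ⋙ᵈ inv) a (a ⋙ᵈ src ⋙ᵈ one)
  assoc : ∀ {S : DGSpace.{u}}, IsDGManifold S → ∀ a b c ab bc x y : DGHom S G₁,
    toGroupoidData.Comp a b ab → toGroupoidData.Comp b c bc →
    toGroupoidData.Comp ab c x → toGroupoidData.Comp a bc y → x = y

/-- Morphisms of dg-Lie groupoids: functors internal to dg-manifolds. -/
@[ext]
structure DGFunctor {G₀ G₁ G₂ H₀ H₁ H₂ : DGSpace.{u}}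
    (𝒢 : DGLieGroupoid G₀ G₁ G₂) (ℋ : DGLieGroupoid H₀ H₁ H₂) where
  obj : DGHom G₀ H₀
  mor : DGHom G₁ H₁
  map_src : mor ⋙ᵈ ℋ.src = 𝒢.src ⋙ᵈ obj
  map_tgt : mor ⋙ᵈ ℋ.tgt = 𝒢.tgt ⋙ᵈ obj
  map_one : 𝒢.one ⋙ᵈ mor = obj ⋙ᵈ ℋ.one
  map_mul : ℋ.Comp (𝒢.fst ⋙ᵈ mor) (𝒢.snd ⋙ᵈ mor) (𝒢.mul ⋙ᵈ mor)

/-- A square of functors that is a pullback in the category of dg-Lie groupoids.  Two functors are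
equal iff they are equal on objects and on morphisms. -/
def IsGroupoidPullback {P₀ P₁ P₂ A₀ A₁ A₂ B₀ B₁ B₂ C₀ C₁ C₂ : DGSpace.{u}}
    {𝒬 : DGLieGroupoid P₀ P₁ P₂} {𝒜 : DGLieGroupoid A₀ A₁ A₂}
    {ℬ : DGLieGroupoid B₀ B₁ B₂} {𝒞 : DGLieGroupoid C₀ C₁ C₂}
    (p : DGFunctor 𝒬 𝒜) (q : DGFunctor 𝒬 ℬ) (f : DGFunctor 𝒜 𝒞) (g : DGFunctor ℬ 𝒞) : Prop :=
  (p.obj ⋙ᵈ f.obj = q.obj ⋙ᵈ g.obj ∧ p.mor ⋙ᵈ f.mor = q.mor ⋙ᵈ g.mor) ∧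
  ∀ (S₀ S₁ S₂ : DGSpace.{u}) (𝒮 : DGLieGroupoid S₀ S₁ S₂)
    (Ψ : DGFunctor 𝒮 𝒜) (Φ : DGFunctor 𝒮 ℬ),
    Ψ.obj ⋙ᵈ f.obj = Φ.obj ⋙ᵈ g.obj → Ψ.mor ⋙ᵈ f.mor = Φ.mor ⋙ᵈ g.mor →
    ∃! Υ : DGFunctor 𝒮 𝒬,
      (Υ.obj ⋙ᵈ p.obj = Ψ.obj ∧ Υ.mor ⋙ᵈ p.mor = Ψ.mor) ∧
      (Υ.obj ⋙ᵈ q.obj = Φ.obj ∧ Υ.mor ⋙ᵈ q.mor = Φ.mor)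

/-! ### The dg-manifolds `T[1]M × V[1]` -/

section TangentTimesLie

variable {E : Type u} [NormedAddCommGroup E] [NormedSpace ℝ E]
  {H : Type u} [TopologicalSpace H] (I : ModelWithCorners ℝ E H)
  (M : Type u) [TopologicalSpace M] [ChartedSpace H M]
  (V : Type u) [AddCommGroup V] [Module ℝ V]

variable {M} in
/-- The derivative of a map between manifolds at a point; `E` and `E'` are the tangent spaces. -/
def tangentMap {E' : Type u} [NormedAddCommGroup E'] [NormedSpace ℝ E']
    {H' : Type u} [TopologicalSpace H'] (I' : ModelWithCorners ℝ E' H')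
    {M' : Type u} [TopologicalSpace M'] [ChartedSpace H' M'] (f : M → M') (x : M) : E →ₗ[ℝ] E' :=
  ContinuousLinearMap.toLinearMap (show E →L[ℝ] E' from mfderiv I I' f x)

/-- The exterior algebra of `(T_x M × V)^*`, where `E` is the tangent space of `M` at any point. -/
abbrev Fibre (E V : Type u) [NormedAddCommGroup E] [NormedSpace ℝ E]
    [AddCommGroup V] [Module ℝ V] : Type u :=
  ExteriorAlgebra ℝ (Module.Dual ℝ (E × V))

/-- The elements of degree `k` of the exterior algebra of `(T_x M × V)^*`. -/
def fibreDeg (E V : Type u) [NormedAddCommGroup E] [NormedSpace ℝ E]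
    [AddCommGroup V] [Module ℝ V] : ℤ → Submodule ℝ (Fibre E V)
  | Int.ofNat n => ⋀[ℝ]^n (Module.Dual ℝ (E × V))
  | Int.negSucc _ => ⊥

variable {M} in
/-- The differential of the function `f` at the point `x`, as an element of degree `1`. -/
def differentialAt (f : M → ℝ) (x : M) : Fibre E V :=
  ExteriorAlgebra.ι ℝ
    (ContinuousLinearMap.toLinearMap (show E →L[ℝ] ℝ from mfderiv I 𝓘(ℝ, ℝ) f x) ∘ₗ
      LinearMap.fst ℝ E V)

variable {V} in
/-- A linear form on `V`, as an element of degree `1`. -/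
def linearForm (E : Type u) [NormedAddCommGroup E] [NormedSpace ℝ E] (ξ : Module.Dual ℝ V) :
    Fibre E V :=
  ExteriorAlgebra.ι ℝ (ξ ∘ₗ LinearMap.snd ℝ E V)

/-- Functions `f`, their differentials `df`, and linear forms on `V`, where `f` is
smooth on `N`. -/
def generators (N : Opens M) : Set (M → Fibre E V) :=
  {η | (∃ f : M → ℝ, ContMDiffOn I 𝓘(ℝ, ℝ) ∞ f N ∧
      ((η = fun x => algebraMap ℝ _ (f x)) ∨ η = differentialAt I V f)) ∨
    ∃ ξ : Module.Dual ℝ V, η = fun _ => linearForm E ξ}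

/-- The smooth sections over `U` of the bundle of exterior algebras of `(TM × V)^*`, that is, the
differential forms on `U` with values in `Λ V^*`: the sections that near each
point are sums of products of smooth functions, their differentials, and linear forms on `V`. -/
def smoothSections (U : Opens M) : Subalgebra ℝ (U → Fibre E V) where
  carrier := {s | ∀ x : U, ∃ N : Opens M, (x : M) ∈ N ∧
    ∃ η ∈ Algebra.adjoin ℝ (generators I M V N), ∀ y : U, (y : M) ∈ N → s y = η y}
  mul_mem' := by
    intro a b ha hb x
    obtain ⟨N, hN, η, hη, h⟩ := ha x
    obtain ⟨N', hN', η', hη', h'⟩ := hb x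
    have mono : ∀ {N₁ N₂ : Opens M}, N₁ ≤ N₂ → generators I M V N₂ ⊆ generators I M V N₁ := by
      rintro N₁ N₂ hle η (⟨f, hf, hη⟩ | hη)
      · exact Or.inl ⟨f, hf.mono hle, hη⟩
      · exact Or.inr hη
    exact ⟨N ⊓ N', ⟨hN, hN'⟩, η * η', mul_mem
      (Algebra.adjoin_mono (mono inf_le_left) hη) (Algebra.adjoin_mono (mono inf_le_right) hη'),
      fun y hy => by simp [h y hy.1, h' y hy.2]⟩
  add_mem' := by
    intro a b ha hb x
    obtain ⟨N, hN, η, hη, h⟩ := ha x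
    obtain ⟨N', hN', η', hη', h'⟩ := hb x
    have mono : ∀ {N₁ N₂ : Opens M}, N₁ ≤ N₂ → generators I M V N₂ ⊆ generators I M V N₁ := by
      rintro N₁ N₂ hle η (⟨f, hf, hη⟩ | hη)
      · exact Or.inl ⟨f, hf.mono hle, hη⟩
      · exact Or.inr hη
    exact ⟨N ⊓ N', ⟨hN, hN'⟩, η + η', add_mem
      (Algebra.adjoin_mono (mono inf_le_left) hη) (Algebra.adjoin_mono (mono inf_le_right) hη'),
      fun y hy => by simp [h y hy.1, h' y hy.2]⟩
  algebraMap_mem' r x :=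
    ⟨⊤, trivial, algebraMap ℝ _ r, Subalgebra.algebraMap_mem _ r, fun _ _ => rfl⟩

/-- The restriction of sections to a smaller open set. -/
def restrictSections {U W : Opens M} (h : W ≤ U) :
    smoothSections I M V U →ₐ[ℝ] smoothSections I M V W where
  toFun s := ⟨fun x => s.1 ⟨x, h x.2⟩, fun x => by
    obtain ⟨N, hN, η, hη, h'⟩ := s.2 ⟨x, h x.2⟩
    exact ⟨N, hN, η, hη, fun y hy => h' ⟨y, h y.2⟩ hy⟩⟩
  map_one' := rfl
  map_mul' _ _ := rfl
  map_zero' := rfl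
  map_add' _ _ := rfl
  commutes' _ := rfl

/-- The sections over `U` of degree `k`. -/
def sectionsDeg (U : Opens M) (k : ℤ) : Submodule ℝ (smoothSections I M V U) where
  carrier := {s | ∀ x, s.1 x ∈ fibreDeg E V k}
  add_mem' ha hb x := add_mem (ha x) (hb x)
  zero_mem' _ := zero_mem _
  smul_mem' r _ ha x := Submodule.smul_mem _ r (ha x)

variable [Module.Finite ℝ V] [Bracket V V]

variable {V} in
/-- The Chevalley–Eilenberg differential of a linear form on `V`: for a basis `e` of `V`
with dual basis `e^*`, it is `-1/2 ∑ ξ([e_b, e_c]) e_b^* e_c^*`. -/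
def chevalleyEilenberg (E : Type u) [NormedAddCommGroup E] [NormedSpace ℝ E]
    (ξ : Module.Dual ℝ V) : Fibre E V :=
  -(1 / 2 : ℝ) • ∑ b, ∑ c, ξ ⁅Module.finBasis ℝ V b, Module.finBasis ℝ V c⁆ •
    (linearForm E ((Module.finBasis ℝ V).coord b) * linearForm E ((Module.finBasis ℝ V).coord c))

/-- `D` is the sum of the de Rham differential of `M` and the Chevalley–Eilenberg differential of
`V`: it is a local graded derivation whose values on smooth functions, their
differentials and linear forms on `V` are as they have to be.
There is at most one such `D`. -/
structure IsDeRhamCE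
    (D : ∀ U : Opens M, smoothSections I M V U →ₗ[ℝ] smoothSections I M V U) : Prop where
  res : ∀ {U W : Opens M} (h : W ≤ U) (s : smoothSections I M V U),
    restrictSections I M V h (D U s) = D W (restrictSections I M V h s)
  mul : ∀ (U : Opens M) (k : ℤ) (s η : smoothSections I M V U), s ∈ sectionsDeg I M V U k →
    D U (s * η) = D U s * η + ((-1 : ℝ) ^ k) • (s * D U η)
  function : ∀ (U : Opens M) (f : M → ℝ), ContMDiffOn I 𝓘(ℝ, ℝ) ∞ f U →
    ∀ s : smoothSections I M V U, (∀ x, s.1 x = algebraMap ℝ _ (f x)) →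
      ∀ x, (D U s).1 x = differentialAt I V f x
  differential : ∀ (U : Opens M) (f : M → ℝ), ContMDiffOn I 𝓘(ℝ, ℝ) ∞ f U →
    ∀ s : smoothSections I M V U, (∀ x, s.1 x = differentialAt I V f x) → D U s = 0
  linear : ∀ (U : Opens M) (ξ : Module.Dual ℝ V) (s : smoothSections I M V U),
    (∀ x, s.1 x = linearForm E ξ) → ∀ x, (D U s).1 x = chevalleyEilenberg E ξ

open Classical in
/-- The sum of the de Rham differential of `M` and the Chevalley–Eilenberg differential of `V`. -/
def deRhamCE (U : Opens M) : smoothSections I M V U →ₗ[ℝ] smoothSections I M V U :=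
  if h : ∃ D, IsDeRhamCE I M V D then h.choose U else 0

/-- `T[1]M × V[1]` for a manifold `M` and a Lie algebra `V`.  For `V = 0` this is the shifted
tangent bundle `T[1]M`, and for `M` a point it is `V[1]`. -/
def tangentTimes : DGSpace.{u} where
  body := M
  O U := smoothSections I M V U
  deg U k := sectionsDeg I M V U k
  res h := restrictSections I M V h
  res_self _ _ := rfl
  res_res _ _ _ := rfl
  d U := deRhamCE I M V U

/-- The shifted tangent bundle `T[1]M`, with the de Rham differential. -/
abbrev shiftedTangent : DGSpace.{u} := tangentTimes I M PUnit.{u + 1}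

end TangentTimesLie

section BundleMaps

variable {E : Type u} [NormedAddCommGroup E] [NormedSpace ℝ E]
  {H : Type u} [TopologicalSpace H] {I : ModelWithCorners ℝ E H}
  {M : Type u} [TopologicalSpace M] [ChartedSpace H M]
  {V : Type u} [AddCommGroup V] [Module ℝ V] [Module.Finite ℝ V] [Bracket V V]
  {E' : Type u} [NormedAddCommGroup E'] [NormedSpace ℝ E']
  {H' : Type u} [TopologicalSpace H'] {I' : ModelWithCorners ℝ E' H'}
  {M' : Type u} [TopologicalSpace M'] [ChartedSpace H' M']
  {V' : Type u} [AddCommGroup V'] [Module ℝ V'] [Module.Finite ℝ V'] [Bracket V' V']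

/-- The morphism `φ : T[1]M × V[1] → T[1]M' × V'[1]` is the one that is given, on points
`(x, v, ν)` with `v ∈ T_x M` and `ν ∈ V`, by
`(x, v, ν) ↦ (f x, df_x v, A x (v, ν))`, where `A x` is linear: functions are pulled back along the
dual of this fibrewise linear map.  This determines `φ`. -/
def IsGivenBy (φ : DGHom (tangentTimes I M V) (tangentTimes I' M' V'))
    (f : M → M') (A : M → (E × V →ₗ[ℝ] V')) : Prop :=
  (∀ x : M, φ.base x = f x) ∧
  ∀ (W : Opens M') (U : Opens M) (h : ∀ x ∈ U, φ.base x ∈ W)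
    (s : smoothSections I' M' V' W) (x : U),
    (φ.sharp W U h s : smoothSections I M V U).1 x =
      ExteriorAlgebra.map
        ((tangentMap I I' f x ∘ₗ LinearMap.fst ℝ E V).prod (A x)).dualMap (s.1 ⟨φ.base (x : M), h x x.2⟩)

/-- The morphism `φ : T[1]M → T[1]M'` is the differential of the map `f`. -/
def IsDifferentialOf (φ : DGHom (shiftedTangent I M) (shiftedTangent I' M')) (f : M → M') : Prop :=
  IsGivenBy φ f fun _ => 0

end BundleMaps

/-! ### Fibre products along submersions and the Čech groupoid -/

section FibreProducts

variable {EX EY EZ X Y Z : Type u}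
  [NormedAddCommGroup EX] [NormedSpace ℝ EX] [TopologicalSpace X] [ChartedSpace EX X]
  [NormedAddCommGroup EY] [NormedSpace ℝ EY] [TopologicalSpace Y] [ChartedSpace EY Y]
  [NormedAddCommGroup EZ] [TopologicalSpace Z] [ChartedSpace EZ Z]
  {f : Z → X} {σ : Y → X}

/-- The fibre product `Z ×_X Y` of a continuous (in the applications, smooth) map `f : Z → X` and
a submersion `σ : Y → X`, as a subspace of `Z × Y`. -/
@[ext]
structure FibreProduct (hf : Continuous f)
    (hσ : Manifold.IsSubmersion 𝓘(ℝ, EY) 𝓘(ℝ, EX) ∞ σ) : Type u where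
  fst : Z
  snd : Y
  comm : f fst = σ snd

variable (hf : Continuous f) (hσ : Manifold.IsSubmersion 𝓘(ℝ, EY) 𝓘(ℝ, EX) ∞ σ)

instance : TopologicalSpace (FibreProduct hf hσ) :=
  TopologicalSpace.induced (fun p => (p.fst, p.snd)) inferInstance

lemma FibreProduct.isInducing :
    Topology.IsInducing (fun p : FibreProduct hf hσ => (p.fst, p.snd)) := ⟨rfl⟩

lemma FibreProduct.continuous_fst : Continuous (fun p : FibreProduct hf hσ => p.fst) :=
  _root_.continuous_fst.comp (FibreProduct.isInducing hf hσ).continuous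

lemma FibreProduct.continuous_snd : Continuous (fun p : FibreProduct hf hσ => p.snd) :=
  _root_.continuous_snd.comp (FibreProduct.isInducing hf hσ).continuous

lemma codChart_apply {y : Y}
    (h : Manifold.IsSubmersionAtOfComplement hσ.complement 𝓘(ℝ, EY) 𝓘(ℝ, EX) ∞ σ y) {y' : Y}
    (hy' : y' ∈ h.domChart.source) : h.codChart (σ y') = (h.equiv (h.domChart y')).1 := by
  have := h.writtenInCharts (show h.domChart y' ∈ (h.domChart.extend 𝓘(ℝ, EY)).target by
    simpa using h.domChart.map_source hy')
  simpa [h.domChart.left_inv hy'] using this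

lemma codChart_inverse {y : Y}
    (h : Manifold.IsSubmersionAtOfComplement hσ.complement 𝓘(ℝ, EY) 𝓘(ℝ, EX) ∞ σ y) {x : X}
    (hx : x ∈ h.codChart.source) {w : hσ.complement}
    (hw : h.equiv.symm (h.codChart x, w) ∈ h.domChart.target) :
    x = σ (h.domChart.symm (h.equiv.symm (h.codChart x, w))) := by
  have hs := h.domChart.map_target hw
  refine h.codChart.injOn hx (h.source_subset_preimage_source hs) ?_
  rw [codChart_apply hσ h hs, h.domChart.right_inv hw]
  simp

open Classical in
/-- The chart of `Z ×_X Y` at the point `p = (z, y)`.  In suitable charts of `Y` at `y` and of `X`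
at `σ y`, the submersion `σ` is the projection `EX × F → EX`.  The chart of `Z ×_X Y` consists of
the chart of `Z` at `z` for the first component and the `F`-coordinate of
the second component; the `EX`-coordinate of the latter is determined by the former. -/
def FibreProduct.chart (p : FibreProduct hf hσ) :
    OpenPartialHomeomorph (FibreProduct hf hσ) (EZ × hσ.complement) :=
  let h := hσ.isSubmersionOfComplement_complement p.snd
  let χ := chartAt EZ p.fst
  { toFun := fun q => (χ q.fst, (h.equiv (h.domChart q.snd)).2)
    invFun := fun a =>
      if ha : f (χ.symm a.1) =
          σ (h.domChart.symm (h.equiv.symm (h.codChart (f (χ.symm a.1)), a.2))) then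
        ⟨χ.symm a.1, h.domChart.symm (h.equiv.symm (h.codChart (f (χ.symm a.1)), a.2)), ha⟩
      else p
    source := {q | q.fst ∈ χ.source ∧ q.snd ∈ h.domChart.source}
    target := {a | a.1 ∈ χ.target ∧ f (χ.symm a.1) ∈ h.codChart.source ∧
      h.equiv.symm (h.codChart (f (χ.symm a.1)), a.2) ∈ h.domChart.target}
    map_source' := by
      rintro q ⟨hq, hq'⟩
      have hx : f q.fst = σ q.snd := q.comm
      have key : h.equiv.symm (h.codChart (f q.fst), (h.equiv (h.domChart q.snd)).2) =
          h.domChart q.snd := by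
        rw [hx, codChart_apply hσ h hq']
        simp
      refine ⟨χ.map_source hq, ?_, ?_⟩
      · simp only [χ.left_inv hq]
        rw [hx]
        exact h.source_subset_preimage_source hq'
      · simp only [χ.left_inv hq, key]
        exact h.domChart.map_source hq'
    map_target' := by
      rintro a ⟨ha, ha', ha''⟩
      rw [dif_pos (codChart_inverse hσ h ha' ha'')]
      exact ⟨χ.map_target ha, h.domChart.map_target ha''⟩
    left_inv' := by
      rintro q ⟨hq, hq'⟩
      have hx : f q.fst = σ q.snd := q.comm
      have key : h.equiv.symm (h.codChart (f q.fst), (h.equiv (h.domChart q.snd)).2) =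
          h.domChart q.snd := by
        rw [hx, codChart_apply hσ h hq']
        simp
      have : f (χ.symm (χ q.fst)) = σ (h.domChart.symm (h.equiv.symm
          (h.codChart (f (χ.symm (χ q.fst))), (h.equiv (h.domChart q.snd)).2))) := by
        rw [χ.left_inv hq, key, h.domChart.left_inv hq', hx]
      rw [dif_pos this]
      refine FibreProduct.ext (χ.left_inv hq) ?_
      simp only [χ.left_inv hq, key]
      exact h.domChart.left_inv hq'
    right_inv' := by
      rintro a ⟨ha, ha', ha''⟩
      rw [dif_pos (codChart_inverse hσ h ha' ha'')]
      refine Prod.ext (χ.right_inv ha) ?_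
      simp only [h.domChart.right_inv ha'']
      simp
    open_source := (χ.open_source.preimage (FibreProduct.continuous_fst hf hσ)).inter
      (h.domChart.open_source.preimage (FibreProduct.continuous_snd hf hσ))
    open_target := by
      have c₁ : ContinuousOn (fun a : EZ × hσ.complement => f (χ.symm a.1))
          (Prod.fst ⁻¹' χ.target) :=
        hf.comp_continuousOn (χ.continuousOn_symm.comp _root_.continuousOn_fst fun _ h => h)
      have o₁ := c₁.isOpen_inter_preimage (χ.open_target.preimage _root_.continuous_fst)
        h.codChart.open_source
      have c₂ : ContinuousOn (fun a : EZ × hσ.complement =>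
          h.equiv.symm (h.codChart (f (χ.symm a.1)), a.2))
          (Prod.fst ⁻¹' χ.target ∩ (fun a => f (χ.symm a.1)) ⁻¹' h.codChart.source) :=
        h.equiv.symm.continuous.comp_continuousOn
          ((h.codChart.continuousOn.comp (c₁.mono Set.inter_subset_left) fun _ h => h.2).prodMk
            continuousOn_snd)
      have o₂ := c₂.isOpen_inter_preimage o₁ h.domChart.open_target
      convert o₂ using 1
      ext a
      simp [and_assoc]
    continuousOn_toFun := by
      refine (χ.continuousOn.comp
        (FibreProduct.continuous_fst hf hσ).continuousOn fun _ h => h.1).prodMk ?_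
      exact (_root_.continuous_snd.comp h.equiv.continuous).comp_continuousOn
        (h.domChart.continuousOn.comp
          (FibreProduct.continuous_snd hf hσ).continuousOn fun _ h => h.2)
    continuousOn_invFun := by
      rw [(FibreProduct.isInducing hf hσ).continuousOn_iff]
      have c₁ : ContinuousOn (fun a : EZ × hσ.complement => χ.symm a.1)
          {a | a.1 ∈ χ.target ∧ f (χ.symm a.1) ∈ h.codChart.source ∧
            h.equiv.symm (h.codChart (f (χ.symm a.1)), a.2) ∈ h.domChart.target} :=
        χ.continuousOn_symm.comp _root_.continuousOn_fst fun _ h => h.1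
      refine (c₁.prodMk (h.domChart.continuousOn_symm.comp
        (h.equiv.symm.continuous.comp_continuousOn ((h.codChart.continuousOn.comp
          (hf.comp_continuousOn c₁) fun _ h => h.2.1).prodMk continuousOn_snd))
          fun _ h => h.2.2)).congr ?_
      rintro a ⟨ha, ha', ha''⟩
      simp only [Function.comp_apply]
      rw [dif_pos (codChart_inverse hσ h ha' ha'')] }

instance : ChartedSpace (EZ × hσ.complement) (FibreProduct hf hσ) where
  atlas := Set.range (FibreProduct.chart hf hσ)
  chartAt := FibreProduct.chart hf hσ
  mem_chart_source p := ⟨mem_chart_source EZ p.fst,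
    (hσ.isSubmersionOfComplement_complement p.snd).mem_domChart_source⟩
  chart_mem_atlas p := ⟨p, rfl⟩

/-- The manifold `Y^[2] = Y ×_X Y` of morphisms of the Čech groupoid. -/
abbrev CechPairs : Type u := FibreProduct hσ.contMDiff.continuous hσ

/-- The manifold `Y^[3] = Y^[2] ×_X Y` of triples of points of `Y` in the same fibre,
where `Y^[2]` is mapped to `X` by `(y₁, y₂) ↦ σ y₂`. -/
abbrev CechTriples : Type u :=
  FibreProduct (Z := CechPairs hσ) (f := fun z => σ z.snd)
    (hσ.contMDiff.continuous.comp (FibreProduct.continuous_snd _ hσ)) hσ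

variable {hσ}

/-- `y ↦ (y, y)` -/
def cechOne (y : Y) : CechPairs hσ := ⟨y, y, rfl⟩

/-- `(y₁, y₂) ↦ (y₂, y₁)` -/
def cechInv (z : CechPairs hσ) : CechPairs hσ := ⟨z.snd, z.fst, z.comm.symm⟩

/-- `(y₁, y₂, y₃) ↦ (y₁, y₂)` -/
def cechFst (t : CechTriples hσ) : CechPairs hσ := t.fst

/-- `(y₁, y₂, y₃) ↦ (y₂, y₃)` -/
def cechSnd (t : CechTriples hσ) : CechPairs hσ := ⟨t.fst.snd, t.snd, t.comm⟩

/-- `(y₁, y₂, y₃) ↦ (y₁, y₃)` -/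
def cechMul (t : CechTriples hσ) : CechPairs hσ := ⟨t.fst.fst, t.snd, t.fst.comm.trans t.comm⟩

end FibreProducts

/-! ### The Lie algebra and the gauge action -/

section Gauge

variable (EG G : Type u) [NormedAddCommGroup EG] [NormedSpace ℝ EG] [TopologicalSpace G]
  [ChartedSpace EG G] [Group G]

/-- The Lie algebra of `G`, with the bracket of left-invariant vector fields. -/
abbrev LieAlg : Type u := GroupLieAlgebra 𝓘(ℝ, EG) G

instance [FiniteDimensional ℝ EG] : Module.Finite ℝ (LieAlg EG G) :=
  inferInstanceAs (FiniteDimensional ℝ EG)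

variable {G}

/-- `ν ↦ h⁻¹ ν h` -/
def adInv (h : G) : LieAlg EG G →ₗ[ℝ] LieAlg EG G :=
  show EG →ₗ[ℝ] EG from tangentMap 𝓘(ℝ, EG) 𝓘(ℝ, EG) (fun x : G => h⁻¹ * x * h) 1

/-- `γ ↦ h⁻¹ γ` for tangent vectors `γ` of `G` at `h` -/
def leftTranslate (h : G) : EG →ₗ[ℝ] LieAlg EG G :=
  show EG →ₗ[ℝ] EG from tangentMap 𝓘(ℝ, EG) 𝓘(ℝ, EG) (fun x : G => h⁻¹ * x) h

/-- `(γ, ν) ↦ h⁻¹ ν h + h⁻¹ γ` for tangent vectors `γ` of `G` at `h` and `ν` in the Lie algebra -/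
def gauge (h : G) : EG × LieAlg EG G →ₗ[ℝ] LieAlg EG G :=
  adInv EG h ∘ₗ LinearMap.snd ℝ EG (LieAlg EG G) +
    leftTranslate EG h ∘ₗ LinearMap.fst ℝ EG (LieAlg EG G)

end Gauge

/-! ### The four groupoids -/

section Groupoids

variable {EX EY X Y : Type u}
  [NormedAddCommGroup EX] [NormedSpace ℝ EX] [TopologicalSpace X] [ChartedSpace EX X]
  [NormedAddCommGroup EY] [NormedSpace ℝ EY] [TopologicalSpace Y] [ChartedSpace EY Y]
  {σ : Y → X} (hσ : Manifold.IsSubmersion 𝓘(ℝ, EY) 𝓘(ℝ, EX) ∞ σ)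
  (EG G : Type u) [NormedAddCommGroup EG] [NormedSpace ℝ EG] [FiniteDimensional ℝ EG]
  [TopologicalSpace G] [ChartedSpace EG G] [Group G]

/-- The model of `Y^[2]`. -/
abbrev model₂ := 𝓘(ℝ, EY × hσ.complement)

/-- The model of `Y^[3]`. -/
abbrev model₃ := 𝓘(ℝ, (EY × hσ.complement) × hσ.complement)

/-- The model of the one-point manifold. -/
abbrev modelPt := 𝓘(ℝ, PUnit.{u + 1})

/-- The one-point manifold. -/
abbrev Pt : Type u := PUnit.{u + 1}

variable {G} in
/-- Smooth transition functions `g : Y^[2] → G` of a principal `G`-bundle: smooth functors from the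
Čech groupoid of `σ` to the one-object groupoid `BG`. -/
structure IsTransitionFunction (g : CechPairs hσ → G) : Prop where
  smooth : ContMDiff (model₂ hσ) 𝓘(ℝ, EG) ∞ g
  cocycle : ∀ t : CechTriples hσ, g (cechFst t) * g (cechSnd t) = g (cechMul t)

/-- dg-Lie groupoids with the spaces of the tangent Čech groupoid `T[1]Č(σ)`. -/
abbrev CechLike := DGLieGroupoid (shiftedTangent 𝓘(ℝ, EY) Y)
  (shiftedTangent (model₂ hσ) (CechPairs hσ)) (shiftedTangent (model₃ hσ) (CechTriples hσ))

variable {hσ} in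
/-- The tangent Čech groupoid `T[1]Č(σ) = (T[1]Y^[2] ⇉ T[1]Y)`: the structure maps are the
differentials of those of the Čech groupoid, and the differentials are the de Rham differentials. -/
structure IsTangentCech (𝒞 : CechLike hσ) : Prop where
  d₀ : IsDeRhamCE 𝓘(ℝ, EY) Y PUnit.{u + 1} (deRhamCE _ _ _)
  d₁ : IsDeRhamCE (model₂ hσ) (CechPairs hσ) PUnit.{u + 1} (deRhamCE _ _ _)
  d₂ : IsDeRhamCE (model₃ hσ) (CechTriples hσ) PUnit.{u + 1} (deRhamCE _ _ _)
  tgt : IsDifferentialOf 𝒞.tgt fun z : CechPairs hσ => z.fst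
  src : IsDifferentialOf 𝒞.src fun z : CechPairs hσ => z.snd
  one : IsDifferentialOf 𝒞.one (cechOne (hσ := hσ))
  inv : IsDifferentialOf 𝒞.inv (cechInv (hσ := hσ))
  fst : IsDifferentialOf 𝒞.fst (cechFst (hσ := hσ))
  snd : IsDifferentialOf 𝒞.snd (cechSnd (hσ := hσ))
  mul : IsDifferentialOf 𝒞.mul (cechMul (hσ := hσ))

/-- dg-Lie groupoids with the spaces of `T[1]BG`. -/
abbrev DeloopingLike := DGLieGroupoid (shiftedTangent modelPt Pt)
  (shiftedTangent 𝓘(ℝ, EG) G) (shiftedTangent (𝓘(ℝ, EG).prod 𝓘(ℝ, EG)) (G × G))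

variable {EG G} in
/-- The tangent groupoid `T[1]BG = (T[1]G ⇉ *)` of the one-object groupoid `BG = (G ⇉ *)`. -/
structure IsTangentDelooping (ℬ : DeloopingLike EG G) : Prop where
  d₀ : IsDeRhamCE modelPt Pt PUnit.{u + 1} (deRhamCE _ _ _)
  d₁ : IsDeRhamCE 𝓘(ℝ, EG) G PUnit.{u + 1} (deRhamCE _ _ _)
  d₂ : IsDeRhamCE (𝓘(ℝ, EG).prod 𝓘(ℝ, EG)) (G × G) PUnit.{u + 1} (deRhamCE _ _ _)
  tgt : IsDifferentialOf ℬ.tgt fun _ : G => PUnit.unit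
  src : IsDifferentialOf ℬ.src fun _ : G => PUnit.unit
  one : IsDifferentialOf ℬ.one fun _ => (1 : G)
  inv : IsDifferentialOf ℬ.inv fun h : G => h⁻¹
  fst : IsDifferentialOf ℬ.fst fun p : G × G => p.1
  snd : IsDifferentialOf ℬ.snd fun p : G × G => p.2
  mul : IsDifferentialOf ℬ.mul fun p : G × G => p.1 * p.2

/-- dg-Lie groupoids with the spaces of the inner action groupoid of `BG`. -/
abbrev InnerActionLike := DGLieGroupoid (tangentTimes modelPt Pt (LieAlg EG G))
  (tangentTimes 𝓘(ℝ, EG) G (LieAlg EG G))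
  (tangentTimes (𝓘(ℝ, EG).prod 𝓘(ℝ, EG)) (G × G) (LieAlg EG G))

variable {EG G} in
/-- The inner action groupoid `A(BG) = (𝔤[1] × T[1]G ⇉ 𝔤[1])`:
* `t(ν; h, γ) = ν` and `s(ν; h, γ) = h⁻¹ν h + h⁻¹γ`;
* `(ν; h₁, γ₁) ∘ (h₁⁻¹ν h₁ + h₁⁻¹γ₁; h₂, γ₂) = (ν; h₁h₂, h₁γ₂ + γ₁h₂)`;
* `e(ν) = (ν; 1, 0)` and `(ν; h, γ)⁻¹ = (h⁻¹ν h + h⁻¹γ; h⁻¹, -h⁻¹γ h⁻¹)`.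

The space of composable pairs has the points `(ν; h₁, γ₁; h₂, γ₂)`. -/
structure IsInnerAction (𝒜 : InnerActionLike EG G) : Prop where
  d₀ : IsDeRhamCE modelPt Pt (LieAlg EG G) (deRhamCE _ _ _)
  d₁ : IsDeRhamCE 𝓘(ℝ, EG) G (LieAlg EG G) (deRhamCE _ _ _)
  d₂ : IsDeRhamCE (𝓘(ℝ, EG).prod 𝓘(ℝ, EG)) (G × G) (LieAlg EG G) (deRhamCE _ _ _)
  tgt : IsGivenBy 𝒜.tgt (fun _ : G => PUnit.unit) fun _ => LinearMap.snd ℝ _ _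
  src : IsGivenBy 𝒜.src (fun _ : G => PUnit.unit) fun h => gauge EG h
  one : IsGivenBy 𝒜.one (fun _ => (1 : G)) fun _ => LinearMap.snd ℝ _ _
  inv : IsGivenBy 𝒜.inv (fun h : G => h⁻¹) fun h => gauge EG h
  fst : IsGivenBy 𝒜.fst (fun p : G × G => p.1) fun _ => LinearMap.snd ℝ _ _
  snd : IsGivenBy 𝒜.snd (fun p : G × G => p.2) fun p =>
    gauge EG p.1 ∘ₗ (LinearMap.fst ℝ EG EG).prodMap LinearMap.id
  mul : IsGivenBy 𝒜.mul (fun p : G × G => p.1 * p.2) fun _ => LinearMap.snd ℝ _ _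

/-- dg-Lie groupoids with the spaces of the resolved Atiyah algebroid. -/
abbrev AtiyahLike := DGLieGroupoid (tangentTimes 𝓘(ℝ, EY) Y (LieAlg EG G))
  (tangentTimes (model₂ hσ) (CechPairs hσ) (LieAlg EG G))
  (tangentTimes (model₃ hσ) (CechTriples hσ) (LieAlg EG G))

variable {hσ EG G}

/-- `(v, ν) ↦ g_z⁻¹ ν g_z + g_z⁻¹ dg_z(v)` for tangent vectors `v` of `Y^[2]` at `z` and `ν` in the
Lie algebra -/
def cechGauge (g : CechPairs hσ → G) (z : CechPairs hσ) :
    (EY × hσ.complement) × LieAlg EG G →ₗ[ℝ] LieAlg EG G :=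
  gauge EG (g z) ∘ₗ (tangentMap (model₂ hσ) 𝓘(ℝ, EG) g z).prodMap LinearMap.id

/-- The resolved Atiyah algebroid `(T[1]Y^[2] × 𝔤[1] ⇉ T[1]Y × 𝔤[1])` of the principal bundle with
transition functions `g`.  With `ν' = g₁₂⁻¹ν g₁₂ + g₁₂⁻¹dg₁₂`:
* `t(ŷ₁, ŷ₂, ν) = (ŷ₁, ν)` and `s(ŷ₁, ŷ₂, ν) = (ŷ₂, ν')`;
* `(ŷ₁, ŷ₂, ν) ∘ (ŷ₂, ŷ₃, ν') = (ŷ₁, ŷ₃, ν)`;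
* `e(ŷ, ν) = (ŷ, ŷ, ν)` and `(ŷ₁, ŷ₂, ν)⁻¹ = (ŷ₂, ŷ₁, ν')`.

The space of composable pairs has the points `(ŷ₁, ŷ₂, ŷ₃, ν)`. -/
structure IsResolvedAtiyah (g : CechPairs hσ → G) (ℛ : AtiyahLike hσ EG G) : Prop where
  d₀ : IsDeRhamCE 𝓘(ℝ, EY) Y (LieAlg EG G) (deRhamCE _ _ _)
  d₁ : IsDeRhamCE (model₂ hσ) (CechPairs hσ) (LieAlg EG G) (deRhamCE _ _ _)
  d₂ : IsDeRhamCE (model₃ hσ) (CechTriples hσ) (LieAlg EG G) (deRhamCE _ _ _)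
  tgt : IsGivenBy ℛ.tgt (fun z : CechPairs hσ => z.fst) fun _ => LinearMap.snd ℝ _ _
  src : IsGivenBy ℛ.src (fun z : CechPairs hσ => z.snd) fun z => cechGauge g z
  one : IsGivenBy ℛ.one (cechOne (hσ := hσ)) fun _ => LinearMap.snd ℝ _ _
  inv : IsGivenBy ℛ.inv (cechInv (hσ := hσ)) fun z => cechGauge g z
  fst : IsGivenBy ℛ.fst (cechFst (hσ := hσ)) fun _ => LinearMap.snd ℝ _ _
  snd : IsGivenBy ℛ.snd (cechSnd (hσ := hσ)) fun t => cechGauge g (cechFst t) ∘ₗ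
    (tangentMap (model₃ hσ) (model₂ hσ) (cechFst (hσ := hσ)) t).prodMap LinearMap.id
  mul : IsGivenBy ℛ.mul (cechMul (hσ := hσ)) fun _ => LinearMap.snd ℝ _ _

variable {ℛ : AtiyahLike hσ EG G} {𝒜 : InnerActionLike EG G} {𝒞 : CechLike hσ}
  {ℬ : DeloopingLike EG G}

/-- The functor `ρ` from the resolved Atiyah algebroid to the tangent Čech groupoid:
`(ŷ, ν) ↦ ŷ` and `(ŷ₁, ŷ₂, ν) ↦ (ŷ₁, ŷ₂)`. -/
structure IsAnchor (ρ : DGFunctor ℛ 𝒞) : Prop where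
  obj : IsGivenBy ρ.obj (fun y : Y => y) fun _ => 0
  mor : IsGivenBy ρ.mor (fun z : CechPairs hσ => z) fun _ => 0

/-- The functor `ĝ` from the resolved Atiyah algebroid to the inner action groupoid:
`(ŷ, ν) ↦ ν` and `(ŷ₁, ŷ₂, ν) ↦ (ν; g₁₂, dg₁₂)`. -/
structure IsLiftOfTransition (g : CechPairs hσ → G) (γ : DGFunctor ℛ 𝒜) : Prop where
  obj : IsGivenBy γ.obj (fun _ : Y => PUnit.unit) fun _ => LinearMap.snd ℝ _ _
  mor : IsGivenBy γ.mor g fun _ => LinearMap.snd ℝ _ _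

/-- The functor `ϱ` from the inner action groupoid to `T[1]BG`: `(ν; h, γ) ↦ (h, γ)`. -/
structure IsInnerProjection (ϱ : DGFunctor 𝒜 ℬ) : Prop where
  obj : IsGivenBy ϱ.obj (fun x : Pt => x) fun _ => 0
  mor : IsGivenBy ϱ.mor (fun h : G => h) fun _ => 0

/-- The functor `dg` from the tangent Čech groupoid to `T[1]BG`, the differential of `g`. -/
structure IsDifferentialOfTransition (g : CechPairs hσ → G) (δ : DGFunctor 𝒞 ℬ) : Prop where
  obj : IsDifferentialOf δ.obj (fun _ : Y => PUnit.unit)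
  mor : IsDifferentialOf δ.mor g

end Groupoids

end DGAtiyah

end

open DGAtiyah

noncomputable section

namespace DGAtiyah

set_option linter.unusedSectionVars false
set_option linter.unusedSimpArgs false
set_option linter.unusedVariables false
set_option linter.style.longLine false

section ExteriorBasis

variable {W : Type*} [AddCommGroup W] [Module ℝ W]

open ExteriorAlgebra in
lemma exteriorBasis_eq_prod {m : ℕ} (b : Module.Basis (Fin m) ℝ W) (s : Finset (Fin m)) :
    b.ExteriorAlgebra s = ((s.sort (· ≤ ·)).map fun i => ι ℝ (b i)).prod := by
  rw [basis_apply_ofCard b (rfl : s.card = s.card)]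
  refine (ιMulti_apply _).trans ?_
  congr 1
  apply List.ext_getElem
  · simp
  · intro n h₁ h₂
    simp only [List.getElem_ofFn, Function.comp_apply, List.getElem_map]
    congr 2

lemma exteriorBasis_empty {m : ℕ} (b : Module.Basis (Fin m) ℝ W) :
    b.ExteriorAlgebra ∅ = 1 := by
  simp [exteriorBasis_eq_prod]

open ExteriorAlgebra in
lemma exteriorBasis_insert {m : ℕ} (b : Module.Basis (Fin m) ℝ W) {a : Fin m}
    {s : Finset (Fin m)} (h : ∀ x ∈ s, a < x) :
    b.ExteriorAlgebra (insert a s) = ι ℝ (b a) * b.ExteriorAlgebra s := by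
  rw [exteriorBasis_eq_prod, exteriorBasis_eq_prod, Finset.sort_insert]
  · simp
  · exact fun x hx => (h x hx).le
  · exact fun ha => lt_irrefl _ (h a ha)

open ExteriorAlgebra in
lemma ι_mul_ι_mul {R : Type*} [CommRing R] {W : Type*} [AddCommGroup W] [Module R W] (x y : W)
    (z : ExteriorAlgebra R W) : ι R x * (ι R y * z) = -(ι R y * (ι R x * z)) := by
  have := ι_add_mul_swap (R := R) x y
  rw [← mul_assoc, ← mul_assoc, eq_neg_of_add_eq_zero_left this, neg_mul]

open ExteriorAlgebra in
lemma ι_mul_exteriorBasis {m : ℕ} (b : Module.Basis (Fin m) ℝ W) (a : Fin m)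
    (t : Finset (Fin m)) :
    ι ℝ (b a) * b.ExteriorAlgebra t = if a ∈ t then 0 else
      (-1 : ℝ) ^ (t.filter (· < a)).card • b.ExteriorAlgebra (insert a t) := by
  induction t using Finset.induction_on_min with
  | empty => simpa using (exteriorBasis_insert b (a := a) (s := ∅) (by simp)).symm
  | insert c t hc ih =>
    have hct : c ∉ t := fun h => lt_irrefl _ (hc c h)
    rcases lt_trichotomy a c with hac | rfl | hac
    · have ha : ∀ x ∈ insert c t, a < x := by
        intro x hx
        rcases Finset.mem_insert.1 hx with rfl | hx
        · exact hac
        · exact hac.trans (hc x hx)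
      rw [if_neg fun h => lt_irrefl _ (ha a h), exteriorBasis_insert b ha]
      rw [Finset.filter_false_of_mem fun x hx => (ha x hx).le.not_gt]
      simp
    · rw [if_pos (Finset.mem_insert_self _ _), exteriorBasis_insert b hc, ← mul_assoc,
        ι_sq_zero, zero_mul]
    · rw [exteriorBasis_insert b hc, ι_mul_ι_mul, ih]
      by_cases hat : a ∈ t
      · simp [hat]
      · rw [if_neg hat, if_neg (by simp [hat, hac.ne'])]
        have hc' : ∀ x ∈ insert a t, c < x := by
          intro x hx
          rcases Finset.mem_insert.1 hx with rfl | hx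
          · exact hac
          · exact hc x hx
        rw [Finset.insert_comm, exteriorBasis_insert b hc', Finset.filter_insert, if_pos hac,
          Finset.card_insert_of_notMem (by simp [hct]), pow_succ, mul_smul_comm]
        simp

lemma exteriorBasis_mul {m : ℕ} (b : Module.Basis (Fin m) ℝ W) (s t : Finset (Fin m)) :
    b.ExteriorAlgebra s * b.ExteriorAlgebra t = if Disjoint s t then
      (-1 : ℝ) ^ (∑ i ∈ s, (t.filter (· < i)).card) • b.ExteriorAlgebra (s ∪ t) else 0 := by
  induction s using Finset.induction_on_min with
  | empty => simp [exteriorBasis_empty]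
  | insert c s hc ih =>
    have hcs : c ∉ s := fun h => lt_irrefl _ (hc c h)
    rw [exteriorBasis_insert b hc, mul_assoc, ih]
    by_cases hst : Disjoint s t
    · rw [if_pos hst, mul_smul_comm, ι_mul_exteriorBasis]
      by_cases hct : c ∈ t
      · simp [hct]
      · rw [if_neg (by simp [hcs, hct]), if_pos (by simp [hct, hst]), smul_smul, ← pow_add,
          Finset.sum_insert hcs, Finset.insert_union]
        have : (s ∪ t).filter (· < c) = t.filter (· < c) := by
          rw [Finset.filter_union, Finset.filter_false_of_mem fun x hx => (hc x hx).le.not_gt,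
            Finset.empty_union]
        rw [this, add_comm]
    · rw [if_neg hst, if_neg (by simp [hst]), mul_zero]

/-- Multi-indices with entries at most `1` are indicator functions. -/
lemma admissible_one_eq {m : ℕ} {α : Fin m →₀ ℕ} (h : Admissible (fun _ : Fin m => (1 : ℤ)) α)
    (i : Fin m) : α i = if i ∈ α.support then 1 else 0 := by
  have := h i odd_one
  by_cases hi : α i = 0
  · simp [hi]
  · simp [hi]; omega

lemma weight_one_eq {m : ℕ} {α : Fin m →₀ ℕ} (h : Admissible (fun _ : Fin m => (1 : ℤ)) α) :
    weight (fun _ : Fin m => (1 : ℤ)) α = α.support.card := by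
  unfold weight
  simp_rw [admissible_one_eq h, mul_one, Nat.cast_ite, Nat.cast_one, Nat.cast_zero]
  rw [Finset.sum_ite_mem, Finset.univ_inter]
  simp

/-- The indicator function of a finite set, as a multi-index. -/
def indicatorIndex {m : ℕ} (s : Finset (Fin m)) : Fin m →₀ ℕ :=
  Finsupp.indicator s fun _ _ => 1

lemma indicatorIndex_apply {m : ℕ} (s : Finset (Fin m)) (i : Fin m) :
    indicatorIndex s i = if i ∈ s then 1 else 0 := by
  simp [indicatorIndex, Finsupp.indicator_apply]

lemma support_indicatorIndex {m : ℕ} (s : Finset (Fin m)) : (indicatorIndex s).support = s := by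
  ext i; simp [indicatorIndex_apply]

lemma admissible_indicatorIndex {m : ℕ} (s : Finset (Fin m)) :
    Admissible (fun _ : Fin m => (1 : ℤ)) (indicatorIndex s) := by
  intro i _
  rw [indicatorIndex_apply]
  split_ifs <;> simp

lemma indicatorIndex_support {m : ℕ} {α : Fin m →₀ ℕ}
    (h : Admissible (fun _ : Fin m => (1 : ℤ)) α) : indicatorIndex α.support = α := by
  ext i
  rw [indicatorIndex_apply, ← admissible_one_eq h]

lemma koszulSign_indicatorIndex {m : ℕ} (s t : Finset (Fin m)) :
    koszulSign (fun _ : Fin m => (1 : ℤ)) (indicatorIndex s) (indicatorIndex t) =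
      (-1 : ℝ) ^ (∑ i ∈ s, (t.filter (· < i)).card) := by
  unfold koszulSign
  congr 1
  simp only [indicatorIndex_apply, Int.natAbs_one, mul_one]
  rw [← Finset.sum_filter_add_sum_filter_not Finset.univ (· ∈ s)]
  simp only [Finset.sum_filter]
  rw [Finset.sum_eq_zero (s := Finset.univ) (f := fun a => if a ∉ s then _ else 0), add_zero]
  · rw [← Finset.sum_filter, Finset.filter_mem_eq_inter, Finset.univ_inter]
    refine Finset.sum_congr rfl fun i hi => ?_
    rw [Finset.card_filter, ← Finset.sum_filter_add_sum_filter_not Finset.univ (· ∈ t)]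
    simp only [hi, if_true, one_mul]
    rw [Finset.sum_filter, Finset.sum_filter]
    rw [Finset.sum_eq_zero (f := fun a => if a ∉ t then _ else 0), add_zero,
      ← Finset.sum_filter, Finset.filter_mem_eq_inter, Finset.univ_inter]
    · refine Finset.sum_congr rfl fun j hj => ?_
      simp [hj]
    · intro j _
      split_ifs <;> simp
  · intro i _
    by_cases h : i ∈ s <;> simp [h]

/-- The coefficients of a product in an exterior algebra. -/
lemma exteriorBasis_repr_mul {m : ℕ} (b : Module.Basis (Fin m) ℝ W) (x y : ExteriorAlgebra ℝ W)
    (α : Fin m →₀ ℕ) (hα : Admissible (fun _ : Fin m => (1 : ℤ)) α) :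
    b.ExteriorAlgebra.repr (x * y) α.support =
      ∑ p ∈ Finset.HasAntidiagonal.antidiagonal α,
        koszulSign (fun _ : Fin m => (1 : ℤ)) p.1 p.2 * b.ExteriorAlgebra.repr x p.1.support *
          b.ExteriorAlgebra.repr y p.2.support := by
  set B := b.ExteriorAlgebra with hB
  have hxy : x * y = ∑ s, ∑ t, (B.repr x s * B.repr y t) • (B s * B t) := by
    conv_lhs => rw [← B.sum_repr x, ← B.sum_repr y, Finset.sum_mul_sum]
    simp_rw [smul_mul_smul_comm]
  rw [hxy]
  simp only [map_sum, map_smul, Finsupp.coe_finsetSum, Finset.sum_apply, Finsupp.smul_apply,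
    smul_eq_mul]
  rw [← Finset.sum_product', Finset.univ_product_univ]
  have key : ∀ q : Finset (Fin m) × Finset (Fin m),
      B.repr x q.1 * B.repr y q.2 * B.repr (B q.1 * B q.2) α.support =
      if Disjoint q.1 q.2 ∧ q.1 ∪ q.2 = α.support then
        koszulSign (fun _ : Fin m => (1 : ℤ)) (indicatorIndex q.1) (indicatorIndex q.2) *
        B.repr x q.1 * B.repr y q.2 else 0 := by
    rintro ⟨s, t⟩
    simp only [koszulSign_indicatorIndex]
    rw [hB, exteriorBasis_mul, ← hB]
    by_cases h : Disjoint s t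
    · by_cases h' : s ∪ t = α.support
      · simp [h, h']; ring
      · simp [h, h']
    · simp [h]
  simp_rw [key]
  rw [← Finset.sum_filter]
  refine Finset.sum_nbij' (fun q => (indicatorIndex q.1, indicatorIndex q.2))
    (fun p => (p.1.support, p.2.support)) ?_ ?_ ?_ ?_ ?_
  · rintro ⟨s, t⟩ h
    simp only [Finset.mem_filter, Finset.mem_univ, true_and] at h
    rw [Finset.HasAntidiagonal.mem_antidiagonal]
    ext i
    have hi : i ∈ α.support ↔ i ∈ s ∨ i ∈ t := by rw [← h.2, Finset.mem_union]
    rw [Finsupp.add_apply, admissible_one_eq hα, indicatorIndex_apply, indicatorIndex_apply]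
    by_cases h1 : i ∈ s
    · have h2 : i ∉ t := Finset.disjoint_left.1 h.1 h1
      simp only [hi, h1, h2, true_or, if_true, if_false, add_zero]
    · by_cases h2 : i ∈ t <;> simp only [hi, h1, h2, or_self, or_true, if_true, if_false, zero_add]
  · rintro ⟨p, q⟩ h
    rw [Finset.HasAntidiagonal.mem_antidiagonal] at h
    subst h
    simp only [Finset.mem_filter, Finset.mem_univ, true_and]
    constructor
    · rw [Finset.disjoint_left]
      intro i hp hq
      have := hα i odd_one
      simp only [Finsupp.mem_support_iff, Finsupp.add_apply] at *
      omega
    · ext i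
      simp only [Finset.mem_union, Finsupp.mem_support_iff, Finsupp.add_apply]
      omega
  · rintro ⟨s, t⟩ _
    simp [support_indicatorIndex]
  · rintro ⟨p, q⟩ h
    rw [Finset.HasAntidiagonal.mem_antidiagonal] at h
    subst h
    have hp : Admissible (fun _ : Fin m => (1 : ℤ)) p := fun i hi => by
      have := hα i hi; simp only [Finsupp.add_apply] at this; omega
    have hq : Admissible (fun _ : Fin m => (1 : ℤ)) q := fun i hi => by
      have := hα i hi; simp only [Finsupp.add_apply] at this; omega
    simp [indicatorIndex_support, hp, hq]
  · rintro ⟨s, t⟩ _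
    simp [support_indicatorIndex]

end ExteriorBasis

section ExteriorGrading

variable {W : Type*} [AddCommGroup W] [Module ℝ W]

open ExteriorAlgebra

/-- The automorphism of the exterior algebra that is `(-1)^k` in degree `k`. -/
abbrev gradeInvolution : ExteriorAlgebra ℝ W →ₐ[ℝ] ExteriorAlgebra ℝ W :=
  CliffordAlgebra.involute

lemma gradeInvolution_ι (v : W) : gradeInvolution (ι ℝ v) = -ι ℝ v :=
  CliffordAlgebra.involute_ι v

/-- Induction on elements of the exterior algebra by left multiplication with vectors. -/
lemma exterior_left_induction {P : ExteriorAlgebra ℝ W → Prop}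
    (algebraMap : ∀ r : ℝ, P (algebraMap ℝ _ r)) (add : ∀ x y, P x → P y → P (x + y))
    (ι_mul : ∀ x v, P x → P (ι ℝ v * x)) (x : ExteriorAlgebra ℝ W) : P x :=
  CliffordAlgebra.left_induction _ algebraMap add ι_mul x

lemma ι_mul_eq_gradeInvolution_mul (v : W) (x : ExteriorAlgebra ℝ W) :
    ι ℝ v * x = gradeInvolution x * ι ℝ v := by
  induction x using exterior_left_induction with
  | algebraMap r => rw [AlgHom.commutes, Algebra.commutes]
  | add x y hx hy => rw [mul_add, hx, hy, map_add, add_mul]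
  | ι_mul x w hx => rw [ι_mul_ι_mul, hx, map_mul, gradeInvolution_ι, neg_mul, neg_mul, mul_assoc]

lemma gradeInvolution_of_mem {n : ℕ} {x : ExteriorAlgebra ℝ W} (hx : x ∈ ⋀[ℝ]^n W) :
    gradeInvolution x = (-1 : ℝ) ^ n • x := by
  induction n generalizing x with
  | zero =>
    simp only [pow_zero, Submodule.mem_one] at hx
    obtain ⟨r, rfl⟩ := hx
    simp
  | succ n ih =>
    rw [ExteriorAlgebra.exteriorPower, pow_succ'] at hx
    induction hx using Submodule.mul_induction_on' with
    | mem_mul_mem v hv y hy =>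
      obtain ⟨v, rfl⟩ := hv
      rw [map_mul, ih hy]
      refine (congrArg (· * _) (gradeInvolution_ι v)).trans ?_
      rw [neg_mul, mul_smul_comm, pow_succ', neg_one_mul, neg_smul]
    | add a _ b _ ha hb => rw [map_add, ha, hb, smul_add]

lemma exterior_mul_comm {k l : ℕ} {x y : ExteriorAlgebra ℝ W} (hx : x ∈ ⋀[ℝ]^k W)
    (hy : y ∈ ⋀[ℝ]^l W) : x * y = (-1 : ℝ) ^ (k * l) • (y * x) := by
  induction k generalizing x with
  | zero =>
    simp only [pow_zero, Submodule.mem_one] at hx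
    obtain ⟨r, rfl⟩ := hx
    simp [Algebra.commutes]
  | succ n ih =>
    rw [ExteriorAlgebra.exteriorPower, pow_succ'] at hx
    induction hx using Submodule.mul_induction_on' with
    | mem_mul_mem v hv z hz =>
      obtain ⟨v, rfl⟩ := hv
      rw [mul_assoc, ih hz, mul_smul_comm, ← mul_assoc]
      refine (congrArg (fun t => _ • (t * z)) (ι_mul_eq_gradeInvolution_mul v y)).trans ?_
      rw [gradeInvolution_of_mem hy, smul_mul_assoc, smul_mul_assoc, smul_smul, mul_assoc,
        ← pow_add]
      congr 2
      ring
    | add a _ b _ ha hb => rw [add_mul, mul_add, smul_add, ha, hb]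

lemma exteriorBasis_mem {m : ℕ} (b : Module.Basis (Fin m) ℝ W) (s : Finset (Fin m)) :
    b.ExteriorAlgebra s ∈ ⋀[ℝ]^s.card W := by
  induction s using Finset.induction_on_min with
  | empty => rw [exteriorBasis_empty, Finset.card_empty]; simp
  | insert a s h ih =>
    rw [exteriorBasis_insert b h, Finset.card_insert_of_notMem fun ha => lt_irrefl _ (h a ha),
      ExteriorAlgebra.exteriorPower, pow_succ']
    exact Submodule.mul_mem_mul ⟨b a, rfl⟩ ih

/-- Antiderivations of the exterior algebra satisfy the Leibniz rule if they do so for products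
with vectors. -/
lemma antiderivation_mul {δ : ExteriorAlgebra ℝ W →ₗ[ℝ] ExteriorAlgebra ℝ W} (h1 : δ 1 = 0)
    (hι : ∀ v x, δ (ι ℝ v * x) = δ (ι ℝ v) * x - ι ℝ v * δ x) (x y : ExteriorAlgebra ℝ W) :
    δ (x * y) = δ x * y + gradeInvolution x * δ y := by
  induction x using exterior_left_induction with
  | algebraMap r =>
    rw [AlgHom.commutes, Algebra.algebraMap_eq_smul_one]
    simp [h1]
  | add x x' hx hx' => simp only [add_mul, map_add, hx, hx']; abel
  | ι_mul x v hx =>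
    rw [mul_assoc, hι, hx, hι, map_mul, gradeInvolution_ι]
    noncomm_ring

end ExteriorGrading

section FibreGrading

variable {E V : Type u} [NormedAddCommGroup E] [NormedSpace ℝ E] [AddCommGroup V] [Module ℝ V]

lemma fibreDeg_natCast (n : ℕ) : fibreDeg E V n = ⋀[ℝ]^n (Module.Dual ℝ (E × V)) := rfl

lemma fibreDeg_neg {k : ℤ} (hk : k < 0) : fibreDeg E V k = ⊥ := by
  obtain ⟨n, rfl⟩ := Int.eq_negSucc_of_lt_zero hk
  rfl

lemma one_mem_fibreDeg : (1 : Fibre E V) ∈ fibreDeg E V 0 :=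
  show (1 : Fibre E V) ∈ ⋀[ℝ]^0 (Module.Dual ℝ (E × V)) by simp

lemma algebraMap_mem_fibreDeg (r : ℝ) : algebraMap ℝ (Fibre E V) r ∈ fibreDeg E V 0 := by
  rw [Algebra.algebraMap_eq_smul_one]
  exact Submodule.smul_mem _ _ one_mem_fibreDeg

lemma ι_mem_fibreDeg (v : Module.Dual ℝ (E × V)) : ExteriorAlgebra.ι ℝ v ∈ fibreDeg E V 1 := by
  change _ ∈ ⋀[ℝ]^1 (Module.Dual ℝ (E × V))
  rw [ExteriorAlgebra.exteriorPower, pow_one]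
  exact ⟨v, rfl⟩

lemma mul_mem_fibreDeg {k l : ℤ} {x y : Fibre E V} (hx : x ∈ fibreDeg E V k)
    (hy : y ∈ fibreDeg E V l) : x * y ∈ fibreDeg E V (k + l) := by
  rcases lt_or_ge k 0 with hk | hk
  · rw [fibreDeg_neg hk, Submodule.mem_bot] at hx
    simp [hx]
  rcases lt_or_ge l 0 with hl | hl
  · rw [fibreDeg_neg hl, Submodule.mem_bot] at hy
    simp [hy]
  lift k to ℕ using hk
  lift l to ℕ using hl
  rw [← Nat.cast_add, fibreDeg_natCast, ExteriorAlgebra.exteriorPower, pow_add]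
  exact Submodule.mul_mem_mul hx hy

lemma fibre_mul_comm {k l : ℤ} {x y : Fibre E V} (hx : x ∈ fibreDeg E V k)
    (hy : y ∈ fibreDeg E V l) : x * y = ((-1 : ℝ) ^ (k * l)) • (y * x) := by
  rcases lt_or_ge k 0 with hk | hk
  · rw [fibreDeg_neg hk, Submodule.mem_bot] at hx
    simp [hx]
  rcases lt_or_ge l 0 with hl | hl
  · rw [fibreDeg_neg hl, Submodule.mem_bot] at hy
    simp [hy]
  lift k to ℕ using hk
  lift l to ℕ using hl
  rw [← Nat.cast_mul, zpow_natCast]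
  exact exterior_mul_comm hx hy

lemma gradeInvolution_of_mem_fibreDeg {k : ℤ} {x : Fibre E V} (hx : x ∈ fibreDeg E V k) :
    gradeInvolution x = ((-1 : ℝ) ^ k) • x := by
  rcases lt_or_ge k 0 with hk | hk
  · rw [fibreDeg_neg hk, Submodule.mem_bot] at hx
    simp [hx]
  lift k to ℕ using hk
  rw [zpow_natCast]
  exact gradeInvolution_of_mem hx

/-- The projection to the elements of degree `k`. -/
def fibreProj (E V : Type u) [NormedAddCommGroup E] [NormedSpace ℝ E]
    [AddCommGroup V] [Module ℝ V] : ℤ → (Fibre E V →ₗ[ℝ] Fibre E V)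
  | Int.ofNat n => GradedAlgebra.proj (fun i : ℕ => ⋀[ℝ]^i (Module.Dual ℝ (E × V))) n
  | Int.negSucc _ => 0

lemma fibreProj_mem (k : ℤ) (x : Fibre E V) : fibreProj E V k x ∈ fibreDeg E V k := by
  cases k with
  | ofNat n => exact SetLike.coe_mem _
  | negSucc n => exact zero_mem _

lemma fibreProj_of_mem {k : ℤ} {x : Fibre E V} (hx : x ∈ fibreDeg E V k) (l : ℤ) :
    fibreProj E V l x = if l = k then x else 0 := by
  rcases lt_or_ge k 0 with hk | hk
  · rw [fibreDeg_neg hk, Submodule.mem_bot] at hx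
    simp [hx]
  lift k to ℕ using hk
  cases l with
  | negSucc n => rw [if_neg (by omega)]; rfl
  | ofNat n =>
    change GradedAlgebra.proj (fun i : ℕ => ⋀[ℝ]^i (Module.Dual ℝ (E × V))) n x = _
    rw [GradedAlgebra.proj_apply]
    by_cases h : n = k
    · subst h
      rw [DirectSum.decompose_of_mem_same (fun i : ℕ => ⋀[ℝ]^i (Module.Dual ℝ (E × V))) hx]
      simp
    · rw [DirectSum.decompose_of_mem_ne (fun i : ℕ => ⋀[ℝ]^i (Module.Dual ℝ (E × V))) hx (Ne.symm h), if_neg (by simpa using h)]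

open Classical in
lemma fibreProj_ι_mul (v : Module.Dual ℝ (E × V)) (x : Fibre E V) (k : ℤ) :
    fibreProj E V k (ExteriorAlgebra.ι ℝ v * x) =
      ExteriorAlgebra.ι ℝ v * fibreProj E V (k - 1) x := by
  have hx : x = ∑ i ∈ (DirectSum.decompose (fun i : ℕ => ⋀[ℝ]^i (Module.Dual ℝ (E × V))) x).support,
      (DirectSum.decompose (fun i : ℕ => ⋀[ℝ]^i (Module.Dual ℝ (E × V))) x i : Fibre E V) :=
    (DirectSum.sum_support_decompose _ x).symm
  rw [hx]
  simp only [Finset.mul_sum, map_sum]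
  refine Finset.sum_congr rfl fun i _ => ?_
  generalize DirectSum.decompose (fun i : ℕ => ⋀[ℝ]^i (Module.Dual ℝ (E × V))) x i = y
  have hy : (y : Fibre E V) ∈ fibreDeg E V i := y.2
  rw [fibreProj_of_mem hy, fibreProj_of_mem (mul_mem_fibreDeg (ι_mem_fibreDeg v) hy)]
  by_cases h : k = 1 + i
  · rw [if_pos h, if_pos (by omega)]
  · rw [if_neg h, if_neg (by omega), mul_zero]

lemma sum_fibreProj [FiniteDimensional ℝ E] [Module.Finite ℝ V] (x : Fibre E V) :
    ∑ n ∈ Finset.range (Module.finrank ℝ (Module.Dual ℝ (E × V)) + 1), fibreProj E V n x = x := by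
  set B := (Module.finBasis ℝ (Module.Dual ℝ (E × V))).ExteriorAlgebra with hB
  rw [← B.sum_repr x]
  simp only [map_sum, map_smul]
  rw [Finset.sum_comm]
  refine Finset.sum_congr rfl fun s _ => ?_
  rw [← Finset.smul_sum]
  congr 1
  have hs : B s ∈ fibreDeg E V s.card := exteriorBasis_mem _ s
  simp_rw [fibreProj_of_mem hs, Nat.cast_inj]
  have : s.card < Module.finrank ℝ (Module.Dual ℝ (E × V)) + 1 :=
    Nat.lt_succ_of_le ((Finset.card_le_univ s).trans (by simp))
  have hc : ∀ n : ℕ, (if n = s.card then B s else 0) = if s.card = n then B s else 0 :=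
    fun n => by simp [eq_comm]
  simp_rw [hc]
  rw [Finset.sum_ite_eq, if_pos (Finset.mem_range.2 this)]

end FibreGrading

section ChevalleyEilenberg

variable {E V : Type u} [NormedAddCommGroup E] [NormedSpace ℝ E] [AddCommGroup V] [Module ℝ V]
  [Module.Finite ℝ V] [Bracket V V]

open ExteriorAlgebra

variable (E) in
lemma chevalleyEilenberg_sum {ι' : Type*} (s : Finset ι') (c : ι' → ℝ)
    (ξ : ι' → Module.Dual ℝ V) :
    chevalleyEilenberg E (∑ i ∈ s, c i • ξ i) = ∑ i ∈ s, c i • chevalleyEilenberg E (ξ i) := by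
  simp only [chevalleyEilenberg, LinearMap.sum_apply, LinearMap.smul_apply, smul_eq_mul,
    Finset.sum_smul, Finset.smul_sum, smul_smul]
  simp_rw [Finset.sum_comm (s := s)]
  refine Finset.sum_congr rfl fun b _ => Finset.sum_congr rfl fun c _ =>
    Finset.sum_congr rfl fun i _ => ?_
  congr 1
  ring

lemma chevalleyEilenberg_mem (ξ : Module.Dual ℝ V) :
    chevalleyEilenberg E ξ ∈ fibreDeg E V 2 := by
  refine Submodule.smul_mem _ _ (Submodule.sum_mem _ fun b _ => Submodule.sum_mem _ fun c _ =>
    Submodule.smul_mem _ _ ?_)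
  exact mul_mem_fibreDeg (ι_mem_fibreDeg _) (ι_mem_fibreDeg _)

lemma commute_of_mem_fibreDeg_two {x : Fibre E V} (hx : x ∈ fibreDeg E V 2) (v) :
    ι ℝ v * x = x * ι ℝ v := by
  rw [ι_mul_eq_gradeInvolution_mul, gradeInvolution_of_mem_fibreDeg hx]
  norm_num

variable (E V) in
/-- The Chevalley–Eilenberg differential as an antiderivation of the exterior algebra. -/
def ceDerivation : Fibre E V →ₗ[ℝ] Fibre E V :=
  ∑ a, LinearMap.mulLeft ℝ (chevalleyEilenberg E ((Module.finBasis ℝ V).coord a)) ∘ₗ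
    CliffordAlgebra.contractLeft (Module.Dual.eval ℝ (E × V) (0, Module.finBasis ℝ V a))

lemma ceDerivation_apply (x : Fibre E V) : ceDerivation E V x =
    ∑ a, chevalleyEilenberg E ((Module.finBasis ℝ V).coord a) *
      CliffordAlgebra.contractLeft (Module.Dual.eval ℝ (E × V) (0, Module.finBasis ℝ V a)) x := by
  simp [ceDerivation]

lemma ceDerivation_one : ceDerivation E V 1 = 0 := by
  rw [ceDerivation_apply]
  refine Finset.sum_eq_zero fun a _ => ?_
  exact (congrArg _ (CliffordAlgebra.contractLeft_one (Q := (0 : QuadraticForm ℝ _)) _)).trans (mul_zero _)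

lemma ceDerivation_ι (v : Module.Dual ℝ (E × V)) :
    ceDerivation E V (ι ℝ v) = chevalleyEilenberg E (v ∘ₗ LinearMap.inr ℝ E V) := by
  have : v ∘ₗ LinearMap.inr ℝ E V = ∑ a, v (0, Module.finBasis ℝ V a) •
      (Module.finBasis ℝ V).coord a := by
    refine (Module.finBasis ℝ V).ext fun b => ?_
    simp [Finsupp.single_apply]
  rw [ceDerivation_apply, this, chevalleyEilenberg_sum]
  refine Finset.sum_congr rfl fun a _ => ?_
  refine (congrArg _ (CliffordAlgebra.contractLeft_ι (Q := (0 : QuadraticForm ℝ _)) _ _)).trans ?_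
  rw [← Algebra.commutes, ← Algebra.smul_def]
  rfl

lemma ceDerivation_ι_mul (v : Module.Dual ℝ (E × V)) (x : Fibre E V) :
    ceDerivation E V (ι ℝ v * x) =
      ceDerivation E V (ι ℝ v) * x - ι ℝ v * ceDerivation E V x := by
  simp only [ceDerivation_apply, Finset.sum_mul, Finset.mul_sum, ← Finset.sum_sub_distrib]
  refine Finset.sum_congr rfl fun a _ => ?_
  have h1 := CliffordAlgebra.contractLeft_ι_mul (Q := (0 : QuadraticForm ℝ _))
    (Module.Dual.eval ℝ (E × V) (0, Module.finBasis ℝ V a)) v x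
  have h2 := CliffordAlgebra.contractLeft_ι (Q := (0 : QuadraticForm ℝ _))
    (Module.Dual.eval ℝ (E × V) (0, Module.finBasis ℝ V a)) v
  refine (congrArg _ h1).trans ?_
  refine Eq.trans ?_ (congrArg (fun t => _ * t * x - _) h2).symm
  rw [mul_sub, ← mul_assoc, ← mul_assoc, mul_smul_comm]
  refine congrArg₂ _ ?_ (congrArg (· * _) ?_)
  · rw [← Algebra.commutes, ← Algebra.smul_def, smul_mul_assoc]
  · exact (commute_of_mem_fibreDeg_two (chevalleyEilenberg_mem _) v).symm

lemma ceDerivation_mul (x y : Fibre E V) :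
    ceDerivation E V (x * y) = ceDerivation E V x * y + gradeInvolution x * ceDerivation E V y :=
  antiderivation_mul ceDerivation_one ceDerivation_ι_mul x y

end ChevalleyEilenberg

section TangentMaps

variable {E : Type u} [NormedAddCommGroup E] [NormedSpace ℝ E]
  {H : Type u} [TopologicalSpace H] {I : ModelWithCorners ℝ E H}
  {M : Type u} [TopologicalSpace M] [ChartedSpace H M]
  {E' : Type u} [NormedAddCommGroup E'] [NormedSpace ℝ E']
  {H' : Type u} [TopologicalSpace H'] {I' : ModelWithCorners ℝ E' H'}
  {M' : Type u} [TopologicalSpace M'] [ChartedSpace H' M']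
  {E'' : Type u} [NormedAddCommGroup E''] [NormedSpace ℝ E'']
  {H'' : Type u} [TopologicalSpace H''] {I'' : ModelWithCorners ℝ E'' H''}
  {M'' : Type u} [TopologicalSpace M''] [ChartedSpace H'' M'']

lemma _root_.ContMDiffOn.mdifferentiableAt_of_mem {n : WithTop ℕ∞} (hn : n ≠ 0) {E' H' M' : Type*}
    [NormedAddCommGroup E'] [NormedSpace ℝ E'] [TopologicalSpace H']
    {I' : ModelWithCorners ℝ E' H'} [TopologicalSpace M'] [ChartedSpace H' M']
    {f : M → M'} {N : Set M} (hf : ContMDiffOn I I' n f N) (hN : IsOpen N) {x : M} (hx : x ∈ N) :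
    MDifferentiableAt I I' f x :=
  (hf.contMDiffAt (hN.mem_nhds hx)).mdifferentiableAt hn

lemma tangentMap_comp {g : M' → M''} {f : M → M'} {x : M}
    (hg : MDifferentiableAt I' I'' g (f x)) (hf : MDifferentiableAt I I' f x) :
    tangentMap I I'' (g ∘ f) x = tangentMap I' I'' g (f x) ∘ₗ tangentMap I I' f x := by
  ext v
  exact congrArg (fun L => L v) (mfderiv_comp x hg hf)

lemma tangentMap_congr {f g : M → M'} {x : M} (h : f =ᶠ[𝓝 x] g) :
    tangentMap I I' f x = tangentMap I I' g x := by
  ext v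
  exact congrArg (fun L : E →L[ℝ] E' => L v) h.mfderiv_eq

lemma tangentMap_id (x : M) : tangentMap I I (fun y : M => y) x = LinearMap.id := by
  ext v
  exact congrArg (fun L : E →L[ℝ] E => L v) mfderiv_id

lemma tangentMap_const (c : M') (x : M) : tangentMap I I' (fun _ : M => c) x = 0 := by
  ext v
  exact congrArg (fun L : E →L[ℝ] E' => L v) mfderiv_const

/-- The differential of a function at a point, as a linear form. -/
def dAt (I : ModelWithCorners ℝ E H) (f : M → ℝ) (x : M) : Module.Dual ℝ E :=
  ContinuousLinearMap.toLinearMap (show E →L[ℝ] ℝ from mfderiv I 𝓘(ℝ, ℝ) f x)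

lemma differentialAt_eq (V : Type u) [AddCommGroup V] [Module ℝ V] (f : M → ℝ) (x : M) :
    differentialAt I V f x = ExteriorAlgebra.ι ℝ (dAt I f x ∘ₗ LinearMap.fst ℝ E V) := rfl

lemma dAt_congr {f g : M → ℝ} {x : M} (h : f =ᶠ[𝓝 x] g) : dAt I f x = dAt I g x := by
  ext v
  exact congrArg (fun L : E →L[ℝ] ℝ => L v) h.mfderiv_eq

lemma dAt_comp {g : M' → ℝ} {f : M → M'} {x : M}
    (hg : MDifferentiableAt I' 𝓘(ℝ, ℝ) g (f x)) (hf : MDifferentiableAt I I' f x) :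
    dAt I (g ∘ f) x = dAt I' g (f x) ∘ₗ tangentMap I I' f x := by
  ext v
  exact congrArg (fun L : E →L[ℝ] ℝ => L v) (mfderiv_comp x hg hf)

lemma dAt_const (c : ℝ) (x : M) : dAt I (fun _ : M => c) x = 0 := by
  ext v
  exact congrArg (fun L : E →L[ℝ] ℝ => L v) mfderiv_const

lemma dAt_add {f g : M → ℝ} {x : M} (hf : MDifferentiableAt I 𝓘(ℝ, ℝ) f x)
    (hg : MDifferentiableAt I 𝓘(ℝ, ℝ) g x) :
    dAt I (fun y => f y + g y) x = dAt I f x + dAt I g x := by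
  ext v
  exact congrArg (fun L : E →L[ℝ] ℝ => L v) (mfderiv_add hf hg)

lemma dAt_mul {f g : M → ℝ} {x : M} (hf : MDifferentiableAt I 𝓘(ℝ, ℝ) f x)
    (hg : MDifferentiableAt I 𝓘(ℝ, ℝ) g x) :
    dAt I (fun y => f y * g y) x = f x • dAt I g x + g x • dAt I f x := by
  ext v
  have h := (hf.hasMFDerivAt.mul hg.hasMFDerivAt).mfderiv
  exact congrArg (fun L : E →L[ℝ] ℝ => L v) h

lemma dAt_sum {ι : Type*} (s : Finset ι) {f : ι → M → ℝ} {x : M}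
    (hf : ∀ i ∈ s, MDifferentiableAt I 𝓘(ℝ, ℝ) (f i) x) :
    MDifferentiableAt I 𝓘(ℝ, ℝ) (fun y => ∑ i ∈ s, f i y) x ∧
      dAt I (fun y => ∑ i ∈ s, f i y) x = ∑ i ∈ s, dAt I (f i) x := by
  classical
  induction s using Finset.induction_on with
  | empty => simpa using ⟨mdifferentiableAt_const, dAt_const 0 x⟩
  | insert a s ha ih =>
    obtain ⟨h1, h2⟩ := ih fun i hi => hf i (Finset.mem_insert_of_mem hi)
    have h3 := hf a (Finset.mem_insert_self _ _)
    simp only [Finset.sum_insert ha]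
    exact ⟨h3.add h1, by rw [dAt_add h3 h1, h2]⟩

end TangentMaps

section Charts

variable {E : Type u} [NormedAddCommGroup E] [NormedSpace ℝ E]
  {H : Type u} [TopologicalSpace H] {I : ModelWithCorners ℝ E H} [I.Boundaryless]
  {M : Type u} [TopologicalSpace M] [ChartedSpace H M] [IsManifold I ∞ M]

/-- The domain of the preferred chart at a point. -/
def chartDomain (H : Type u) [TopologicalSpace H] {M : Type u} [TopologicalSpace M]
    [ChartedSpace H M] (x : M) : Opens M :=
  ⟨(chartAt H x).source, (chartAt H x).open_source⟩

lemma mem_chartDomain (x : M) : x ∈ chartDomain H x := mem_chart_source H x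

lemma mdifferentiableAt_extChartAt_symm {x : M} {u : E} (hu : u ∈ (extChartAt I x).target) :
    MDifferentiableAt 𝓘(ℝ, E) I (extChartAt I x).symm u :=
  (contMDiffOn_extChartAt_symm (I := I) (n := ∞) x).mdifferentiableAt_of_mem (by simp)
    (isOpen_extChartAt_target x) hu

lemma tangentMap_chart_comp_symm {x y : M} (hy : y ∈ chartDomain H x) :
    tangentMap I 𝓘(ℝ, E) (extChartAt I x) y ∘ₗ
      tangentMap 𝓘(ℝ, E) I (extChartAt I x).symm (extChartAt I x y) = LinearMap.id := by
  have hy' : y ∈ (extChartAt I x).source := by rwa [extChartAt_source]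
  have hu := (extChartAt I x).map_source hy'
  have h1 : MDifferentiableAt I 𝓘(ℝ, E) (extChartAt I x)
      ((extChartAt I x).symm (extChartAt I x y)) := by
    rw [(extChartAt I x).left_inv hy']
    exact mdifferentiableAt_extChartAt hy
  have h2 := tangentMap_comp h1 (mdifferentiableAt_extChartAt_symm hu)
  rw [(extChartAt I x).left_inv hy'] at h2
  rw [← h2, ← tangentMap_id (I := 𝓘(ℝ, E)) (extChartAt I x y)]
  refine tangentMap_congr ?_
  filter_upwards [(isOpen_extChartAt_target x).mem_nhds hu] with z hz
  exact (extChartAt I x).right_inv hz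

lemma tangentMap_symm_comp_chart {x y : M} (hy : y ∈ chartDomain H x) :
    tangentMap 𝓘(ℝ, E) I (extChartAt I x).symm (extChartAt I x y) ∘ₗ
      tangentMap I 𝓘(ℝ, E) (extChartAt I x) y = LinearMap.id := by
  have hy' : y ∈ (extChartAt I x).source := by rwa [extChartAt_source]
  have hu := (extChartAt I x).map_source hy'
  rw [← tangentMap_comp (mdifferentiableAt_extChartAt_symm hu) (mdifferentiableAt_extChartAt hy),
    ← tangentMap_id (I := I) y]
  refine tangentMap_congr ?_
  filter_upwards [(chartDomain H x).2.mem_nhds hy] with z hz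
  exact (extChartAt I x).left_inv (by rwa [extChartAt_source])

lemma tangentMap_extChartAt_self (x : M) :
    tangentMap I 𝓘(ℝ, E) (extChartAt I x) x = LinearMap.id := by
  ext v
  exact congrArg (fun L : E →L[ℝ] E => L v) (mfderiv_extChartAt_self (I := I) (x := x))

lemma tangentMap_extChartAt_symm_self (x : M) :
    tangentMap 𝓘(ℝ, E) I (extChartAt I x).symm (extChartAt I x x) = LinearMap.id := by
  have := tangentMap_symm_comp_chart (I := I) (mem_chartDomain (H := H) x)
  rwa [tangentMap_extChartAt_self, LinearMap.comp_id] at this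

/-- The derivative of the function `F` at `y` in direction `v` in the coordinates of the preferred
chart at `x`. -/
def chartDeriv (I : ModelWithCorners ℝ E H) (x : M) (v : E) (F : M → ℝ) (y : M) : ℝ :=
  fderiv ℝ (F ∘ (extChartAt I x).symm) (extChartAt I x y) v

lemma contDiffOn_comp_extChartAt_symm {F : M → ℝ} {N : Set M} (x : M)
    (hF : ContMDiffOn I 𝓘(ℝ, ℝ) ∞ F N) :
    ContDiffOn ℝ ∞ (F ∘ (extChartAt I x).symm)
      ((extChartAt I x).target ∩ (extChartAt I x).symm ⁻¹' N) := by
  rw [← contMDiffOn_iff_contDiffOn]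
  exact hF.comp ((contMDiffOn_extChartAt_symm x).mono Set.inter_subset_left) fun u hu => hu.2

lemma isOpen_target_inter_preimage {N : Set M} (x : M) (hN : IsOpen N) :
    IsOpen ((extChartAt I x).target ∩ (extChartAt I x).symm ⁻¹' N) :=
  (continuousOn_extChartAt_symm x).isOpen_inter_preimage (isOpen_extChartAt_target x) hN

lemma contMDiffOn_chartDeriv {F : M → ℝ} {N : Set M} (hN : IsOpen N) (x : M) (v : E)
    (hF : ContMDiffOn I 𝓘(ℝ, ℝ) ∞ F N) :
    ContMDiffOn I 𝓘(ℝ, ℝ) ∞ (chartDeriv I x v F) (N ∩ chartDomain H x) := by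
  have h1 := (contDiffOn_comp_extChartAt_symm x hF).fderiv_of_isOpen (m := ∞)
    (isOpen_target_inter_preimage x hN) (by simp)
  have h2 : ContDiffOn ℝ ∞ (fun u => fderiv ℝ (F ∘ (extChartAt I x).symm) u v)
      ((extChartAt I x).target ∩ (extChartAt I x).symm ⁻¹' N) := h1.clm_apply contDiffOn_const
  rw [← contMDiffOn_iff_contDiffOn] at h2
  refine h2.comp ((contMDiffOn_extChartAt (I := I) (n := ∞) (x := x)).mono
    Set.inter_subset_right) ?_
  rintro y ⟨hy, hy'⟩
  have hs : y ∈ (extChartAt I x).source := by rwa [extChartAt_source]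
  exact ⟨(extChartAt I x).map_source hs, by rwa [Set.mem_preimage, (extChartAt I x).left_inv hs]⟩

lemma dAt_comp_symm {F : M → ℝ} {x y : M} (hy : y ∈ chartDomain H x)
    (hF : MDifferentiableAt I 𝓘(ℝ, ℝ) F y) (v : E) :
    dAt I F y (tangentMap 𝓘(ℝ, E) I (extChartAt I x).symm (extChartAt I x y) v) =
      chartDeriv I x v F y := by
  have hs : y ∈ (extChartAt I x).source := by rwa [extChartAt_source]
  have hF' : MDifferentiableAt I 𝓘(ℝ, ℝ) F ((extChartAt I x).symm (extChartAt I x y)) := by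
    rwa [(extChartAt I x).left_inv hs]
  have := dAt_comp hF' (mdifferentiableAt_extChartAt_symm ((extChartAt I x).map_source hs))
  rw [(extChartAt I x).left_inv hs] at this
  refine (congrArg (fun L => L v) this.symm).trans ?_
  exact congrArg (fun L : E →L[ℝ] ℝ => L v) mfderiv_eq_fderiv

lemma dAt_self {F : M → ℝ} {x : M} (hF : MDifferentiableAt I 𝓘(ℝ, ℝ) F x) (v : E) :
    dAt I F x v = chartDeriv I x v F x := by
  rw [← dAt_comp_symm (mem_chartDomain x) hF, tangentMap_extChartAt_symm_self]
  rfl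

end Charts

section Sections

variable {E : Type u} [NormedAddCommGroup E] [NormedSpace ℝ E]
  {H : Type u} [TopologicalSpace H] {I : ModelWithCorners ℝ E H}
  {M : Type u} [TopologicalSpace M] [ChartedSpace H M]
  {V : Type u} [AddCommGroup V] [Module ℝ V]

open ExteriorAlgebra

lemma smoothSections_of_adjoin {U N : Opens M} (h : U ≤ N) {η : M → Fibre E V}
    (hη : η ∈ Algebra.adjoin ℝ (generators I M V N)) :
    (fun x : U => η x) ∈ smoothSections I M V U :=
  fun x => ⟨N, h x.2, η, hη, fun _ _ => rfl⟩

variable (V) in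
/-- A smooth function as a section of degree `0`. -/
def fn (U : Opens M) (F : M → ℝ) (hF : ContMDiffOn I 𝓘(ℝ, ℝ) ∞ F U) : smoothSections I M V U :=
  ⟨fun x => algebraMap ℝ _ (F x), smoothSections_of_adjoin le_rfl (η := fun x => algebraMap ℝ _ (F x))
    (Algebra.subset_adjoin (Or.inl ⟨F, hF, Or.inl rfl⟩))⟩

variable (V) in
/-- The differential of a smooth function as a section of degree `1`. -/
def dfn (U : Opens M) (F : M → ℝ) (hF : ContMDiffOn I 𝓘(ℝ, ℝ) ∞ F U) : smoothSections I M V U :=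
  ⟨fun x => differentialAt I V F x, smoothSections_of_adjoin le_rfl
    (Algebra.subset_adjoin (Or.inl ⟨F, hF, Or.inr rfl⟩))⟩

variable (I) in
/-- A linear form on `V` as a section of degree `1`. -/
def lin (U : Opens M) (ξ : Module.Dual ℝ V) : smoothSections I M V U :=
  ⟨fun _ => linearForm E ξ, smoothSections_of_adjoin (η := fun _ => linearForm E ξ) le_rfl
    (Algebra.subset_adjoin (Or.inr ⟨ξ, rfl⟩))⟩

lemma fn_apply {U : Opens M} {F : M → ℝ} (hF : ContMDiffOn I 𝓘(ℝ, ℝ) ∞ F U) (x : U) :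
    (fn V U F hF).1 x = algebraMap ℝ _ (F x) := rfl

lemma dfn_apply {U : Opens M} {F : M → ℝ} (hF : ContMDiffOn I 𝓘(ℝ, ℝ) ∞ F U) (x : U) :
    (dfn V U F hF).1 x = ι ℝ (dAt I F x ∘ₗ LinearMap.fst ℝ E V) := rfl

lemma lin_apply {U : Opens M} (ξ : Module.Dual ℝ V) (x : U) :
    (lin I U ξ).1 x = ι ℝ (ξ ∘ₗ LinearMap.snd ℝ E V) := rfl

lemma mul_apply {U : Opens M} (s t : smoothSections I M V U) (x : U) :
    (s * t).1 x = s.1 x * t.1 x := rfl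

lemma add_apply {U : Opens M} (s t : smoothSections I M V U) (x : U) :
    (s + t).1 x = s.1 x + t.1 x := rfl

lemma smul_apply {U : Opens M} (r : ℝ) (s : smoothSections I M V U) (x : U) :
    (r • s).1 x = r • s.1 x := rfl

lemma sum_apply {ι' : Type*} {U : Opens M} (A : Finset ι') (s : ι' → smoothSections I M V U)
    (x : U) : (∑ i ∈ A, s i).1 x = ∑ i ∈ A, (s i).1 x := by
  rw [AddSubmonoidClass.coe_finsetSum, Finset.sum_apply]

lemma one_apply {U : Opens M} (x : U) : (1 : smoothSections I M V U).1 x = 1 := rfl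

lemma section_ext {U : Opens M} {s t : smoothSections I M V U} (h : ∀ x, s.1 x = t.1 x) : s = t :=
  Subtype.ext (funext h)

lemma res_apply {U W : Opens M} (h : W ≤ U) (s : smoothSections I M V U) (x : W) :
    (restrictSections I M V h s).1 x = s.1 ⟨x, h x.2⟩ := rfl

lemma res_lin {U W : Opens M} (h : W ≤ U) (ξ : Module.Dual ℝ V) :
    restrictSections I M V h (lin I U ξ) = lin I W ξ := rfl

lemma fn_mem {U : Opens M} {F : M → ℝ} (hF : ContMDiffOn I 𝓘(ℝ, ℝ) ∞ F U) :
    fn V U F hF ∈ sectionsDeg I M V U 0 := fun _ => algebraMap_mem_fibreDeg _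

lemma dfn_mem {U : Opens M} {F : M → ℝ} (hF : ContMDiffOn I 𝓘(ℝ, ℝ) ∞ F U) :
    dfn V U F hF ∈ sectionsDeg I M V U 1 := fun _ => ι_mem_fibreDeg _

lemma lin_mem {U : Opens M} (ξ : Module.Dual ℝ V) :
    lin I U ξ ∈ sectionsDeg I M V U 1 := fun _ => ι_mem_fibreDeg _

lemma one_eq_fn {U : Opens M} : (1 : smoothSections I M V U) = fn V U (fun _ => 1) contMDiffOn_const :=
  section_ext fun x => by rw [one_apply, fn_apply, map_one]

/-- A local property of sections that holds for `1` and is stable under sums and under products with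
smooth functions, differentials of smooth functions and linear forms holds for all sections. -/
theorem section_induction {P : ∀ U : Opens M, smoothSections I M V U → Prop}
    (one : ∀ U, P U 1) (add : ∀ U s t, P U s → P U t → P U (s + t))
    (fn_mul : ∀ U F hF t, P U t → P U (fn V U F hF * t))
    (dfn_mul : ∀ U F hF t, P U t → P U (dfn V U F hF * t))
    (lin_mul : ∀ U ξ t, P U t → P U (lin I U ξ * t))
    (loc : ∀ U s, (∀ x ∈ U, ∃ (N : Opens M) (h : N ≤ U), x ∈ N ∧
      P N (restrictSections I M V h s)) → P U s) (U : Opens M) (s : smoothSections I M V U) :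
    P U s := by
  refine loc U s fun x hx => ?_
  obtain ⟨N', hN', η, hη, hs⟩ := s.2 ⟨x, hx⟩
  refine ⟨U ⊓ N', inf_le_left, ⟨hx, hN'⟩, ?_⟩
  have key : ∃ a : smoothSections I M V (U ⊓ N'), (∀ y, a.1 y = η y) ∧
      ∀ t, P _ t → P _ (a * t) := by
    clear hs
    induction hη using Algebra.adjoin_induction with
    | mem η hη =>
      rcases hη with ⟨F, hF, rfl | rfl⟩ | ⟨ξ, rfl⟩
      · exact ⟨fn V _ F (hF.mono fun y hy => hy.2), fun _ => rfl, fun t ht => fn_mul _ _ _ _ ht⟩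
      · exact ⟨dfn V _ F (hF.mono fun y hy => hy.2), fun _ => rfl, fun t ht => dfn_mul _ _ _ _ ht⟩
      · exact ⟨lin I _ ξ, fun _ => rfl, fun t ht => lin_mul _ _ _ ht⟩
    | algebraMap r =>
      exact ⟨fn V _ (fun _ => r) contMDiffOn_const, fun _ => rfl, fun t ht => fn_mul _ _ _ _ ht⟩
    | add η₁ η₂ _ _ h₁ h₂ =>
      obtain ⟨a, ha, ha'⟩ := h₁
      obtain ⟨b, hb, hb'⟩ := h₂
      refine ⟨a + b, fun y => ?_, fun t ht => ?_⟩
      · rw [add_apply, ha, hb, Pi.add_apply]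
      · rw [add_mul]; exact add _ _ _ (ha' t ht) (hb' t ht)
    | mul η₁ η₂ _ _ h₁ h₂ =>
      obtain ⟨a, ha, ha'⟩ := h₁
      obtain ⟨b, hb, hb'⟩ := h₂
      refine ⟨a * b, fun y => ?_, fun t ht => ?_⟩
      · rw [mul_apply, ha, hb, Pi.mul_apply]
      · rw [mul_assoc]; exact ha' _ (hb' t ht)
  obtain ⟨a, ha, ha'⟩ := key
  have : restrictSections I M V inf_le_left s = a * 1 := by
    rw [mul_one]
    exact section_ext fun y => (hs ⟨y, y.2.1⟩ y.2.2).trans (ha y).symm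
  rw [this]
  exact ha' 1 (one _)

/-- Smoothness of sections is a local property. -/
lemma smoothSections_of_locally {U : Opens M} {s : U → Fibre E V}
    (h : ∀ x ∈ U, ∃ (N : Opens M) (hN : N ≤ U), x ∈ N ∧
      (fun y : N => s ⟨y, hN y.2⟩) ∈ smoothSections I M V N) : s ∈ smoothSections I M V U := by
  intro x
  obtain ⟨N, hN, hx, hs⟩ := h x x.2
  obtain ⟨N', hN', η, hη, hs'⟩ := hs ⟨x, hx⟩
  refine ⟨N ⊓ N', ⟨hx, hN'⟩, η, Algebra.adjoin_mono ?_ hη, fun y hy => hs' ⟨y, hy.1⟩ hy.2⟩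
  rintro η (⟨f, hf, hη⟩ | hη)
  · exact Or.inl ⟨f, hf.mono fun y hy => hy.2, hη⟩
  · exact Or.inr hη

/-- The extension of a section by zero. -/
def extendSection {U : Opens M} (s : smoothSections I M V U) (x : M) : Fibre E V :=
  open Classical in if h : x ∈ U then s.1 ⟨x, h⟩ else 0

lemma extendSection_of_mem {U : Opens M} (s : smoothSections I M V U) {x : M} (h : x ∈ U) :
    extendSection s x = s.1 ⟨x, h⟩ := dif_pos h

/-- The coframe of the preferred chart at `x`: it expresses elements of the exterior algebra at `y`
in the coordinates of that chart. -/
def toChart (I : ModelWithCorners ℝ E H) (V : Type u) [AddCommGroup V] [Module ℝ V] (x y : M) :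
    Fibre E V →ₐ[ℝ] Fibre E V :=
  ExteriorAlgebra.map ((tangentMap 𝓘(ℝ, E) I (extChartAt I x).symm (extChartAt I x y)).prodMap
    (LinearMap.id : V →ₗ[ℝ] V)).dualMap

/-- The inverse of `toChart`. -/
def fromChart (I : ModelWithCorners ℝ E H) (V : Type u) [AddCommGroup V] [Module ℝ V] (x y : M) :
    Fibre E V →ₐ[ℝ] Fibre E V :=
  ExteriorAlgebra.map ((tangentMap I 𝓘(ℝ, E) (extChartAt I x) y).prodMap
    (LinearMap.id : V →ₗ[ℝ] V)).dualMap

variable [I.Boundaryless] [IsManifold I ∞ M]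

lemma fromChart_toChart {x y : M} (hy : y ∈ chartDomain H x) (z : Fibre E V) :
    fromChart I V x y (toChart I V x y z) = z := by
  have : fromChart I V x y (toChart I V x y z) =
    ((ExteriorAlgebra.map _).comp (ExteriorAlgebra.map _)) z := rfl
  rw [this, ExteriorAlgebra.map_comp_map, LinearMap.dualMap_comp_dualMap, LinearMap.prodMap_comp,
    tangentMap_symm_comp_chart hy, LinearMap.comp_id, LinearMap.prodMap_id, LinearMap.dualMap_id,
    ExteriorAlgebra.map_id]
  rfl

lemma toChart_fromChart {x y : M} (hy : y ∈ chartDomain H x) (z : Fibre E V) :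
    toChart I V x y (fromChart I V x y z) = z := by
  have : toChart I V x y (fromChart I V x y z) =
    ((ExteriorAlgebra.map _).comp (ExteriorAlgebra.map _)) z := rfl
  rw [this, ExteriorAlgebra.map_comp_map, LinearMap.dualMap_comp_dualMap, LinearMap.prodMap_comp,
    tangentMap_chart_comp_symm hy, LinearMap.comp_id, LinearMap.prodMap_id, LinearMap.dualMap_id,
    ExteriorAlgebra.map_id]
  rfl

lemma toChart_self (x : M) (z : Fibre E V) : toChart I V x x z = z := by
  rw [toChart, tangentMap_extChartAt_symm_self, LinearMap.prodMap_id, LinearMap.dualMap_id,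
    ExteriorAlgebra.map_id]
  rfl

lemma map_mem_fibreDeg {E' V' : Type u} [NormedAddCommGroup E'] [NormedSpace ℝ E'] [AddCommGroup V']
    [Module ℝ V'] (L : Module.Dual ℝ (E' × V') →ₗ[ℝ] Module.Dual ℝ (E × V)) {k : ℤ}
    {z : Fibre E' V'} (hz : z ∈ fibreDeg E' V' k) : ExteriorAlgebra.map L z ∈ fibreDeg E V k := by
  rcases lt_or_ge k 0 with hk | hk
  · rw [fibreDeg_neg hk, Submodule.mem_bot] at hz
    simp [hz]
  lift k to ℕ using hk
  rw [fibreDeg_natCast] at hz ⊢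
  induction k generalizing z with
  | zero =>
    simp only [pow_zero, Submodule.mem_one] at hz ⊢
    obtain ⟨r, rfl⟩ := hz
    exact ⟨r, by simp⟩
  | succ n ih =>
    rw [exteriorPower, pow_succ'] at hz ⊢
    induction hz using Submodule.mul_induction_on' with
    | mem_mul_mem v hv y hy =>
      obtain ⟨v, rfl⟩ := hv
      rw [map_mul]
      refine Submodule.mul_mem_mul ⟨L v, ?_⟩ (ih hy)
      exact (ExteriorAlgebra.map_apply_ι L v).symm
    | add a _ b _ ha hb => rw [map_add]; exact add_mem ha hb

lemma toChart_mem {x y : M} {k : ℤ} {z : Fibre E V} (hz : z ∈ fibreDeg E V k) :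
    toChart I V x y z ∈ fibreDeg E V k := map_mem_fibreDeg _ hz

lemma fromChart_mem {x y : M} {k : ℤ} {z : Fibre E V} (hz : z ∈ fibreDeg E V k) :
    fromChart I V x y z ∈ fibreDeg E V k := map_mem_fibreDeg _ hz

/-- The value of a section at `y` in the coordinates of the preferred chart at `x`. -/
def inChart (x : M) {U : Opens M} (s : smoothSections I M V U) (y : M) : Fibre E V :=
  toChart I V x y (extendSection s y)

lemma inChart_of_mem (x : M) {U : Opens M} (s : smoothSections I M V U) {y : M} (hy : y ∈ U) :
    inChart x s y = toChart I V x y (s.1 ⟨y, hy⟩) := by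
  rw [inChart, extendSection_of_mem]

lemma inChart_res (x : M) {U W : Opens M} (h : W ≤ U) (s : smoothSections I M V U) {y : M}
    (hy : y ∈ W) : inChart x (restrictSections I M V h s) y = inChart x s y := by
  rw [inChart_of_mem x _ hy, inChart_of_mem x _ (h hy), res_apply]

lemma inChart_mul (x : M) {U : Opens M} (s t : smoothSections I M V U) {y : M} (hy : y ∈ U) :
    inChart x (s * t) y = inChart x s y * inChart x t y := by
  simp only [inChart_of_mem x _ hy, mul_apply, map_mul]

lemma inChart_add (x : M) {U : Opens M} (s t : smoothSections I M V U) {y : M} (hy : y ∈ U) :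
    inChart x (s + t) y = inChart x s y + inChart x t y := by
  simp only [inChart_of_mem x _ hy, add_apply, map_add]

lemma inChart_smul (x : M) {U : Opens M} (r : ℝ) (s : smoothSections I M V U) {y : M}
    (hy : y ∈ U) : inChart x (r • s) y = r • inChart x s y := by
  simp only [inChart_of_mem x _ hy, smul_apply, map_smul]

lemma inChart_self {U : Opens M} (s : smoothSections I M V U) {x : M} (hx : x ∈ U) :
    inChart x s x = s.1 ⟨x, hx⟩ := by
  rw [inChart_of_mem x _ hx, toChart_self]

lemma inChart_fn (x : M) {U : Opens M} {F : M → ℝ} (hF : ContMDiffOn I 𝓘(ℝ, ℝ) ∞ F U) {y : M}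
    (hy : y ∈ U) : inChart x (fn V U F hF) y = algebraMap ℝ _ (F y) := by
  rw [inChart_of_mem x _ hy, fn_apply, AlgHom.commutes]

lemma inChart_lin (x : M) {U : Opens M} (ξ : Module.Dual ℝ V) {y : M}
    (hy : y ∈ U) : inChart x (lin I U ξ) y = ι ℝ (ξ ∘ₗ LinearMap.snd ℝ E V) := by
  rw [inChart_of_mem x _ hy, lin_apply, toChart, ExteriorAlgebra.map_apply_ι]
  rfl

section FiniteDimensional

variable [FiniteDimensional ℝ E]

lemma inChart_dfn (x : M) {U : Opens M} {F : M → ℝ} (hF : ContMDiffOn I 𝓘(ℝ, ℝ) ∞ F U) {y : M}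
    (hy : y ∈ U) (hy' : y ∈ chartDomain H x) : inChart x (dfn V U F hF) y =
      ∑ i, chartDeriv I x (Module.finBasis ℝ E i) F y •
        ι ℝ ((Module.finBasis ℝ E).coord i ∘ₗ LinearMap.fst ℝ E V) := by
  rw [inChart_of_mem x _ hy, dfn_apply, toChart, ExteriorAlgebra.map_apply_ι]
  simp only [← map_smul, ← map_sum]
  congr 1
  refine LinearMap.ext fun p => ?_
  have h := dAt_comp_symm hy' (hF.mdifferentiableAt_of_mem (by simp) U.2 hy)
  simp only [LinearMap.dualMap_apply, LinearMap.comp_apply, LinearMap.prodMap_apply,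
    LinearMap.fst_apply, LinearMap.sum_apply, LinearMap.smul_apply, smul_eq_mul, ← h]
  conv_lhs => rw [← (Module.finBasis ℝ E).sum_repr p.1]
  simp only [map_sum, map_smul, smul_eq_mul]
  exact Finset.sum_congr rfl fun i _ => mul_comm _ _

/-- The coefficients of a section in the coordinates of a chart are smooth. -/
lemma contMDiffOn_inChart {U : Opens M} (s : smoothSections I M V U) (x : M)
    (L : Module.Dual ℝ (Fibre E V)) :
    ContMDiffOn I 𝓘(ℝ, ℝ) ∞ (fun y => L (inChart x s y)) (U ∩ chartDomain H x) := by
  induction U, s using section_induction generalizing L with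
  | one U =>
    refine contMDiffOn_const (c := L 1) |>.congr fun y hy => ?_
    rw [inChart_of_mem x _ hy.1, one_apply, map_one]
  | add U s t hs ht =>
    refine (hs L).add (ht L) |>.congr fun y hy => ?_
    rw [inChart_add x _ _ hy.1, map_add]; rfl
  | fn_mul U F hF t ht =>
    refine ((hF.mono Set.inter_subset_left).mul (ht L)).congr fun y hy => ?_
    rw [inChart_mul x _ _ hy.1, inChart_fn x _ hy.1, ← Algebra.smul_def, map_smul]; rfl
  | lin_mul U ξ t ht =>
    refine (ht (L ∘ₗ LinearMap.mulLeft ℝ (ι ℝ (ξ ∘ₗ LinearMap.snd ℝ E V)))).congr fun y hy => ?_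
    rw [inChart_mul x _ _ hy.1, inChart_lin x _ hy.1]; rfl
  | dfn_mul U F hF t ht =>
    have h : ContMDiffOn I 𝓘(ℝ, ℝ) ∞ (fun y => ∑ i, chartDeriv I x (Module.finBasis ℝ E i) F y *
        (L ∘ₗ LinearMap.mulLeft ℝ (ι ℝ ((Module.finBasis ℝ E).coord i ∘ₗ LinearMap.fst ℝ E V)))
          (inChart x t y)) (U ∩ chartDomain H x) :=
      contMDiffOn_finsetSum fun i _ => (contMDiffOn_chartDeriv U.2 x _ hF).mul (ht _)
    refine h.congr fun y hy => ?_
    rw [inChart_mul x _ _ hy.1, inChart_dfn x _ hy.1 hy.2]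
    simp [Finset.sum_mul]
  | loc U s h =>
    intro y hy
    obtain ⟨N, hN, hyN, hs⟩ := h y hy.1
    refine ContMDiffAt.contMDiffWithinAt ?_
    have : ContMDiffAt I 𝓘(ℝ, ℝ) ∞ (fun y => L (inChart x (restrictSections I M V hN s) y)) y :=
      (hs L).contMDiffAt ((N.2.inter (chartDomain H x).2).mem_nhds ⟨hyN, hy.2⟩)
    refine this.congr_of_eventuallyEq ?_
    filter_upwards [N.2.mem_nhds hyN] with z hz
    rw [inChart_res x hN s hz]

/-- A linear function of the coordinates of the preferred chart at `x`. -/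
def chartCoord (I : ModelWithCorners ℝ E H) (x : M) (ℓ : Module.Dual ℝ E) (y : M) : ℝ :=
  ℓ (extChartAt I x y)

lemma contMDiffOn_chartCoord (x : M) (ℓ : Module.Dual ℝ E) :
    ContMDiffOn I 𝓘(ℝ, ℝ) ∞ (chartCoord I x ℓ) (chartDomain H x) :=
  (LinearMap.toContinuousLinearMap ℓ).contDiff.contMDiff.comp_contMDiffOn
    (contMDiffOn_extChartAt (I := I) (n := ∞) (x := x))

lemma dAt_chartCoord {x y : M} (hy : y ∈ chartDomain H x) (ℓ : Module.Dual ℝ E) :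
    dAt I (chartCoord I x ℓ) y = ℓ ∘ₗ tangentMap I 𝓘(ℝ, E) (extChartAt I x) y := by
  refine (dAt_comp (I' := 𝓘(ℝ, E)) (g := ℓ) (f := extChartAt I x) ?_
    (mdifferentiableAt_extChartAt hy)).trans ?_
  · exact (LinearMap.toContinuousLinearMap ℓ).mdifferentiableAt
  · congr 1
    ext v
    exact congrArg (fun L : E →L[ℝ] ℝ => L v)
      (ContinuousLinearMap.mfderiv_eq (LinearMap.toContinuousLinearMap ℓ))

lemma fromChart_ι {x y : M} (hy : y ∈ chartDomain H x) (v : Module.Dual ℝ (E × V)) :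
    fromChart I V x y (ι ℝ v) = differentialAt I V (chartCoord I x (v ∘ₗ LinearMap.inl ℝ E V)) y +
      linearForm E (v ∘ₗ LinearMap.inr ℝ E V) := by
  rw [fromChart, ExteriorAlgebra.map_apply_ι, differentialAt_eq, dAt_chartCoord hy, linearForm,
    ← map_add]
  congr 1
  refine LinearMap.ext fun p => ?_
  simp [← map_add]

/-- The sections with constant coefficients in the coordinates of a chart. -/
def frame (x : M) {U : Opens M} (hU : U ≤ chartDomain H x) :
    Fibre E V →ₐ[ℝ] smoothSections I M V U where
  toFun z := ⟨fun y => fromChart I V x y z, by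
    induction z using exterior_left_induction with
    | algebraMap r =>
      simp only [AlgHom.commutes]
      exact (fn V U (fun _ => r) contMDiffOn_const).2
    | add a b ha hb => simp only [map_add]; exact add_mem ha hb
    | ι_mul a v ha =>
      simp only [map_mul]
      refine mul_mem ?_ ha
      convert (dfn V U _ ((contMDiffOn_chartCoord x (v ∘ₗ LinearMap.inl ℝ E V)).mono hU) +
        lin I U (v ∘ₗ LinearMap.inr ℝ E V)).2 using 1
      ext y
      exact fromChart_ι (hU y.2) v⟩
  map_one' := section_ext fun y => map_one _
  map_mul' a b := section_ext fun y => map_mul _ a b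
  map_zero' := section_ext fun y => map_zero _
  map_add' a b := section_ext fun y => map_add _ a b
  commutes' r := section_ext fun y => AlgHom.commutes _ r

lemma frame_apply {x : M} {U : Opens M} (hU : U ≤ chartDomain H x) (z : Fibre E V) (y : U) :
    (frame (I := I) x hU z).1 y = fromChart I V x y z := rfl

lemma frame_ι {x : M} {U : Opens M} (hU : U ≤ chartDomain H x) (v : Module.Dual ℝ (E × V)) :
    frame (I := I) x hU (ι ℝ v) =
      dfn V U _ ((contMDiffOn_chartCoord x (v ∘ₗ LinearMap.inl ℝ E V)).mono hU) +
        lin I U (v ∘ₗ LinearMap.inr ℝ E V) :=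
  section_ext fun y => fromChart_ι (hU y.2) v

lemma frame_mem {x : M} {U : Opens M} (hU : U ≤ chartDomain H x) {k : ℤ} {z : Fibre E V}
    (hz : z ∈ fibreDeg E V k) : frame (I := I) x hU z ∈ sectionsDeg I M V U k :=
  fun _ => fromChart_mem hz

lemma inChart_frame {x : M} {U : Opens M} (hU : U ≤ chartDomain H x) (z : Fibre E V) {y : M}
    (hy : y ∈ U) : inChart x (frame (I := I) x hU z) y = z := by
  rw [inChart_of_mem x _ hy, frame_apply, toChart_fromChart (hU hy)]

lemma res_frame {x : M} {U W : Opens M} (hU : U ≤ chartDomain H x) (h : W ≤ U) (z : Fibre E V) :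
    restrictSections I M V h (frame (I := I) x hU z) = frame x (h.trans hU) z := rfl

variable [Module.Finite ℝ V]

variable (E V) in
/-- A basis of the exterior algebra. -/
def fibreBasis : Module.Basis (Finset (Fin (Module.finrank ℝ (Module.Dual ℝ (E × V))))) ℝ (Fibre E V) :=
  (Module.finBasis ℝ (Module.Dual ℝ (E × V))).ExteriorAlgebra

lemma fibreBasis_mem (σ : Finset (Fin (Module.finrank ℝ (Module.Dual ℝ (E × V))))) :
    fibreBasis E V σ ∈ fibreDeg E V σ.card := exteriorBasis_mem _ σ

lemma fibreBasis_repr_of_mem {k : ℤ} {z : Fibre E V} (hz : z ∈ fibreDeg E V k)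
    {σ : Finset (Fin (Module.finrank ℝ (Module.Dual ℝ (E × V))))} (hσ : (σ.card : ℤ) ≠ k) :
    (fibreBasis E V).repr z σ = 0 := by
  have h1 : ∑ τ, (fibreBasis E V).repr z τ • fibreProj E V σ.card (fibreBasis E V τ) = 0 := by
    rw [← fibreProj_of_mem hz σ.card |>.trans (if_neg hσ)]
    conv_rhs => rw [← (fibreBasis E V).sum_repr z]
    simp only [map_sum, map_smul]
  have h2 := congrArg (fun w => (fibreBasis E V).repr w σ) h1
  simp only [fibreProj_of_mem (fibreBasis_mem _), map_sum, map_smul, Finsupp.coe_finsetSum,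
    Finset.sum_apply, Finsupp.smul_apply, smul_eq_mul, map_zero, Finsupp.zero_apply] at h2
  rw [Finset.sum_eq_single σ] at h2
  · simpa using h2
  · intro τ _ hτ
    split_ifs
    · simp [hτ]
    · simp
  · simp

/-- The coefficients of a section in the coordinates of a chart. -/
def coef (x : M) {U : Opens M} (s : smoothSections I M V U)
    (σ : Finset (Fin (Module.finrank ℝ (Module.Dual ℝ (E × V))))) (y : M) : ℝ :=
  (fibreBasis E V).repr (inChart x s y) σ

lemma contMDiffOn_coef (x : M) {U : Opens M} (hU : U ≤ chartDomain H x)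
    (s : smoothSections I M V U) (σ) : ContMDiffOn I 𝓘(ℝ, ℝ) ∞ (coef x s σ) U :=
  (contMDiffOn_inChart s x ((fibreBasis E V).coord σ)).mono fun y hy => ⟨hy, hU hy⟩

/-- A section is determined by its coefficients. -/
lemma eq_sum_coef (x : M) {U : Opens M} (hU : U ≤ chartDomain H x)
    (s : smoothSections I M V U) :
    s = ∑ σ, fn V U (coef x s σ) (contMDiffOn_coef x hU s σ) * frame x hU (fibreBasis E V σ) := by
  refine section_ext fun y => ?_
  rw [sum_apply]
  simp only [mul_apply, fn_apply, frame_apply, ← Algebra.smul_def]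
  rw [← fromChart_toChart (I := I) (hU y.2) (s.1 y)]
  conv_lhs => rw [← (fibreBasis E V).sum_repr (toChart I V x y (s.1 y))]
  simp only [map_sum, map_smul]
  refine Finset.sum_congr rfl fun σ _ => ?_
  rw [coef, inChart_of_mem x s y.2]

end FiniteDimensional

end Sections

section DeRham

variable {E : Type u} [NormedAddCommGroup E] [NormedSpace ℝ E] [FiniteDimensional ℝ E]
  {H : Type u} [TopologicalSpace H] {I : ModelWithCorners ℝ E H} [I.Boundaryless]
  {M : Type u} [TopologicalSpace M] [ChartedSpace H M] [IsManifold I ∞ M]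
  {V : Type u} [AddCommGroup V] [Module ℝ V] [Module.Finite ℝ V]

open ExteriorAlgebra

variable (V) in
/-- A linear form on the tangent space, as an element of degree `1`. -/
def covector : Module.Dual ℝ E →ₗ[ℝ] Fibre E V where
  toFun ℓ := ι ℝ (ℓ ∘ₗ LinearMap.fst ℝ E V)
  map_add' a b := by rw [← map_add, LinearMap.add_comp]
  map_smul' r a := by rw [RingHom.id_apply, ← map_smul, LinearMap.smul_comp]

lemma covector_eq_sum (ℓ : Module.Dual ℝ E) :
    covector V ℓ = ∑ j, ℓ (Module.finBasis ℝ E j) • covector V ((Module.finBasis ℝ E).coord j) := by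
  rw [← (Module.finBasis ℝ E).sum_dual_apply_smul_coord ℓ]
  simp only [map_sum, map_smul]
  refine Finset.sum_congr rfl fun j _ => ?_
  rw [(Module.finBasis ℝ E).sum_dual_apply_smul_coord ℓ]

/-- The differential at `x` of a function with values in the exterior algebra. -/
def fibreDiff (I : ModelWithCorners ℝ E H) (x : M) (h : M → Fibre E V) : Fibre E V :=
  ∑ σ, covector V (dAt I (fun y => (fibreBasis E V).repr (h y) σ) x) * fibreBasis E V σ

/-- Differentiability of functions with values in the exterior algebra. -/
def FibreDifferentiableAt (I : ModelWithCorners ℝ E H) (h : M → Fibre E V) (x : M) : Prop :=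
  ∀ L : Module.Dual ℝ (Fibre E V), MDifferentiableAt I 𝓘(ℝ, ℝ) (fun y => L (h y)) x

lemma fibreDiff_congr {x : M} {h h' : M → Fibre E V} (hh : h =ᶠ[𝓝 x] h') :
    fibreDiff I x h = fibreDiff I x h' := by
  refine Finset.sum_congr rfl fun σ _ => ?_
  have : (fun y => (fibreBasis E V).repr (h y) σ) =ᶠ[𝓝 x]
      fun y => (fibreBasis E V).repr (h' y) σ := hh.mono fun y hy => by simp only [hy]
  rw [dAt_congr this]

lemma fibreDiff_sum_smul {ι' : Type*} (A : Finset ι') {x : M} {g : ι' → M → ℝ}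
    (hg : ∀ i ∈ A, MDifferentiableAt I 𝓘(ℝ, ℝ) (g i) x) (z : ι' → Fibre E V) :
    fibreDiff I x (fun y => ∑ i ∈ A, g i y • z i) = ∑ i ∈ A, covector V (dAt I (g i) x) * z i := by
  have h : ∀ σ, dAt I (fun y => (fibreBasis E V).repr (∑ i ∈ A, g i y • z i) σ) x =
      ∑ i ∈ A, (fibreBasis E V).repr (z i) σ • dAt I (g i) x := by
    intro σ
    have h1 : ∀ i ∈ A, MDifferentiableAt I 𝓘(ℝ, ℝ)
        (fun y => g i y * (fibreBasis E V).repr (z i) σ) x :=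
      fun i hi => (hg i hi).mul mdifferentiableAt_const
    have h2 := (dAt_sum A h1).2
    simp only [map_sum, map_smul, Finsupp.coe_finsetSum, Finset.sum_apply, Finsupp.smul_apply,
      smul_eq_mul]
    rw [h2]
    refine Finset.sum_congr rfl fun i hi => ?_
    rw [dAt_mul (hg i hi) mdifferentiableAt_const, dAt_const, smul_zero, zero_add]
  rw [fibreDiff, Finset.sum_congr rfl fun σ _ => by rw [h σ]]
  simp only [map_sum, map_smul, Finset.sum_mul]
  rw [Finset.sum_comm]
  refine Finset.sum_congr rfl fun i _ => ?_
  conv_rhs => rw [← (fibreBasis E V).sum_repr (z i), Finset.mul_sum]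
  refine Finset.sum_congr rfl fun σ _ => ?_
  rw [smul_mul_assoc, mul_smul_comm]

lemma fibreDiff_smul {x : M} {g : M → ℝ} (hg : MDifferentiableAt I 𝓘(ℝ, ℝ) g x) (z : Fibre E V) :
    fibreDiff I x (fun y => g y • z) = covector V (dAt I g x) * z := by
  simpa using fibreDiff_sum_smul (I := I) {()} (g := fun _ => g) (by simpa using hg) (fun _ => z)

lemma fibreDiff_const (x : M) (z : Fibre E V) : fibreDiff I x (fun _ => z) = 0 := by
  simp [fibreDiff, dAt_const]

lemma fibreDiff_add {x : M} {h h' : M → Fibre E V} (hh : FibreDifferentiableAt I h x)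
    (hh' : FibreDifferentiableAt I h' x) :
    fibreDiff I x (fun y => h y + h' y) = fibreDiff I x h + fibreDiff I x h' := by
  simp only [fibreDiff, ← Finset.sum_add_distrib, ← add_mul, ← map_add]
  refine Finset.sum_congr rfl fun σ _ => ?_
  refine congrArg (fun ℓ => covector V ℓ * _) (Eq.trans ?_
    (dAt_add (hh ((fibreBasis E V).coord σ)) (hh' ((fibreBasis E V).coord σ))))
  simp

lemma fibreDiff_const_smul {x : M} {h : M → Fibre E V} (hh : FibreDifferentiableAt I h x) (r : ℝ) :
    fibreDiff I x (fun y => r • h y) = r • fibreDiff I x h := by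
  simp only [fibreDiff, Finset.smul_sum, ← smul_mul_assoc, ← map_smul]
  refine Finset.sum_congr rfl fun σ _ => ?_
  have := dAt_mul (mdifferentiableAt_const (c := r)) (hh ((fibreBasis E V).coord σ))
  rw [dAt_const, smul_zero, add_zero] at this
  refine congrArg (fun ℓ => covector V ℓ * _) (Eq.trans ?_ this)
  simp

lemma fibreDiff_mul {x : M} {h h' : M → Fibre E V} (hh : FibreDifferentiableAt I h x)
    (hh' : FibreDifferentiableAt I h' x) :
    fibreDiff I x (fun y => h y * h' y) =
      fibreDiff I x h * h' x + gradeInvolution (h x) * fibreDiff I x h' := by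
  set B := fibreBasis E V with hB
  have e1 : (fun y => h y * h' y) = fun y => ∑ p : _ × _,
      (B.repr (h y) p.1 * B.repr (h' y) p.2) • (B p.1 * B p.2) := by
    funext y
    conv_lhs => rw [← B.sum_repr (h y), ← B.sum_repr (h' y), Finset.sum_mul_sum]
    rw [← Finset.univ_product_univ, Finset.sum_product]
    simp_rw [smul_mul_smul_comm]
  have d1 : ∀ σ, MDifferentiableAt I 𝓘(ℝ, ℝ) (fun y => B.repr (h y) σ) x := fun σ => hh (B.coord σ)
  have d2 : ∀ σ, MDifferentiableAt I 𝓘(ℝ, ℝ) (fun y => B.repr (h' y) σ) x :=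
    fun σ => hh' (B.coord σ)
  rw [e1, fibreDiff_sum_smul _ fun p _ => (d1 p.1).mul (d2 p.2)]
  simp only [dAt_mul (d1 _) (d2 _), map_add, map_smul, add_mul, smul_mul_assoc,
    Finset.sum_add_distrib]
  rw [add_comm]
  congr 1
  · conv_rhs => rw [← B.sum_repr (h' x), fibreDiff, Finset.sum_mul_sum]
    rw [← Finset.univ_product_univ, Finset.sum_product]
    refine Finset.sum_congr rfl fun σ _ => Finset.sum_congr rfl fun τ _ => ?_
    rw [mul_smul_comm, mul_assoc]
  · conv_rhs => rw [← B.sum_repr (h x), fibreDiff, map_sum, Finset.sum_mul_sum]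
    rw [← Finset.univ_product_univ, Finset.sum_product]
    refine Finset.sum_congr rfl fun σ _ => Finset.sum_congr rfl fun τ _ => ?_
    rw [map_smul, smul_mul_assoc, ← mul_assoc, ← mul_assoc]
    exact congrArg (fun t => _ • (t * _)) (ι_mul_eq_gradeInvolution_mul _ _)

lemma sum_sum_smul_mul_eq_zero {n : ℕ} {a : Fin n → Fin n → ℝ} (ha : ∀ i j, a i j = a j i)
    {A : Type*} [Ring A] [Algebra ℝ A] {c : Fin n → A} (hc : ∀ i j, c i * c j = -(c j * c i)) :
    ∑ i, ∑ j, a i j • (c i * c j) = 0 := by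
  have : ∑ i, ∑ j, a i j • (c i * c j) = -∑ i, ∑ j, a i j • (c i * c j) := by
    conv_lhs => rw [Finset.sum_comm]
    rw [← Finset.sum_neg_distrib]
    refine Finset.sum_congr rfl fun i _ => ?_
    rw [← Finset.sum_neg_distrib]
    refine Finset.sum_congr rfl fun j _ => ?_
    rw [hc, smul_neg, ha]
  have h2 : (2 : ℝ) • ∑ i, ∑ j, a i j • (c i * c j) = 0 := by
    rw [two_smul]; nth_rw 1 [this]; simp
  exact (smul_eq_zero.1 h2).resolve_left two_ne_zero

lemma covector_anticomm (a b : Module.Dual ℝ E) :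
    covector V a * covector V b = -(covector V b * covector V a) :=
  eq_neg_of_add_eq_zero_left (ι_add_mul_swap _ _)

lemma chartDeriv_chartDeriv_comm {F : M → ℝ} {N : Set M} (hN : IsOpen N)
    (hF : ContMDiffOn I 𝓘(ℝ, ℝ) ∞ F N) {x : M} (hx : x ∈ N) (v w : E) :
    chartDeriv I x v (chartDeriv I x w F) x = chartDeriv I x w (chartDeriv I x v F) x := by
  have hs : x ∈ (extChartAt I x).source := mem_extChartAt_source x
  have hu : extChartAt I x x ∈ (extChartAt I x).target ∩ (extChartAt I x).symm ⁻¹' N :=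
    ⟨(extChartAt I x).map_source hs, by rwa [Set.mem_preimage, (extChartAt I x).left_inv hs]⟩
  have ho := isOpen_target_inter_preimage (I := I) x hN
  have hc := (contDiffOn_comp_extChartAt_symm x hF).contDiffAt (ho.mem_nhds hu)
  have hd : DifferentiableAt ℝ (fderiv ℝ (F ∘ (extChartAt I x).symm)) (extChartAt I x x) :=
    (hc.fderiv_right (m := 1) (by norm_cast)).differentiableAt (by simp)
  have key : ∀ v w : E, chartDeriv I x v (chartDeriv I x w F) x =
      fderiv ℝ (fderiv ℝ (F ∘ (extChartAt I x).symm)) (extChartAt I x x) v w := by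
    intro v w
    have h1 : (chartDeriv I x w F ∘ (extChartAt I x).symm) =ᶠ[𝓝 (extChartAt I x x)]
        fun u => fderiv ℝ (F ∘ (extChartAt I x).symm) u w := by
      filter_upwards [ho.mem_nhds hu] with u hu
      rw [Function.comp_apply, chartDeriv, (extChartAt I x).right_inv hu.1]
    rw [chartDeriv, h1.fderiv_eq, fderiv_clm_apply hd (differentiableAt_const _)]
    simp
  rw [key, key]
  exact (hc.isSymmSndFDerivAt (by rw [minSmoothness_of_isRCLikeNormedField]; norm_cast)).eq v w

lemma fibreDifferentiableAt_inChart {U : Opens M} (s : smoothSections I M V U) {x : M}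
    (hx : x ∈ U) : FibreDifferentiableAt I (inChart x s) x := fun L =>
  (contMDiffOn_inChart s x L).mdifferentiableAt_of_mem (by simp) (U.2.inter (chartDomain H x).2)
    ⟨hx, mem_chartDomain x⟩

variable [Bracket V V]

/-- The differential of a section at a point. -/
def diffAt {U : Opens M} (s : smoothSections I M V U) (x : M) : Fibre E V :=
  fibreDiff I x (inChart x s) + ceDerivation E V (inChart x s x)

lemma diffAt_res {U W : Opens M} (h : W ≤ U) (s : smoothSections I M V U) {x : M} (hx : x ∈ W) :
    diffAt (restrictSections I M V h s) x = diffAt s x := by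
  rw [diffAt, diffAt, inChart_res x h s hx, fibreDiff_congr]
  filter_upwards [W.2.mem_nhds hx] with y hy
  rw [inChart_res x h s hy]

lemma diffAt_mul {U : Opens M} (s t : smoothSections I M V U) {x : M} (hx : x ∈ U) :
    diffAt (s * t) x = diffAt s x * t.1 ⟨x, hx⟩ + gradeInvolution (s.1 ⟨x, hx⟩) * diffAt t x := by
  have h1 : inChart x (s * t) =ᶠ[𝓝 x] fun y => inChart x s y * inChart x t y := by
    filter_upwards [U.2.mem_nhds hx] with y hy
    exact inChart_mul x s t hy
  rw [diffAt, fibreDiff_congr h1, inChart_mul x s t hx, fibreDiff_mul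
    (fibreDifferentiableAt_inChart s hx) (fibreDifferentiableAt_inChart t hx), ceDerivation_mul,
    diffAt, diffAt, inChart_self s hx, inChart_self t hx]
  noncomm_ring

lemma diffAt_add {U : Opens M} (s t : smoothSections I M V U) {x : M} (hx : x ∈ U) :
    diffAt (s + t) x = diffAt s x + diffAt t x := by
  have h1 : inChart x (s + t) =ᶠ[𝓝 x] fun y => inChart x s y + inChart x t y := by
    filter_upwards [U.2.mem_nhds hx] with y hy
    exact inChart_add x s t hy
  rw [diffAt, fibreDiff_congr h1, inChart_add x s t hx, fibreDiff_add
    (fibreDifferentiableAt_inChart s hx) (fibreDifferentiableAt_inChart t hx), map_add, diffAt,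
    diffAt]
  abel

lemma diffAt_smul {U : Opens M} (r : ℝ) (s : smoothSections I M V U) {x : M} (hx : x ∈ U) :
    diffAt (r • s) x = r • diffAt s x := by
  have h1 : inChart x (r • s) =ᶠ[𝓝 x] fun y => r • inChart x s y := by
    filter_upwards [U.2.mem_nhds hx] with y hy
    exact inChart_smul x r s hy
  rw [diffAt, fibreDiff_congr h1, inChart_smul x r s hx, fibreDiff_const_smul
    (fibreDifferentiableAt_inChart s hx), map_smul, diffAt, smul_add]

lemma diffAt_fn {U : Opens M} {F : M → ℝ} (hF : ContMDiffOn I 𝓘(ℝ, ℝ) ∞ F U) {x : M}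
    (hx : x ∈ U) : diffAt (fn V U F hF) x = differentialAt I V F x := by
  have h1 : inChart x (fn V U F hF) =ᶠ[𝓝 x] fun y => F y • (1 : Fibre E V) := by
    filter_upwards [U.2.mem_nhds hx] with y hy
    rw [inChart_fn x hF hy, Algebra.algebraMap_eq_smul_one]
  rw [diffAt, fibreDiff_congr h1, h1.eq_of_nhds, map_smul, ceDerivation_one, smul_zero, add_zero,
    fibreDiff_smul (hF.mdifferentiableAt_of_mem (by simp) U.2 hx), mul_one]
  rfl

lemma chevalleyEilenberg_zero : chevalleyEilenberg E (0 : Module.Dual ℝ V) = 0 := by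
  simp [chevalleyEilenberg]

lemma diffAt_dfn {U : Opens M} {F : M → ℝ} (hF : ContMDiffOn I 𝓘(ℝ, ℝ) ∞ F U) {x : M}
    (hx : x ∈ U) : diffAt (dfn V U F hF) x = 0 := by
  have h1 : inChart x (dfn V U F hF) =ᶠ[𝓝 x] fun y => ∑ i,
      chartDeriv I x (Module.finBasis ℝ E i) F y • covector V ((Module.finBasis ℝ E).coord i) := by
    filter_upwards [U.2.mem_nhds hx, (chartDomain H x).2.mem_nhds (mem_chartDomain x)] with y hy hy'
    exact inChart_dfn x hF hy hy'
  have h2 : ∀ i, MDifferentiableAt I 𝓘(ℝ, ℝ) (chartDeriv I x (Module.finBasis ℝ E i) F) x :=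
    fun i => (contMDiffOn_chartDeriv U.2 x _ hF).mdifferentiableAt_of_mem (by simp)
      (U.2.inter (chartDomain H x).2) ⟨hx, mem_chartDomain x⟩
  have h3 : ∀ ℓ : Module.Dual ℝ E, ceDerivation E V (covector V ℓ) = 0 := by
    intro ℓ
    refine (ceDerivation_ι _).trans ?_
    have : (ℓ ∘ₗ LinearMap.fst ℝ E V) ∘ₗ LinearMap.inr ℝ E V = 0 := by ext; simp
    rw [this, chevalleyEilenberg_zero]
  rw [diffAt, fibreDiff_congr h1, h1.eq_of_nhds]
  simp only [map_sum, map_smul, h3, smul_zero, Finset.sum_const_zero, add_zero]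
  rw [fibreDiff_sum_smul _ fun i _ => h2 i]
  simp_rw [covector_eq_sum (dAt I _ x), Finset.sum_mul, smul_mul_assoc, dAt_self (h2 _)]
  rw [Finset.sum_comm]
  exact sum_sum_smul_mul_eq_zero (fun i j => chartDeriv_chartDeriv_comm U.2 hF hx _ _)
    fun i j => covector_anticomm _ _

lemma diffAt_lin {U : Opens M} (ξ : Module.Dual ℝ V) {x : M} (hx : x ∈ U) :
    diffAt (lin I U ξ) x = chevalleyEilenberg E ξ := by
  have h1 : inChart x (lin I U ξ) =ᶠ[𝓝 x] fun y => ι ℝ (ξ ∘ₗ LinearMap.snd ℝ E V) := by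
    filter_upwards [U.2.mem_nhds hx] with y hy
    exact inChart_lin x ξ hy
  rw [diffAt, fibreDiff_congr h1, h1.eq_of_nhds, fibreDiff_const, zero_add, ceDerivation_ι]
  rfl

lemma diffAt_mem {U : Opens M} (s : smoothSections I M V U) :
    (fun x : U => diffAt s x) ∈ smoothSections I M V U := by
  induction U, s using section_induction with
  | one U =>
    convert (0 : smoothSections I M V U).2 using 1
    ext x
    rw [one_eq_fn, diffAt_fn _ x.2, differentialAt_eq, dAt_const]
    simp
  | add U s t hs ht =>
    convert add_mem hs ht using 1
    ext x
    exact diffAt_add s t x.2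
  | fn_mul U F hF t ht =>
    convert add_mem (dfn V U F hF * t).2 (mul_mem (fn V U F hF).2 ht) using 1
    ext x
    refine (diffAt_mul _ t x.2).trans ?_
    rw [diffAt_fn _ x.2, gradeInvolution_of_mem_fibreDeg (fn_mem hF x)]
    simp [mul_apply, dfn]
  | dfn_mul U F hF t ht =>
    convert neg_mem (mul_mem (dfn V U F hF).2 ht) using 1
    ext x
    refine (diffAt_mul _ t x.2).trans ?_
    rw [diffAt_dfn _ x.2, gradeInvolution_of_mem_fibreDeg (dfn_mem hF x)]
    simp
  | lin_mul U ξ t ht =>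
    have hc : (fun x : U => chevalleyEilenberg E ξ) ∈ smoothSections I M V U := by
      convert (-(1 / 2 : ℝ) • ∑ b, ∑ c, ξ ⁅Module.finBasis ℝ V b, Module.finBasis ℝ V c⁆ •
        (lin I U ((Module.finBasis ℝ V).coord b) * lin I U ((Module.finBasis ℝ V).coord c))).2
        using 1
      ext x
      simp only [smul_apply, sum_apply, mul_apply]
      rfl
    convert sub_mem (mul_mem hc t.2) (mul_mem (lin I U ξ).2 ht) using 1
    ext x
    refine (diffAt_mul _ t x.2).trans ?_
    rw [diffAt_lin _ x.2, gradeInvolution_of_mem_fibreDeg (lin_mem ξ x)]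
    simp [sub_eq_add_neg]
  | loc U s h =>
    refine smoothSections_of_locally fun x hx => ?_
    obtain ⟨N, hN, hxN, hs⟩ := h x hx
    refine ⟨N, hN, hxN, ?_⟩
    convert hs using 1
    ext y
    exact (diffAt_res hN s y.2).symm

lemma exists_isDeRhamCE : ∃ D, IsDeRhamCE I M V D := by
  refine ⟨fun U =>
    { toFun := fun s => ⟨fun x => diffAt s x, diffAt_mem s⟩
      map_add' := fun s t => section_ext fun x => diffAt_add s t x.2
      map_smul' := fun r s => section_ext fun x => diffAt_smul r s x.2 }, ?_⟩
  constructor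
  · exact fun h s => section_ext fun x => (diffAt_res h s x.2).symm
  · intro U k s η hs
    refine section_ext fun x => (diffAt_mul s η x.2).trans ?_
    rw [gradeInvolution_of_mem_fibreDeg (hs x), smul_mul_assoc]
    rfl
  · intro U f hf s hs x
    rw [show s = fn V U f hf from section_ext hs]
    exact diffAt_fn hf x.2
  · intro U f hf s hs
    rw [show s = dfn V U f hf from section_ext hs]
    exact section_ext fun x => diffAt_dfn hf x.2
  · intro U ξ s hs x
    rw [show s = lin I U ξ from section_ext hs]
    exact diffAt_lin ξ x.2

end DeRham

section Differential

/-- The model space of a nonempty manifold is finite-dimensional. -/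
class FinDimModel (E M : Type u) [NormedAddCommGroup E] [NormedSpace ℝ E] : Prop where
  finiteDimensional : Nonempty M → FiniteDimensional ℝ E

instance (priority := 100) {E M : Type u} [NormedAddCommGroup E] [NormedSpace ℝ E]
    [FiniteDimensional ℝ E] : FinDimModel E M := ⟨fun _ => inferInstance⟩

/-- The laws of a Lie algebra. -/
class LieLaws (V : Type u) [AddCommGroup V] [Module ℝ V] [Bracket V V] : Prop where
  add_lie : ∀ x y z : V, ⁅x + y, z⁆ = ⁅x, z⁆ + ⁅y, z⁆
  smul_lie : ∀ (r : ℝ) (x y : V), ⁅r • x, y⁆ = r • ⁅x, y⁆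
  skew : ∀ x y : V, ⁅x, y⁆ = -⁅y, x⁆
  jacobi : ∀ x y z : V, ⁅⁅x, y⁆, z⁆ + ⁅⁅y, z⁆, x⁆ + ⁅⁅z, x⁆, y⁆ = 0

instance : LieLaws PUnit.{u + 1} := by
  constructor <;> intros <;> rfl

variable {E : Type u} [NormedAddCommGroup E] [NormedSpace ℝ E]
  {H : Type u} [TopologicalSpace H] {I : ModelWithCorners ℝ E H} [I.Boundaryless]
  {M : Type u} [TopologicalSpace M] [ChartedSpace H M] [IsManifold I ∞ M]
  {V : Type u} [AddCommGroup V] [Module ℝ V] [Module.Finite ℝ V] [Bracket V V]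

open ExteriorAlgebra

instance [IsEmpty M] (U : Opens M) : Subsingleton (smoothSections I M V U) :=
  ⟨fun _ _ => section_ext fun x => isEmptyElim (x : M)⟩

variable (I M V) in
lemma isDeRhamCE_deRhamCE [FinDimModel E M] : IsDeRhamCE I M V (deRhamCE I M V) := by
  have h : ∃ D, IsDeRhamCE I M V D := by
    rcases isEmpty_or_nonempty M with hM | hM
    · refine ⟨fun _ => 0, ⟨fun _ _ => Subsingleton.elim _ _, fun _ _ _ _ _ => Subsingleton.elim _ _,
        fun _ _ _ _ _ x => isEmptyElim (x : M), fun _ _ _ _ _ => Subsingleton.elim _ _,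
        fun _ _ _ _ x => isEmptyElim (x : M)⟩⟩
    · have := FinDimModel.finiteDimensional (E := E) hM
      exact exists_isDeRhamCE
  have : deRhamCE I M V = h.choose := by
    funext U
    rw [deRhamCE, dif_pos h]
  rw [this]
  exact h.choose_spec

/-- The Chevalley–Eilenberg differential of a linear form, as a section. -/
def ceSection (I : ModelWithCorners ℝ E H) (U : Opens M) (ξ : Module.Dual ℝ V) :
    smoothSections I M V U :=
  -(1 / 2 : ℝ) • ∑ b, ∑ c, ξ ⁅Module.finBasis ℝ V b, Module.finBasis ℝ V c⁆ •
    (lin I U ((Module.finBasis ℝ V).coord b) * lin I U ((Module.finBasis ℝ V).coord c))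

lemma ceSection_apply {U : Opens M} (ξ : Module.Dual ℝ V) (x : U) :
    (ceSection I U ξ).1 x = chevalleyEilenberg E ξ := by
  simp only [ceSection, smul_apply, sum_apply, mul_apply]
  rfl

lemma ceSection_mem {U : Opens M} (ξ : Module.Dual ℝ V) :
    ceSection I U ξ ∈ sectionsDeg I M V U 2 := fun x => by
  rw [ceSection_apply]
  exact chevalleyEilenberg_mem ξ

section

variable [FinDimModel E M]

lemma d_fn {U : Opens M} {F : M → ℝ} (hF : ContMDiffOn I 𝓘(ℝ, ℝ) ∞ F U) :
    deRhamCE I M V U (fn V U F hF) = dfn V U F hF :=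
  section_ext fun x => (isDeRhamCE_deRhamCE I M V).function U F hF _ (fun _ => rfl) x

lemma d_dfn {U : Opens M} {F : M → ℝ} (hF : ContMDiffOn I 𝓘(ℝ, ℝ) ∞ F U) :
    deRhamCE I M V U (dfn V U F hF) = 0 :=
  (isDeRhamCE_deRhamCE I M V).differential U F hF _ fun _ => rfl

lemma d_lin {U : Opens M} (ξ : Module.Dual ℝ V) :
    deRhamCE I M V U (lin I U ξ) = ceSection I U ξ :=
  section_ext fun x => ((isDeRhamCE_deRhamCE I M V).linear U ξ _ (fun _ => rfl) x).trans
    (ceSection_apply ξ x).symm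

lemma d_one {U : Opens M} : deRhamCE I M V U 1 = 0 := by
  rw [one_eq_fn, d_fn]
  refine section_ext fun x => ?_
  rw [dfn_apply, dAt_const, LinearMap.zero_comp, map_zero]
  rfl

lemma d_fn_mul {U : Opens M} {F : M → ℝ} (hF : ContMDiffOn I 𝓘(ℝ, ℝ) ∞ F U)
    (t : smoothSections I M V U) : deRhamCE I M V U (fn V U F hF * t) =
      dfn V U F hF * t + fn V U F hF * deRhamCE I M V U t := by
  rw [(isDeRhamCE_deRhamCE I M V).mul U 0 _ _ (fn_mem hF), d_fn, zpow_zero, one_smul]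

lemma d_dfn_mul {U : Opens M} {F : M → ℝ} (hF : ContMDiffOn I 𝓘(ℝ, ℝ) ∞ F U)
    (t : smoothSections I M V U) : deRhamCE I M V U (dfn V U F hF * t) =
      -(dfn V U F hF * deRhamCE I M V U t) := by
  rw [(isDeRhamCE_deRhamCE I M V).mul U 1 _ _ (dfn_mem hF), d_dfn, zpow_one, zero_mul, zero_add,
    neg_one_smul]

lemma d_lin_mul {U : Opens M} (ξ : Module.Dual ℝ V)
    (t : smoothSections I M V U) : deRhamCE I M V U (lin I U ξ * t) =
      ceSection I U ξ * t - lin I U ξ * deRhamCE I M V U t := by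
  rw [(isDeRhamCE_deRhamCE I M V).mul U 1 _ _ (lin_mem ξ), d_lin, zpow_one, neg_one_smul,
    sub_eq_add_neg]

lemma lin_mul_ceSection {U : Opens M} (ξ ζ : Module.Dual ℝ V) :
    lin I U ξ * ceSection I U ζ = ceSection I U ζ * lin I U ξ := by
  refine section_ext fun x => ?_
  rw [mul_apply, mul_apply, ceSection_apply, lin_apply]
  exact commute_of_mem_fibreDeg_two (chevalleyEilenberg_mem ζ) _

lemma sum_cyclic_eq_zero {n : ℕ} {A : Type*} [AddCommGroup A] [Module ℝ A]
    (f : Fin n → Fin n → Fin n → ℝ) (m : Fin n → Fin n → Fin n → A)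
    (hf : ∀ a b c, f a b c + f b c a + f c a b = 0) (hm : ∀ a b c, m a b c = m b c a) :
    ∑ a, ∑ b, ∑ c, f a b c • m a b c = 0 := by
  have h1 : ∑ a, ∑ b, ∑ c, f b c a • m a b c = ∑ a, ∑ b, ∑ c, f a b c • m a b c := by
    calc ∑ a, ∑ b, ∑ c, f b c a • m a b c = ∑ b, ∑ a, ∑ c, f b c a • m b c a := by
          rw [Finset.sum_comm]; simp_rw [hm]
      _ = _ := Finset.sum_congr rfl fun b _ => Finset.sum_comm
  have h2 : ∑ a, ∑ b, ∑ c, f c a b • m a b c = ∑ a, ∑ b, ∑ c, f a b c • m a b c := by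
    calc ∑ a, ∑ b, ∑ c, f c a b • m a b c = ∑ a, ∑ c, ∑ b, f c a b • m c a b := by
          refine Finset.sum_congr rfl fun a _ => ?_
          rw [Finset.sum_comm]
          refine Finset.sum_congr rfl fun b _ => Finset.sum_congr rfl fun c _ => ?_
          rw [hm b a c, hm a c b]
      _ = _ := Finset.sum_comm
  have h3 : (3 : ℝ) • ∑ a, ∑ b, ∑ c, f a b c • m a b c = 0 := by
    have : (3 : ℝ) • ∑ a, ∑ b, ∑ c, f a b c • m a b c = ∑ a, ∑ b, ∑ c, f a b c • m a b c +
        ∑ a, ∑ b, ∑ c, f b c a • m a b c + ∑ a, ∑ b, ∑ c, f c a b • m a b c := by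
      rw [h1, h2]; module
    rw [this]
    simp only [← Finset.sum_add_distrib, ← add_smul, hf, zero_smul, Finset.sum_const_zero]
  exact (smul_eq_zero.1 h3).resolve_left three_ne_zero

lemma sum_lie [LieLaws V] {ι' : Type*} (s : Finset ι') (r : ι' → ℝ) (x : ι' → V) (y : V) :
    ⁅∑ i ∈ s, r i • x i, y⁆ = ∑ i ∈ s, r i • ⁅x i, y⁆ := by
  classical
  induction s using Finset.induction_on with
  | empty =>
    have := LieLaws.smul_lie (0 : ℝ) (0 : V) y
    simpa using this
  | insert a s ha ih => rw [Finset.sum_insert ha, Finset.sum_insert ha, LieLaws.add_lie, ih,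
      LieLaws.smul_lie]

lemma sum_rotate {n : ℕ} {A : Type*} [AddCommMonoid A] (f : Fin n → Fin n → Fin n → Fin n → A) :
    ∑ b, ∑ c, ∑ a, ∑ d, f a d c b = ∑ a, ∑ d, ∑ c, ∑ b, f a d c b := by
  calc ∑ b, ∑ c, ∑ a, ∑ d, f a d c b = ∑ c, ∑ b, ∑ a, ∑ d, f a d c b := Finset.sum_comm
    _ = ∑ c, ∑ a, ∑ b, ∑ d, f a d c b := Finset.sum_congr rfl fun _ _ => Finset.sum_comm
    _ = ∑ a, ∑ c, ∑ b, ∑ d, f a d c b := Finset.sum_comm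
    _ = ∑ a, ∑ c, ∑ d, ∑ b, f a d c b := Finset.sum_congr rfl fun _ _ =>
      Finset.sum_congr rfl fun _ _ => Finset.sum_comm
    _ = _ := Finset.sum_congr rfl fun _ _ => Finset.sum_comm

lemma d_ceSection [LieLaws V] {U : Opens M} (ξ : Module.Dual ℝ V) :
    deRhamCE I M V U (ceSection I U ξ) = 0 := by
  obtain ⟨e, he⟩ : ∃ e, e = Module.finBasis ℝ V := ⟨_, rfl⟩
  have h1 : deRhamCE I M V U (ceSection I U ξ) = -(1 / 2 : ℝ) • ∑ b, ∑ c, ξ ⁅e b, e c⁆ •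
      (ceSection I U (e.coord b) * lin I U (e.coord c) -
        ceSection I U (e.coord c) * lin I U (e.coord b)) := by
    rw [ceSection]
    simp only [map_sum, map_smul, d_lin_mul, d_lin, lin_mul_ceSection, ← he]
  have h2 : ∑ b, ∑ c, ξ ⁅e b, e c⁆ • (ceSection I U (e.coord b) * lin I U (e.coord c) -
        ceSection I U (e.coord c) * lin I U (e.coord b)) =
      (2 : ℝ) • ∑ b, ∑ c, ξ ⁅e b, e c⁆ • (ceSection I U (e.coord b) * lin I U (e.coord c)) := by
    simp only [smul_sub, Finset.sum_sub_distrib]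
    have : ∑ b, ∑ c, ξ ⁅e b, e c⁆ • (ceSection I U (e.coord c) * lin I U (e.coord b)) =
        -∑ b, ∑ c, ξ ⁅e b, e c⁆ • (ceSection I U (e.coord b) * lin I U (e.coord c)) := by
      rw [Finset.sum_comm]
      simp only [← Finset.sum_neg_distrib]
      refine Finset.sum_congr rfl fun b _ => Finset.sum_congr rfl fun c _ => ?_
      rw [LieLaws.skew, map_neg, neg_smul]
    rw [this]
    module
  have h3 : ∑ b, ∑ c, ξ ⁅e b, e c⁆ • (ceSection I U (e.coord b) * lin I U (e.coord c)) =
      -(1 / 2 : ℝ) • ∑ a, ∑ d, ∑ c, ξ ⁅⁅e a, e d⁆, e c⁆ •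
        (lin I U (e.coord a) * lin I U (e.coord d) * lin I U (e.coord c)) := by
    have h4 : ∀ a d c, ξ ⁅⁅e a, e d⁆, e c⁆ = ∑ b, e.coord b ⁅e a, e d⁆ * ξ ⁅e b, e c⁆ := by
      intro a d c
      conv_lhs => rw [← e.sum_repr ⁅e a, e d⁆, sum_lie, map_sum]
      simp
    simp only [h4, Finset.sum_smul, mul_smul]
    simp only [ceSection, ← he, Finset.smul_sum, Finset.sum_mul, smul_mul_assoc]
    refine Eq.trans ?_ (sum_rotate _)
    refine Finset.sum_congr rfl fun b _ => Finset.sum_congr rfl fun c _ =>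
      Finset.sum_congr rfl fun a _ => Finset.sum_congr rfl fun d _ => ?_
    simp only [smul_smul]
    exact congrArg₂ (· • ·) (by ring) rfl
  rw [h1, h2, h3, sum_cyclic_eq_zero, smul_zero, smul_zero, smul_zero]
  · intro a b c
    rw [← map_add, ← map_add, LieLaws.jacobi, map_zero]
  · intro a b c
    refine section_ext fun x => ?_
    simp only [mul_apply, lin_apply]
    rw [mul_assoc, ι_mul_eq_gradeInvolution_mul, map_mul, gradeInvolution_ι, gradeInvolution_ι,
      neg_mul_neg]

lemma d_ceSection_mul [LieLaws V] {U : Opens M} (ξ : Module.Dual ℝ V)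
    (t : smoothSections I M V U) : deRhamCE I M V U (ceSection I U ξ * t) =
      ceSection I U ξ * deRhamCE I M V U t := by
  rw [(isDeRhamCE_deRhamCE I M V).mul U 2 _ _ (ceSection_mem ξ), d_ceSection, zero_mul, zero_add]
  norm_num

lemma section_eq_of_locally {U : Opens M} {s t : smoothSections I M V U}
    (h : ∀ x ∈ U, ∃ (N : Opens M) (hN : N ≤ U), x ∈ N ∧
      restrictSections I M V hN s = restrictSections I M V hN t) : s = t := by
  refine section_ext fun x => ?_
  obtain ⟨N, hN, hx, h⟩ := h x x.2
  exact congrArg (fun s : smoothSections I M V N => s.1 ⟨x, hx⟩) h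

lemma d_d [LieLaws V] (U : Opens M) (s : smoothSections I M V U) :
    deRhamCE I M V U (deRhamCE I M V U s) = 0 := by
  induction U, s using section_induction with
  | one U => rw [d_one, map_zero]
  | add U s t hs ht => rw [map_add, map_add, hs, ht, add_zero]
  | fn_mul U F hF t ht => rw [d_fn_mul, map_add, d_dfn_mul, d_fn_mul, ht]; simp
  | dfn_mul U F hF t ht => rw [d_dfn_mul, map_neg, d_dfn_mul, ht]; simp
  | lin_mul U ξ t ht => rw [d_lin_mul, map_sub, d_ceSection_mul, d_lin_mul, ht]; simp
  | loc U s h =>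
    refine section_eq_of_locally fun x hx => ?_
    obtain ⟨N, hN, hxN, hs⟩ := h x hx
    refine ⟨N, hN, hxN, ?_⟩
    rw [(isDeRhamCE_deRhamCE I M V).res, (isDeRhamCE_deRhamCE I M V).res, hs, map_zero]

lemma fibreProj_fn_mul {U : Opens M} {F : M → ℝ} (hF : ContMDiffOn I 𝓘(ℝ, ℝ) ∞ F U)
    (t : smoothSections I M V U) (x : U) (k : ℤ) : fibreProj E V k ((fn V U F hF * t).1 x) =
      (fn V U F hF).1 x * fibreProj E V k (t.1 x) := by
  rw [mul_apply, fn_apply, ← Algebra.smul_def, map_smul, Algebra.smul_def]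

/-- The homogeneous component of degree `k` of a section. -/
def sectionProj (U : Opens M) (k : ℤ) : smoothSections I M V U →ₗ[ℝ] smoothSections I M V U where
  toFun s := ⟨fun x => fibreProj E V k (s.1 x), by
    induction U, s using section_induction generalizing k with
    | one U =>
      simp only [one_apply, fibreProj_of_mem one_mem_fibreDeg]
      split_ifs
      · exact one_mem _
      · exact zero_mem _
    | add U s t hs ht =>
      convert add_mem (hs k) (ht k) using 1
      ext x
      exact map_add _ _ _
    | fn_mul U F hF t ht =>
      convert mul_mem (fn V U F hF).2 (ht k) using 1
      ext x
      exact fibreProj_fn_mul hF t x k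
    | dfn_mul U F hF t ht =>
      convert mul_mem (dfn V U F hF).2 (ht (k - 1)) using 1
      ext x
      exact fibreProj_ι_mul _ _ _
    | lin_mul U ξ t ht =>
      convert mul_mem (lin I U ξ).2 (ht (k - 1)) using 1
      ext x
      exact fibreProj_ι_mul _ _ _
    | loc U s h =>
      refine smoothSections_of_locally fun x hx => ?_
      obtain ⟨N, hN, hxN, hs⟩ := h x hx
      exact ⟨N, hN, hxN, hs k⟩⟩
  map_add' s t := section_ext fun x => map_add _ _ _
  map_smul' r s := section_ext fun x => (fibreProj E V k).map_smul r (s.1 x)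

lemma sectionProj_apply {U : Opens M} (k : ℤ) (s : smoothSections I M V U) (x : U) :
    (sectionProj U k s).1 x = fibreProj E V k (s.1 x) := rfl

lemma sectionProj_mem {U : Opens M} (k : ℤ) (s : smoothSections I M V U) :
    sectionProj U k s ∈ sectionsDeg I M V U k := fun _ => fibreProj_mem _ _

lemma sectionProj_of_mem {U : Opens M} {k : ℤ} {s : smoothSections I M V U}
    (hs : s ∈ sectionsDeg I M V U k) (l : ℤ) : sectionProj U l s = if l = k then s else 0 := by
  refine section_ext fun x => ?_
  rw [sectionProj_apply, fibreProj_of_mem (hs x)]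
  split_ifs <;> rfl

lemma sectionProj_gen_mul {U : Opens M} (k : ℤ) (v : U → Module.Dual ℝ (E × V))
    (s t : smoothSections I M V U) (hs : ∀ x, s.1 x = ι ℝ (v x)) :
    sectionProj U k (s * t) = s * sectionProj U (k - 1) t :=
  section_ext fun x => by rw [sectionProj_apply, mul_apply, hs, fibreProj_ι_mul]; simp [mul_apply, hs, sectionProj_apply]

lemma sectionProj_mul_of_mem_two {U : Opens M} (k : ℤ) (ξ : Module.Dual ℝ V)
    (t : smoothSections I M V U) :
    sectionProj U k (ceSection I U ξ * t) = ceSection I U ξ * sectionProj U (k - 2) t := by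
  rw [show k - 2 = k - 1 - 1 by ring]
  simp only [ceSection, smul_mul_assoc, Finset.sum_mul, map_smul, map_sum, mul_assoc]
  refine congrArg _ (Finset.sum_congr rfl fun b _ => Finset.sum_congr rfl fun c _ => ?_)
  rw [sectionProj_gen_mul k _ _ _ fun x => lin_apply _ x,
    sectionProj_gen_mul _ _ _ _ fun x => lin_apply _ x]

lemma d_sectionProj (U : Opens M) (s : smoothSections I M V U) (k : ℤ) :
    deRhamCE I M V U (sectionProj U k s) = sectionProj U (k + 1) (deRhamCE I M V U s) := by
  induction U, s using section_induction generalizing k with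
  | one U =>
    rw [d_one, map_zero, sectionProj_of_mem fun _ => one_mem_fibreDeg]
    split_ifs
    · exact d_one
    · exact map_zero _
  | add U s t hs ht => simp only [map_add, hs, ht]
  | fn_mul U F hF t ht =>
    have : ∀ (k : ℤ) (t : smoothSections I M V U), sectionProj U k (fn V U F hF * t) =
        fn V U F hF * sectionProj U k t := fun k t => section_ext fun x => fibreProj_fn_mul hF t x k
    rw [this, d_fn_mul, d_fn_mul, map_add, this, ht,
      sectionProj_gen_mul (k + 1) _ _ _ fun x => dfn_apply hF x, add_sub_cancel_right]
  | dfn_mul U F hF t ht =>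
    rw [sectionProj_gen_mul k _ _ _ fun x => dfn_apply hF x, d_dfn_mul, d_dfn_mul, map_neg,
      sectionProj_gen_mul (k + 1) _ _ _ fun x => dfn_apply hF x, ht, sub_add_cancel,
      add_sub_cancel_right]
  | lin_mul U ξ t ht =>
    rw [sectionProj_gen_mul k _ _ _ fun x => lin_apply ξ x, d_lin_mul, d_lin_mul, map_sub,
      sectionProj_gen_mul (k + 1) _ _ _ fun x => lin_apply ξ x, ht, sub_add_cancel,
      add_sub_cancel_right, sectionProj_mul_of_mem_two, show k + 1 - 2 = k - 1 by ring]
  | loc U s h =>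
    refine section_eq_of_locally fun x hx => ?_
    obtain ⟨N, hN, hxN, hs⟩ := h x hx
    refine ⟨N, hN, hxN, ?_⟩
    have hr : ∀ (k : ℤ) (s : smoothSections I M V U), restrictSections I M V hN (sectionProj U k s) =
        sectionProj N k (restrictSections I M V hN s) := fun _ _ => rfl
    rw [(isDeRhamCE_deRhamCE I M V).res, hr, hr, (isDeRhamCE_deRhamCE I M V).res, hs]

lemma d_mem {U : Opens M} {k : ℤ} {s : smoothSections I M V U} (hs : s ∈ sectionsDeg I M V U k) :
    deRhamCE I M V U s ∈ sectionsDeg I M V U (k + 1) := by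
  have h := d_sectionProj U s k
  rw [sectionProj_of_mem hs, if_pos rfl] at h
  rw [h]
  exact sectionProj_mem _ _

lemma isInternal_of_proj {A : Type*} [AddCommGroup A] [Module ℝ A] (B : ℤ → Submodule ℝ A)
    (π : ℤ → A →ₗ[ℝ] A) (h : ∀ k l, ∀ x ∈ B k, π l x = if l = k then x else 0)
    (hB : ∀ k x, π k x ∈ B k) (hs : ∀ x, ∃ s : Finset ℤ, ∑ k ∈ s, π k x = x) :
    DirectSum.IsInternal B := by
  classical
  have key : ∀ (x : DirectSum ℤ fun k => B k) k, π k (DirectSum.coeAddMonoidHom B x) = x k := by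
    intro x k
    induction x using DirectSum.induction_on with
    | zero => simp
    | of i y =>
      rw [DirectSum.coeAddMonoidHom_of, h i k y y.2, DirectSum.coe_of_apply]
      split_ifs with h1 h2 h2
      · rfl
      · exact absurd h1.symm h2
      · exact absurd h2.symm h1
      · rfl
    | add x y hx hy => simp [hx, hy]
  constructor
  · refine (injective_iff_map_eq_zero _).2 fun x hx => ?_
    refine DFinsupp.ext fun k => Subtype.ext ?_
    have := key x k
    rw [hx, map_zero] at this
    exact this.symm
  · intro x
    obtain ⟨s, hs⟩ := hs x
    refine ⟨∑ k ∈ s, DirectSum.of (fun k => B k) k ⟨π k x, hB k x⟩, ?_⟩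
    rw [map_sum]
    simpa using hs

lemma isInternal_sectionsDeg (U : Opens M) : DirectSum.IsInternal (sectionsDeg I M V U) := by
  refine isInternal_of_proj _ (sectionProj U) (fun k l x hx => sectionProj_of_mem hx l)
    (fun k x => sectionProj_mem k x) fun s => ?_
  rcases isEmpty_or_nonempty M with hM | hM
  · exact ⟨∅, Subsingleton.elim _ _⟩
  have := FinDimModel.finiteDimensional (E := E) hM
  refine ⟨(Finset.range (Module.finrank ℝ (Module.Dual ℝ (E × V)) + 1)).map Nat.castEmbedding, ?_⟩
  refine section_ext fun x => ?_
  rw [sum_apply, Finset.sum_map]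
  exact sum_fibreProj (s.1 x)

end

end Differential

section DGManifold

variable {E : Type u} [NormedAddCommGroup E] [NormedSpace ℝ E]
  {H : Type u} [TopologicalSpace H] {I : ModelWithCorners ℝ E H} [I.Boundaryless]
  {M : Type u} [TopologicalSpace M] [ChartedSpace H M] [IsManifold I ∞ M]
  {V : Type u} [AddCommGroup V] [Module ℝ V] [Module.Finite ℝ V] [Bracket V V]

open ExteriorAlgebra

lemma exists_glue_sections (k : ℤ) (ι : Type u) (W : ι → Opens M) (U : Opens M)
    (hU : U = ⨆ i, W i) (s : ∀ i, smoothSections I M V (W i))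
    (hs : ∀ i, s i ∈ sectionsDeg I M V (W i) k)
    (h : ∀ i j, restrictSections I M V (inf_le_left : W i ⊓ W j ≤ W i) (s i) =
      restrictSections I M V (inf_le_right : W i ⊓ W j ≤ W j) (s j)) :
    ∃! a : smoothSections I M V U, a ∈ sectionsDeg I M V U k ∧
      ∀ i, restrictSections I M V (show W i ≤ U from hU ▸ le_iSup W i) a = s i := by
  have hx : ∀ x : U, ∃ i, (x : M) ∈ W i := fun x => Opens.mem_iSup.1 (hU.le x.2)
  choose i hi using hx
  have hle : ∀ j, W j ≤ U := fun j => hU ▸ le_iSup W j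
  have key : ∀ (x : U) (j) (hj : (x : M) ∈ W j), (s (i x)).1 ⟨x, hi x⟩ = (s j).1 ⟨x, hj⟩ :=
    fun x j hj => congrArg (fun t : smoothSections I M V (W (i x) ⊓ W j) => t.1 ⟨x, hi x, hj⟩)
      (h (i x) j)
  refine ⟨⟨fun x => (s (i x)).1 ⟨x, hi x⟩, smoothSections_of_locally fun x hx => ?_⟩, ⟨?_, ?_⟩, ?_⟩
  · refine ⟨W (i ⟨x, hx⟩), hle _, hi ⟨x, hx⟩, ?_⟩
    convert (s (i ⟨x, hx⟩)).2 using 1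
    ext y
    exact key ⟨y, hle _ y.2⟩ _ y.2
  · exact fun x => hs _ _
  · exact fun j => section_ext fun x => key ⟨x, hle j x.2⟩ j x.2
  · rintro b ⟨_, hb⟩
    refine section_ext fun x => ?_
    exact congrArg (fun t : smoothSections I M V (W (i x)) => t.1 ⟨x, hi x⟩) (hb (i x))

section FiniteDimensional

variable [FiniteDimensional ℝ E]

/-- The preferred chart at `x`, with values in Euclidean space. -/
def euclideanChart (I : ModelWithCorners ℝ E H) [I.Boundaryless] (x : M) :
    OpenPartialHomeomorph M (EuclideanSpace ℝ (Fin (Module.finrank ℝ E))) :=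
  (chartAt H x).transHomeomorph (I.toHomeomorph.trans toEuclidean.toHomeomorph)

lemma euclideanChart_apply (x y : M) :
    euclideanChart I x y = toEuclidean (extChartAt I x y) := by
  simp [euclideanChart, extChartAt]

lemma contMDiffOn_iff_euclideanChart {x : M} {U : Opens M} (hU : U ≤ chartDomain H x) (c : U → ℝ) :
    (∃ F : M → ℝ, ContMDiffOn I 𝓘(ℝ, ℝ) ∞ F U ∧ ∀ y : U, c y = F y) ↔
      ∃ F : EuclideanSpace ℝ (Fin (Module.finrank ℝ E)) → ℝ,
        ContDiffOn ℝ ∞ F (euclideanChart I x '' (U : Set M)) ∧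
          ∀ y : U, c y = F (euclideanChart I x y) := by
  have hs : ∀ y ∈ U, y ∈ (extChartAt I x).source := fun y hy => by
    rw [extChartAt_source]; exact hU hy
  constructor
  · rintro ⟨F, hF, hc⟩
    refine ⟨F ∘ (extChartAt I x).symm ∘ toEuclidean.symm, ?_, fun y => ?_⟩
    · refine (contDiffOn_comp_extChartAt_symm x hF).comp
        toEuclidean.symm.contDiff.contDiffOn ?_
      rintro _ ⟨y, hy, rfl⟩
      rw [euclideanChart_apply, ContinuousLinearEquiv.symm_apply_apply]
      refine ⟨(extChartAt I x).map_source (hs y hy), ?_⟩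
      rwa [Set.mem_preimage, (extChartAt I x).left_inv (hs y hy)]
    · rw [hc, euclideanChart_apply, Function.comp_apply, Function.comp_apply,
        ContinuousLinearEquiv.symm_apply_apply, (extChartAt I x).left_inv (hs y y.2)]
  · rintro ⟨F, hF, hc⟩
    refine ⟨fun y => F (euclideanChart I x y), ?_, hc⟩
    have h1 : ContMDiffOn I 𝓘(ℝ, EuclideanSpace ℝ (Fin (Module.finrank ℝ E))) ∞
        (fun y => euclideanChart I x y) U := by
      simp_rw [euclideanChart_apply]
      exact toEuclidean.contDiff.contMDiff.comp_contMDiffOn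
        ((contMDiffOn_extChartAt (I := I) (n := ∞) (x := x)).mono hU)
    exact hF.contMDiffOn.comp h1 fun y hy => ⟨y, hy, rfl⟩

/-- The coefficients of a section, indexed by multi-indices. -/
def modelCoef (x : M) {U : Opens M} (s : smoothSections I M V U)
    (α : Fin (Module.finrank ℝ (Module.Dual ℝ (E × V))) →₀ ℕ) (y : U) : ℝ :=
  open Classical in if Admissible (fun _ => 1) α then coef x s α.support y else 0

lemma modelCoef_mem (x : M) {U : Opens M} (hU : U ≤ chartDomain H x) {k : ℤ}
    {s : smoothSections I M V U} (hs : s ∈ sectionsDeg I M V U k) :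
    modelCoef x s ∈ modelSections (euclideanChart I x) (fun _ => 1) U k := by
  refine ⟨fun α => ?_, fun α hα => ?_⟩
  · refine (contMDiffOn_iff_euclideanChart hU _).1 ?_
    by_cases h : Admissible (fun _ => 1) α
    · exact ⟨_, contMDiffOn_coef x hU s α.support, fun y => if_pos h⟩
    · exact ⟨fun _ => 0, contMDiffOn_const, fun y => if_neg h⟩
  · ext y
    by_cases h : Admissible (fun _ => 1) α
    · refine (if_pos h).trans (fibreBasis_repr_of_mem (k := k) ?_ fun h' => hα ⟨h, ?_⟩)
      · rw [inChart_of_mem x s y.2]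
        exact toChart_mem (hs y)
      · rw [weight_one_eq h, h']
    · exact if_neg h

lemma exists_section_of_modelSections (x : M) {U : Opens M} (hU : U ≤ chartDomain H x) {k : ℤ}
    {c : (Fin (Module.finrank ℝ (Module.Dual ℝ (E × V))) →₀ ℕ) → U → ℝ}
    (hc : c ∈ modelSections (euclideanChart I x) (fun _ => 1) U k) :
    ∃ s ∈ sectionsDeg I M V U k, modelCoef x s = c := by
  have h1 := fun α => (contMDiffOn_iff_euclideanChart hU (c α)).2 (hc.1 α)
  choose F hF hcF using h1
  set s : smoothSections I M V U := ∑ σ, fn V U (F (indicatorIndex σ)) (hF _) *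
    frame x hU (fibreBasis E V σ) with hs
  have h2 : ∀ y ∈ U, inChart x s y = ∑ σ, F (indicatorIndex σ) y • fibreBasis E V σ := by
    intro y hy
    rw [inChart_of_mem x s hy, hs, sum_apply, map_sum]
    refine Finset.sum_congr rfl fun σ _ => ?_
    rw [← inChart_of_mem x _ hy, inChart_mul x _ _ hy, inChart_fn x _ hy, inChart_frame hU _ hy,
      Algebra.smul_def]
  have h3 : modelCoef x s = c := by
    ext α y
    by_cases h : Admissible (fun _ => 1) α
    · refine (if_pos h).trans ?_
      rw [coef, h2 y y.2, (fibreBasis E V).repr_sum_self, indicatorIndex_support h, hcF]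
    · refine (if_neg h).trans ?_
      rw [hc.2 α fun h' => h h'.1]
      rfl
  refine ⟨s, fun y => ?_, h3⟩
  rw [hs, sum_apply]
  refine Submodule.sum_mem _ fun σ _ => ?_
  by_cases h : (σ.card : ℤ) = k
  · rw [mul_apply, fn_apply, ← Algebra.smul_def, ← h]
    exact Submodule.smul_mem _ _ (frame_mem hU (fibreBasis_mem σ) y)
  · have : F (indicatorIndex σ) y = 0 := by
      rw [← hcF, hc.2]
      · rfl
      · rintro ⟨h4, h5⟩
        rw [weight_one_eq h4, support_indicatorIndex] at h5
        exact h h5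
    rw [mul_apply, fn_apply, this, map_zero, zero_mul]
    exact zero_mem _

lemma section_eq_of_modelCoef {x : M} {U : Opens M} (hU : U ≤ chartDomain H x)
    {s t : smoothSections I M V U} (h : modelCoef x s = modelCoef x t) : s = t := by
  refine section_ext fun y => ?_
  rw [← fromChart_toChart (I := I) (hU y.2) (s.1 y), ← fromChart_toChart (I := I) (hU y.2) (t.1 y),
    ← inChart_of_mem x s y.2, ← inChart_of_mem x t y.2]
  congr 1
  refine (fibreBasis E V).repr.injective (Finsupp.ext fun σ => ?_)
  have := congrFun (congrFun h (indicatorIndex σ)) y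
  rw [modelCoef, modelCoef, if_pos (admissible_indicatorIndex σ),
    if_pos (admissible_indicatorIndex σ), support_indicatorIndex] at this
  exact this

lemma modelCoef_res (x : M) {U W : Opens M} (h : W ≤ U) (s : smoothSections I M V U) (α) (y : W) :
    modelCoef x (restrictSections I M V h s) α y = modelCoef x s α ⟨y, h y.2⟩ := by
  simp only [modelCoef, coef, inChart_res x h _ y.2]

lemma modelCoef_mul (x : M) {U : Opens M} (a b : smoothSections I M V U) {α}
    (hα : Admissible (fun _ => 1) α) (y : U) :
    modelCoef x (a * b) α y = ∑ p ∈ Finset.HasAntidiagonal.antidiagonal α,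
      koszulSign (fun _ => 1) p.1 p.2 * modelCoef x a p.1 y * modelCoef x b p.2 y := by
  rw [modelCoef, if_pos hα, coef, inChart_mul x _ _ y.2]
  refine (exteriorBasis_repr_mul _ _ _ α hα).trans (Finset.sum_congr rfl fun p hp => ?_)
  rw [Finset.HasAntidiagonal.mem_antidiagonal] at hp
  have h1 : Admissible (fun _ => 1) p.1 := fun i hi => by
    have := hα i hi
    rw [← hp, Finsupp.add_apply] at this
    omega
  have h2 : Admissible (fun _ => 1) p.2 := fun i hi => by
    have := hα i hi
    rw [← hp, Finsupp.add_apply] at this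
    omega
  rw [modelCoef, modelCoef, if_pos h1, if_pos h2]
  rfl

/-- The coefficients of the sections of degree `k`. -/
def modelCoefMap (x : M) {U : Opens M} (hU : U ≤ chartDomain H x) (k : ℤ) :
    sectionsDeg I M V U k →ₗ[ℝ]
      modelSections (m := Module.finrank ℝ (Module.Dual ℝ (E × V))) (euclideanChart I x)
        (fun _ => 1) U k where
  toFun := fun s => ⟨modelCoef x s.1, modelCoef_mem x hU s.2⟩
  map_add' := fun s t => by
    refine Subtype.ext (funext fun α => funext fun y => ?_)
    change modelCoef x (s.1 + t.1) α y = modelCoef x s.1 α y + modelCoef x t.1 α y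
    simp only [modelCoef, coef, inChart_add x _ _ y.2, map_add, Finsupp.add_apply]
    split_ifs <;> simp
  map_smul' := fun r s => by
    refine Subtype.ext (funext fun α => funext fun y => ?_)
    change modelCoef x (r • s.1) α y = r * modelCoef x s.1 α y
    simp only [modelCoef, coef, inChart_smul x _ _ y.2, map_smul, Finsupp.smul_apply]
    split_ifs <;> simp

lemma coe_modelCoefMap (x : M) {U : Opens M} (hU : U ≤ chartDomain H x) (k : ℤ)
    (s : sectionsDeg I M V U k) : (modelCoefMap x hU k s).1 = modelCoef x s.1 := rfl

lemma modelCoefMap_bijective (x : M) {U : Opens M} (hU : U ≤ chartDomain H x) (k : ℤ) :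
    Function.Bijective (modelCoefMap (I := I) (V := V) x hU k) := by
  constructor
  · intro s t h
    have h' := congrArg Subtype.val h
    rw [coe_modelCoefMap, coe_modelCoefMap] at h'
    exact Subtype.ext (section_eq_of_modelCoef hU h')
  · intro c
    obtain ⟨s, hs, h⟩ := exists_section_of_modelSections (V := V) x hU c.2
    exact ⟨⟨s, hs⟩, Subtype.ext h⟩

variable (I M V) in
lemma isLocallyModelledAt_tangentTimes (x : M) :
    IsLocallyModelledAt (tangentTimes I M V) x := by
  let e := euclideanChart I x
  have hx : x ∈ e.source := mem_chartDomain x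
  let Φ : ∀ U : Opens M, U ≤ chartDomain H x → ∀ k : ℤ, sectionsDeg I M V U k ≃ₗ[ℝ]
      modelSections (m := Module.finrank ℝ (Module.Dual ℝ (E × V))) e (fun _ => 1) U k :=
    fun U hU k => LinearEquiv.ofBijective _ (modelCoefMap_bijective x hU k)
  have h1 : ∀ (U W : Opens M) (hU : U ≤ chartDomain H x) (hW : W ≤ chartDomain H x) (h : W ≤ U)
      (k : ℤ) (a : sectionsDeg I M V U k) (b : sectionsDeg I M V W k),
      restrictSections I M V h a.1 = b.1 →
      ∀ α (y : W), (Φ W hW k b).1 α y = (Φ U hU k a).1 α ⟨y, h y.2⟩ := by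
    intro U W hU hW h k a b hab α y
    refine Eq.trans ?_ (modelCoef_res x h a.1 α y)
    exact congrArg (fun b : smoothSections I M V W => modelCoef x b α y) hab.symm
  have h2 : ∀ (U : Opens M) (hU : U ≤ chartDomain H x) (k l : ℤ) (a : sectionsDeg I M V U k)
      (b : sectionsDeg I M V U l) (c : sectionsDeg I M V U (k + l)), a.1 * b.1 = c.1 →
      ∀ α, Admissible (fun _ => 1) α → ∀ y : U, (Φ U hU (k + l) c).1 α y =
        ∑ p ∈ Finset.HasAntidiagonal.antidiagonal α,
          koszulSign (fun _ => 1) p.1 p.2 * (Φ U hU k a).1 p.1 y * (Φ U hU l b).1 p.2 y := by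
    intro U hU k l a b c habc α hα y
    refine Eq.trans ?_ (modelCoef_mul x a.1 b.1 hα y)
    exact congrArg (fun b : smoothSections I M V U => modelCoef x b α y) habc.symm
  exact ⟨Module.finrank ℝ E, Module.finrank ℝ (Module.Dual ℝ (E × V)), e, fun _ => 1, Φ, hx,
    fun _ => one_ne_zero, h1, h2⟩

end FiniteDimensional

variable (I M V) in
lemma sections_graded_comm (U : Opens M) (k l : ℤ) (a b : smoothSections I M V U)
    (ha : a ∈ sectionsDeg I M V U k) (hb : b ∈ sectionsDeg I M V U l) :
    a * b = ((-1 : ℝ) ^ (k * l)) • (b * a) :=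
  section_ext fun x => fibre_mul_comm (ha x) (hb x)

lemma sections_d_mem [FinDimModel E M] (U : Opens M) (k : ℤ) (a : smoothSections I M V U)
    (ha : a ∈ sectionsDeg I M V U k) : deRhamCE I M V U a ∈ sectionsDeg I M V U (k + 1) := d_mem ha

variable (I M V) in
theorem isDGManifold_tangentTimes [FinDimModel E M] [T2Space M] [SecondCountableTopology M]
    [LieLaws V] : IsDGManifold (tangentTimes I M V) := by
  have h1 := fun U : Opens M => isInternal_sectionsDeg (I := I) (V := V) U
  have h2 := fun (U : Opens M) k a => sections_d_mem (I := I) (V := V) U k a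
  have h3 := fun x : M => by
    have := FinDimModel.finiteDimensional (E := E) (M := M) ⟨x⟩
    exact isLocallyModelledAt_tangentTimes I M V x
  have h4 := fun (U : Opens M) a => d_d (I := I) (V := V) U a
  have h5 := fun k ι (W : ι → Opens M) => exists_glue_sections (I := I) (V := V) k ι W
  exact
    { t2 := ‹T2Space M›
      secondCountable := ‹SecondCountableTopology M›
      one_mem := fun U _ => one_mem_fibreDeg
      mul_mem := fun U k l a b ha hb x => mul_mem_fibreDeg (ha x) (hb x)
      isInternal := h1
      graded_comm := sections_graded_comm I M V
      res_mem := fun h k a ha x => ha ⟨x.1, h x.2⟩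
      glue := h5
      locallyModelled := h3
      d_mem := h2
      d_mul := (isDeRhamCE_deRhamCE I M V).mul
      d_d := h4
      res_d := (isDeRhamCE_deRhamCE I M V).res }

end DGManifold

section Hadamard

open MeasureTheory

variable {E : Type u} [NormedAddCommGroup E] [NormedSpace ℝ E]

lemma contDiff_intervalIntegral {W : Type u} [NormedAddCommGroup W] [NormedSpace ℝ W]
    {g : E → ℝ → W} (hg : ContDiff ℝ ∞ fun x : E × ℝ => g x.1 x.2) :
    ContDiff ℝ ∞ fun q => ∫ t in (0 : ℝ)..1, g q t := by
  obtain ⟨ρ, hρ1, hρ2⟩ : ∃ ρ : ContDiffBump (0 : ℝ), ρ.rIn = 1 ∧ ρ.rOut = 2 :=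
    ⟨⟨1, 2, one_pos, one_lt_two⟩, rfl, rfl⟩
  obtain ⟨f, hf⟩ : ∃ f : ℝ → ℝ, f = Set.indicator (Set.Icc 0 1) fun _ => 1 := ⟨_, rfl⟩
  obtain ⟨g', hg'⟩ : ∃ g' : E → ℝ → W, ∀ q t, g' q t = ρ t • g q (-t) := ⟨_, fun _ _ => rfl⟩
  have hfi : LocallyIntegrable f volume := by
    rw [hf]
    exact ((integrable_indicator_iff measurableSet_Icc).2
      (integrableOn_const (by simp))).locallyIntegrable
  have hgs : ContDiff ℝ ∞ (Function.HasUncurry.uncurry g') := by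
    have : Function.HasUncurry.uncurry g' = fun x : E × ℝ => ρ x.2 • g x.1 (-x.2) :=
      funext fun x => hg' x.1 x.2
    rw [this]
    have h1 : ContDiff ℝ ∞ fun x : E × ℝ => ρ x.2 := ρ.contDiff.comp contDiff_snd
    have h2 : ContDiff ℝ ∞ fun x : E × ℝ => g x.1 (-x.2) :=
      hg.comp (contDiff_fst.prodMk contDiff_snd.neg)
    exact h1.smul h2
  have hgz : ∀ (q : E) (t : ℝ), q ∈ Set.univ → t ∉ Metric.closedBall (0 : ℝ) 2 → g' q t = 0 := by
    intro q t _ ht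
    rw [hg', ρ.zero_of_le_dist, zero_smul]
    rw [hρ2]
    exact (not_le.1 ht).le
  have h := contDiffOn_convolution_right_with_param (μ := volume) (n := ⊤)
    (ContinuousLinearMap.lsmul ℝ ℝ) isOpen_univ (isCompact_closedBall (0 : ℝ) 2) hgz hfi
    hgs.contDiffOn
  have h' : ContDiff ℝ ∞ fun q : E => ∫ t, f t • g' q (0 - t) := by
    rw [← contDiffOn_univ]
    exact h.comp (contDiff_prodMk_left (0 : ℝ)).contDiffOn fun q _ => ⟨trivial, trivial⟩
  convert h' using 2 with q
  rw [intervalIntegral.integral_of_le zero_le_one, ← integral_Icc_eq_integral_Ioc,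
    ← integral_indicator measurableSet_Icc]
  congr 1
  ext1 t
  by_cases ht : t ∈ Set.Icc (0 : ℝ) 1
  · have : ρ (0 - t) = 1 := ρ.one_of_mem_closedBall (by
      rw [hρ1, Metric.mem_closedBall, dist_zero_right, zero_sub, norm_neg, Real.norm_eq_abs,
        abs_of_nonneg ht.1]
      exact ht.2)
    rw [hg', this, hf, Set.indicator_of_mem ht, Set.indicator_of_mem ht]
    simp
  · rw [hf, Set.indicator_of_notMem ht, Set.indicator_of_notMem ht, zero_smul]

/-- The first-order Taylor formula with a smooth remainder. -/
lemma exists_smooth_remainder {F : E → ℝ} (hF : ContDiff ℝ ∞ F) (p : E) :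
    ∃ G : E → E →L[ℝ] ℝ, ContDiff ℝ ∞ G ∧ ∀ q, F q = F p + G q (q - p) := by
  have hF' : ContDiff ℝ ∞ (fderiv ℝ F) := hF.fderiv_right (by norm_cast)
  have hg : ContDiff ℝ ∞ (fun x : E × ℝ => fderiv ℝ F (p + x.2 • (x.1 - p))) :=
    hF'.comp (contDiff_const.add (contDiff_snd.smul (contDiff_fst.sub contDiff_const)))
  refine ⟨_, contDiff_intervalIntegral (g := fun q t => fderiv ℝ F (p + t • (q - p))) hg,
    fun q => ?_⟩
  have hc : Continuous fun t : ℝ => fderiv ℝ F (p + t • (q - p)) :=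
    hF'.continuous.comp (by fun_prop)
  have h2 : ∀ t : ℝ, HasDerivAt (fun t : ℝ => F (p + t • (q - p)))
      (fderiv ℝ F (p + t • (q - p)) (q - p)) t := by
    intro t
    have h3 : HasDerivAt (fun t : ℝ => p + t • (q - p)) (q - p) t := by
      simpa using ((hasDerivAt_id t).smul_const (q - p)).const_add p
    exact ((hF.differentiable (by simp)) _).hasFDerivAt.comp_hasDerivAt t h3
  have h3 := intervalIntegral.integral_eq_sub_of_hasDerivAt (a := 0) (b := 1)
    (fun t _ => h2 t) ((hc.clm_apply continuous_const).intervalIntegrable _ _)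
  rw [ContinuousLinearMap.intervalIntegral_apply (hc.intervalIntegrable _ _), h3]
  simp

lemma exists_smooth_remainder_of_contDiffOn [FiniteDimensional ℝ E] {F : E → ℝ} {N : Set E}
    (hN : IsOpen N) (hF : ContDiffOn ℝ ∞ F N) {p : E} (hp : p ∈ N) :
    ∃ G : E → E →L[ℝ] ℝ, ContDiff ℝ ∞ G ∧ ∀ᶠ q in 𝓝 p, F q = F p + G q (q - p) := by
  obtain ⟨r, hr, hrN⟩ := Metric.isOpen_iff.1 hN p hp
  let ρ : ContDiffBump p := ⟨r / 4, r / 2, by linarith, by linarith⟩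
  have h : ContDiff ℝ ∞ fun q => ρ q * F q := by
    rw [contDiff_iff_contDiffAt]
    intro q
    by_cases hq : q ∈ Metric.ball p r
    · exact ρ.contDiffAt.mul (hF.contDiffAt (hN.mem_nhds (hrN hq)))
    · have : (fun q => ρ q * F q) =ᶠ[𝓝 q] fun _ => 0 := by
        have hq' : q ∈ (Metric.closedBall p (r / 2))ᶜ := fun h =>
          hq (Metric.closedBall_subset_ball (by linarith) h)
        filter_upwards [Metric.isClosed_closedBall.isOpen_compl.mem_nhds hq'] with z hz
        rw [ρ.zero_of_le_dist (show r / 2 ≤ dist z p from (not_le.1 fun h => hz h).le), zero_mul]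
      exact contDiffAt_const.congr_of_eventuallyEq this
  obtain ⟨G, hG, hG'⟩ := exists_smooth_remainder h p
  refine ⟨G, hG, ?_⟩
  filter_upwards [ρ.eventuallyEq_one] with q hq
  have := hG' q
  rw [hq, ρ.eventuallyEq_one.eq_of_nhds] at this
  simpa using this

variable {H : Type u} [TopologicalSpace H] (I : ModelWithCorners ℝ E H)
  {M : Type u} [TopologicalSpace M] [ChartedSpace H M]
  {E' : Type u} [NormedAddCommGroup E'] [NormedSpace ℝ E'] [FiniteDimensional ℝ E']

/-- The components of the map `c` generate the ideal of the functions vanishing at `p`. -/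
def HadamardAt (c : M → E') (p : M) : Prop :=
  ∀ (N : Opens M) (F : M → ℝ), p ∈ N → ContMDiffOn I 𝓘(ℝ, ℝ) ∞ F N →
    ∃ (N' : Opens M) (G : Fin (Module.finrank ℝ E') → M → ℝ), N' ≤ N ∧ p ∈ N' ∧
      ContMDiffOn I 𝓘(ℝ, E') ∞ c N' ∧ (∀ i, ContMDiffOn I 𝓘(ℝ, ℝ) ∞ (G i) N') ∧
      ∀ q ∈ N', F q = F p + ∑ i, (Module.finBasis ℝ E').coord i (c q - c p) * G i q

variable {I}

lemma hadamardAt_of_leftInverse {c : M → E'} {r : E' → M} {N₀ : Set M} {Ω : Set E'}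
    (hN₀ : IsOpen N₀) (hΩ : IsOpen Ω) (hc : ContMDiffOn I 𝓘(ℝ, E') ∞ c N₀)
    (hr : ContMDiffOn 𝓘(ℝ, E') I ∞ r Ω) {p : M} (hp : p ∈ N₀) (hp' : c p ∈ Ω)
    (h : ∀ q ∈ N₀, r (c q) = q) : HadamardAt I c p := by
  intro N F hpN hF
  have ho : IsOpen (Ω ∩ r ⁻¹' N) := hr.continuousOn.isOpen_inter_preimage hΩ N.2
  have hF' : ContDiffOn ℝ ∞ (F ∘ r) (Ω ∩ r ⁻¹' N) := by
    rw [← contMDiffOn_iff_contDiffOn]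
    exact hF.comp (hr.mono Set.inter_subset_left) fun q hq => hq.2
  obtain ⟨G, hG, hG'⟩ := exists_smooth_remainder_of_contDiffOn ho hF'
    (⟨hp', by rwa [Set.mem_preimage, h p hp]⟩ : c p ∈ Ω ∩ r ⁻¹' N)
  obtain ⟨Ω', hΩ', ho', hpΩ⟩ := eventually_nhds_iff.1 hG'
  refine ⟨⟨(N₀ ∩ c ⁻¹' Ω') ∩ N, (hc.continuousOn.isOpen_inter_preimage hN₀ ho').inter N.2⟩,
    fun i q => G (c q) (Module.finBasis ℝ E' i), fun q hq => hq.2, ⟨⟨hp, hpΩ⟩, hpN⟩,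
    hc.mono fun q hq => hq.1.1, fun i => ?_, fun q hq => ?_⟩
  · have : ContDiff ℝ ∞ fun z => G z (Module.finBasis ℝ E' i) := hG.clm_apply contDiff_const
    exact this.contMDiff.comp_contMDiffOn (hc.mono fun q hq => hq.1.1)
  · have := hΩ' (c q) hq.1.2
    simp only [Function.comp_apply, h q hq.1.1, h p hp] at this
    rw [this]
    conv_lhs => rw [← (Module.finBasis ℝ E').sum_repr (c q - c p), map_sum]
    simp

lemma hadamardAt_extChartAt [IsManifold I ∞ M] [I.Boundaryless] [FiniteDimensional ℝ E] {x p : M}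
    (hp : p ∈ chartDomain H x) : HadamardAt I (extChartAt I x) p := by
  have hp' : p ∈ (extChartAt I x).source := by rwa [extChartAt_source]
  refine hadamardAt_of_leftInverse (chartDomain H x).2 (isOpen_extChartAt_target x)
    contMDiffOn_extChartAt (contMDiffOn_extChartAt_symm x) hp ((extChartAt I x).map_source hp')
    fun q hq => (extChartAt I x).left_inv (by rwa [extChartAt_source])

end Hadamard

section Coefficients

variable {S : DGSpace.{u}}

namespace IsDGManifold

/-- The homogeneous component of degree `k`. -/
def component (hS : IsDGManifold S) (U : Opens S.body) (k : ℤ) : S.O U →ₗ[ℝ] S.O U :=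
  letI := (hS.isInternal U).chooseDecomposition
  (S.deg U k).subtype ∘ₗ DirectSum.component ℝ ℤ (fun k => S.deg U k) k ∘ₗ
    (DirectSum.decomposeLinearEquiv (S.deg U)).toLinearMap

lemma component_mem (hS : IsDGManifold S) {U : Opens S.body} (k : ℤ) (a : S.O U) :
    component hS U k a ∈ S.deg U k := by
  let _ := (hS.isInternal U).chooseDecomposition
  exact SetLike.coe_mem _

lemma component_of_mem (hS : IsDGManifold S) {U : Opens S.body} {k : ℤ} {a : S.O U} (ha : a ∈ S.deg U k) (l : ℤ) :
    component hS U l a = if l = k then a else 0 := by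
  let _ := (hS.isInternal U).chooseDecomposition
  change ((DirectSum.decompose (S.deg U) a) l : S.O U) = _
  split_ifs with h
  · subst h
    exact DirectSum.decompose_of_mem_same _ ha
  · exact DirectSum.decompose_of_mem_ne _ ha (Ne.symm h)

lemma eq_zero_of_component (hS : IsDGManifold S) {U : Opens S.body} {a : S.O U} (h : ∀ k, component hS U k a = 0) :
    a = 0 := by
  let _ := (hS.isInternal U).chooseDecomposition
  refine (DirectSum.decomposeLinearEquiv (S.deg U)).injective ?_
  rw [map_zero]
  exact DFinsupp.ext fun k => Subtype.ext (h k)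

lemma homogeneous_induction (hS : IsDGManifold S) {U : Opens S.body} {P : S.O U → Prop}
    (mem : ∀ k, ∀ a ∈ S.deg U k, P a) (add : ∀ a b, P a → P b → P (a + b)) (a : S.O U) : P a := by
  have h : a ∈ ⨆ k, S.deg U k := by
    rw [(hS.isInternal U).submodule_iSup_eq_top]
    trivial
  exact Submodule.iSup_induction (fun k => S.deg U k) (motive := P) h mem (mem 0 0 (zero_mem _)) add

lemma component_res (hS : IsDGManifold S) {U W : Opens S.body} (h : W ≤ U) (k : ℤ) (a : S.O U) :
    component hS W k (S.res h a) = S.res h (component hS U k a) := by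
  refine homogeneous_induction hS (P := fun a => component hS W k (S.res h a) =
    S.res h (component hS U k a)) (fun l a ha => ?_) (fun a b ha hb => ?_) a
  · rw [component_of_mem hS ha, component_of_mem hS (hS.res_mem h l a ha)]
    split_ifs
    · rfl
    · rw [map_zero]
  · rw [map_add, map_add, map_add, map_add, ha, hb]

/-- Functions are determined locally. -/
lemma eq_of_locally (hS : IsDGManifold S) {U : Opens S.body} {a b : S.O U} (h : ∀ x ∈ U, ∃ (W : Opens S.body)
    (hW : W ≤ U), x ∈ W ∧ S.res hW a = S.res hW b) : a = b := by
  rw [← sub_eq_zero]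
  refine eq_zero_of_component hS fun k => ?_
  choose W hW hxW hab using fun x : U => h x x.2
  have hU : U = ⨆ x : U, W x := le_antisymm
    (fun x hx => Opens.mem_iSup.2 ⟨⟨x, hx⟩, hxW ⟨x, hx⟩⟩) (iSup_le hW)
  obtain ⟨c, -, hc⟩ := hS.glue k U W U hU (fun x => 0) (fun x => zero_mem _)
    (fun x y => by rw [map_zero, map_zero])
  rw [hc _ ⟨component_mem hS k (a - b), fun x => ?_⟩, hc 0 ⟨zero_mem _, fun x => map_zero _⟩]
  rw [← component_res hS, map_sub, hab x, sub_self, map_zero]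

lemma mul_comm_of_mem_zero (hS : IsDGManifold S) {U : Opens S.body} {a : S.O U} (ha : a ∈ S.deg U 0) (b : S.O U) :
    a * b = b * a := by
  refine homogeneous_induction hS (P := fun b => a * b = b * a) (fun l b hb => ?_)
    (fun b c hb hc => by rw [mul_add, add_mul, hb, hc]) b
  rw [hS.graded_comm U 0 l a b ha hb, zero_mul, zpow_zero, one_smul]

lemma mul_self_eq_zero (hS : IsDGManifold S) {U : Opens S.body} {a : S.O U} (ha : a ∈ S.deg U 1) : a * a = 0 := by
  have h := hS.graded_comm U 1 1 a a ha ha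
  rw [mul_one, zpow_one, neg_one_smul] at h
  have h2 : (2 : ℝ) • (a * a) = 0 := by rw [two_smul]; nth_rw 1 [h]; simp
  exact (smul_eq_zero.1 h2).resolve_left two_ne_zero

lemma d_algebraMap (hS : IsDGManifold S) {U : Opens S.body} (r : ℝ) : S.d U (algebraMap ℝ _ r) = 0 := by
  have h := hS.d_mul U 0 1 1 (hS.one_mem U)
  rw [mul_one, mul_one, one_mul, zpow_zero, one_smul, left_eq_add] at h
  rw [Algebra.algebraMap_eq_smul_one, map_smul, h, smul_zero]

end IsDGManifold

/-- A coordinate patch of a dg-manifold. -/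
structure LocalChart (S : DGSpace.{u}) where
  isDG : IsDGManifold S
  n : ℕ
  m : ℕ
  e : OpenPartialHomeomorph S.body (EuclideanSpace ℝ (Fin n))
  w : Fin m → ℤ
  Φ : ∀ U : Opens S.body, (U : Set S.body) ⊆ e.source → ∀ k : ℤ,
      S.deg U k ≃ₗ[ℝ] modelSections e w U k
  map_res : ∀ (U V : Opens S.body) (hU : (U : Set S.body) ⊆ e.source)
      (hV : (V : Set S.body) ⊆ e.source) (h : V ≤ U) (k : ℤ) (a : S.deg U k) (b : S.deg V k),
      S.res h (a : S.O U) = b →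
      ∀ α (y : V), (Φ V hV k b).1 α y = (Φ U hU k a).1 α ⟨y, h y.2⟩
  map_mul : ∀ (U : Opens S.body) (hU : (U : Set S.body) ⊆ e.source) (k l : ℤ)
      (a : S.deg U k) (b : S.deg U l) (c : S.deg U (k + l)),
      (a : S.O U) * b = c →
      ∀ α, Admissible w α → ∀ y : U, (Φ U hU (k + l) c).1 α y =
        ∑ p ∈ Finset.HasAntidiagonal.antidiagonal α,
          koszulSign w p.1 p.2 * (Φ U hU k a).1 p.1 y * (Φ U hU l b).1 p.2 y

lemma IsDGManifold.exists_localChart (hS : IsDGManifold S) (x : S.body) :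
    ∃ L : LocalChart S, x ∈ L.e.source := by
  obtain ⟨n, m, e, w, Φ, hx, -, h1, h2⟩ := hS.locallyModelled x
  exact ⟨⟨hS, n, m, e, w, Φ, h1, h2⟩, hx⟩

namespace LocalChart

variable (L : LocalChart S) {U W : Opens S.body}

/-- The coefficients of a function in a coordinate patch. -/
def coeff (hU : (U : Set S.body) ⊆ L.e.source) : S.O U →ₗ[ℝ] (Fin L.m →₀ ℕ) → U → ℝ where
  toFun a α y := (L.Φ U hU (weight L.w α) ⟨L.isDG.component U (weight L.w α) a,
    L.isDG.component_mem _ a⟩).1 α y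
  map_add' a b := by
    funext α y
    have : (⟨L.isDG.component U (weight L.w α) (a + b), L.isDG.component_mem _ _⟩ :
        S.deg U (weight L.w α)) = ⟨L.isDG.component U (weight L.w α) a, L.isDG.component_mem _ a⟩ +
          ⟨L.isDG.component U (weight L.w α) b, L.isDG.component_mem _ b⟩ :=
      Subtype.ext (map_add _ _ _)
    rw [this, map_add]
    rfl
  map_smul' r a := by
    funext α y
    have : (⟨L.isDG.component U (weight L.w α) (r • a), L.isDG.component_mem _ _⟩ :
        S.deg U (weight L.w α)) =
          r • ⟨L.isDG.component U (weight L.w α) a, L.isDG.component_mem _ a⟩ :=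
      Subtype.ext (map_smul _ _ _)
    rw [this, map_smul]
    rfl

variable {hU : (U : Set S.body) ⊆ L.e.source}

lemma coeff_of_mem {k : ℤ} {a : S.O U} (ha : a ∈ S.deg U k) (α) (y : U) :
    L.coeff hU a α y = (L.Φ U hU k ⟨a, ha⟩).1 α y := by
  by_cases h : weight L.w α = k
  · subst h
    have : (⟨L.isDG.component U (weight L.w α) a, L.isDG.component_mem _ a⟩ :
        S.deg U (weight L.w α)) = ⟨a, ha⟩ :=
      Subtype.ext ((L.isDG.component_of_mem ha _).trans (if_pos rfl))
    exact congrArg (fun b => (L.Φ U hU (weight L.w α) b).1 α y) this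
  · have : (⟨L.isDG.component U (weight L.w α) a, L.isDG.component_mem _ a⟩ :
        S.deg U (weight L.w α)) = 0 :=
      Subtype.ext ((L.isDG.component_of_mem ha _).trans (if_neg h))
    refine (congrArg (fun b => (L.Φ U hU (weight L.w α) b).1 α y) this).trans ?_
    rw [map_zero, (L.Φ U hU k ⟨a, ha⟩).2.2 α fun h' => h h'.2]
    rfl

lemma coeff_of_not_admissible (a : S.O U) {α} (hα : ¬ Admissible L.w α) (y : U) :
    L.coeff hU a α y = 0 :=
  congrFun ((L.Φ U hU _ _).2.2 α fun h => hα h.1) y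

lemma coeff_of_weight_ne {k : ℤ} {a : S.O U} (ha : a ∈ S.deg U k) {α} (hα : weight L.w α ≠ k)
    (y : U) : L.coeff hU a α y = 0 := by
  rw [coeff_of_mem L ha]
  exact congrFun ((L.Φ U hU _ _).2.2 α fun h => hα h.2) y

lemma coeff_res {hW : (W : Set S.body) ⊆ L.e.source} (h : W ≤ U) (a : S.O U) (α) (y : W) :
    L.coeff hW (S.res h a) α y = L.coeff hU a α ⟨y, h y.2⟩ := by
  refine L.isDG.homogeneous_induction (P := fun a => L.coeff hW (S.res h a) α y =
    L.coeff hU a α ⟨y, h y.2⟩) (fun k a ha => ?_) (fun a b ha hb => ?_) a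
  · rw [coeff_of_mem L ha, coeff_of_mem L (L.isDG.res_mem h k a ha)]
    exact L.map_res U W hU hW h k ⟨a, ha⟩ ⟨_, L.isDG.res_mem h k a ha⟩ rfl α y
  · simp only [map_add, Pi.add_apply, ha, hb]

lemma coeff_mul (a b : S.O U) {α} (hα : Admissible L.w α) (y : U) :
    L.coeff hU (a * b) α y = ∑ p ∈ Finset.HasAntidiagonal.antidiagonal α,
      koszulSign L.w p.1 p.2 * L.coeff hU a p.1 y * L.coeff hU b p.2 y := by
  refine L.isDG.homogeneous_induction (P := fun a => L.coeff hU (a * b) α y =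
      ∑ p ∈ Finset.HasAntidiagonal.antidiagonal α,
        koszulSign L.w p.1 p.2 * L.coeff hU a p.1 y * L.coeff hU b p.2 y)
    (fun k a ha => ?_) (fun a a' ha ha' => ?_) a
  · refine L.isDG.homogeneous_induction (P := fun b => L.coeff hU (a * b) α y =
      ∑ p ∈ Finset.HasAntidiagonal.antidiagonal α,
        koszulSign L.w p.1 p.2 * L.coeff hU a p.1 y * L.coeff hU b p.2 y)
      (fun l b hb => ?_) (fun b b' hb hb' => ?_) b
    · simp only [coeff_of_mem L ha, coeff_of_mem L hb,
        coeff_of_mem L (L.isDG.mul_mem U k l a b ha hb)]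
      exact L.map_mul U hU k l ⟨a, ha⟩ ⟨b, hb⟩ ⟨_, L.isDG.mul_mem U k l a b ha hb⟩ rfl α hα y
    · simp only [mul_add, map_add, Pi.add_apply, hb, hb', Finset.sum_add_distrib]
  · simp only [add_mul, mul_add, map_add, Pi.add_apply, ha, ha', Finset.sum_add_distrib]

lemma ext_coeff {a b : S.O U} (h : ∀ α (y : U), L.coeff hU a α y = L.coeff hU b α y) : a = b := by
  rw [← sub_eq_zero]
  refine L.isDG.eq_zero_of_component fun k => ?_
  have : (⟨L.isDG.component U k (a - b), L.isDG.component_mem k _⟩ : S.deg U k) = 0 := by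
    refine (L.Φ U hU k).injective ?_
    rw [map_zero]
    refine Subtype.ext (funext fun α => funext fun y => ?_)
    by_cases hα : weight L.w α = k
    · subst hα
      have h1 : L.coeff hU (a - b) α y = 0 := by
        rw [map_sub, Pi.sub_apply, Pi.sub_apply, h, sub_self]
      exact h1
    · exact congrFun ((L.Φ U hU k _).2.2 α fun h' => hα h'.2) y
  exact congrArg Subtype.val this

/-- Smooth functions on the body. -/
def smooth (U : Opens S.body) : Subalgebra ℝ (U → ℝ) where
  carrier := {c | ∃ F : EuclideanSpace ℝ (Fin L.n) → ℝ,
    ContDiffOn ℝ ∞ F (L.e '' (U : Set S.body)) ∧ ∀ x : U, c x = F (L.e x)}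
  mul_mem' := by
    rintro a b ⟨F, hF, h⟩ ⟨G, hG, h'⟩
    exact ⟨fun x => F x * G x, hF.mul hG, fun x => by simp [h, h']⟩
  add_mem' := by
    rintro a b ⟨F, hF, h⟩ ⟨G, hG, h'⟩
    exact ⟨fun x => F x + G x, hF.add hG, fun x => by simp [h, h']⟩
  algebraMap_mem' r := ⟨fun _ => r, contDiffOn_const, fun _ => rfl⟩

lemma coeff_smooth (hU : (U : Set S.body) ⊆ L.e.source) (a : S.O U) (α) :
    L.coeff hU a α ∈ L.smooth U :=
  (L.Φ U hU _ ⟨L.isDG.component U (weight L.w α) a, L.isDG.component_mem _ a⟩).2.1 α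

lemma exists_coeff (hU : (U : Set S.body) ⊆ L.e.source) (k : ℤ) (c : (Fin L.m →₀ ℕ) → U → ℝ)
    (hc : ∀ α, c α ∈ L.smooth U) (hc' : ∀ α, ¬ (Admissible L.w α ∧ weight L.w α = k) → c α = 0) :
    ∃ a ∈ S.deg U k, L.coeff hU a = c := by
  refine ⟨(L.Φ U hU k).symm ⟨c, hc, hc'⟩, SetLike.coe_mem _, ?_⟩
  funext α y
  rw [coeff_of_mem L (SetLike.coe_mem _)]
  simp

lemma admissible_zero : Admissible L.w 0 := fun i _ => by simp

lemma weight_zero : weight L.w 0 = 0 := by simp [weight]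

lemma koszulSign_zero_left (α) : koszulSign L.w 0 α = 1 := by simp [koszulSign]

lemma coeff_mul_zero (a b : S.O U) (y : U) :
    L.coeff hU (a * b) 0 y = L.coeff hU a 0 y * L.coeff hU b 0 y := by
  rw [coeff_mul L a b L.admissible_zero]
  simp [koszulSign_zero_left]

lemma exists_const (hU : (U : Set S.body) ⊆ L.e.source) (h : L.smooth U) :
    ∃ a ∈ S.deg U 0, ∀ α y, L.coeff hU a α y = if α = 0 then h.1 y else 0 := by
  obtain ⟨a, ha, hc⟩ := L.exists_coeff hU 0 (fun α => if α = 0 then h.1 else 0) (fun α => by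
    split_ifs
    · exact h.2
    · exact zero_mem _) (fun α hα => by
    split_ifs with h0
    · subst h0
      exact absurd ⟨L.admissible_zero, L.weight_zero⟩ hα
    · rfl)
  refine ⟨a, ha, fun α y => ?_⟩
  rw [hc]
  dsimp only
  split_ifs <;> rfl

lemma coeff_const_mul {a : S.O U} {h : U → ℝ}
    (ha : ∀ α y, L.coeff hU a α y = if α = 0 then h y else 0) (b : S.O U) (α) (y : U) :
    L.coeff hU (a * b) α y = h y * L.coeff hU b α y := by
  by_cases hα : Admissible L.w α
  · rw [coeff_mul L a b hα, Finset.sum_eq_single (0, α)]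
    · simp [ha, koszulSign_zero_left]
    · rintro ⟨p, q⟩ hp hne
      have : p ≠ 0 := by
        rintro rfl
        rw [Finset.HasAntidiagonal.mem_antidiagonal, zero_add] at hp
        exact hne (by rw [← hp])
      simp [ha, this]
    · intro h'
      simp [Finset.HasAntidiagonal.mem_antidiagonal] at h'
  · rw [coeff_of_not_admissible L _ hα, coeff_of_not_admissible L _ hα, mul_zero]

lemma coeff_one (α) (y : U) : L.coeff hU (1 : S.O U) α y = if α = 0 then 1 else 0 := by
  obtain ⟨a, ha, hc⟩ := L.exists_const hU (1 : L.smooth U)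
  have : a * 1 = 1 := ext_coeff L (hU := hU) fun α y => by
    rw [coeff_const_mul L hc]
    exact one_mul _
  rw [mul_one] at this
  rw [← this, hc]
  rfl

lemma coeff_algebraMap (r : ℝ) (α) (y : U) :
    L.coeff hU (algebraMap ℝ (S.O U) r) α y = if α = 0 then r else 0 := by
  rw [Algebra.algebraMap_eq_smul_one, map_smul, Pi.smul_apply, Pi.smul_apply, coeff_one]
  split_ifs <;> simp

end LocalChart

end Coefficients

section PresheafHoms

/-- A presheaf of real algebras, each with a family of subspaces indexed by `ℤ`. -/
structure GradedPresheaf (M : Type u) [TopologicalSpace M] where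
  O : Opens M → Type u
  [ring : ∀ N, Ring (O N)]
  [alg : ∀ N, Algebra ℝ (O N)]
  deg : ∀ N, ℤ → Submodule ℝ (O N)
  res : ∀ {N N' : Opens M}, N' ≤ N → (O N →ₐ[ℝ] O N')
  res_self : ∀ {N : Opens M} (h : N ≤ N) (a : O N), res h a = a

attribute [instance] GradedPresheaf.ring GradedPresheaf.alg

/-- Homomorphisms of presheaves of graded algebras over the map `f`, defined over the open subset
`U₀` of the source. -/
structure PresheafHom (S : DGSpace.{u}) {M : Type u} [TopologicalSpace M] (A : GradedPresheaf M)
    (f : S.body → M) (U₀ : Opens S.body) where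
  cont : ContinuousOn f U₀
  sharp : ∀ (N : Opens M) (U : Opens S.body), U ≤ U₀ → (∀ x ∈ U, f x ∈ N) → (A.O N →ₐ[ℝ] S.O U)
  sharp_res : ∀ {N N' : Opens M} {U U' : Opens S.body} (hN : N' ≤ N) (hU : U' ≤ U) (h₀ : U ≤ U₀)
    (h : ∀ x ∈ U, f x ∈ N) (h' : ∀ x ∈ U', f x ∈ N') (a : A.O N),
    S.res hU (sharp N U h₀ h a) = sharp N' U' (hU.trans h₀) h' (A.res hN a)
  sharp_mem : ∀ N U h₀ h k (a : A.O N), a ∈ A.deg N k → sharp N U h₀ h a ∈ S.deg U k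

/-- The part of an open set `U` that a map sends to `N`. -/
def shrink {X M : Type u} [TopologicalSpace X] [TopologicalSpace M] {f : X → M} {U₀ : Opens X}
    (hf : ContinuousOn f U₀) {U : Opens X} (hU : U ≤ U₀) (N : Opens M) : Opens X :=
  ⟨U ∩ f ⁻¹' N, (hf.mono hU).isOpen_inter_preimage U.2 N.2⟩

lemma shrink_le {X M : Type u} [TopologicalSpace X] [TopologicalSpace M] {f : X → M} {U₀ : Opens X}
    (hf : ContinuousOn f U₀) {U : Opens X} (hU : U ≤ U₀) (N : Opens M) : shrink hf hU N ≤ U :=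
  fun _ hx => hx.1

/-- The restriction of a homomorphism to a smaller open set. -/
def PresheafHom.restrict {S : DGSpace.{u}} {M : Type u} [TopologicalSpace M] {A : GradedPresheaf M}
    {f : S.body → M} {U₀ U₁ : Opens S.body} (φ : PresheafHom S A f U₀) (h₁ : U₁ ≤ U₀) :
    PresheafHom S A f U₁ where
  cont := φ.cont.mono h₁
  sharp N U h₀ h := φ.sharp N U (h₀.trans h₁) h
  sharp_res hN hU h₀ h h' a := φ.sharp_res hN hU (h₀.trans h₁) h h' a
  sharp_mem N U h₀ h k a ha := φ.sharp_mem N U (h₀.trans h₁) h k a ha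

/-- Homomorphisms can be glued. -/
theorem PresheafHom.exists_glue {S : DGSpace.{u}} (hS : IsDGManifold S) {M : Type u}
    [TopologicalSpace M] {A : GradedPresheaf M} (hA : ∀ N, ⨆ k, A.deg N k = ⊤) {f : S.body → M}
    (hf : Continuous f) (D : S.body → Opens S.body) (hD : ∀ y, y ∈ D y)
    (ψ : ∀ y, PresheafHom S A f (D y))
    (compat : ∀ y y' N U (hU : U ≤ D y) (hU' : U ≤ D y') h a,
      (ψ y).sharp N U hU h a = (ψ y').sharp N U hU' h a) :
    ∃ Ψ : PresheafHom S A f ⊤, ∀ y N U hU h a,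
      Ψ.sharp N U le_top h a = (ψ y).sharp N U hU h a := by
  have uniq : ∀ {U : Opens S.body} {a b : S.O U}, (∀ y,
      S.res (inf_le_left : U ⊓ D y ≤ U) a = S.res (inf_le_left : U ⊓ D y ≤ U) b) → a = b :=
    fun {U a b} h => hS.eq_of_locally fun x hx => ⟨U ⊓ D x, inf_le_left, ⟨hx, hD x⟩, h x⟩
  have hom : ∀ N U (h : ∀ x ∈ U, f x ∈ N) k, ∀ a ∈ A.deg N k, ∃ b ∈ S.deg U k, ∀ y,
      S.res (inf_le_left : U ⊓ D y ≤ U) b =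
        (ψ y).sharp N (U ⊓ D y) inf_le_right (fun x hx => h x hx.1) a := by
    intro N U h k a ha
    have hU : U = ⨆ y, U ⊓ D y := le_antisymm (fun x hx => Opens.mem_iSup.2 ⟨x, show x ∈ U ⊓ D x from ⟨hx, hD x⟩⟩)
      (iSup_le fun _ => inf_le_left)
    obtain ⟨b, ⟨hb, hb'⟩, -⟩ := hS.glue k S.body (fun y => U ⊓ D y) U hU
      (fun y => (ψ y).sharp N (U ⊓ D y) inf_le_right (fun x hx => h x hx.1) a)
      (fun y => (ψ y).sharp_mem _ _ _ _ k a ha) (fun y y' => by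
        have hh : ∀ x ∈ (U ⊓ D y) ⊓ (U ⊓ D y'), f x ∈ N := fun x hx => h x hx.1.1
        rw [(ψ y).sharp_res le_rfl _ _ _ hh, (ψ y').sharp_res le_rfl _ _ _ hh]
        exact compat _ _ _ _ _ _ _ _)
    exact ⟨b, hb, hb'⟩
  have ex : ∀ N U (h : ∀ x ∈ U, f x ∈ N) (a : A.O N), ∃ b : S.O U, ∀ y,
      S.res (inf_le_left : U ⊓ D y ≤ U) b =
        (ψ y).sharp N (U ⊓ D y) inf_le_right (fun x hx => h x hx.1) a := by
    intro N U h a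
    have ha : a ∈ ⨆ k, A.deg N k := by rw [hA]; trivial
    refine Submodule.iSup_induction (fun k => A.deg N k) (motive := fun a => ∃ b : S.O U, ∀ y,
      S.res (inf_le_left : U ⊓ D y ≤ U) b =
        (ψ y).sharp N (U ⊓ D y) inf_le_right (fun x hx => h x hx.1) a) ha ?_ ?_ ?_
    · intro k a ha
      obtain ⟨b, -, hb⟩ := hom N U h k a ha
      exact ⟨b, hb⟩
    · exact ⟨0, fun y => by rw [map_zero, map_zero]⟩
    · rintro a a' ⟨b, hb⟩ ⟨b', hb'⟩
      exact ⟨b + b', fun y => by rw [map_add, map_add, hb, hb']⟩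
  choose Ψ hΨ using ex
  refine ⟨{ cont := hf.continuousOn
            sharp := fun N U _ h =>
              { toFun := Ψ N U h
                map_one' := uniq fun y => by rw [hΨ, map_one, map_one]
                map_mul' := fun a b => uniq fun y => by
                  rw [hΨ, map_mul, map_mul, hΨ, hΨ]
                map_zero' := uniq fun y => by rw [hΨ, map_zero, map_zero]
                map_add' := fun a b => uniq fun y => by rw [hΨ, map_add, map_add, hΨ, hΨ]
                commutes' := fun r => uniq fun y => by rw [hΨ, AlgHom.commutes, AlgHom.commutes] }
            sharp_res := ?_
            sharp_mem := ?_ }, ?_⟩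
  · intro N N' U U' hN hU _ h h' a
    refine uniq fun y => ?_
    change S.res _ (S.res hU (Ψ N U h a)) = S.res _ (Ψ N' U' h' (A.res hN a))
    rw [hΨ, S.res_res, ← S.res_res (inf_le_left : U ⊓ D y ≤ U) (inf_le_inf_right _ hU), hΨ,
      (ψ y).sharp_res hN]
  · intro N U _ h k a ha
    obtain ⟨b, hb, hb'⟩ := hom N U h k a ha
    have : Ψ N U h a = b := uniq fun y => by rw [hΨ, hb']
    change Ψ N U h a ∈ _
    rwa [this]
  · intro y N U hU h a
    refine uniq fun y' => ?_
    change S.res _ (Ψ N U h a) = _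
    rw [hΨ, (ψ y).sharp_res le_rfl (inf_le_left : U ⊓ D y' ≤ U) hU h fun x hx => h x hx.1,
      A.res_self]
    exact compat _ _ _ _ _ _ _ _

end PresheafHoms

section Functions

variable {E : Type u} [NormedAddCommGroup E] [NormedSpace ℝ E]
  {H : Type u} [TopologicalSpace H] (I : ModelWithCorners ℝ E H)
  {M : Type u} [TopologicalSpace M] [ChartedSpace H M]

/-- The algebra of smooth functions on an open subset. -/
def smoothFunctions (N : Opens M) : Subalgebra ℝ (N → ℝ) where
  carrier := {c | ∃ F : M → ℝ, ContMDiffOn I 𝓘(ℝ, ℝ) ∞ F N ∧ ∀ y : N, c y = F y}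
  mul_mem' := by
    rintro a b ⟨F, hF, h⟩ ⟨G, hG, h'⟩
    exact ⟨fun x => F x * G x, hF.mul hG, fun x => by simp [h, h']⟩
  add_mem' := by
    rintro a b ⟨F, hF, h⟩ ⟨G, hG, h'⟩
    exact ⟨fun x => F x + G x, hF.add hG, fun x => by simp [h, h']⟩
  algebraMap_mem' r := ⟨fun _ => r, contMDiffOn_const, fun _ => rfl⟩

variable {I} in
/-- A smooth function on `N`. -/
def mkFn (N : Opens M) (F : M → ℝ) (hF : ContMDiffOn I 𝓘(ℝ, ℝ) ∞ F N) : smoothFunctions I N :=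
  ⟨fun y => F y, F, hF, fun _ => rfl⟩

variable {I} in
lemma smoothFunctions_ext {N : Opens M} {a b : smoothFunctions I N} (h : ∀ y, a.1 y = b.1 y) :
    a = b := Subtype.ext (funext h)

variable {I} in
lemma exists_mkFn {N : Opens M} (a : smoothFunctions I N) : ∃ F hF, a = mkFn N F hF := by
  obtain ⟨F, hF, h⟩ := a.2
  exact ⟨F, hF, smoothFunctions_ext h⟩

/-- The restriction of smooth functions. -/
def resFn {N N' : Opens M} (h : N' ≤ N) : smoothFunctions I N →ₐ[ℝ] smoothFunctions I N' where
  toFun a := ⟨fun y => a.1 ⟨y, h y.2⟩, by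
    obtain ⟨F, hF, h'⟩ := a.2
    exact ⟨F, hF.mono h, fun y => h' ⟨y, h y.2⟩⟩⟩
  map_one' := rfl
  map_mul' _ _ := rfl
  map_zero' := rfl
  map_add' _ _ := rfl
  commutes' _ := rfl

variable (M) in
/-- The sheaf of smooth functions. -/
abbrev functions : GradedPresheaf M where
  O N := smoothFunctions I N
  deg N k := if k = 0 then ⊤ else ⊥
  res h := resFn I h
  res_self _ _ := rfl

variable (M) in
/-- The sheaf of differential forms with values in `Λ V^*`. -/
abbrev forms (V : Type u) [AddCommGroup V] [Module ℝ V] : GradedPresheaf M where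
  O N := smoothSections I M V N
  deg N k := sectionsDeg I M V N k
  res h := restrictSections I M V h
  res_self _ _ := rfl

/-- Homomorphisms from smooth functions on `M` to functions on a dg-manifold. -/
abbrev FunHom (S : DGSpace.{u}) (f : S.body → M) (U₀ : Opens S.body) :=
  PresheafHom S (functions I M) f U₀

/-- Homomorphisms from differential forms on `M` to functions on a dg-manifold. -/
abbrev FormHom (V : Type u) [AddCommGroup V] [Module ℝ V] (S : DGSpace.{u}) (f : S.body → M)
    (U₀ : Opens S.body) :=
  PresheafHom S (forms I M V) f U₀

variable {I} {S : DGSpace.{u}} {f : S.body → M} {U₀ : Opens S.body}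

lemma FunHom.mem (φ : FunHom I S f U₀) {N : Opens M} {U : Opens S.body} (h₀ : U ≤ U₀)
    (h : ∀ x ∈ U, f x ∈ N) (a : smoothFunctions I N) : φ.sharp N U h₀ h a ∈ S.deg U 0 :=
  φ.sharp_mem N U h₀ h 0 a (by simp)

/-- The zeroth coefficient of the pullback of a function is its composition with the map of
bodies. -/
lemma FunHom.coeff_zero (φ : FunHom I S f U₀) (L : LocalChart S) {N : Opens M} {U : Opens S.body}
    (hU : (U : Set S.body) ⊆ L.e.source) (h₀ : U ≤ U₀) (h : ∀ x ∈ U, f x ∈ N)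
    (a : smoothFunctions I N) (y : U) :
    L.coeff hU (φ.sharp N U h₀ h a) 0 y = a.1 ⟨f y, h y y.2⟩ := by
  obtain ⟨F, hF, rfl⟩ := exists_mkFn a
  set c := L.coeff hU (φ.sharp N U h₀ h (mkFn N F hF)) 0 y with hc
  change c = F (f y)
  by_contra hne
  let N' : Opens M := ⟨N ∩ F ⁻¹' {c}ᶜ, hF.continuousOn.isOpen_inter_preimage N.2 isOpen_ne⟩
  have hN' : N' ≤ N := fun _ hx => hx.1
  let U' := shrink φ.cont h₀ N'
  have hU' : U' ≤ U := shrink_le _ _ _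
  have hyU' : (y : S.body) ∈ U' := ⟨y.2, h y y.2, fun h' => hne (by simpa using h'.symm)⟩
  have hG : ContMDiffOn I 𝓘(ℝ, ℝ) ∞ (fun x => F x - c) N' := (hF.mono hN').sub contMDiffOn_const
  have hG0 : ∀ x ∈ N', F x - c ≠ 0 := fun x hx => sub_ne_zero.2 hx.2
  have hG' : ContMDiffOn I 𝓘(ℝ, ℝ) ∞ (fun x => (F x - c)⁻¹) N' := hG.inv₀ hG0
  have h1 : mkFn N' _ hG * mkFn N' _ hG' = 1 :=
    smoothFunctions_ext fun x => mul_inv_cancel₀ (hG0 x x.2)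
  have h2 : mkFn N' _ hG = resFn I hN' (mkFn N F hF) - algebraMap ℝ _ c := rfl
  have h' : ∀ x ∈ U', f x ∈ N' := fun x hx => hx.2
  have hUL : (U' : Set S.body) ⊆ L.e.source := fun x hx => hU (hU' hx)
  have h3 := congrArg (fun b => L.coeff hUL b 0 ⟨y, hyU'⟩)
    (congrArg (φ.sharp N' U' (hU'.trans h₀) h') h1)
  simp only [map_mul, map_one] at h3
  have h4 := φ.sharp_res hN' hU' h₀ h h' (mkFn N F hF)
  rw [LocalChart.coeff_mul_zero, h2, map_sub, ← h4, AlgHom.commutes, map_sub, Pi.sub_apply,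
    Pi.sub_apply, LocalChart.coeff_algebraMap, L.coeff_res (hU := hU), ← hc, LocalChart.coeff_one] at h3
  simp at h3

variable {E' : Type u} [NormedAddCommGroup E'] [NormedSpace ℝ E'] [FiniteDimensional ℝ E']

lemma antidiagonal_degree_lt {m : ℕ} {α : Fin m →₀ ℕ} {p : (Fin m →₀ ℕ) × (Fin m →₀ ℕ)}
    (hp : p ∈ Finset.HasAntidiagonal.antidiagonal α) (h0 : p.1 ≠ 0) :
    Finsupp.degree p.2 < Finsupp.degree α := by
  rw [Finset.HasAntidiagonal.mem_antidiagonal] at hp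
  rw [← hp, map_add]
  have : Finsupp.degree p.1 ≠ 0 := fun h => h0 ((Finsupp.degree_eq_zero_iff _).1 h)
  omega

/-- A derivation along a pair of homomorphisms is zero if it is zero on coordinates. -/
theorem eq_zero_of_twistedDerivation (hS : IsDGManifold S) (φ ψ : FunHom I S f U₀)
    (δ : ∀ (N : Opens M) (U : Opens S.body), U ≤ U₀ → (∀ x ∈ U, f x ∈ N) →
      (smoothFunctions I N →ₗ[ℝ] S.O U))
    (δ_res : ∀ {N N' : Opens M} {U U' : Opens S.body} (hN : N' ≤ N) (hU : U' ≤ U) (h₀ : U ≤ U₀)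
      (h : ∀ x ∈ U, f x ∈ N) (h' : ∀ x ∈ U', f x ∈ N') (a : smoothFunctions I N),
      S.res hU (δ N U h₀ h a) = δ N' U' (hU.trans h₀) h' (resFn I hN a))
    (δ_mul : ∀ N U h₀ h (a b : smoothFunctions I N),
      δ N U h₀ h (a * b) = φ.sharp N U h₀ h a * δ N U h₀ h b + δ N U h₀ h a * ψ.sharp N U h₀ h b)
    (coord : ∀ y ∈ U₀, ∃ c : M → E', HadamardAt I c (f y) ∧ ∃ N₀ : Opens M, f y ∈ N₀ ∧
      ∀ i N U h₀ h, N ≤ N₀ → ∀ hc : ContMDiffOn I 𝓘(ℝ, ℝ) ∞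
        (fun x => (Module.finBasis ℝ E').coord i (c x)) N, y ∈ U → δ N U h₀ h (mkFn N _ hc) = 0)
    (N : Opens M) (U : Opens S.body) (h₀ : U ≤ U₀) (h : ∀ x ∈ U, f x ∈ N)
    (a : smoothFunctions I N) : δ N U h₀ h a = 0 := by
  have δ_one : ∀ N U h₀ h, δ N U h₀ h 1 = 0 := by
    intro N U h₀ h
    have := δ_mul N U h₀ h 1 1
    rwa [map_one (φ.sharp N U h₀ h), map_one (ψ.sharp N U h₀ h), mul_one, mul_one, one_mul, left_eq_add] at this
  have δ_const : ∀ N U h₀ h (r : ℝ), δ N U h₀ h (algebraMap ℝ _ r) = 0 := by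
    intro N U h₀ h r
    rw [Algebra.algebraMap_eq_smul_one, map_smul, δ_one, smul_zero]
  have key : ∀ (L : LocalChart S) (d : ℕ) (α : Fin L.m →₀ ℕ), Finsupp.degree α = d →
      ∀ (N : Opens M) (U : Opens S.body) h₀ h (hU : (U : Set S.body) ⊆ L.e.source) (a : smoothFunctions I N) (y : U),
      L.coeff hU (δ N U h₀ h a) α y = 0 := by
    intro L d
    induction d using Nat.strong_induction_on with
    | _ d ih =>
    intro α hd N U h₀ h hU a y
    by_cases hα : Admissible L.w α
    swap
    · exact L.coeff_of_not_admissible _ hα y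
    obtain ⟨F, hF, rfl⟩ := exists_mkFn a
    obtain ⟨c, hc, N₀, hyN₀, hc0⟩ := coord y (h₀ y.2)
    obtain ⟨N', G, hN', hyN', hcN', hG, hFG⟩ := hc (N ⊓ N₀) F ⟨h y y.2, hyN₀⟩
      (hF.mono fun x hx => hx.1)
    have hNN : N' ≤ N := hN'.trans inf_le_left
    let U' := shrink φ.cont h₀ N'
    have hU' : U' ≤ U := shrink_le _ _ _
    have hyU' : (y : S.body) ∈ U' := ⟨y.2, hyN'⟩
    have h' : ∀ x ∈ U', f x ∈ N' := fun x hx => hx.2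
    have hci : ∀ i, ContMDiffOn I 𝓘(ℝ, ℝ) ∞ (fun x => (Module.finBasis ℝ E').coord i (c x)) N' :=
      fun i => (LinearMap.toContinuousLinearMap
        ((Module.finBasis ℝ E').coord i)).contDiff.contMDiff.comp_contMDiffOn hcN'
    let x' : Fin (Module.finrank ℝ E') → smoothFunctions I N' := fun i =>
      mkFn N' _ (hci i) - algebraMap ℝ _ ((Module.finBasis ℝ E').coord i (c (f y)))
    have h1 : resFn I hNN (mkFn N F hF) = algebraMap ℝ _ (F (f y)) + ∑ i, x' i * mkFn N' (G i) (hG i) := by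
      refine smoothFunctions_ext fun q => ?_
      refine (hFG q q.2).trans ?_
      have : ∀ (ι : Finset (Fin (Module.finrank ℝ E'))), (∑ i ∈ ι, x' i * mkFn N' (G i) (hG i)).1 q =
          ∑ i ∈ ι, (Module.finBasis ℝ E').coord i (c q - c (f y)) * G i q := by
        intro ι
        induction ι using Finset.induction_on with
        | empty => rfl
        | insert i ι hi ih =>
          rw [Finset.sum_insert hi, Finset.sum_insert hi, ← ih, map_sub]
          rfl
      rw [← this]
      rfl
    have h2 : ∀ i, δ N' U' (hU'.trans h₀) h' (x' i) = 0 := fun i => by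
      rw [map_sub, hc0 i N' U' (hU'.trans h₀) h' (hN'.trans inf_le_right) (hci i) hyU', δ_const, sub_zero]
    have h3 := δ_res hNN hU' h₀ h h' (mkFn N F hF)
    rw [h1, map_add, δ_const, zero_add, map_sum] at h3
    simp only [δ_mul, h2, zero_mul, add_zero] at h3
    have hUL : (U' : Set S.body) ⊆ L.e.source := fun x hx => hU (hU' hx)
    have h4 := L.coeff_res (hU := hU) (hW := hUL) hU' (δ N U h₀ h (mkFn N F hF)) α ⟨y, hyU'⟩
    rw [← h4, h3, map_sum, Finset.sum_apply, Finset.sum_apply]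
    refine Finset.sum_eq_zero fun i _ => ?_
    refine (L.coeff_mul _ _ hα _).trans ?_
    refine Finset.sum_eq_zero fun p hp => ?_
    by_cases hp0 : p.1 = 0
    · rw [hp0, FunHom.coeff_zero φ L]
      have : (x' i).1 ⟨f y, hyN'⟩ = 0 := sub_self _
      rw [this, mul_zero, zero_mul]
    · rw [ih _ (hd ▸ antidiagonal_degree_lt hp hp0) p.2 rfl, mul_zero]
  refine hS.eq_of_locally fun x hx => ?_
  obtain ⟨L, hL⟩ := hS.exists_localChart x
  let W : Opens S.body := U ⊓ ⟨L.e.source, L.e.open_source⟩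
  refine ⟨W, inf_le_left, ⟨hx, hL⟩, ?_⟩
  have hW : (W : Set S.body) ⊆ L.e.source := fun _ h => h.2
  rw [δ_res le_rfl inf_le_left h₀ h fun x hx => h x hx.1]
  refine L.ext_coeff (hU := hW) fun α y => ?_
  rw [key L _ α rfl, map_zero, map_zero]
  rfl

/-- Homomorphisms are determined by their values on coordinates. -/
theorem FunHom.eq_of_coord (hS : IsDGManifold S) (φ ψ : FunHom I S f U₀)
    (coord : ∀ y ∈ U₀, ∃ c : M → E', HadamardAt I c (f y) ∧ ∃ N₀ : Opens M, f y ∈ N₀ ∧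
      ∀ i N U h₀ h, N ≤ N₀ → ∀ hc : ContMDiffOn I 𝓘(ℝ, ℝ) ∞
        (fun x => (Module.finBasis ℝ E').coord i (c x)) N, y ∈ U →
        φ.sharp N U h₀ h (mkFn N _ hc) = ψ.sharp N U h₀ h (mkFn N _ hc))
    (N : Opens M) (U : Opens S.body) (h₀ : U ≤ U₀) (h : ∀ x ∈ U, f x ∈ N)
    (a : smoothFunctions I N) : φ.sharp N U h₀ h a = ψ.sharp N U h₀ h a := by
  rw [← sub_eq_zero]
  refine eq_zero_of_twistedDerivation (E' := E') hS φ ψ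
    (fun N U h₀ h => (φ.sharp N U h₀ h).toLinearMap - (ψ.sharp N U h₀ h).toLinearMap)
    ?_ ?_ ?_ N U h₀ h a
  · intro N N' U U' hN hU h₀ h h' a
    simp only [LinearMap.sub_apply, AlgHom.toLinearMap_apply, map_sub]
    rw [φ.sharp_res hN hU h₀ h h', ψ.sharp_res hN hU h₀ h h']
  · intro N U h₀ h a b
    simp only [LinearMap.sub_apply, AlgHom.toLinearMap_apply, map_mul]
    noncomm_ring
  · intro y hy
    obtain ⟨c, hc, N₀, hyN₀, h⟩ := coord y hy
    exact ⟨c, hc, N₀, hyN₀, fun i N U h₀ h' hN hc hyU => sub_eq_zero.2 (h i N U h₀ h' hN hc hyU)⟩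

end Functions

section Calculus

/-- The terms of a formal Taylor expansion. -/
def taylorTerm {A R : Type*} [AddCommGroup A] [Module ℝ A] [Ring R] [Algebra ℝ R] {n : ℕ}
    (ν : Fin n → R) (D : Fin n → A →ₗ[ℝ] A) (κ : A →ₗ[ℝ] R) : ℕ → A →ₗ[ℝ] R
  | 0 => κ
  | j + 1 => ((j : ℝ) + 1)⁻¹ • ∑ i, LinearMap.mulLeft ℝ (ν i) ∘ₗ taylorTerm ν D κ j ∘ₗ D i

lemma taylorTerm_succ {A R : Type*} [AddCommGroup A] [Module ℝ A] [Ring R] [Algebra ℝ R] {n : ℕ}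
    (ν : Fin n → R) (D : Fin n → A →ₗ[ℝ] A) (κ : A →ₗ[ℝ] R) (j : ℕ) (a : A) :
    taylorTerm ν D κ (j + 1) a = ((j : ℝ) + 1)⁻¹ • ∑ i, ν i * taylorTerm ν D κ j (D i a) := by
  simp [taylorTerm, LinearMap.sum_apply]

/-- The formal Taylor expansion is multiplicative. -/
theorem taylorTerm_mul_of_commRing {A R : Type*} [CommRing A] [Algebra ℝ A] [CommRing R] [Algebra ℝ R] {n : ℕ}
    (ν : Fin n → R) (D : Fin n → A →ₗ[ℝ] A) (hD : ∀ i a b, D i (a * b) = D i a * b + a * D i b)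
    (κ : A →ₐ[ℝ] R) (j : ℕ) (a b : A) :
    taylorTerm ν D κ.toLinearMap j (a * b) = ∑ p ∈ Finset.HasAntidiagonal.antidiagonal j,
      taylorTerm ν D κ.toLinearMap p.1 a * taylorTerm ν D κ.toLinearMap p.2 b := by
  set T := taylorTerm ν D κ.toLinearMap with hT
  let P : A → PowerSeries R := fun a => PowerSeries.mk fun j => T j a
  have hP : ∀ a, PowerSeries.derivative R (P a) = ∑ i, PowerSeries.C (ν i) * P (D i a) := by
    intro a
    ext j
    rw [PowerSeries.coeff_derivative, map_sum]
    simp only [PowerSeries.coeff_C_mul, P, PowerSeries.coeff_mk]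
    rw [hT, taylorTerm_succ, ← hT, Algebra.smul_mul_assoc, mul_comm _ ((j : R) + 1),
      show ((j : R) + 1) = algebraMap ℝ R ((j : ℝ) + 1) by simp, ← Algebra.smul_def,
      inv_smul_smul₀ (by positivity)]
  have hc : ∀ j a b, PowerSeries.coeff j (P a * P b) =
      ∑ p ∈ Finset.HasAntidiagonal.antidiagonal j, T p.1 a * T p.2 b := by
    intro j a b
    simp [PowerSeries.coeff_mul, P]
  rw [← hc]
  induction j generalizing a b with
  | zero =>
    rw [hc]
    simp [hT, taylorTerm]
  | succ j ih =>
    have h1 := PowerSeries.coeff_derivative (P a * P b) j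
    have h2 : PowerSeries.coeff j (PowerSeries.derivative R (P a * P b)) =
        ∑ i, ν i * T j (D i (a * b)) := by
      rw [Derivation.leibniz, hP, hP, smul_eq_mul, smul_eq_mul, Finset.mul_sum, Finset.mul_sum,
        ← Finset.sum_add_distrib, map_sum]
      refine Finset.sum_congr rfl fun i _ => ?_
      rw [hD, (T j).map_add, ih, ih, mul_add, ← PowerSeries.coeff_C_mul, ← PowerSeries.coeff_C_mul,
        ← map_add]
      congr 1
      ring
    rw [h2] at h1
    rw [hT, taylorTerm_succ, ← hT, h1, mul_comm,
      show ((j : R) + 1) = algebraMap ℝ R ((j : ℝ) + 1) by simp, ← Algebra.smul_def,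
      inv_smul_smul₀ (by positivity)]

theorem taylorTerm_mul {A R : Type*} [CommRing A] [Algebra ℝ A] [Ring R] [Algebra ℝ R]
    (hR : ∀ x y : R, x * y = y * x) {n : ℕ}
    (ν : Fin n → R) (D : Fin n → A →ₗ[ℝ] A) (hD : ∀ i a b, D i (a * b) = D i a * b + a * D i b)
    (κ : A →ₐ[ℝ] R) (j : ℕ) (a b : A) :
    taylorTerm ν D κ.toLinearMap j (a * b) = ∑ p ∈ Finset.HasAntidiagonal.antidiagonal j,
      taylorTerm ν D κ.toLinearMap p.1 a * taylorTerm ν D κ.toLinearMap p.2 b :=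
  letI : CommRing R := { ‹Ring R› with mul_comm := hR }
  taylorTerm_mul_of_commRing ν D hD κ j a b

variable {S : DGSpace.{u}}

/-- The functions of degree zero. -/
def degZero (hS : IsDGManifold S) (U : Opens S.body) : Subalgebra ℝ (S.O U) where
  carrier := S.deg U 0
  mul_mem' ha hb := by simpa using hS.mul_mem U 0 0 _ _ ha hb
  add_mem' ha hb := add_mem ha hb
  algebraMap_mem' r := by
    rw [Algebra.algebraMap_eq_smul_one]
    exact Submodule.smul_mem _ r (hS.one_mem U)

lemma degZero_comm (hS : IsDGManifold S) (U : Opens S.body) (a b : degZero hS U) : a * b = b * a :=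
  Subtype.ext (hS.mul_comm_of_mem_zero a.2 b.1)

namespace LocalChart

variable (L : LocalChart S) {U W : Opens S.body}

/-- The functions whose terms of order less than `D` are zero. -/
def filtration (hU : (U : Set S.body) ⊆ L.e.source) (D : ℕ) : Submodule ℝ (S.O U) where
  carrier := {a | ∀ α, Finsupp.degree α < D → ∀ y, L.coeff hU a α y = 0}
  add_mem' ha hb α h y := by rw [map_add, Pi.add_apply, Pi.add_apply, ha α h, hb α h, add_zero]
  zero_mem' α h y := by rw [map_zero]; rfl
  smul_mem' r a ha α h y := by
    rw [map_smul, Pi.smul_apply, Pi.smul_apply, ha α h, smul_zero]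

variable {L} {hU : (U : Set S.body) ⊆ L.e.source}

lemma mem_filtration_zero (a : S.O U) : a ∈ L.filtration hU 0 := fun α h => absurd h (by omega)

lemma mem_filtration_mono {i j : ℕ} (hij : i ≤ j) {a : S.O U} (ha : a ∈ L.filtration hU j) :
    a ∈ L.filtration hU i := fun α h => ha α (h.trans_le hij)

lemma mul_mem_filtration {i j : ℕ} {a b : S.O U} (ha : a ∈ L.filtration hU i)
    (hb : b ∈ L.filtration hU j) : a * b ∈ L.filtration hU (i + j) := by
  intro α h y
  by_cases hα : Admissible L.w α
  · rw [L.coeff_mul a b hα]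
    refine Finset.sum_eq_zero fun p hp => ?_
    rw [Finset.HasAntidiagonal.mem_antidiagonal] at hp
    rw [← hp, map_add] at h
    by_cases h1 : Finsupp.degree p.1 < i
    · rw [ha _ h1, mul_zero, zero_mul]
    · rw [hb p.2 (by omega), mul_zero]
  · exact L.coeff_of_not_admissible _ hα y

lemma eq_of_filtration {a b : S.O U} (h : ∀ D, a - b ∈ L.filtration hU D) : a = b := by
  refine L.ext_coeff (hU := hU) fun α y => ?_
  have := h (Finsupp.degree α + 1) α (by omega) y
  rwa [map_sub, Pi.sub_apply, Pi.sub_apply, sub_eq_zero] at this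

/-- Power series converge in the filtration. -/
lemma exists_limit (hU : (U : Set S.body) ⊆ L.e.source) (T : ℕ → degZero L.isDG U)
    (hT : ∀ j, (T j).1 ∈ L.filtration hU j) :
    ∃ s ∈ S.deg U 0, ∀ D, s - ∑ j ∈ Finset.range D, (T j).1 ∈ L.filtration hU D := by
  obtain ⟨s, hs, hc⟩ := L.exists_coeff hU 0
    (fun α => ∑ j ∈ Finset.range (Finsupp.degree α + 1), L.coeff hU (T j).1 α)
    (fun α => sum_mem fun j _ => L.coeff_smooth hU _ α) (fun α hα => by
      refine Finset.sum_eq_zero fun j _ => funext fun y => ?_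
      by_cases h : Admissible L.w α
      · exact L.coeff_of_weight_ne (T j).2 (fun h' => hα ⟨h, h'⟩) y
      · exact L.coeff_of_not_admissible _ h y)
  refine ⟨s, hs, fun D α hα y => ?_⟩
  rw [map_sub, hc, map_sum, Pi.sub_apply, Pi.sub_apply, sub_eq_zero, Finset.sum_apply,
    Finset.sum_apply, Finset.sum_apply]
  refine Finset.sum_subset (Finset.range_mono hα) fun j _ hj => hT j α ?_ y
  simpa using hj

variable (L) in
/-- A function on the body as a function on the dg-manifold. -/
def const (hU : (U : Set S.body) ⊆ L.e.source) : L.smooth U →ₐ[ℝ] degZero L.isDG U :=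
  have h : ∀ c, ∀ α y, L.coeff hU (L.exists_const hU c).choose α y = if α = 0 then c.1 y else 0 :=
    fun c => (L.exists_const hU c).choose_spec.2
  AlgHom.ofLinearMap
    { toFun := fun c => ⟨(L.exists_const hU c).choose, (L.exists_const hU c).choose_spec.1⟩
      map_add' := fun a b => Subtype.ext <| L.ext_coeff (hU := hU) fun α y => by
        change L.coeff hU _ α y = L.coeff hU ((L.exists_const hU a).choose +
          (L.exists_const hU b).choose) α y
        rw [map_add, Pi.add_apply, Pi.add_apply, h, h, h]
        split_ifs
        · rfl
        · rw [add_zero]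
      map_smul' := fun r a => Subtype.ext <| L.ext_coeff (hU := hU) fun α y => by
        change L.coeff hU _ α y = L.coeff hU (r • (L.exists_const hU a).choose) α y
        rw [map_smul, Pi.smul_apply, Pi.smul_apply, h, h]
        split_ifs
        · rfl
        · rw [smul_zero] }
    (Subtype.ext <| L.ext_coeff (hU := hU) fun α y => by
      change L.coeff hU (L.exists_const hU 1).choose α y = L.coeff hU 1 α y
      rw [h, coeff_one]
      rfl)
    (fun a b => Subtype.ext <| L.ext_coeff (hU := hU) fun α y => by
      change L.coeff hU (L.exists_const hU (a * b)).choose α y =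
        L.coeff hU ((L.exists_const hU a).choose * (L.exists_const hU b).choose) α y
      rw [coeff_const_mul L (h a), h, h]
      split_ifs
      · rfl
      · rw [mul_zero])

lemma coeff_const (c : L.smooth U) (α) (y : U) :
    L.coeff hU (L.const hU c).1 α y = if α = 0 then c.1 y else 0 :=
  (L.exists_const hU c).choose_spec.2 α y

end LocalChart

section PartialDerivatives

variable {E : Type u} [NormedAddCommGroup E] [NormedSpace ℝ E]

lemma contDiffOn_iff_smooth {N : Opens E} {F : E → ℝ} :
    ContMDiffOn 𝓘(ℝ, E) 𝓘(ℝ, ℝ) ∞ F N ↔ ContDiffOn ℝ ∞ F N := contMDiffOn_iff_contDiffOn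

open Classical in
/-- The extension by zero of a function on an open set. -/
def extendZero {N : Opens E} (a : N → ℝ) (x : E) : ℝ := if h : x ∈ N then a ⟨x, h⟩ else 0

lemma extendZero_apply {N : Opens E} (a : N → ℝ) (y : N) : extendZero a y = a y := dif_pos y.2

lemma extendZero_smooth {N : Opens E} (a : smoothFunctions 𝓘(ℝ, E) N) :
    ContDiffOn ℝ ∞ (extendZero a.1) N := by
  obtain ⟨F, hF, h⟩ := a.2
  exact (contDiffOn_iff_smooth.1 hF).congr fun x hx =>
    (extendZero_apply a.1 ⟨x, hx⟩).trans (h ⟨x, hx⟩)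

lemma extendZero_differentiableAt {N : Opens E} (a : smoothFunctions 𝓘(ℝ, E) N) (y : N) :
    DifferentiableAt ℝ (extendZero a.1) y :=
  ((extendZero_smooth a).contDiffAt (N.2.mem_nhds y.2)).differentiableAt (by simp)

lemma fderiv_extendZero {N : Opens E} (a : N → ℝ) (F : E → ℝ) (h : ∀ y : N, a y = F y) (y : N) :
    fderiv ℝ (extendZero a) y = fderiv ℝ F y := by
  refine Filter.EventuallyEq.fderiv_eq ?_
  filter_upwards [N.2.mem_nhds y.2] with x hx
  exact (extendZero_apply a ⟨x, hx⟩).trans (h ⟨x, hx⟩)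

/-- The derivative of smooth functions in the direction of a vector. -/
def directional (N : Opens E) (v : E) :
    smoothFunctions 𝓘(ℝ, E) N →ₗ[ℝ] smoothFunctions 𝓘(ℝ, E) N where
  toFun a := mkFn N (fun x => fderiv ℝ (extendZero a.1) x v) (contDiffOn_iff_smooth.2
    (((extendZero_smooth a).fderiv_of_isOpen N.2 (by simp)).clm_apply contDiffOn_const))
  map_add' a b := smoothFunctions_ext fun y => by
    change fderiv ℝ (extendZero (a.1 + b.1)) y v = fderiv ℝ (extendZero a.1) y v +
      fderiv ℝ (extendZero b.1) y v
    rw [fderiv_extendZero (a.1 + b.1) (extendZero a.1 + extendZero b.1) (fun y => by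
      simp only [Pi.add_apply, extendZero_apply]), fderiv_add (extendZero_differentiableAt a y)
      (extendZero_differentiableAt b y)]
    rfl
  map_smul' r a := smoothFunctions_ext fun y => by
    change fderiv ℝ (extendZero (r • a.1)) y v = r * fderiv ℝ (extendZero a.1) y v
    rw [fderiv_extendZero (r • a.1) (r • extendZero a.1) (fun y => by
      simp only [Pi.smul_apply, extendZero_apply]), fderiv_const_smul (extendZero_differentiableAt a y)]
    rfl

lemma directional_apply {N : Opens E} (v : E) (a : smoothFunctions 𝓘(ℝ, E) N) (F : E → ℝ)
    (h : ∀ y : N, a.1 y = F y) (y : N) : (directional N v a).1 y = fderiv ℝ F y v := by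
  rw [← fderiv_extendZero a.1 F h]
  rfl

lemma directional_mul {N : Opens E} (v : E) (a b : smoothFunctions 𝓘(ℝ, E) N) :
    directional N v (a * b) = directional N v a * b + a * directional N v b := by
  refine smoothFunctions_ext fun y => ?_
  rw [directional_apply v (a * b) (extendZero a.1 * extendZero b.1) (fun y => by
    simp only [Pi.mul_apply, extendZero_apply]; rfl), fderiv_mul (extendZero_differentiableAt a y)
    (extendZero_differentiableAt b y)]
  change extendZero a.1 y * fderiv ℝ (extendZero b.1) y v + extendZero b.1 y * fderiv ℝ (extendZero a.1) y v =
    fderiv ℝ (extendZero a.1) y v * b.1 y + a.1 y * fderiv ℝ (extendZero b.1) y v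
  rw [extendZero_apply, extendZero_apply]
  ring

lemma directional_res {N N' : Opens E} (h : N' ≤ N) (v : E) (a : smoothFunctions 𝓘(ℝ, E) N) :
    resFn 𝓘(ℝ, E) h (directional N v a) = directional N' v (resFn 𝓘(ℝ, E) h a) := by
  refine smoothFunctions_ext fun y => ?_
  rw [directional_apply v (resFn 𝓘(ℝ, E) h a) (extendZero a.1) fun y =>
    (extendZero_apply a.1 ⟨y, h y.2⟩).symm]
  rfl

end PartialDerivatives

end Calculus

section FormalComposition

variable {S : DGSpace.{u}} {E : Type u} [NormedAddCommGroup E] [NormedSpace ℝ E]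
  [FiniteDimensional ℝ E]

/-- Functions of degree zero over a coordinate patch, as values for the linear coordinates on a
vector space. -/
structure CoordinateValues (L : LocalChart S) (U₀ : Opens S.body) (f : S.body → E) where
  subset : (U₀ : Set S.body) ⊆ L.e.source
  cont : ContinuousOn f U₀
  val : Module.Dual ℝ E →ₗ[ℝ] S.O U₀
  mem : ∀ ℓ, val ℓ ∈ S.deg U₀ 0
  coeff_zero : ∀ ℓ y, L.coeff subset (val ℓ) 0 y = ℓ (f y)

namespace CoordinateValues

variable {L : LocalChart S} {U₀ U U' : Opens S.body} {f : S.body → E} {N N' : Opens E}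
  (c : CoordinateValues L U₀ f) (h₀ : U ≤ U₀) (h : ∀ x ∈ U, f x ∈ N)

lemma subset_source (c : CoordinateValues L U₀ f) (h₀ : U ≤ U₀) : (U : Set S.body) ⊆ L.e.source := fun _ hx => c.subset (h₀ hx)

lemma smooth_coord (c : CoordinateValues L U₀ f) (h₀ : U ≤ U₀) (ℓ : Module.Dual ℝ E) : (fun y : U => ℓ (f y)) ∈ L.smooth U := by
  have := L.coeff_smooth (c.subset_source h₀) (S.res h₀ (c.val ℓ)) 0
  convert this using 1
  funext y
  rw [L.coeff_res (hU := c.subset) h₀, c.coeff_zero]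

/-- Composition of functions with the map of bodies. -/
def pull : smoothFunctions 𝓘(ℝ, E) N →ₐ[ℝ] L.smooth U where
  toFun a := ⟨fun y => a.1 ⟨f y, h y y.2⟩, by
    obtain ⟨F, hF, ha⟩ := a.2
    choose G hG hGf using fun i => c.smooth_coord h₀ ((Module.finBasis ℝ E).coord i)
    have key : ∀ x : U, ∑ i, G i (L.e x) • Module.finBasis ℝ E i = f x := fun x => by
      simp only [← hGf, Module.Basis.coord_apply, Module.Basis.sum_repr]
    refine ⟨fun z => F (∑ i, G i z • Module.finBasis ℝ E i),
      (contDiffOn_iff_smooth.1 hF).comp (ContDiffOn.sum fun i _ => (hG i).smul contDiffOn_const) ?_,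
      fun x => ?_⟩
    · rintro _ ⟨x, hx, rfl⟩
      exact Set.mem_of_eq_of_mem (key ⟨x, hx⟩) (h x hx)
    · exact (ha _).trans (congrArg F (key x).symm)⟩
  map_one' := rfl
  map_mul' _ _ := rfl
  map_zero' := rfl
  map_add' _ _ := rfl
  commutes' _ := rfl

/-- The nilpotent part of the value of a coordinate. -/
def nilpotent (h₀ : U ≤ U₀) (i : Fin (Module.finrank ℝ E)) : degZero L.isDG U :=
  ⟨S.res h₀ (c.val ((Module.finBasis ℝ E).coord i)), L.isDG.res_mem h₀ 0 _ (c.mem _)⟩ -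
    L.const (c.subset_source h₀) ⟨_, c.smooth_coord h₀ ((Module.finBasis ℝ E).coord i)⟩

/-- The term of order `j` of the composition of a function with the coordinate values. -/
def term (j : ℕ) : smoothFunctions 𝓘(ℝ, E) N →ₗ[ℝ] degZero L.isDG U :=
  taylorTerm (c.nilpotent h₀) (fun i => directional N (Module.finBasis ℝ E i))
    ((L.const (c.subset_source h₀)).comp (c.pull h₀ h)).toLinearMap j

lemma res_const (h₀ : U ≤ U₀) (hU : U' ≤ U) (a : L.smooth U) (b : L.smooth U')
    (hab : ∀ y : U', b.1 y = a.1 ⟨y, hU y.2⟩) :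
    S.res hU (L.const (c.subset_source h₀) a).1 =
      (L.const (c.subset_source (hU.trans h₀)) b).1 := by
  refine L.ext_coeff (hU := c.subset_source (hU.trans h₀)) fun α y => ?_
  rw [L.coeff_res (hU := c.subset_source h₀) hU, LocalChart.coeff_const, LocalChart.coeff_const, hab]

lemma res_nilpotent (h₀ : U ≤ U₀) (hU : U' ≤ U) (i) :
    S.res hU (c.nilpotent h₀ i).1 = (c.nilpotent (hU.trans h₀) i).1 := by
  change S.res hU (S.res h₀ _ - (L.const _ _).1) = S.res _ _ - (L.const _ _).1
  rw [map_sub, S.res_res, c.res_const h₀ hU]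
  exact fun _ => rfl

lemma nilpotent_mem (i) : (c.nilpotent h₀ i).1 ∈ L.filtration (c.subset_source h₀) 1 := by
  intro α hα y
  have hα' : α = 0 := (Finsupp.degree_eq_zero_iff _).1 (by omega)
  change L.coeff _ (S.res h₀ _ - (L.const _ _).1) α y = 0
  rw [map_sub, Pi.sub_apply, Pi.sub_apply, LocalChart.coeff_const, hα', if_pos rfl,
    L.coeff_res (hU := c.subset) h₀, c.coeff_zero, sub_self]

lemma term_succ (j : ℕ) (a : smoothFunctions 𝓘(ℝ, E) N) :
    (c.term h₀ h (j + 1) a).1 = ((j : ℝ) + 1)⁻¹ • ∑ i, (c.nilpotent h₀ i).1 *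
      (c.term h₀ h j (directional N (Module.finBasis ℝ E i) a)).1 := by
  rw [term, taylorTerm_succ, SetLike.val_smul, AddSubmonoidClass.coe_finsetSum]
  rfl

lemma term_mem (j : ℕ) (a : smoothFunctions 𝓘(ℝ, E) N) :
    (c.term h₀ h j a).1 ∈ L.filtration (c.subset_source h₀) j := by
  induction j generalizing a with
  | zero => exact LocalChart.mem_filtration_zero _
  | succ j ih =>
    rw [term_succ]
    refine Submodule.smul_mem _ _ (Submodule.sum_mem _ fun i _ => ?_)
    rw [add_comm j 1]
    exact LocalChart.mul_mem_filtration (c.nilpotent_mem h₀ i) (ih _)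

lemma res_term (hN : N' ≤ N) (hU : U' ≤ U) (h' : ∀ x ∈ U', f x ∈ N') (j : ℕ)
    (a : smoothFunctions 𝓘(ℝ, E) N) :
    S.res hU (c.term h₀ h j a).1 = (c.term (hU.trans h₀) h' j (resFn 𝓘(ℝ, E) hN a)).1 := by
  induction j generalizing a with
  | zero => exact c.res_const h₀ hU _ _ fun _ => rfl
  | succ j ih =>
    rw [term_succ, term_succ, map_smul, map_sum]
    refine congrArg _ (Finset.sum_congr rfl fun i _ => ?_)
    rw [map_mul, res_nilpotent, ih, directional_res]

lemma term_mul (j : ℕ) (a b : smoothFunctions 𝓘(ℝ, E) N) :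
    (c.term h₀ h j (a * b)).1 = ∑ p ∈ Finset.HasAntidiagonal.antidiagonal j,
      (c.term h₀ h p.1 a).1 * (c.term h₀ h p.2 b).1 := by
  have := taylorTerm_mul (R := degZero L.isDG U) (degZero_comm L.isDG U) (c.nilpotent h₀)
    (fun i => directional N (Module.finBasis ℝ E i)) (fun i a b => directional_mul _ a b)
    ((L.const (c.subset_source h₀)).comp (c.pull h₀ h)) j a b
  rw [term, this, AddSubmonoidClass.coe_finsetSum]
  rfl

lemma directional_one (v : E) : directional N v 1 = 0 := by
  have := directional_mul v (1 : smoothFunctions 𝓘(ℝ, E) N) 1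
  rwa [mul_one, mul_one, one_mul, left_eq_add] at this

lemma term_one (j : ℕ) : (c.term h₀ h j (1 : smoothFunctions 𝓘(ℝ, E) N)).1 = if j = 0 then 1 else 0 := by
  cases j with
  | zero => exact congrArg Subtype.val (map_one ((L.const (c.subset_source h₀)).comp (c.pull h₀ h)))
  | succ j =>
    rw [term_succ]
    simp [directional_one]

/-- The partial sums of the composition. -/
def partialSum (D : ℕ) (a : smoothFunctions 𝓘(ℝ, E) N) : S.O U :=
  ∑ j ∈ Finset.range D, (c.term h₀ h j a).1

/-- The composition of a smooth function with the coordinate values. -/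
def comp (a : smoothFunctions 𝓘(ℝ, E) N) : S.O U :=
  (LocalChart.exists_limit (c.subset_source h₀) (fun j => c.term h₀ h j a) fun j =>
    c.term_mem h₀ h j a).choose

lemma comp_mem (a : smoothFunctions 𝓘(ℝ, E) N) : c.comp h₀ h a ∈ S.deg U 0 :=
  (LocalChart.exists_limit (c.subset_source h₀) (fun j => c.term h₀ h j a) fun j =>
    c.term_mem h₀ h j a).choose_spec.1

lemma comp_sub (a : smoothFunctions 𝓘(ℝ, E) N) (D : ℕ) :
    c.comp h₀ h a - c.partialSum h₀ h D a ∈ L.filtration (c.subset_source h₀) D :=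
  (LocalChart.exists_limit (c.subset_source h₀) (fun j => c.term h₀ h j a) fun j =>
    c.term_mem h₀ h j a).choose_spec.2 D

lemma eq_comp {s : S.O U} (a : smoothFunctions 𝓘(ℝ, E) N)
    (hs : ∀ D, 2 ≤ D → s - c.partialSum h₀ h D a ∈ L.filtration (c.subset_source h₀) D) :
    c.comp h₀ h a = s := by
  refine LocalChart.eq_of_filtration (hU := c.subset_source h₀) fun D => ?_
  refine LocalChart.mem_filtration_mono (Nat.le_add_right D 2) ?_
  have := sub_mem (c.comp_sub h₀ h a (D + 2)) (hs (D + 2) (by omega))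
  rwa [sub_sub_sub_cancel_right] at this

lemma partialSum_mul (D : ℕ) (a b : smoothFunctions 𝓘(ℝ, E) N) :
    c.partialSum h₀ h D a * c.partialSum h₀ h D b - c.partialSum h₀ h D (a * b) ∈
      L.filtration (c.subset_source h₀) D := by
  classical
  have h1 : c.partialSum h₀ h D (a * b) =
      ∑ p ∈ (Finset.range D ×ˢ Finset.range D).filter (fun p => p.1 + p.2 < D),
        (c.term h₀ h p.1 a).1 * (c.term h₀ h p.2 b).1 := by
    simp only [partialSum, term_mul]
    rw [Finset.sum_sigma']
    refine Finset.sum_bij' (fun p _ => p.2) (fun p _ => ⟨p.1 + p.2, p⟩) ?_ ?_ ?_ ?_ ?_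
    · rintro ⟨j, p⟩ hp
      simp only [Finset.mem_sigma, Finset.mem_range, Finset.HasAntidiagonal.mem_antidiagonal] at hp
      simp only [Finset.mem_filter, Finset.mem_product, Finset.mem_range]
      omega
    · rintro p hp
      simp only [Finset.mem_filter, Finset.mem_product, Finset.mem_range] at hp
      simp only [Finset.mem_sigma, Finset.mem_range, Finset.HasAntidiagonal.mem_antidiagonal]
      exact ⟨hp.2, trivial⟩
    · rintro ⟨j, p⟩ hp
      simp only [Finset.mem_sigma, Finset.mem_range, Finset.HasAntidiagonal.mem_antidiagonal] at hp
      obtain ⟨-, rfl⟩ := hp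
      rfl
    · intro p hp
      rfl
    · intro p hp
      rfl
  have h2 : c.partialSum h₀ h D a * c.partialSum h₀ h D b =
      ∑ p ∈ Finset.range D ×ˢ Finset.range D, (c.term h₀ h p.1 a).1 * (c.term h₀ h p.2 b).1 := by
    rw [partialSum, partialSum, Finset.sum_mul_sum, Finset.sum_product]
  rw [h1, h2, ← Finset.sum_filter_add_sum_filter_not _ (fun p : ℕ × ℕ => p.1 + p.2 < D),
    add_sub_cancel_left]
  refine Submodule.sum_mem _ fun p hp => ?_
  exact LocalChart.mem_filtration_mono (by simpa using (Finset.mem_filter.1 hp).2)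
    (LocalChart.mul_mem_filtration (c.term_mem h₀ h p.1 a) (c.term_mem h₀ h p.2 b))

lemma comp_mul (a b : smoothFunctions 𝓘(ℝ, E) N) :
    c.comp h₀ h (a * b) = c.comp h₀ h a * c.comp h₀ h b := by
  refine c.eq_comp h₀ h _ fun D _ => ?_
  have h1 := LocalChart.mul_mem_filtration (c.comp_sub h₀ h a D)
    (LocalChart.mem_filtration_zero (hU := c.subset_source h₀) (c.comp h₀ h b))
  have h2 := LocalChart.mul_mem_filtration
    (LocalChart.mem_filtration_zero (hU := c.subset_source h₀) (c.partialSum h₀ h D a))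
    (c.comp_sub h₀ h b D)
  rw [add_zero] at h1
  rw [zero_add] at h2
  convert add_mem (add_mem h1 h2) (c.partialSum_mul h₀ h D a b) using 1
  noncomm_ring

/-- Composition with coordinate values, as a homomorphism. -/
def funHom : FunHom 𝓘(ℝ, E) S f U₀ where
  cont := c.cont
  sharp N U h₀ h := AlgHom.ofLinearMap
    { toFun := c.comp h₀ h
      map_add' := fun a b => c.eq_comp h₀ h _ fun D _ => by
        convert add_mem (c.comp_sub h₀ h a D) (c.comp_sub h₀ h b D) using 1
        simp only [partialSum, map_add, AddMemClass.coe_add, Finset.sum_add_distrib]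
        abel
      map_smul' := fun r a => c.eq_comp h₀ h _ fun D _ => by
        convert Submodule.smul_mem _ r (c.comp_sub h₀ h a D) using 1
        simp only [partialSum, map_smul, SetLike.val_smul, ← Finset.smul_sum, RingHom.id_apply,
          smul_sub] }
    (c.eq_comp h₀ h _ fun D hD => by
      have : c.partialSum h₀ h D 1 = 1 := by
        simp only [partialSum, term_one]
        rw [Finset.sum_ite_eq' , if_pos (by simpa using by omega)]
      rw [this, sub_self]
      exact zero_mem _)
    (c.comp_mul h₀ h)
  sharp_res {N N' U U'} hN hU h₀ h h' a := by
    refine (c.eq_comp (hU.trans h₀) h' _ fun D _ => ?_).symm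
    have h1 : c.partialSum (hU.trans h₀) h' D (resFn 𝓘(ℝ, E) hN a) =
        S.res hU (c.partialSum h₀ h D a) := by
      simp only [partialSum, map_sum]
      exact Finset.sum_congr rfl fun j _ => (c.res_term h₀ h hN hU h' j a).symm
    change S.res hU (c.comp h₀ h a) - _ ∈ _
    rw [h1, ← map_sub]
    intro α hα y
    rw [L.coeff_res (hU := c.subset_source h₀) hU]
    exact c.comp_sub h₀ h a D α hα _
  sharp_mem N U h₀ h k a ha := by
    by_cases hk : k = 0
    · subst hk
      exact c.comp_mem h₀ h a
    · have : a = 0 := by simpa [hk] using ha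
      rw [this, map_zero]
      exact zero_mem _

lemma funHom_linear (ℓ : Module.Dual ℝ E) (hℓ : ContMDiffOn 𝓘(ℝ, E) 𝓘(ℝ, ℝ) ∞ (fun x => ℓ x) N) :
    c.funHom.sharp N U h₀ h (mkFn N (fun x => ℓ x) hℓ) = S.res h₀ (c.val ℓ) := by
  refine c.eq_comp h₀ h _ fun D hD => ?_
  set a := mkFn N (fun x => ℓ x) hℓ with ha
  have hd : ∀ v, directional N v a = algebraMap ℝ _ (ℓ v) := fun v => by
    refine smoothFunctions_ext fun y => ?_
    rw [directional_apply v a (LinearMap.toContinuousLinearMap ℓ) fun y => rfl,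
      ContinuousLinearMap.fderiv]
    rfl
  have hd0 : ∀ v r, directional N v (algebraMap ℝ (smoothFunctions 𝓘(ℝ, E) N) r) = 0 := fun v r => by
    rw [Algebra.algebraMap_eq_smul_one, map_smul, directional_one, smul_zero]
  have hz : ∀ j r, c.term h₀ h (j + 1) (algebraMap ℝ (smoothFunctions 𝓘(ℝ, E) N) r) = 0 := fun j r => by
    refine Subtype.ext ?_
    rw [term_succ]
    simp [hd0]
  have h2 : ∀ j, c.term h₀ h (j + 2) a = 0 := fun j => by
    refine Subtype.ext ?_
    rw [term_succ]
    simp [hd, hz]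
  have h1 : (c.term h₀ h 1 a).1 = ∑ i, ℓ (Module.finBasis ℝ E i) • (c.nilpotent h₀ i).1 := by
    rw [show 1 = 0 + 1 from rfl, term_succ]
    simp only [Nat.cast_zero, zero_add, inv_one, one_smul, hd]
    refine Finset.sum_congr rfl fun i _ => ?_
    have : (c.term h₀ h 0 (algebraMap ℝ (smoothFunctions 𝓘(ℝ, E) N) (ℓ (Module.finBasis ℝ E i)))).1 =
        algebraMap ℝ _ (ℓ (Module.finBasis ℝ E i)) :=
      congrArg Subtype.val (AlgHom.commutes ((L.const (c.subset_source h₀)).comp (c.pull h₀ h)) _)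
    rw [this, ← Algebra.commutes, ← Algebra.smul_def]
  have hℓs : ℓ = ∑ i, ℓ (Module.finBasis ℝ E i) • (Module.finBasis ℝ E).coord i := by
    refine (Module.finBasis ℝ E).ext fun i => ?_
    simp [LinearMap.sum_apply, Finsupp.single_apply]
  have h0 : (c.term h₀ h 0 a).1 = ∑ i, ℓ (Module.finBasis ℝ E i) • (L.const (c.subset_source h₀)
      ⟨_, c.smooth_coord h₀ ((Module.finBasis ℝ E).coord i)⟩).1 := by
    have : c.pull h₀ h a = ∑ i, ℓ (Module.finBasis ℝ E i) •
        (⟨_, c.smooth_coord h₀ ((Module.finBasis ℝ E).coord i)⟩ : L.smooth U) := by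
      refine Subtype.ext (funext fun y => ?_)
      have h3 : ℓ (f y) = ∑ i, ℓ (Module.finBasis ℝ E i) * (Module.finBasis ℝ E).coord i (f y) := by
        refine (congrArg (fun ℓ : Module.Dual ℝ E => ℓ (f y)) hℓs).trans ?_
        simp only [LinearMap.sum_apply, LinearMap.smul_apply, smul_eq_mul]
      refine h3.trans ?_
      simp
    change (degZero L.isDG U).val (L.const (c.subset_source h₀) (c.pull h₀ h a)) = _
    rw [this, map_sum, map_sum]
    refine Finset.sum_congr rfl fun i _ => ?_
    rw [map_smul, map_smul]
    rfl
  have h3 : c.partialSum h₀ h D a = S.res h₀ (c.val ℓ) := by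
    obtain ⟨D, rfl⟩ : ∃ k, D = k + 2 := ⟨D - 2, by omega⟩
    have h4 : ∀ j ∈ Finset.range D, (c.term h₀ h (j + 2) a).1 = 0 := fun j _ => by rw [h2]; rfl
    rw [partialSum, Finset.sum_range_succ', Finset.sum_range_succ', Finset.sum_congr rfl h4,
      Finset.sum_const_zero, zero_add, zero_add, h1, h0, ← Finset.sum_add_distrib]
    conv_rhs => rw [hℓs, map_sum, map_sum]
    refine Finset.sum_congr rfl fun i _ => ?_
    rw [← smul_add, map_smul, map_smul]
    congr 1
    change S.res h₀ _ - (L.const _ _).1 + _ = _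
    rw [sub_add_cancel]
  rw [h3, sub_self]
  exact zero_mem _

end CoordinateValues

end FormalComposition

section FormHoms

open ExteriorAlgebra (ι)

variable {E : Type u} [NormedAddCommGroup E] [NormedSpace ℝ E]
  {H : Type u} [TopologicalSpace H] {I : ModelWithCorners ℝ E H}
  {M : Type u} [TopologicalSpace M] [ChartedSpace H M]
  {E' : Type u} [NormedAddCommGroup E'] [NormedSpace ℝ E']
  {H' : Type u} [TopologicalSpace H'] {I' : ModelWithCorners ℝ E' H'}
  {M' : Type u} [TopologicalSpace M'] [ChartedSpace H' M']
  {V : Type u} [AddCommGroup V] [Module ℝ V]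

/-- Composition of smooth functions with a smooth map. -/
def pullFn {r : M' → M} {N : Opens M} {N' : Opens M'} (hr : ContMDiffOn I' I ∞ r N')
    (h : ∀ x ∈ N', r x ∈ N) : smoothFunctions I N →ₐ[ℝ] smoothFunctions I' N' where
  toFun a := ⟨fun y => a.1 ⟨r y, h y y.2⟩, by
    obtain ⟨F, hF, ha⟩ := a.2
    exact ⟨F ∘ r, hF.comp hr h, fun y => ha _⟩⟩
  map_one' := rfl
  map_mul' _ _ := rfl
  map_zero' := rfl
  map_add' _ _ := rfl
  commutes' _ := rfl

variable (V) in
/-- Smooth functions as sections of degree `0`. -/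
def fnHom (N : Opens M) : smoothFunctions I N →ₐ[ℝ] smoothSections I M V N where
  toFun a := ⟨fun y => algebraMap ℝ _ (a.1 y), by
    obtain ⟨F, hF, ha⟩ := a.2
    have : (fun y => algebraMap ℝ (Fibre E V) (a.1 y)) = (fn V N F hF).1 :=
      funext fun y => congrArg _ (ha y)
    rw [this]
    exact (fn V N F hF).2⟩
  map_one' := section_ext fun y => map_one _
  map_mul' _ _ := section_ext fun y => map_mul _ _ _
  map_zero' := section_ext fun y => map_zero _
  map_add' _ _ := section_ext fun y => map_add _ _ _
  commutes' _ := rfl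

lemma fnHom_mkFn {N : Opens M} {F : M → ℝ} (hF : ContMDiffOn I 𝓘(ℝ, ℝ) ∞ F N) :
    fnHom V N (mkFn N F hF) = fn V N F hF := rfl

lemma res_fnHom {N N' : Opens M} (h : N' ≤ N) (a : smoothFunctions I N) :
    restrictSections I M V h (fnHom V N a) = fnHom V N' (resFn I h a) := rfl

lemma fnHom_mem {N : Opens M} (a : smoothFunctions I N) : fnHom V N a ∈ sectionsDeg I M V N 0 :=
  fun y => algebraMap_mem_fibreDeg _

variable [I.Boundaryless] [IsManifold I ∞ M]

section FiniteDimensional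

variable [FiniteDimensional ℝ E]

/-- The coordinate functions of a chart. -/
def chartCoordFn (I : ModelWithCorners ℝ E H) [I.Boundaryless] [IsManifold I ∞ M] (x : M) :
    Module.Dual ℝ E →ₗ[ℝ] smoothFunctions I (chartDomain H x) where
  toFun ℓ := mkFn _ _ (contMDiffOn_chartCoord x ℓ)
  map_add' _ _ := rfl
  map_smul' _ _ := rfl

/-- Homomorphisms from smooth functions with prescribed values on the coordinates of a chart. -/
theorem exists_funHom_of_chart {S : DGSpace.{u}} (L : LocalChart S) {U₀ : Opens S.body}
    (hU₀ : (U₀ : Set S.body) ⊆ L.e.source) (x₀ : M) {f : S.body → M} (hf : ContinuousOn f U₀)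
    (hfx : ∀ y ∈ U₀, f y ∈ chartDomain H x₀) (a : Module.Dual ℝ E →ₗ[ℝ] S.O U₀)
    (ha : ∀ ℓ, a ℓ ∈ S.deg U₀ 0) (ha0 : ∀ ℓ y, L.coeff hU₀ (a ℓ) 0 y = chartCoord I x₀ ℓ (f y)) :
    ∃ φ : FunHom I S f U₀, ∀ (U : Opens S.body) (h₀ : U ≤ U₀) ℓ,
      φ.sharp (chartDomain H x₀) U h₀ (fun y hy => hfx y (h₀ hy)) (chartCoordFn I x₀ ℓ) =
        S.res h₀ (a ℓ) := by
  let c : CoordinateValues L U₀ (fun y => extChartAt I x₀ (f y)) :=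
    { subset := hU₀
      cont := (continuousOn_extChartAt (I := I) x₀).comp hf fun y hy => by
        rw [extChartAt_source]
        exact hfx y hy
      val := a
      mem := ha
      coeff_zero := ha0 }
  let T : Opens M → Opens E := fun N => ⟨_, isOpen_target_inter_preimage (I := I) x₀ N.2⟩
  have hT : ∀ {N : Opens M} {y : M}, y ∈ chartDomain H x₀ → y ∈ N → extChartAt I x₀ y ∈ T N := by
    intro N y hy hyN
    have hy' : y ∈ (extChartAt I x₀).source := by rwa [extChartAt_source]
    exact ⟨(extChartAt I x₀).map_source hy', by
      rw [Set.mem_preimage, (extChartAt I x₀).left_inv hy']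
      exact hyN⟩
  let r : ∀ N : Opens M, smoothFunctions I N →ₐ[ℝ] smoothFunctions 𝓘(ℝ, E) (T N) := fun N =>
    pullFn (r := (extChartAt I x₀).symm) ((contMDiffOn_extChartAt_symm (I := I) (n := ∞) x₀).mono
      fun z hz => hz.1) fun z hz => hz.2
  refine ⟨{ cont := hf
            sharp := fun N U h₀ h =>
              (c.funHom.sharp (T N) U h₀ fun y hy => hT (hfx y (h₀ hy)) (h y hy)).comp (r N)
            sharp_res := fun {N N' U U'} hN hU h₀ h h' b =>
              c.funHom.sharp_res (show T N' ≤ T N from fun z hz => ⟨hz.1, hN hz.2⟩) hU h₀ _ _ (r N b)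
            sharp_mem := ?_ }, ?_⟩
  · intro N U h₀ h k b hb
    by_cases hk : k = 0
    · subst hk
      exact FunHom.mem c.funHom h₀ _ _
    · have : b = 0 := by simpa [hk] using hb
      rw [this, map_zero]
      exact zero_mem _
  · intro U h₀ ℓ
    refine Eq.trans ?_ (c.funHom_linear (N := T (chartDomain H x₀)) h₀
      (fun y hy => hT (hfx y (h₀ hy)) (hfx y (h₀ hy))) ℓ
      (LinearMap.toContinuousLinearMap ℓ).contDiff.contMDiff.contMDiffOn)
    change c.funHom.sharp (T (chartDomain H x₀)) U h₀ _ (r _ (chartCoordFn I x₀ ℓ)) = _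
    refine congrArg _ (smoothFunctions_ext fun z => ?_)
    exact congrArg ℓ ((extChartAt I x₀).right_inv z.2.1)

variable [Module.Finite ℝ V]

/-- The coefficients of sections in a chart. -/
def coefFn (x : M) {N : Opens M} (hN : N ≤ chartDomain H x)
    (σ : Finset (Fin (Module.finrank ℝ (Module.Dual ℝ (E × V))))) :
    smoothSections I M V N →ₗ[ℝ] smoothFunctions I N where
  toFun s := mkFn N (coef x s σ) (contMDiffOn_coef x hN s σ)
  map_add' s t := smoothFunctions_ext fun y => by
    change (fibreBasis E V).repr (inChart x (s + t) y) σ = _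
    rw [inChart_add x s t y.2, map_add]
    rfl
  map_smul' r s := smoothFunctions_ext fun y => by
    change (fibreBasis E V).repr (inChart x (r • s) y) σ = _
    rw [inChart_smul x r s y.2, map_smul]
    rfl

lemma coefFn_apply (x : M) {N : Opens M} (hN : N ≤ chartDomain H x) (σ)
    (s : smoothSections I M V N) (y : N) :
    (coefFn x hN σ s).1 y = (fibreBasis E V).repr (inChart x s y) σ := rfl

lemma coefFn_frame (x : M) {N : Opens M} (hN : N ≤ chartDomain H x) (σ) (z : Fibre E V) :
    coefFn x hN σ (frame (I := I) x hN z) = algebraMap ℝ _ ((fibreBasis E V).repr z σ) := by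
  refine smoothFunctions_ext fun y => ?_
  rw [coefFn_apply, inChart_frame hN z y.2]
  rfl

lemma coefFn_fnHom_mul (x : M) {N : Opens M} (hN : N ≤ chartDomain H x) (σ)
    (a : smoothFunctions I N) (s : smoothSections I M V N) :
    coefFn x hN σ (fnHom V N a * s) = a * coefFn x hN σ s := by
  refine smoothFunctions_ext fun y => ?_
  obtain ⟨F, hF, rfl⟩ := exists_mkFn a
  change _ = F y * _
  rw [coefFn_apply, fnHom_mkFn, inChart_mul x _ _ y.2, inChart_fn x hF y.2, ← Algebra.smul_def,
    map_smul, coefFn_apply]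
  rfl

lemma sum_fnHom_frame (x : M) {N : Opens M} (hN : N ≤ chartDomain H x)
    (s : smoothSections I M V N) :
    ∑ σ, fnHom V N (coefFn x hN σ s) * frame x hN (fibreBasis E V σ) = s :=
  (eq_sum_coef x hN s).symm

/-- Values for functions and for linear forms on `V`, over a domain that is mapped to a chart. -/
structure FormValues (I : ModelWithCorners ℝ E H) [I.Boundaryless] [IsManifold I ∞ M]
    (V : Type u) [AddCommGroup V] [Module ℝ V] (S : DGSpace.{u}) (f : S.body → M)
    (U₀ : Opens S.body) where
  isDG : IsDGManifold S
  φ : FunHom I S f U₀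
  center : M
  mem_chart : ∀ y ∈ U₀, f y ∈ chartDomain H center
  lam : Module.Dual ℝ V →ₗ[ℝ] S.O U₀
  lam_mem : ∀ ξ, lam ξ ∈ S.deg U₀ 1

namespace FormValues

variable {S : DGSpace.{u}} {f : S.body → M} {U₀ U U' : Opens S.body} (c : FormValues I V S f U₀)
  {N N' : Opens M}

/-- The values of the generators of degree `1`. -/
def genValue (h₀ : U ≤ U₀) : Module.Dual ℝ (E × V) →ₗ[ℝ] S.O U :=
  S.d U ∘ₗ (c.φ.sharp (chartDomain H c.center) U h₀ fun y hy => c.mem_chart y (h₀ hy)).toLinearMap ∘ₗ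
    chartCoordFn I c.center ∘ₗ (LinearMap.inl ℝ E V).dualMap +
  (S.res h₀).toLinearMap ∘ₗ c.lam ∘ₗ (LinearMap.inr ℝ E V).dualMap

lemma genValue_mem (h₀ : U ≤ U₀) (v) : c.genValue h₀ v ∈ S.deg U 1 :=
  add_mem (by simpa using c.isDG.d_mem U 0 _ (FunHom.mem c.φ h₀ _ _))
    (c.isDG.res_mem h₀ 1 _ (c.lam_mem _))

/-- The values of the elements of the exterior algebra. -/
def frameValue (h₀ : U ≤ U₀) : Fibre E V →ₐ[ℝ] S.O U :=
  ExteriorAlgebra.lift ℝ ⟨c.genValue h₀, fun v => c.isDG.mul_self_eq_zero (c.genValue_mem h₀ v)⟩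

lemma frameValue_ι (h₀ : U ≤ U₀) (v) : c.frameValue h₀ (ι ℝ v) = c.genValue h₀ v :=
  ExteriorAlgebra.lift_ι_apply ..

lemma res_frameValue (hU : U' ≤ U) (h₀ : U ≤ U₀) (z) :
    S.res hU (c.frameValue h₀ z) = c.frameValue (hU.trans h₀) z := by
  have : (S.res hU).comp (c.frameValue h₀) = c.frameValue (hU.trans h₀) := by
    refine ExteriorAlgebra.hom_ext (LinearMap.ext fun v => ?_)
    change S.res hU (c.frameValue h₀ (ι ℝ v)) = c.frameValue (hU.trans h₀) (ι ℝ v)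
    rw [frameValue_ι, frameValue_ι]
    change S.res hU (S.d U _ + S.res h₀ _) = S.d U' _ + S.res _ _
    rw [map_add, S.res_res, c.isDG.res_d]
    refine congrArg₂ _ (congrArg _ ?_) rfl
    exact c.φ.sharp_res le_rfl hU h₀ _ _ _
  exact DFunLike.congr_fun this z

lemma frameValue_mem (h₀ : U ≤ U₀) {n : ℕ} {z : Fibre E V} (hz : z ∈ fibreDeg E V n) :
    c.frameValue h₀ z ∈ S.deg U n := by
  rw [fibreDeg_natCast] at hz
  refine Submodule.pow_induction_on_left' (LinearMap.range (ι ℝ))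
    (C := fun n z _ => c.frameValue h₀ z ∈ S.deg U n) (fun r => ?_) (fun x y i _ _ hx hy => ?_)
    (fun m hm i x _ hx => ?_) hz
  · rw [AlgHom.commutes, Algebra.algebraMap_eq_smul_one]
    exact Submodule.smul_mem _ r (c.isDG.one_mem U)
  · rw [map_add]
    exact add_mem hx hy
  · obtain ⟨v, rfl⟩ := hm
    rw [map_mul, frameValue_ι, Nat.cast_succ, add_comm (i : ℤ) 1]
    exact c.isDG.mul_mem U 1 i _ _ (c.genValue_mem h₀ v) hx

lemma mem_inf (h₀ : U ≤ U₀) (h : ∀ x ∈ U, f x ∈ N) (x) (hx : x ∈ U) :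
    f x ∈ N ⊓ chartDomain H c.center := ⟨h x hx, c.mem_chart x (h₀ hx)⟩

/-- The value of a section. -/
def value (h₀ : U ≤ U₀) (h : ∀ x ∈ U, f x ∈ N) : smoothSections I M V N →ₗ[ℝ] S.O U :=
  ∑ σ, LinearMap.mulRight ℝ (c.frameValue h₀ (fibreBasis E V σ)) ∘ₗ
    (c.φ.sharp _ U h₀ (c.mem_inf h₀ h)).toLinearMap ∘ₗ coefFn c.center inf_le_right σ ∘ₗ
      (restrictSections I M V inf_le_left).toLinearMap

lemma value_apply (h₀ : U ≤ U₀) (h : ∀ x ∈ U, f x ∈ N) (s : smoothSections I M V N) :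
    c.value h₀ h s = ∑ σ, c.φ.sharp _ U h₀ (c.mem_inf h₀ h)
      (coefFn c.center inf_le_right σ (restrictSections I M V inf_le_left s)) *
        c.frameValue h₀ (fibreBasis E V σ) := by
  simp [value, LinearMap.sum_apply]

lemma value_res (hN : N' ≤ N) (hU : U' ≤ U) (h₀ : U ≤ U₀) (h : ∀ x ∈ U, f x ∈ N)
    (h' : ∀ x ∈ U', f x ∈ N') (s : smoothSections I M V N) :
    S.res hU (c.value h₀ h s) = c.value (hU.trans h₀) h' (restrictSections I M V hN s) := by
  rw [value_apply, value_apply, map_sum]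
  refine Finset.sum_congr rfl fun σ _ => ?_
  rw [map_mul, res_frameValue, c.φ.sharp_res (inf_le_inf_right _ hN) hU h₀ _ (c.mem_inf (hU.trans h₀) h')]
  congr 2
  refine smoothFunctions_ext fun y => ?_
  change (fibreBasis E V).repr (inChart _ _ _) σ = (fibreBasis E V).repr (inChart _ _ _) σ
  rw [inChart_res _ _ _ (⟨hN y.2.1, y.2.2⟩ : (y : M) ∈ N ⊓ chartDomain H c.center),
    inChart_res _ _ _ y.2, inChart_res _ _ _ y.2.1]

lemma value_fnHom_mul (h₀ : U ≤ U₀) (h : ∀ x ∈ U, f x ∈ N) (a : smoothFunctions I N)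
    (s : smoothSections I M V N) :
    c.value h₀ h (fnHom V N a * s) = c.φ.sharp N U h₀ h a * c.value h₀ h s := by
  rw [value_apply, value_apply, Finset.mul_sum]
  refine Finset.sum_congr rfl fun σ _ => ?_
  rw [map_mul, res_fnHom, coefFn_fnHom_mul, map_mul, mul_assoc]
  congr 1
  have := c.φ.sharp_res (inf_le_left : N ⊓ chartDomain H c.center ≤ N) le_rfl h₀ h
    (c.mem_inf h₀ h) a
  rw [S.res_self] at this
  exact this.symm

lemma value_frame (h₀ : U ≤ U₀) (h : ∀ x ∈ U, f x ∈ N) (hN : N ≤ chartDomain H c.center)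
    (z : Fibre E V) : c.value h₀ h (frame c.center hN z) = c.frameValue h₀ z := by
  rw [value_apply]
  conv_rhs => rw [← (fibreBasis E V).sum_repr z, map_sum]
  refine Finset.sum_congr rfl fun σ _ => ?_
  rw [res_frame, coefFn_frame, AlgHom.commutes, map_smul, Algebra.smul_def]

lemma value_of_res (h₀ : U ≤ U₀) (h : ∀ x ∈ U, f x ∈ N) (s : smoothSections I M V N) :
    c.value h₀ h s = c.value h₀ (c.mem_inf h₀ h) (restrictSections I M V inf_le_left s) := by
  rw [← c.value_res inf_le_left le_rfl h₀ h, S.res_self]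

lemma value_mul (h₀ : U ≤ U₀) (h : ∀ x ∈ U, f x ∈ N) (s t : smoothSections I M V N) :
    c.value h₀ h (s * t) = c.value h₀ h s * c.value h₀ h t := by
  rw [value_of_res, value_of_res c h₀ h s, value_of_res c h₀ h t, map_mul]
  generalize restrictSections I M V inf_le_left s = s'
  generalize restrictSections I M V inf_le_left t = t'
  have hN : N ⊓ chartDomain H c.center ≤ chartDomain H c.center := inf_le_right
  have key : ∀ z, c.value h₀ (c.mem_inf h₀ h) (frame c.center hN z * t') =
      c.frameValue h₀ z * c.value h₀ (c.mem_inf h₀ h) t' := by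
    intro z
    conv_lhs => rw [← sum_fnHom_frame c.center hN t']
    conv_rhs => rw [← sum_fnHom_frame c.center hN t']
    rw [Finset.mul_sum, map_sum, map_sum, Finset.mul_sum]
    refine Finset.sum_congr rfl fun σ _ => ?_
    generalize coefFn c.center hN σ t' = a
    have h1 : frame c.center hN z * (fnHom V _ a * frame c.center hN (fibreBasis E V σ)) =
        fnHom V _ a * frame c.center hN (z * fibreBasis E V σ) := by
      rw [map_mul, ← mul_assoc, ← mul_assoc]
      congr 1
      refine section_ext fun y => ?_
      rw [mul_apply, mul_apply]
      exact (Algebra.commutes _ _).symm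
    rw [h1, value_fnHom_mul, value_fnHom_mul, value_frame, value_frame, map_mul, ← mul_assoc,
      ← mul_assoc]
    congr 1
    exact c.isDG.mul_comm_of_mem_zero (FunHom.mem c.φ h₀ _ _) _
  conv_lhs => rw [← sum_fnHom_frame c.center hN s']
  conv_rhs => rw [← sum_fnHom_frame c.center hN s']
  rw [Finset.sum_mul, map_sum, map_sum, Finset.sum_mul]
  refine Finset.sum_congr rfl fun σ _ => ?_
  rw [mul_assoc, value_fnHom_mul, key, value_fnHom_mul, value_frame, mul_assoc]

lemma value_one (h₀ : U ≤ U₀) (h : ∀ x ∈ U, f x ∈ N) :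
    c.value h₀ h (1 : smoothSections I M V N) = 1 := by
  rw [value_of_res, map_one, ← map_one (frame (I := I) (V := V) c.center inf_le_right), value_frame, map_one]

lemma value_mem (h₀ : U ≤ U₀) (h : ∀ x ∈ U, f x ∈ N) {k : ℤ} {s : smoothSections I M V N}
    (hs : s ∈ sectionsDeg I M V N k) : c.value h₀ h s ∈ S.deg U k := by
  rw [value_apply]
  refine Submodule.sum_mem _ fun σ _ => ?_
  by_cases hσ : (σ.card : ℤ) = k
  · have := c.isDG.mul_mem U 0 σ.card _ _ (FunHom.mem c.φ h₀ (c.mem_inf h₀ h)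
      (coefFn c.center inf_le_right σ (restrictSections I M V inf_le_left s)))
      (c.frameValue_mem h₀ (fibreBasis_mem (E := E) (V := V) σ))
    rwa [zero_add, hσ] at this
  · have : coefFn c.center inf_le_right σ (restrictSections I M V
        (inf_le_left : N ⊓ chartDomain H c.center ≤ N) s) = 0 := by
      refine smoothFunctions_ext fun y => ?_
      rw [coefFn_apply, inChart_of_mem _ _ y.2]
      exact fibreBasis_repr_of_mem (toChart_mem (hs ⟨y, y.2.1⟩)) hσ
    rw [this, map_zero, zero_mul]
    exact zero_mem _

/-- The homomorphism from sections with given values. -/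
def formHom : FormHom I V S f U₀ where
  cont := c.φ.cont
  sharp N U h₀ h := AlgHom.ofLinearMap (c.value h₀ h) (c.value_one h₀ h) (c.value_mul h₀ h)
  sharp_res hN hU h₀ h h' a := c.value_res hN hU h₀ h h' a
  sharp_mem N U h₀ h k a ha := c.value_mem h₀ h ha

lemma formHom_fnHom (h₀ : U ≤ U₀) (h : ∀ x ∈ U, f x ∈ N) (a : smoothFunctions I N) :
    c.formHom.sharp N U h₀ h (fnHom V N a) = c.φ.sharp N U h₀ h a := by
  have := c.value_fnHom_mul h₀ h a 1
  rwa [mul_one, value_one, mul_one] at this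

lemma formHom_lin (h₀ : U ≤ U₀) (h : ∀ x ∈ U, f x ∈ N) (ξ : Module.Dual ℝ V) :
    c.formHom.sharp N U h₀ h (lin I N ξ) = S.res h₀ (c.lam ξ) := by
  change c.value h₀ h (lin I N ξ) = _
  have h1 : restrictSections I M V inf_le_left (lin I N ξ) =
      frame c.center (inf_le_right : N ⊓ chartDomain H c.center ≤ _) (ι ℝ (ξ ∘ₗ LinearMap.snd ℝ E V)) := by
    rw [frame_ι, res_lin]
    refine section_ext fun y => ?_
    rw [add_apply, lin_apply, dfn_apply, lin_apply]
    have : (ξ ∘ₗ LinearMap.snd ℝ E V) ∘ₗ LinearMap.inl ℝ E V = 0 := by ext; simp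
    rw [this]
    have h2 : dAt I (chartCoord I c.center 0) (y : M) = 0 := dAt_const 0 _
    rw [h2, LinearMap.zero_comp, map_zero, zero_add]
    congr 1
  rw [value_of_res, h1, value_frame, frameValue_ι]
  change S.d U (c.φ.sharp _ _ _ _ (chartCoordFn I c.center ((ξ ∘ₗ LinearMap.snd ℝ E V) ∘ₗ LinearMap.inl ℝ E V))) +
    S.res h₀ (c.lam ((ξ ∘ₗ LinearMap.snd ℝ E V) ∘ₗ LinearMap.inr ℝ E V)) = _
  have h3 : (ξ ∘ₗ LinearMap.snd ℝ E V) ∘ₗ LinearMap.inl ℝ E V = 0 := by ext; simp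
  have h4 : (ξ ∘ₗ LinearMap.snd ℝ E V) ∘ₗ LinearMap.inr ℝ E V = ξ := by ext; simp
  rw [h3, h4, map_zero, map_zero, map_zero, zero_add]

lemma formHom_dfn_chartCoord (h₀ : U ≤ U₀) (h : ∀ x ∈ U, f x ∈ N)
    (hN : N ≤ chartDomain H c.center) (ℓ : Module.Dual ℝ E) :
    c.formHom.sharp N U h₀ h (dfn V N _ ((contMDiffOn_chartCoord c.center ℓ).mono hN)) =
      S.d U (c.φ.sharp N U h₀ h (mkFn N _ ((contMDiffOn_chartCoord c.center ℓ).mono hN))) := by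
  change c.value h₀ h _ = _
  have h3 : (ℓ ∘ₗ LinearMap.fst ℝ E V) ∘ₗ LinearMap.inl ℝ E V = ℓ := by ext; simp
  have h4 : (ℓ ∘ₗ LinearMap.fst ℝ E V) ∘ₗ LinearMap.inr ℝ E V = 0 := by ext; simp
  have h1 : dfn V N _ ((contMDiffOn_chartCoord (I := I) c.center ℓ).mono hN) =
      frame (I := I) c.center hN (ι ℝ (ℓ ∘ₗ LinearMap.fst ℝ E V)) := by
    rw [frame_ι]
    refine section_ext fun y => ?_
    rw [add_apply, lin_apply, dfn_apply, dfn_apply, h3, h4, LinearMap.zero_comp, map_zero, add_zero]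
  rw [h1, value_frame, frameValue_ι]
  change S.d U (c.φ.sharp _ _ _ _ (chartCoordFn I c.center ((ℓ ∘ₗ LinearMap.fst ℝ E V) ∘ₗ LinearMap.inl ℝ E V))) +
    S.res h₀ (c.lam ((ℓ ∘ₗ LinearMap.fst ℝ E V) ∘ₗ LinearMap.inr ℝ E V)) = _
  rw [h3, h4, map_zero, map_zero, add_zero]
  congr 1
  have := c.φ.sharp_res hN le_rfl h₀ (fun y hy => c.mem_chart y (h₀ hy)) h (chartCoordFn I c.center ℓ)
  rw [S.res_self] at this
  exact this

end FormValues

end FiniteDimensional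

end FormHoms

section Classification

open ExteriorAlgebra (ι)

variable {E : Type u} [NormedAddCommGroup E] [NormedSpace ℝ E]
  {H : Type u} [TopologicalSpace H] {I : ModelWithCorners ℝ E H}
  {M : Type u} [TopologicalSpace M] [ChartedSpace H M]
  {V : Type u} [AddCommGroup V] [Module ℝ V] [Module.Finite ℝ V] [Bracket V V]
  {S : DGSpace.{u}} {f : S.body → M} {U₀ : Opens S.body}

/-- The right-hand side of the Maurer–Cartan equation. -/
def maurerCartan {A : Type*} [Ring A] [Algebra ℝ A] (lam : Module.Dual ℝ V →ₗ[ℝ] A)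
    (ξ : Module.Dual ℝ V) : A :=
  -(1 / 2 : ℝ) • ∑ b, ∑ c, ξ ⁅Module.finBasis ℝ V b, Module.finBasis ℝ V c⁆ •
    (lam ((Module.finBasis ℝ V).coord b) * lam ((Module.finBasis ℝ V).coord c))

lemma map_maurerCartan {A B : Type*} [Ring A] [Algebra ℝ A] [Ring B] [Algebra ℝ B]
    (F : A →ₐ[ℝ] B) (lam : Module.Dual ℝ V →ₗ[ℝ] A) (ξ : Module.Dual ℝ V) :
    F (maurerCartan lam ξ) = maurerCartan (F.toLinearMap ∘ₗ lam) ξ := by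
  simp only [maurerCartan, map_smul, map_sum, map_mul, LinearMap.comp_apply, AlgHom.toLinearMap_apply]

variable (I) in
/-- Linear forms on `V` as sections of degree `1`. -/
def linHom (N : Opens M) : Module.Dual ℝ V →ₗ[ℝ] smoothSections I M V N where
  toFun ξ := lin I N ξ
  map_add' _ _ := section_ext fun _ => by
    rw [add_apply, lin_apply, lin_apply, lin_apply, LinearMap.add_comp, map_add]
  map_smul' _ _ := section_ext fun _ => by
    rw [smul_apply, lin_apply, lin_apply, LinearMap.smul_comp, map_smul]; rfl

lemma linHom_apply (N : Opens M) (ξ : Module.Dual ℝ V) : linHom I N ξ = lin I N ξ := rfl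

lemma ceSection_eq [I.Boundaryless] [IsManifold I ∞ M] {N : Opens M} (ξ : Module.Dual ℝ V) :
    ceSection I N ξ = maurerCartan (linHom I N) ξ := by
  refine section_ext fun y => ?_
  rw [ceSection_apply, maurerCartan, smul_apply, sum_apply]
  simp only [sum_apply, smul_apply, mul_apply]
  rfl

lemma FormHom.ext_generators (hS : IsDGManifold S) (ψ ψ' : FormHom I V S f U₀)
    (h_fn : ∀ N U h₀ h F hF, ψ.sharp N U h₀ h (fn V N F hF) = ψ'.sharp N U h₀ h (fn V N F hF))
    (h_dfn : ∀ N U h₀ h F hF, ψ.sharp N U h₀ h (dfn V N F hF) = ψ'.sharp N U h₀ h (dfn V N F hF))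
    (h_lin : ∀ N U h₀ h ξ, ψ.sharp N U h₀ h (lin I N ξ) = ψ'.sharp N U h₀ h (lin I N ξ))
    (N : Opens M) (s : smoothSections I M V N) :
    ∀ U h₀ h, ψ.sharp N U h₀ h s = ψ'.sharp N U h₀ h s := by
  refine section_induction (P := fun N s => ∀ U h₀ h, ψ.sharp N U h₀ h s = ψ'.sharp N U h₀ h s)
    ?_ ?_ ?_ ?_ ?_ ?_ N s
  · intro N U h₀ h
    rw [map_one, map_one]
  · intro N s t hs ht U h₀ h
    rw [map_add, map_add, hs, ht]
  · intro N F hF t ht U h₀ h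
    rw [map_mul, map_mul, h_fn, ht]
  · intro N F hF t ht U h₀ h
    rw [map_mul, map_mul, h_dfn, ht]
  · intro N ξ t ht U h₀ h
    rw [map_mul, map_mul, h_lin, ht]
  · intro N s hs U h₀ h
    refine hS.eq_of_locally fun x hx => ?_
    obtain ⟨N', hN', hxN', hP⟩ := hs (f x) (h x hx)
    refine ⟨shrink ψ.cont h₀ N', shrink_le _ _ _, ⟨hx, hxN'⟩, ?_⟩
    have h' : ∀ y ∈ shrink ψ.cont h₀ N', f y ∈ N' := fun y hy => hy.2
    rw [ψ.sharp_res hN' (shrink_le _ _ _) h₀ h h', ψ'.sharp_res hN' (shrink_le _ _ _) h₀ h h']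
    exact hP _ _ _

variable [I.Boundaryless] [IsManifold I ∞ M]

lemma FormHom.map_d [FinDimModel E M] (hS : IsDGManifold S) (ψ : FormHom I V S f U₀)
    (h_fn : ∀ N U h₀ h F hF, ψ.sharp N U h₀ h (dfn V N F hF) = S.d U (ψ.sharp N U h₀ h (fn V N F hF)))
    (h_lin : ∀ N U h₀ h ξ, ψ.sharp N U h₀ h (ceSection I N ξ) = S.d U (ψ.sharp N U h₀ h (lin I N ξ)))
    (N : Opens M) (s : smoothSections I M V N) :
    ∀ U h₀ h, ψ.sharp N U h₀ h (deRhamCE I M V N s) = S.d U (ψ.sharp N U h₀ h s) := by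
  refine section_induction (P := fun N s => ∀ U h₀ h,
    ψ.sharp N U h₀ h (deRhamCE I M V N s) = S.d U (ψ.sharp N U h₀ h s)) ?_ ?_ ?_ ?_ ?_ ?_ N s
  · intro N U h₀ h
    rw [d_one, map_zero, map_one, ← map_one (algebraMap ℝ (S.O U)), hS.d_algebraMap]
  · intro N s t hs ht U h₀ h
    rw [map_add, map_add, map_add, map_add, hs, ht]
  · intro N F hF t ht U h₀ h
    rw [d_fn_mul, map_add, map_mul, map_mul, map_mul,
      hS.d_mul U 0 _ _ (ψ.sharp_mem N U h₀ h 0 _ (fn_mem hF)), h_fn, ht, zpow_zero, one_smul]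
  · intro N F hF t ht U h₀ h
    rw [d_dfn_mul, map_neg, map_mul, map_mul,
      hS.d_mul U 1 _ _ (ψ.sharp_mem N U h₀ h 1 _ (dfn_mem hF)), h_fn, ht, hS.d_d, zero_mul, zero_add,
      zpow_one, neg_smul, one_smul]
  · intro N ξ t ht U h₀ h
    rw [d_lin_mul, map_sub, map_mul, map_mul, map_mul,
      hS.d_mul U 1 _ _ (ψ.sharp_mem N U h₀ h 1 _ (lin_mem ξ)), h_lin, ht,
      zpow_one, neg_smul, one_smul, sub_eq_add_neg]
  · intro N s hs U h₀ h
    refine hS.eq_of_locally fun x hx => ?_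
    obtain ⟨N', hN', hxN', hP⟩ := hs (f x) (h x hx)
    refine ⟨shrink ψ.cont h₀ N', shrink_le _ _ _, ⟨hx, hxN'⟩, ?_⟩
    have h' : ∀ y ∈ shrink ψ.cont h₀ N', f y ∈ N' := fun y hy => hy.2
    rw [hS.res_d, ψ.sharp_res hN' (shrink_le _ _ _) h₀ h h', ψ.sharp_res hN' (shrink_le _ _ _) h₀ h h']
    exact (congrArg _ ((isDeRhamCE_deRhamCE I M V).res hN' s)).trans (hP _ _ _)

lemma FormValues.formHom_dfn [FiniteDimensional ℝ E] (c : FormValues I V S f U₀) (N : Opens M)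
    (U : Opens S.body) (h₀ : U ≤ U₀) (h : ∀ x ∈ U, f x ∈ N) (F : M → ℝ)
    (hF : ContMDiffOn I 𝓘(ℝ, ℝ) ∞ F N) :
    c.formHom.sharp N U h₀ h (dfn V N F hF) = S.d U (c.formHom.sharp N U h₀ h (fn V N F hF)) := by
  have hS := c.isDG
  have key := eq_zero_of_twistedDerivation (E' := E) hS c.φ c.φ
    (fun N U h₀ h => S.d U ∘ₗ (c.φ.sharp N U h₀ h).toLinearMap -
      (c.formHom.sharp N U h₀ h).toLinearMap ∘ₗ deRhamCE I M V N ∘ₗ (fnHom V N).toLinearMap)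
    ?_ ?_ ?_ N U h₀ h (mkFn N F hF)
  · have h1 : S.d U (c.φ.sharp N U h₀ h (mkFn N F hF)) -
      c.formHom.sharp N U h₀ h (deRhamCE I M V N (fnHom V N (mkFn N F hF))) = 0 := key
    rw [fnHom_mkFn, d_fn, sub_eq_zero, ← c.formHom_fnHom] at h1
    exact h1.symm
  · intro N N' U U' hN hU h₀ h h' a
    simp only [LinearMap.sub_apply, LinearMap.comp_apply, AlgHom.toLinearMap_apply, map_sub]
    rw [hS.res_d, c.φ.sharp_res hN hU h₀ h h', c.formHom.sharp_res hN hU h₀ h h']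
    refine congrArg₂ _ rfl (congrArg _ ?_)
    exact (isDeRhamCE_deRhamCE I M V).res hN _
  · intro N U h₀ h a b
    simp only [LinearMap.sub_apply, LinearMap.comp_apply, AlgHom.toLinearMap_apply, map_mul]
    obtain ⟨F, hF, rfl⟩ := exists_mkFn a
    obtain ⟨G, hG, rfl⟩ := exists_mkFn b
    have h0 : ∀ x : smoothSections I M V N, c.formHom.sharp N U h₀ h (fn V N G hG * x) =
        c.formHom.sharp N U h₀ h x * c.formHom.sharp N U h₀ h (fn V N G hG) := fun x => by
      rw [map_mul]
      exact hS.mul_comm_of_mem_zero (c.formHom.sharp_mem N U h₀ h 0 _ (fn_mem hG)) _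
    have h1 : fn V N F hF * fn V N G hG = fn V N G hG * fn V N F hF := by
      rw [← fnHom_mkFn, ← fnHom_mkFn, ← map_mul, mul_comm, map_mul]
    have h2 : dfn V N F hF * fn V N G hG = fn V N G hG * dfn V N F hF :=
      section_ext fun y => by
        rw [mul_apply, mul_apply, fn_apply]
        exact (Algebra.commutes _ _).symm
    rw [fnHom_mkFn, fnHom_mkFn, d_fn, d_fn, d_fn_mul, d_fn, h2, map_add, h0,
      hS.d_mul U 0 _ _ (FunHom.mem c.φ h₀ h _), zpow_zero, one_smul, map_mul,
      ← fnHom_mkFn, ← fnHom_mkFn, c.formHom_fnHom, c.formHom_fnHom]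
    noncomm_ring
  · intro y hy
    refine ⟨extChartAt I c.center, hadamardAt_extChartAt (c.mem_chart y hy),
      chartDomain H c.center, c.mem_chart y hy, fun i N U h₀ h hN hc hyU => ?_⟩
    have := c.formHom_dfn_chartCoord h₀ h hN ((Module.finBasis ℝ E).coord i)
    change S.d U (c.φ.sharp N U h₀ h (mkFn N _ hc)) -
      c.formHom.sharp N U h₀ h (deRhamCE I M V N (fn V N _ hc)) = 0
    rw [d_fn, sub_eq_zero]
    exact this.symm

/-- Homomorphisms from sections with prescribed values on functions and on linear forms on `V`. -/
theorem exists_formHom [FinDimModel E M] (hS : IsDGManifold S) (hf : Continuous f)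
    (φ : FunHom I S f ⊤) (lam : Module.Dual ℝ V →ₗ[ℝ] S.O ⊤) (lam_mem : ∀ ξ, lam ξ ∈ S.deg ⊤ 1)
    (d_lam : ∀ ξ, S.d ⊤ (lam ξ) = maurerCartan lam ξ) :
    ∃ Ψ : FormHom I V S f ⊤,
      (∀ N U h a, Ψ.sharp N U le_top h (fnHom V N a) = φ.sharp N U le_top h a) ∧
      (∀ N U h ξ, Ψ.sharp N U le_top h (lin I N ξ) = S.res le_top (lam ξ)) ∧
      ∀ N U h s, Ψ.sharp N U le_top h (deRhamCE I M V N s) = S.d U (Ψ.sharp N U le_top h s) := by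
  have fd : ∀ y : S.body, FiniteDimensional ℝ E := fun y =>
    FinDimModel.finiteDimensional (M := M) ⟨f y⟩
  let D : S.body → Opens S.body := fun y =>
    ⟨f ⁻¹' (chartDomain H (f y)), (chartDomain H (f y)).2.preimage hf⟩
  let c : ∀ y, FormValues I V S f (D y) := fun y =>
    { isDG := hS
      φ := φ.restrict le_top
      center := f y
      mem_chart := fun _ hx => hx
      lam := (S.res le_top).toLinearMap ∘ₗ lam
      lam_mem := fun ξ => hS.res_mem _ 1 _ (lam_mem ξ) }
  have hψ : ∀ y, ∃ ψ : FormHom I V S f (D y),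
      (∀ N U h₀ h a, ψ.sharp N U h₀ h (fnHom V N a) = φ.sharp N U le_top h a) ∧
      (∀ N U h₀ h ξ, ψ.sharp N U h₀ h (lin I N ξ) = S.res le_top (lam ξ)) ∧
      ∀ N U h₀ h F hF, ψ.sharp N U h₀ h (dfn V N F hF) = S.d U (ψ.sharp N U h₀ h (fn V N F hF)) := by
    intro y
    have := fd y
    refine ⟨(c y).formHom, fun N U h₀ h a => (c y).formHom_fnHom h₀ h a, fun N U h₀ h ξ => ?_,
      (c y).formHom_dfn⟩
    rw [(c y).formHom_lin]
    exact S.res_res _ _ _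
  choose ψ ψ_fn ψ_lin ψ_dfn using hψ
  have h1 : ∀ y y' N U (hU : U ≤ D y) (hU' : U ≤ D y') h a,
      (ψ y).sharp N U hU h a = (ψ y').sharp N U hU' h a := by
    intro y y' N U hU hU' h a
    have e1 : ∀ N W (h₀ : W ≤ D y ⊓ D y') h F hF,
        (ψ y).sharp N W (h₀.trans inf_le_left) h (fn V N F hF) =
          (ψ y').sharp N W (h₀.trans inf_le_right) h (fn V N F hF) := fun N W h₀ h F hF =>
      (ψ_fn y N W (h₀.trans inf_le_left) h (mkFn N F hF)).trans
        (ψ_fn y' N W (h₀.trans inf_le_right) h (mkFn N F hF)).symm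
    exact FormHom.ext_generators hS ((ψ y).restrict inf_le_left) ((ψ y').restrict inf_le_right) e1
      (fun N W h₀ h F hF => ((ψ_dfn y N W (h₀.trans inf_le_left) h F hF).trans
        (congrArg _ (e1 N W h₀ h F hF))).trans (ψ_dfn y' N W (h₀.trans inf_le_right) h F hF).symm)
      (fun N W h₀ h ξ => (ψ_lin y N W (h₀.trans inf_le_left) h ξ).trans
        (ψ_lin y' N W (h₀.trans inf_le_right) h ξ).symm) N a U (le_inf hU hU') h
  obtain ⟨Ψ, hΨ⟩ := PresheafHom.exists_glue hS
    (fun N => (isInternal_sectionsDeg (I := I) (V := V) N).submodule_iSup_eq_top) hf D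
    (fun y => mem_chartDomain _) ψ h1
  have loc : ∀ {U : Opens S.body} {a b : S.O U},
      (∀ y, S.res (inf_le_left : U ⊓ D y ≤ U) a = S.res inf_le_left b) → a = b := fun {U a b} h =>
    hS.eq_of_locally fun x hx => ⟨U ⊓ D x, inf_le_left, ⟨hx, mem_chartDomain _⟩, h x⟩
  have res : ∀ N U (h : ∀ x ∈ U, f x ∈ N) y a, S.res (inf_le_left : U ⊓ D y ≤ U) (Ψ.sharp N U le_top h a) =
      (ψ y).sharp N (U ⊓ D y) inf_le_right (fun x hx => h x hx.1) a := fun N U h y a => by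
    rw [Ψ.sharp_res le_rfl inf_le_left le_top h fun x hx => h x hx.1, ← hΨ]
    rfl
  have Ψ_fn : ∀ N U h a, Ψ.sharp N U le_top h (fnHom V N a) = φ.sharp N U le_top h a :=
    fun N U h a => loc fun y => by
      rw [res, ψ_fn, φ.sharp_res le_rfl inf_le_left le_top h fun x hx => h x hx.1]
      rfl
  have Ψ_lin : ∀ N U h ξ, Ψ.sharp N U le_top h (lin I N ξ) = S.res le_top (lam ξ) :=
    fun N U h ξ => loc fun y => by rw [res, ψ_lin, S.res_res]
  refine ⟨Ψ, Ψ_fn, Ψ_lin, fun N U h s => FormHom.map_d hS Ψ (fun N U h₀ h F hF => ?_)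
    (fun N U h₀ h ξ => ?_) N s U le_top h⟩
  · exact loc fun y => by rw [res, hS.res_d, res, ψ_dfn]
  · have h2 : (Ψ.sharp N U h₀ h).toLinearMap ∘ₗ linHom I N = (S.res h₀).toLinearMap ∘ₗ lam :=
      LinearMap.ext fun ξ => Ψ_lin N U h ξ
    rw [Ψ_lin, ceSection_eq]
    refine (map_maurerCartan (Ψ.sharp N U h₀ h) _ ξ).trans ?_
    rw [h2, ← map_maurerCartan, ← d_lam, hS.res_d]

/-- A homomorphism from sections that commutes with the differentials, as a morphism. -/
def DGHom.ofFormHom (Ψ : FormHom I V S f ⊤) (hf : Continuous f)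
    (hd : ∀ N U h s, Ψ.sharp N U le_top h (deRhamCE I M V N s) = S.d U (Ψ.sharp N U le_top h s)) :
    DGHom S (tangentTimes I M V) where
  base := ⟨f, hf⟩
  sharp N U h := Ψ.sharp N U le_top h
  sharp_res hN hU h h' a := Ψ.sharp_res hN hU le_top h h' a
  sharp_mem N U h k a ha := Ψ.sharp_mem N U le_top h k a ha
  sharp_d N U h a := hd N U h a

/-- The map of bodies of a morphism to `T[1]M × V[1]`. -/
def DGHom.toBase (Φ : DGHom S (tangentTimes I M V)) (y : S.body) : M := Φ.base y

lemma DGHom.continuous_toBase (Φ : DGHom S (tangentTimes I M V)) : Continuous Φ.toBase :=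
  Φ.base.continuous

/-- A morphism to `T[1]M × V[1]` as a homomorphism from sections. -/
def DGHom.formHom (Φ : DGHom S (tangentTimes I M V)) : FormHom I V S Φ.toBase ⊤ where
  cont := Φ.continuous_toBase.continuousOn
  sharp N U _ h := Φ.sharp N U h
  sharp_res hN hU _ h h' a := Φ.sharp_res hN hU h h' a
  sharp_mem N U _ h k a ha := Φ.sharp_mem N U h k a ha

lemma DGHom.formHom_d (Φ : DGHom S (tangentTimes I M V)) (N : Opens M) (U : Opens S.body) (h)
    (s : smoothSections I M V N) : Φ.formHom.sharp N U le_top h (deRhamCE I M V N s) =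
      S.d U (Φ.formHom.sharp N U le_top h s) := Φ.sharp_d N U h s

/-- The restriction of a morphism to functions on the base. -/
def DGHom.funHom (Φ : DGHom S (tangentTimes I M V)) : FunHom I S Φ.toBase ⊤ where
  cont := Φ.continuous_toBase.continuousOn
  sharp N U _ h := (Φ.formHom.sharp N U le_top h).comp (fnHom V N)
  sharp_res hN hU _ h h' a := Φ.formHom.sharp_res hN hU le_top h h' (fnHom V _ a)
  sharp_mem N U _ h k a ha := by
    by_cases hk : k = 0
    · subst hk
      exact Φ.formHom.sharp_mem N U le_top h 0 _ (fnHom_mem a)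
    · have : a = 0 := by simpa [hk] using ha
      rw [this, map_zero]
      exact zero_mem _

/-- The restriction of a morphism to linear forms on `V`. -/
def DGHom.lam (Φ : DGHom S (tangentTimes I M V)) : Module.Dual ℝ V →ₗ[ℝ] S.O ⊤ :=
  (Φ.formHom.sharp ⊤ ⊤ le_top fun _ _ => trivial).toLinearMap ∘ₗ linHom I ⊤

lemma DGHom.lam_mem (Φ : DGHom S (tangentTimes I M V)) (ξ : Module.Dual ℝ V) :
    Φ.lam ξ ∈ S.deg ⊤ 1 := Φ.formHom.sharp_mem ⊤ ⊤ le_top _ 1 _ (lin_mem ξ)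

lemma DGHom.formHom_lin (Φ : DGHom S (tangentTimes I M V)) (N : Opens M) (U : Opens S.body) (h)
    (ξ : Module.Dual ℝ V) : Φ.formHom.sharp N U le_top h (lin I N ξ) = S.res le_top (Φ.lam ξ) :=
  (Φ.formHom.sharp_res le_top le_top le_top (fun _ _ => trivial) h (lin I ⊤ ξ)).symm

lemma DGHom.d_lam [FinDimModel E M] (Φ : DGHom S (tangentTimes I M V)) (ξ : Module.Dual ℝ V) :
    S.d ⊤ (Φ.lam ξ) = maurerCartan Φ.lam ξ := by
  refine (Φ.formHom_d ⊤ ⊤ _ (lin I ⊤ ξ)).symm.trans ?_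
  rw [d_lin, ceSection_eq]
  exact map_maurerCartan _ _ _

/-- Morphisms to `T[1]M × V[1]` are determined by their values on functions on `M` and on linear
forms on `V`. -/
theorem DGHom.ext_tangentTimes [FinDimModel E M] (hS : IsDGManifold S)
    {Φ Ψ : DGHom S (tangentTimes I M V)} (hb : ∀ y, Φ.toBase y = Ψ.toBase y)
    (h_fn : ∀ (N : Opens M) (U : Opens S.body) h h' (a : smoothFunctions I N),
      Φ.funHom.sharp N U le_top h a = Ψ.funHom.sharp N U le_top h' a)
    (h_lin : ∀ ξ, Φ.lam ξ = Ψ.lam ξ) : Φ = Ψ := by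
  obtain ⟨b, s, r, m, d⟩ := Φ
  obtain ⟨b', s', r', m', d'⟩ := Ψ
  obtain rfl : b = b' := ContinuousMap.ext hb
  refine DGHom.ext rfl (heq_of_eq ?_)
  funext N U h
  refine AlgHom.ext fun a => ?_
  set Φ : DGHom S (tangentTimes I M V) := ⟨b, s, r, m, d⟩
  set Ψ : DGHom S (tangentTimes I M V) := ⟨b, s', r', m', d'⟩
  have e1 : ∀ N U h₀ h F hF, Φ.formHom.sharp N U h₀ h (fn V N F hF) =
      Ψ.formHom.sharp N U h₀ h (fn V N F hF) := fun N U h₀ h F hF => h_fn N U h h (mkFn N F hF)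
  refine FormHom.ext_generators hS Φ.formHom Ψ.formHom e1 (fun N U h₀ h F hF => ?_)
    (fun N U h₀ h ξ => ?_) N a U le_top h
  · rw [← d_fn hF]
    exact (Φ.formHom_d N U h _).trans ((congrArg _ (e1 N U h₀ h F hF)).trans (Ψ.formHom_d N U h _).symm)
  · exact (Φ.formHom_lin N U h ξ).trans ((congrArg _ (h_lin ξ)).trans (Ψ.formHom_lin N U h ξ).symm)

/-- The existence of morphisms to `T[1]M × V[1]` with prescribed values. -/
theorem exists_dgHom [FinDimModel E M] (hS : IsDGManifold S) (hf : Continuous f)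
    (φ : FunHom I S f ⊤) (lam : Module.Dual ℝ V →ₗ[ℝ] S.O ⊤) (lam_mem : ∀ ξ, lam ξ ∈ S.deg ⊤ 1)
    (d_lam : ∀ ξ, S.d ⊤ (lam ξ) = maurerCartan lam ξ) :
    ∃ Ψ : DGHom S (tangentTimes I M V), (∀ y, Ψ.toBase y = f y) ∧
      (∀ N U h h' a, Ψ.funHom.sharp N U le_top h a = φ.sharp N U le_top h' a) ∧
      ∀ ξ, Ψ.lam ξ = lam ξ := by
  obtain ⟨Ψ, h1, h2, h3⟩ := exists_formHom hS hf φ lam lam_mem d_lam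
  exact ⟨DGHom.ofFormHom Ψ hf h3, fun _ => rfl, fun N U h h' a => h1 N U h a,
    fun ξ => (h2 ⊤ ⊤ (fun _ _ => trivial) ξ).trans (S.res_self _ _)⟩

end Classification

section Points

variable {E : Type u} [NormedAddCommGroup E] [NormedSpace ℝ E]
  {H : Type u} [TopologicalSpace H] {I : ModelWithCorners ℝ E H}
  {M : Type u} [TopologicalSpace M] [ChartedSpace H M]
  {E' : Type u} [NormedAddCommGroup E'] [NormedSpace ℝ E']
  {H' : Type u} [TopologicalSpace H'] {I' : ModelWithCorners ℝ E' H'}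
  {M' : Type u} [TopologicalSpace M'] [ChartedSpace H' M']
  {E'' : Type u} [NormedAddCommGroup E''] [NormedSpace ℝ E'']
  {H'' : Type u} [TopologicalSpace H''] {I'' : ModelWithCorners ℝ E'' H''}
  {M'' : Type u} [TopologicalSpace M''] [ChartedSpace H'' M'']
  {S : DGSpace.{u}}

/-- Homomorphisms depend only on the germs of functions. -/
lemma FunHom.sharp_congr {f : S.body → M} {U₀ U : Opens S.body} (φ : FunHom I S f U₀)
    {N N' : Opens M} (h₀ : U ≤ U₀) (h : ∀ x ∈ U, f x ∈ N) (h' : ∀ x ∈ U, f x ∈ N')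
    {a : smoothFunctions I N} {a' : smoothFunctions I N'}
    (haa' : ∀ x (hx : x ∈ N) (hx' : x ∈ N'), a.1 ⟨x, hx⟩ = a'.1 ⟨x, hx'⟩) :
    φ.sharp N U h₀ h a = φ.sharp N' U h₀ h' a' := by
  have h2 : ∀ x ∈ U, f x ∈ N ⊓ N' := fun x hx => ⟨h x hx, h' x hx⟩
  have e1 := φ.sharp_res (inf_le_left : N ⊓ N' ≤ N) le_rfl h₀ h h2 a
  have e2 := φ.sharp_res (inf_le_right : N ⊓ N' ≤ N') le_rfl h₀ h' h2 a'
  rw [S.res_self] at e1 e2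
  rw [e1, e2]
  exact congrArg _ (smoothFunctions_ext fun x => haa' x x.2.1 x.2.2)

/-- The composition of a homomorphism with a smooth map. -/
def FunHom.map {f : S.body → M} {U₀ : Opens S.body} (φ : FunHom I S f U₀) {r : M → M'}
    (hr : ContMDiff I I' ∞ r) : FunHom I' S (r ∘ f) U₀ where
  cont := hr.continuous.comp_continuousOn φ.cont
  sharp N U h₀ h := (φ.sharp (N.comap ⟨r, hr.continuous⟩) U h₀ h).comp
    (pullFn hr.contMDiffOn fun _ hx => hx)
  sharp_res {N N' U U'} hN hU h₀ h h' a :=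
    φ.sharp_res (show N'.comap ⟨r, hr.continuous⟩ ≤ N.comap ⟨r, hr.continuous⟩ from
      fun x hx => hN hx) hU h₀ h h' _
  sharp_mem N U h₀ h k a ha := by
    by_cases hk : k = 0
    · subst hk
      exact FunHom.mem φ h₀ _ _
    · have : a = 0 := by simpa [hk] using ha
      rw [this, map_zero]
      exact zero_mem _

variable (I M S) in
/-- Points of `M` with values in the degree zero functions on a dg-manifold. -/
structure FunPoint where
  base : S.body → M
  cont : Continuous base
  hom : FunHom I S base ⊤

namespace FunPoint

lemma ext {p q : FunPoint I M S} (hb : ∀ y, p.base y = q.base y)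
    (h : ∀ N U h h' a, p.hom.sharp N U le_top h a = q.hom.sharp N U le_top h' a) : p = q := by
  obtain ⟨b, c, φ⟩ := p
  obtain ⟨b', c', φ'⟩ := q
  obtain rfl : b = b' := funext hb
  have : φ = φ' := by
    obtain ⟨_, s, _, _⟩ := φ
    obtain ⟨_, s', _, _⟩ := φ'
    have : s = s' := by
      funext N U h₀ h'
      exact AlgHom.ext fun a => h N U h' h' a
    subst this
    rfl
  subst this
  rfl

lemma congr_base {p q : FunPoint I M S} (h : p = q) (y) : p.base y = q.base y := by rw [h]

lemma congr_hom {p q : FunPoint I M S} (hpq : p = q) (N U h h' a) :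
    p.hom.sharp N U le_top h a = q.hom.sharp N U le_top h' a := by
  subst hpq
  rfl

/-- The image of a point under a smooth map. -/
def map (p : FunPoint I M S) {r : M → M'} (hr : ContMDiff I I' ∞ r) : FunPoint I' M' S where
  base := r ∘ p.base
  cont := hr.continuous.comp p.cont
  hom := FunHom.map p.hom hr

lemma map_map (p : FunPoint I M S) {r : M → M'} (hr : ContMDiff I I' ∞ r) {r' : M' → M''}
    (hr' : ContMDiff I' I'' ∞ r') : (p.map hr).map hr' = p.map (hr'.comp hr) :=
  ext (fun _ => rfl) fun _ _ _ _ _ => rfl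

lemma map_congr (p : FunPoint I M S) {r r' : M → M'} (hr : ContMDiff I I' ∞ r)
    (hr' : ContMDiff I I' ∞ r') (h : ∀ x, r x = r' x) : p.map hr = p.map hr' := by
  obtain rfl : r = r' := funext h
  rfl

lemma map_id (p : FunPoint I M S) {r : M → M} (hr : ContMDiff I I ∞ r) (h : ∀ x, r x = x) :
    p.map hr = p := by
  obtain rfl : r = id := funext h
  exact ext (fun _ => rfl) fun _ _ _ _ _ => rfl

end FunPoint

end Points

section PullbackOfManifolds

variable {E : Type u} [NormedAddCommGroup E] [NormedSpace ℝ E]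
  {H : Type u} [TopologicalSpace H] {I : ModelWithCorners ℝ E H}
  {M : Type u} [TopologicalSpace M] [ChartedSpace H M]
  {EZ : Type u} [NormedAddCommGroup EZ] [NormedSpace ℝ EZ]
  {HZ : Type u} [TopologicalSpace HZ] {IZ : ModelWithCorners ℝ EZ HZ}
  {Z : Type u} [TopologicalSpace Z] [ChartedSpace HZ Z]
  {EY : Type u} [NormedAddCommGroup EY] [NormedSpace ℝ EY]
  {HY : Type u} [TopologicalSpace HY] {IY : ModelWithCorners ℝ EY HY}
  {Y : Type u} [TopologicalSpace Y] [ChartedSpace HY Y]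
  {EX : Type u} [NormedAddCommGroup EX] [NormedSpace ℝ EX]
  {HX : Type u} [TopologicalSpace HX] {IX : ModelWithCorners ℝ EX HX}
  {X : Type u} [TopologicalSpace X] [ChartedSpace HX X]
  {S : DGSpace.{u}}

variable (I IZ IY IX) in
/-- A chart of `M` at `p` that exhibits `M` as a fibre product of `Z` and `Y` over `X`. -/
structure PullbackChart (r₁ : M → Z) (r₂ : M → Y) (σ : Y → X) (p : M) where
  N₂ : Opens Y
  NX : Opens X
  c₁ : Z → E
  c₂ : Y → E
  c₁_smooth : ContMDiffOn IZ 𝓘(ℝ, E) ∞ c₁ (chartDomain HZ (r₁ p))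
  c₂_smooth : ContMDiffOn IY 𝓘(ℝ, E) ∞ c₂ N₂
  maps₁ : ∀ x ∈ chartDomain H p, r₁ x ∈ chartDomain HZ (r₁ p)
  maps₂ : ∀ x ∈ chartDomain H p, r₂ x ∈ N₂
  mapsX : ∀ y ∈ N₂, σ y ∈ NX
  chart_eq : ∀ x ∈ chartDomain H p, extChartAt I p x = c₁ (r₁ x) + c₂ (r₂ x)
  A : E →ₗ[ℝ] EZ
  A_c₁ : ∀ z ∈ chartDomain HZ (r₁ p), A (c₁ z) = extChartAt IZ (r₁ p) z
  A_c₂ : ∀ y ∈ N₂, A (c₂ y) = 0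
  d : Y → EY
  d_smooth : ContMDiffOn IY 𝓘(ℝ, EY) ∞ d N₂
  dInv : EY → Y
  Ω : Opens EY
  dInv_smooth : ContMDiffOn 𝓘(ℝ, EY) IY ∞ dInv Ω
  d_mem : ∀ y ∈ N₂, d y ∈ Ω
  dInv_d : ∀ y ∈ N₂, dInv (d y) = y
  e : X → EY
  e_smooth : ContMDiffOn IX 𝓘(ℝ, EY) ∞ e NX
  B : E →ₗ[ℝ] EY
  B_c₁ : ∀ z ∈ chartDomain HZ (r₁ p), B (c₁ z) = 0
  d_eq : ∀ y ∈ N₂, d y = B (c₂ y) + e (σ y)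

/-- A linear function of a smooth vector-valued function. -/
def linFn {E' : Type u} [NormedAddCommGroup E'] [NormedSpace ℝ E']
    [FiniteDimensional ℝ E'] {N : Opens M} {c : M → E'} (hc : ContMDiffOn I 𝓘(ℝ, E') ∞ c N) :
    Module.Dual ℝ E' →ₗ[ℝ] smoothFunctions I N where
  toFun ℓ := mkFn N (fun x => ℓ (c x))
    ((LinearMap.toContinuousLinearMap ℓ).contDiff.contMDiff.comp_contMDiffOn hc)
  map_add' _ _ := rfl
  map_smul' _ _ := rfl

lemma FunHom.sharp_pullFn {f : S.body → M} {U₀ U : Opens S.body} (φ : FunHom I S f U₀) {r : M → Z}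
    (hr : ContMDiff I IZ ∞ r) {N : Opens M} {N' : Opens Z} (hN : ∀ x ∈ N, r x ∈ N') (h₀ : U ≤ U₀)
    (h : ∀ x ∈ U, f x ∈ N) (h' : ∀ x ∈ U, r (f x) ∈ N') (a : smoothFunctions IZ N') :
    φ.sharp N U h₀ h (pullFn hr.contMDiffOn hN a) = (FunHom.map φ hr).sharp N' U h₀ h' a :=
  FunHom.sharp_congr φ h₀ h _ fun _ _ _ => rfl

variable {r₁ : M → Z} {r₂ : M → Y} {σ : Y → X} {g : Z → X}
  [I.Boundaryless] [IsManifold I ∞ M] [IZ.Boundaryless] [IsManifold IZ ∞ Z]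

lemma funHom_eq_of_pullbackChart [FiniteDimensional ℝ E] (hS : IsDGManifold S)
    (pc : ∀ p, PullbackChart I IZ IY IX r₁ r₂ σ p) (hr₁ : ContMDiff I IZ ∞ r₁)
    (hr₂ : ContMDiff I IY ∞ r₂) {f : S.body → M} {U₀ : Opens S.body} (φ φ' : FunHom I S f U₀)
    (h₁ : ∀ N U h₀ h a, (FunHom.map φ hr₁).sharp N U h₀ h a = (FunHom.map φ' hr₁).sharp N U h₀ h a)
    (h₂ : ∀ N U h₀ h a, (FunHom.map φ hr₂).sharp N U h₀ h a = (FunHom.map φ' hr₂).sharp N U h₀ h a)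
    (N : Opens M) (U : Opens S.body) (h₀ : U ≤ U₀) (h : ∀ x ∈ U, f x ∈ N)
    (a : smoothFunctions I N) : φ.sharp N U h₀ h a = φ'.sharp N U h₀ h a := by
  refine FunHom.eq_of_coord (E' := E) hS φ φ' (fun y hy => ?_) N U h₀ h a
  refine ⟨extChartAt I (f y), hadamardAt_extChartAt (mem_chartDomain _), chartDomain H (f y),
    mem_chartDomain _, fun i N U h₀ h hN hc hyU => ?_⟩
  let p := pc (f y)
  set ℓ := (Module.finBasis ℝ E).coord i with hℓ
  have e : mkFn N (fun x => ℓ (extChartAt I (f y) x)) hc =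
      pullFn hr₁.contMDiffOn (fun x hx => p.maps₁ x (hN hx)) (linFn p.c₁_smooth ℓ) +
        pullFn hr₂.contMDiffOn (fun x hx => p.maps₂ x (hN hx)) (linFn p.c₂_smooth ℓ) :=
    smoothFunctions_ext fun x => (congrArg ℓ (p.chart_eq x (hN x.2))).trans (map_add ℓ _ _)
  have k₁ : ∀ x ∈ U, r₁ (f x) ∈ chartDomain HZ (r₁ (f y)) := fun x hx => p.maps₁ _ (hN (h x hx))
  have k₂ : ∀ x ∈ U, r₂ (f x) ∈ p.N₂ := fun x hx => p.maps₂ _ (hN (h x hx))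
  rw [e, map_add, map_add, FunHom.sharp_pullFn φ hr₁ _ h₀ h k₁, FunHom.sharp_pullFn φ hr₂ _ h₀ h k₂,
    FunHom.sharp_pullFn φ' hr₁ _ h₀ h k₁, FunHom.sharp_pullFn φ' hr₂ _ h₀ h k₂, h₁, h₂]

lemma exists_funHom_of_pullbackChart [FiniteDimensional ℝ E] [FiniteDimensional ℝ EZ]
    [FiniteDimensional ℝ EY] {p : M} (pc : PullbackChart I IZ IY IX r₁ r₂ σ p)
    (hr₁ : ContMDiff I IZ ∞ r₁) (hr₂ : ContMDiff I IY ∞ r₂) (hg : ContMDiff IZ IX ∞ g)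
    (hσ : ContMDiff IY IX ∞ σ) (comm : ∀ x, g (r₁ x) = σ (r₂ x)) {f : S.body → M}
    (L : LocalChart S) {U₀ : Opens S.body} (hU₀ : (U₀ : Set S.body) ⊆ L.e.source)
    (hf : ContinuousOn f U₀) (hfp : ∀ y ∈ U₀, f y ∈ chartDomain H p)
    (α : FunHom IZ S (r₁ ∘ f) U₀) (β : FunHom IY S (r₂ ∘ f) U₀)
    (compat : ∀ N U h₀ h h' a, (FunHom.map α hg).sharp N U h₀ h a = (FunHom.map β hσ).sharp N U h₀ h' a) :
    ∃ φ : FunHom I S f U₀,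
      (∀ N U h₀ h a, (FunHom.map φ hr₁).sharp N U h₀ h a = α.sharp N U h₀ h a) ∧
      ∀ N U h₀ h a, (FunHom.map φ hr₂).sharp N U h₀ h a = β.sharp N U h₀ h a := by
  have k₁ : ∀ x ∈ U₀, r₁ (f x) ∈ chartDomain HZ (r₁ p) := fun x hx => pc.maps₁ _ (hfp x hx)
  have k₂ : ∀ x ∈ U₀, r₂ (f x) ∈ pc.N₂ := fun x hx => pc.maps₂ _ (hfp x hx)
  obtain ⟨φ, hφ'⟩ := exists_funHom_of_chart (I := I) L hU₀ p hf hfp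
    ((α.sharp _ U₀ le_rfl k₁).toLinearMap ∘ₗ linFn pc.c₁_smooth +
      (β.sharp _ U₀ le_rfl k₂).toLinearMap ∘ₗ linFn pc.c₂_smooth)
    (fun ℓ => add_mem (FunHom.mem α le_rfl _ _) (FunHom.mem β le_rfl _ _)) (fun ℓ y => by
      change L.coeff hU₀ (α.sharp _ U₀ le_rfl k₁ _ + β.sharp _ U₀ le_rfl k₂ _) 0 y = _
      rw [map_add, Pi.add_apply, Pi.add_apply, FunHom.coeff_zero α L, FunHom.coeff_zero β L]
      exact (map_add ℓ _ _).symm.trans (congrArg ℓ (pc.chart_eq _ (hfp y y.2)).symm))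
  have hφ : ∀ (U : Opens S.body) (h₀ : U ≤ U₀) ℓ,
      φ.sharp (chartDomain H p) U h₀ (fun y hy => hfp y (h₀ hy)) (chartCoordFn I p ℓ) =
        α.sharp _ U h₀ (fun x hx => k₁ x (h₀ hx)) (linFn pc.c₁_smooth ℓ) +
          β.sharp _ U h₀ (fun x hx => k₂ x (h₀ hx)) (linFn pc.c₂_smooth ℓ) := by
    intro U h₀ ℓ
    refine (hφ' U h₀ ℓ).trans ((map_add (S.res h₀) _ _).trans ?_)
    exact congrArg₂ _ (α.sharp_res le_rfl h₀ le_rfl k₁ (fun x hx => k₁ x (h₀ hx)) _)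
      (β.sharp_res le_rfl h₀ le_rfl k₂ (fun x hx => k₂ x (h₀ hx)) _)
  have H₁ : ∀ N U h₀ h a, (FunHom.map φ hr₁).sharp N U h₀ h a = α.sharp N U h₀ h a := by
    refine FunHom.eq_of_coord (E' := EZ) L.isDG _ α (fun y hy => ?_)
    refine ⟨extChartAt IZ (r₁ p), hadamardAt_extChartAt (k₁ y hy), chartDomain HZ (r₁ p),
      k₁ y hy, fun i N U h₀ h hN hc hyU => ?_⟩
    set ℓ := (Module.finBasis ℝ EZ).coord i with hℓ
    have e1 : (FunHom.map φ hr₁).sharp N U h₀ h (mkFn N (fun x => ℓ (extChartAt IZ (r₁ p) x)) hc) =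
        φ.sharp (chartDomain H p) U h₀ (fun y hy => hfp y (h₀ hy)) (chartCoordFn I p (ℓ ∘ₗ pc.A)) := by
      refine FunHom.sharp_congr φ h₀ _ _ fun x hx hx' => ?_
      change ℓ (extChartAt IZ (r₁ p) (r₁ x)) = ℓ (pc.A (extChartAt I p x))
      rw [pc.chart_eq x hx', map_add, pc.A_c₁ _ (pc.maps₁ x hx'), pc.A_c₂ _ (pc.maps₂ x hx'), add_zero]
    have e2 : linFn pc.c₂_smooth (ℓ ∘ₗ pc.A) = 0 := smoothFunctions_ext fun y =>
      (congrArg ℓ (pc.A_c₂ y y.2)).trans (map_zero ℓ)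
    rw [e1, hφ, e2, map_zero, add_zero]
    refine FunHom.sharp_congr α h₀ _ _ fun z hz hz' => ?_
    exact congrArg ℓ (pc.A_c₁ z hz)
  refine ⟨φ, H₁, FunHom.eq_of_coord (E' := EY) L.isDG _ β (fun y hy => ?_)⟩
  refine ⟨pc.d, hadamardAt_of_leftInverse pc.N₂.2 pc.Ω.2 pc.d_smooth pc.dInv_smooth (k₂ y hy)
    (pc.d_mem _ (k₂ y hy)) pc.dInv_d, pc.N₂, k₂ y hy, fun i N U h₀ h hN hc hyU => ?_⟩
  set ℓ := (Module.finBasis ℝ EY).coord i with hℓ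
  have m₁ : ∀ x ∈ chartDomain H p, (g ∘ r₁) x ∈ pc.NX := fun x hx => by
    rw [Function.comp_apply, comm]
    exact pc.mapsX _ (pc.maps₂ x hx)
  have e1 : (FunHom.map φ hr₂).sharp N U h₀ h (mkFn N (fun x => ℓ (pc.d x)) hc) =
      φ.sharp (chartDomain H p) U h₀ (fun y hy => hfp y (h₀ hy)) (chartCoordFn I p (ℓ ∘ₗ pc.B) +
        pullFn (hg.comp hr₁).contMDiffOn m₁ (linFn pc.e_smooth ℓ)) := by
    refine FunHom.sharp_congr φ h₀ _ _ fun x hx hx' => ?_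
    change ℓ (pc.d (r₂ x)) = ℓ (pc.B (extChartAt I p x)) + ℓ (pc.e (g (r₁ x)))
    rw [pc.chart_eq x hx', map_add, pc.B_c₁ _ (pc.maps₁ x hx'), zero_add, comm, ← map_add,
      ← pc.d_eq _ (pc.maps₂ x hx')]
  have e2 : linFn pc.c₁_smooth (ℓ ∘ₗ pc.B) = 0 := smoothFunctions_ext fun z =>
    (congrArg ℓ (pc.B_c₁ z z.2)).trans (map_zero ℓ)
  have m₂ : ∀ x ∈ U, σ (r₂ (f x)) ∈ pc.NX := fun x hx => pc.mapsX _ (k₂ x (h₀ hx))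
  have m₃ : ∀ x ∈ U, g (r₁ (f x)) ∈ pc.NX := fun x hx => m₁ _ (hfp x (h₀ hx))
  have e3 : φ.sharp (chartDomain H p) U h₀ (fun y hy => hfp y (h₀ hy))
      (pullFn (hg.comp hr₁).contMDiffOn m₁ (linFn pc.e_smooth ℓ)) =
        β.sharp pc.N₂ U h₀ (fun x hx => k₂ x (h₀ hx))
          (pullFn hσ.contMDiffOn pc.mapsX (linFn pc.e_smooth ℓ)) := by
    rw [FunHom.sharp_pullFn β hσ _ _ _ m₂, ← compat _ U h₀ m₃]
    refine Eq.trans ?_ (H₁ (pc.NX.comap ⟨g, hg.continuous⟩) U h₀ m₃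
      (pullFn hg.contMDiffOn (fun _ hx => hx) (linFn pc.e_smooth ℓ)))
    exact FunHom.sharp_congr φ h₀ _ _ fun _ _ _ => rfl
  rw [e1, map_add, hφ, e2, map_zero, zero_add, e3, ← map_add]
  refine FunHom.sharp_congr β h₀ _ _ fun y hy hy' => ?_
  change ℓ (pc.B (pc.c₂ y)) + ℓ (pc.e (σ y)) = ℓ (pc.d y)
  rw [← map_add, ← pc.d_eq y hy]

/-- The universal property of fibre products of manifolds, for points with values in the functions on
a dg-manifold. -/
theorem existsUnique_funPoint [FinDimModel E M] [FinDimModel EZ Z] [FinDimModel EY Y]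
    (hS : IsDGManifold S) (pc : ∀ p, PullbackChart I IZ IY IX r₁ r₂ σ p)
    (hr₁ : ContMDiff I IZ ∞ r₁) (hr₂ : ContMDiff I IY ∞ r₂) (hg : ContMDiff IZ IX ∞ g)
    (hσ : ContMDiff IY IX ∞ σ) (comm : ∀ x, g (r₁ x) = σ (r₂ x))
    (inj : ∀ x x', r₁ x = r₁ x' → r₂ x = r₂ x' → x = x')
    (lift : ∀ (a : S.body → Z) (b : S.body → Y), Continuous a → Continuous b →
      (∀ y, g (a y) = σ (b y)) → ∃ c : S.body → M, Continuous c ∧ ∀ y, r₁ (c y) = a y ∧ r₂ (c y) = b y)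
    (α : FunPoint IZ Z S) (β : FunPoint IY Y S) (hαβ : α.map hg = β.map hσ) :
    ∃! γ : FunPoint I M S, γ.map hr₁ = α ∧ γ.map hr₂ = β := by
  obtain ⟨f, hf, hfab⟩ := lift α.base β.base α.cont β.cont (FunPoint.congr_base hαβ)
  obtain ⟨a, ha, α⟩ := α
  obtain ⟨b, hb, β⟩ := β
  obtain rfl : r₁ ∘ f = a := funext fun y => (hfab y).1
  obtain rfl : r₂ ∘ f = b := funext fun y => (hfab y).2
  have uniq : ∀ {U₀ : Opens S.body} (φ φ' : FunHom I S f U₀),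
      (∀ N U h₀ h a, (FunHom.map φ hr₁).sharp N U h₀ h a = (FunHom.map φ' hr₁).sharp N U h₀ h a) →
      (∀ N U h₀ h a, (FunHom.map φ hr₂).sharp N U h₀ h a = (FunHom.map φ' hr₂).sharp N U h₀ h a) →
      ∀ N U h₀ h a, φ.sharp N U h₀ h a = φ'.sharp N U h₀ h a := by
    intro U₀ φ φ' h₁ h₂ N U h₀ h a
    rcases isEmpty_or_nonempty M with hM | hM
    · exact hS.eq_of_locally fun x hx => (hM.false (f x)).elim
    · have := FinDimModel.finiteDimensional (E := E) hM
      exact funHom_eq_of_pullbackChart hS pc hr₁ hr₂ φ φ' h₁ h₂ N U h₀ h a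
  choose L hL using fun y => hS.exists_localChart y
  let D : S.body → Opens S.body := fun y => ⟨(L y).e.source, (L y).e.open_source⟩ ⊓
    ⟨f ⁻¹' (chartDomain H (f y)), (chartDomain H (f y)).2.preimage hf⟩
  have loc : ∀ y, ∃ φ : FunHom I S f (D y),
      (∀ N U h₀ h a, (FunHom.map φ hr₁).sharp N U h₀ h a = α.sharp N U le_top h a) ∧
      ∀ N U h₀ h a, (FunHom.map φ hr₂).sharp N U h₀ h a = β.sharp N U le_top h a := by
    intro y
    have := FinDimModel.finiteDimensional (E := E) (M := M) ⟨f y⟩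
    have := FinDimModel.finiteDimensional (E := EZ) (M := Z) ⟨r₁ (f y)⟩
    have := FinDimModel.finiteDimensional (E := EY) (M := Y) ⟨r₂ (f y)⟩
    exact exists_funHom_of_pullbackChart (pc (f y)) hr₁ hr₂ hg hσ comm (L y) (U₀ := D y)
      (fun x hx => hx.1) hf.continuousOn (fun x hx => hx.2) (α.restrict le_top) (β.restrict le_top)
      fun N U h₀ h h' a => FunPoint.congr_hom hαβ N U h h' a
  choose φ hφ₁ hφ₂ using loc
  obtain ⟨Φ, hΦ⟩ := PresheafHom.exists_glue hS (fun N => by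
      refine eq_top_iff.2 fun a _ => Submodule.mem_iSup_of_mem 0 ?_
      simp) hf D (fun y => ⟨hL y, mem_chartDomain _⟩) φ fun y y' N U hU hU' h a =>
    uniq ((φ y).restrict inf_le_left) ((φ y').restrict inf_le_right)
      (fun N U h₀ h a => (hφ₁ y N U (h₀.trans inf_le_left) h a).trans
        (hφ₁ y' N U (h₀.trans inf_le_right) h a).symm)
      (fun N U h₀ h a => (hφ₂ y N U (h₀.trans inf_le_left) h a).trans
        (hφ₂ y' N U (h₀.trans inf_le_right) h a).symm) N U (le_inf hU hU') h a
  have glue : ∀ {U : Opens S.body} {a b : S.O U},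
      (∀ y, S.res (inf_le_left : U ⊓ D y ≤ U) a = S.res inf_le_left b) → a = b := fun {U a b} h =>
    hS.eq_of_locally fun x hx => ⟨U ⊓ D x, inf_le_left, ⟨hx, hL x, mem_chartDomain _⟩, h x⟩
  have h₁ : ∀ N U h a, (FunHom.map Φ hr₁).sharp N U le_top h a = α.sharp N U le_top h a :=
    fun N U h a => glue fun y => by
      have h' : ∀ x ∈ U ⊓ D y, (r₁ ∘ f) x ∈ N := fun x hx => h x hx.1
      rw [(FunHom.map Φ hr₁).sharp_res le_rfl inf_le_left le_top h h',
        α.sharp_res le_rfl inf_le_left le_top h h', ← hφ₁ y N _ inf_le_right h']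
      exact hΦ y _ _ _ _ _
  have h₂ : ∀ N U h a, (FunHom.map Φ hr₂).sharp N U le_top h a = β.sharp N U le_top h a :=
    fun N U h a => glue fun y => by
      have h' : ∀ x ∈ U ⊓ D y, (r₂ ∘ f) x ∈ N := fun x hx => h x hx.1
      rw [(FunHom.map Φ hr₂).sharp_res le_rfl inf_le_left le_top h h',
        β.sharp_res le_rfl inf_le_left le_top h h', ← hφ₂ y N _ inf_le_right h']
      exact hΦ y _ _ _ _ _
  refine ⟨⟨f, hf, Φ⟩, ⟨FunPoint.ext (fun _ => rfl) fun N U h h' a => h₁ N U h a,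
    FunPoint.ext (fun _ => rfl) fun N U h h' a => h₂ N U h a⟩, ?_⟩
  rintro ⟨f', hf', Φ'⟩ ⟨e₁, e₂⟩
  obtain rfl : f' = f := funext fun y =>
    inj _ _ (FunPoint.congr_base e₁ y) (FunPoint.congr_base e₂ y)
  exact FunPoint.ext (fun _ => rfl) fun N U h h' a => uniq Φ' Φ
    (fun N U h₀ h a => (FunPoint.congr_hom e₁ N U h h a).trans (h₁ N U h a).symm)
    (fun N U h₀ h a => (FunPoint.congr_hom e₂ N U h h a).trans (h₂ N U h a).symm) N U le_top h a

end PullbackOfManifolds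

section PullSection

open ExteriorAlgebra (ι)

variable {E : Type u} [NormedAddCommGroup E] [NormedSpace ℝ E]
  {H : Type u} [TopologicalSpace H] {I : ModelWithCorners ℝ E H}
  {M : Type u} [TopologicalSpace M] [ChartedSpace H M]
  {V : Type u} [AddCommGroup V] [Module ℝ V]
  {E' : Type u} [NormedAddCommGroup E'] [NormedSpace ℝ E']
  {H' : Type u} [TopologicalSpace H'] {I' : ModelWithCorners ℝ E' H'}
  {M' : Type u} [TopologicalSpace M'] [ChartedSpace H' M']
  {V' : Type u} [AddCommGroup V'] [Module ℝ V']

/-- The fibre of a bundle map `(x, v, ν) ↦ (f x, df_x v, A x (v, ν))`. -/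
def bundleMap (I : ModelWithCorners ℝ E H) (I' : ModelWithCorners ℝ E' H') (f : M → M')
    (A : M → (E × V →ₗ[ℝ] V')) (x : M) : E × V →ₗ[ℝ] E' × V' :=
  (tangentMap I I' f x ∘ₗ LinearMap.fst ℝ E V).prod (A x)

lemma bundleMap_lin (f : M → M') (A : M → (E × V →ₗ[ℝ] V')) (x : M) (ξ : Module.Dual ℝ V') :
    ExteriorAlgebra.map (bundleMap I I' f A x).dualMap (ι ℝ (ξ ∘ₗ LinearMap.snd ℝ E' V')) =
      ι ℝ (ξ ∘ₗ A x) := by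
  rw [ExteriorAlgebra.map_apply_ι]
  rfl

lemma bundleMap_dAt (f : M → M') (A : M → (E × V →ₗ[ℝ] V')) {x : M} {F : M' → ℝ}
    (hF : MDifferentiableAt I' 𝓘(ℝ, ℝ) F (f x)) (hf : MDifferentiableAt I I' f x) :
    ExteriorAlgebra.map (bundleMap I I' f A x).dualMap (ι ℝ (dAt I' F (f x) ∘ₗ LinearMap.fst ℝ E' V')) =
      ι ℝ (dAt I (F ∘ f) x ∘ₗ LinearMap.fst ℝ E V) := by
  rw [ExteriorAlgebra.map_apply_ι, dAt_comp hF hf]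
  rfl

variable {f : M → M'} {A : M → (E × V →ₗ[ℝ] V')} {U₀ : Opens M}

lemma pullSection_smooth (hf : ContMDiffOn I I' ∞ f U₀)
    (hA : ∀ ξ : Module.Dual ℝ V', (fun x : U₀ => ι ℝ (ξ ∘ₗ A x)) ∈ smoothSections I M V U₀)
    (W : Opens M') (s : smoothSections I' M' V' W) :
    ∀ (U : Opens M) (h₀ : U ≤ U₀) (h : ∀ x ∈ U, f x ∈ W),
      (fun x : U => ExteriorAlgebra.map (bundleMap I I' f A x).dualMap (s.1 ⟨f x, h x x.2⟩)) ∈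
        smoothSections I M V U := by
  refine section_induction (P := fun W s => ∀ (U : Opens M) (h₀ : U ≤ U₀) (h : ∀ x ∈ U, f x ∈ W),
      (fun x : U => ExteriorAlgebra.map (bundleMap I I' f A x).dualMap (s.1 ⟨f x, h x x.2⟩)) ∈
        smoothSections I M V U) ?_ ?_ ?_ ?_ ?_ ?_ W s
  · intro W U h₀ h
    convert (1 : smoothSections I M V U).2 using 1
    funext x
    rw [one_apply, map_one, one_apply]
  · intro W s t hs ht U h₀ h
    convert add_mem (hs U h₀ h) (ht U h₀ h) using 1
    funext x
    rw [add_apply, map_add]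
    rfl
  · intro W F hF t ht U h₀ h
    convert mul_mem (fn V U (F ∘ f) (hF.comp (hf.mono h₀) h)).2 (ht U h₀ h) using 1
    funext x
    rw [mul_apply, map_mul, fn_apply, AlgHom.commutes]
    rfl
  · intro W F hF t ht U h₀ h
    convert mul_mem (dfn V U (F ∘ f) (hF.comp (hf.mono h₀) h)).2 (ht U h₀ h) using 1
    funext x
    rw [mul_apply, map_mul, dfn_apply, Pi.mul_apply, dfn_apply, bundleMap_dAt]
    · exact hF.mdifferentiableAt_of_mem (by simp) W.2 (h x x.2)
    · exact hf.mdifferentiableAt_of_mem (by simp) U₀.2 (h₀ x.2)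
  · intro W ξ t ht U h₀ h
    convert mul_mem (restrictSections I M V h₀ ⟨_, hA ξ⟩).2 (ht U h₀ h) using 1
    funext x
    rw [mul_apply, map_mul, lin_apply, Pi.mul_apply, bundleMap_lin]
    rfl
  · intro W s hs U h₀ h
    refine smoothSections_of_locally fun x hx => ?_
    obtain ⟨N, hN, hxN, hP⟩ := hs (f x) (h x hx)
    let U' : Opens M := ⟨U ∩ f ⁻¹' N, (hf.continuousOn.mono h₀).isOpen_inter_preimage U.2 N.2⟩
    have hU' : U' ≤ U := fun y hy => hy.1
    exact ⟨U', hU', ⟨hx, hxN⟩, hP U' (hU'.trans h₀) fun y hy => hy.2⟩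

/-- The pullback of sections along a bundle map. -/
def pullSection (hf : ContMDiffOn I I' ∞ f U₀)
    (hA : ∀ ξ : Module.Dual ℝ V', (fun x : U₀ => ι ℝ (ξ ∘ₗ A x)) ∈ smoothSections I M V U₀)
    (W : Opens M') (U : Opens M) (h₀ : U ≤ U₀) (h : ∀ x ∈ U, f x ∈ W) :
    smoothSections I' M' V' W →ₐ[ℝ] smoothSections I M V U where
  toFun s := ⟨_, pullSection_smooth hf hA W s U h₀ h⟩
  map_one' := section_ext fun x => map_one _
  map_mul' s t := section_ext fun x => map_mul _ _ _
  map_zero' := section_ext fun x => map_zero _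
  map_add' s t := section_ext fun x => map_add _ _ _
  commutes' r := section_ext fun x => AlgHom.commutes _ r

lemma pullSection_apply (hf : ContMDiffOn I I' ∞ f U₀)
    (hA : ∀ ξ : Module.Dual ℝ V', (fun x : U₀ => ι ℝ (ξ ∘ₗ A x)) ∈ smoothSections I M V U₀)
    (W : Opens M') (U : Opens M) (h₀ : U ≤ U₀) (h : ∀ x ∈ U, f x ∈ W) (s) (x : U) :
    (pullSection hf hA W U h₀ h s).1 x =
      ExteriorAlgebra.map (bundleMap I I' f A x).dualMap (s.1 ⟨f x, h x x.2⟩) := rfl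

lemma pullSection_fn (hf : ContMDiffOn I I' ∞ f U₀)
    (hA : ∀ ξ : Module.Dual ℝ V', (fun x : U₀ => ι ℝ (ξ ∘ₗ A x)) ∈ smoothSections I M V U₀)
    (W : Opens M') (U : Opens M) (h₀ : U ≤ U₀) (h : ∀ x ∈ U, f x ∈ W) (F hF) :
    pullSection hf hA W U h₀ h (fn V' W F hF) = fn V U (F ∘ f) (hF.comp (hf.mono h₀) h) :=
  section_ext fun x => by
    rw [pullSection_apply, fn_apply, fn_apply, AlgHom.commutes]
    rfl

lemma pullSection_dfn (hf : ContMDiffOn I I' ∞ f U₀)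
    (hA : ∀ ξ : Module.Dual ℝ V', (fun x : U₀ => ι ℝ (ξ ∘ₗ A x)) ∈ smoothSections I M V U₀)
    (W : Opens M') (U : Opens M) (h₀ : U ≤ U₀) (h : ∀ x ∈ U, f x ∈ W) (F hF) :
    pullSection hf hA W U h₀ h (dfn V' W F hF) = dfn V U (F ∘ f) (hF.comp (hf.mono h₀) h) :=
  section_ext fun x => by
    rw [pullSection_apply, dfn_apply, dfn_apply, bundleMap_dAt]
    · exact hF.mdifferentiableAt_of_mem (by simp) W.2 (h x x.2)
    · exact hf.mdifferentiableAt_of_mem (by simp) U₀.2 (h₀ x.2)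

lemma pullSection_mem (hf : ContMDiffOn I I' ∞ f U₀)
    (hA : ∀ ξ : Module.Dual ℝ V', (fun x : U₀ => ι ℝ (ξ ∘ₗ A x)) ∈ smoothSections I M V U₀)
    (W : Opens M') (U : Opens M) (h₀ : U ≤ U₀) (h : ∀ x ∈ U, f x ∈ W) {k : ℤ}
    {s : smoothSections I' M' V' W} (hs : s ∈ sectionsDeg I' M' V' W k) :
    pullSection hf hA W U h₀ h s ∈ sectionsDeg I M V U k :=
  fun x => map_mem_fibreDeg _ (hs _)

end PullSection

section OfMap

open ExteriorAlgebra (ι)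

variable {E : Type u} [NormedAddCommGroup E] [NormedSpace ℝ E]
  {H : Type u} [TopologicalSpace H] {I : ModelWithCorners ℝ E H} [I.Boundaryless]
  {M : Type u} [TopologicalSpace M] [ChartedSpace H M] [IsManifold I ∞ M]
  {V : Type u} [AddCommGroup V] [Module ℝ V] [Module.Finite ℝ V] [Bracket V V]
  {E' : Type u} [NormedAddCommGroup E'] [NormedSpace ℝ E']
  {H' : Type u} [TopologicalSpace H'] {I' : ModelWithCorners ℝ E' H'} [I'.Boundaryless]
  {M' : Type u} [TopologicalSpace M'] [ChartedSpace H' M'] [IsManifold I' ∞ M']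
  {V' : Type u} [AddCommGroup V'] [Module ℝ V'] [Module.Finite ℝ V'] [Bracket V' V']
  {S : DGSpace.{u}}

variable (I I' M V V') in
/-- The linear forms on `V'` as sections: a smooth fibrewise linear map to `V'` that satisfies the
Maurer–Cartan equation. -/
structure FlatForm (A : M → (E × V →ₗ[ℝ] V')) where
  lam : Module.Dual ℝ V' →ₗ[ℝ] smoothSections I M V ⊤
  lam_apply : ∀ ξ x, (lam ξ).1 x = ι ℝ (ξ ∘ₗ A x)
  d_lam : ∀ ξ, deRhamCE I M V ⊤ (lam ξ) = maurerCartan lam ξ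

lemma FlatForm.smooth {A : M → (E × V →ₗ[ℝ] V')} (hA : FlatForm I M V V' A) (ξ : Module.Dual ℝ V') :
    (fun x : (⊤ : Opens M) => ι ℝ (ξ ∘ₗ A x)) ∈ smoothSections I M V ⊤ := by
  have : (fun x : (⊤ : Opens M) => ι ℝ (ξ ∘ₗ A x)) = (hA.lam ξ).1 :=
    funext fun x => (hA.lam_apply ξ x).symm
  rw [this]
  exact (hA.lam ξ).2

/-- The pullback of sections along a bundle map that is given by a flat form. -/
def FlatForm.pull {f : M → M'} {A : M → (E × V →ₗ[ℝ] V')} (hA : FlatForm I M V V' A)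
    (hf : ContMDiff I I' ∞ f) (W : Opens M') (U : Opens M) (h : ∀ x ∈ U, f x ∈ W) :
    smoothSections I' M' V' W →ₐ[ℝ] smoothSections I M V U :=
  pullSection hf.contMDiffOn hA.smooth W U le_top h

lemma FlatForm.pull_apply {f : M → M'} {A : M → (E × V →ₗ[ℝ] V')} (hA : FlatForm I M V V' A)
    (hf : ContMDiff I I' ∞ f) (W : Opens M') (U : Opens M) (h : ∀ x ∈ U, f x ∈ W)
    (s : smoothSections I' M' V' W) (x : U) : (hA.pull hf W U h s).1 x =
      ExteriorAlgebra.map (bundleMap I I' f A x).dualMap (s.1 ⟨f x, h x x.2⟩) := rfl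

lemma FlatForm.pull_fn {f : M → M'} {A : M → (E × V →ₗ[ℝ] V')} (hA : FlatForm I M V V' A)
    (hf : ContMDiff I I' ∞ f) (W : Opens M') (U : Opens M) (h : ∀ x ∈ U, f x ∈ W) (F hF) :
    hA.pull hf W U h (fn V' W F hF) = fn V U (F ∘ f) (hF.comp hf.contMDiffOn h) :=
  pullSection_fn hf.contMDiffOn hA.smooth W U le_top h F hF

lemma FlatForm.pull_dfn {f : M → M'} {A : M → (E × V →ₗ[ℝ] V')} (hA : FlatForm I M V V' A)
    (hf : ContMDiff I I' ∞ f) (W : Opens M') (U : Opens M) (h : ∀ x ∈ U, f x ∈ W) (F hF) :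
    hA.pull hf W U h (dfn V' W F hF) = dfn V U (F ∘ f) (hF.comp hf.contMDiffOn h) :=
  pullSection_dfn hf.contMDiffOn hA.smooth W U le_top h F hF

lemma FlatForm.pull_lin {f : M → M'} {A : M → (E × V →ₗ[ℝ] V')} (hA : FlatForm I M V V' A)
    (hf : ContMDiff I I' ∞ f) (W : Opens M') (U : Opens M) (h : ∀ x ∈ U, f x ∈ W)
    (ξ : Module.Dual ℝ V') :
    hA.pull hf W U h (lin I' W ξ) = restrictSections I M V le_top (hA.lam ξ) :=
  section_ext fun x => by
    rw [FlatForm.pull_apply, lin_apply, bundleMap_lin, res_apply, hA.lam_apply]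

/-- The pullback of sections along a bundle map, as a homomorphism of sheaves. -/
def pullFormHom {f : M → M'} {A : M → (E × V →ₗ[ℝ] V')} (hf : ContMDiff I I' ∞ f)
    (hA : FlatForm I M V V' A) : FormHom I' V' (tangentTimes I M V) f ⊤ where
  cont := hf.continuous.continuousOn
  sharp W U h₀ h := hA.pull hf W U h
  sharp_res _ _ _ _ _ _ := rfl
  sharp_mem W U h₀ h k s hs := pullSection_mem hf.contMDiffOn hA.smooth W U h₀ h hs

variable [FinDimModel E M] [FinDimModel E' M'] [T2Space M] [SecondCountableTopology M] [LieLaws V]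

lemma FlatForm.pull_d {f : M → M'} {A : M → (E × V →ₗ[ℝ] V')} (hA : FlatForm I M V V' A)
    (hf : ContMDiff I I' ∞ f) (W : Opens M') (U : Opens M) (h : ∀ x ∈ U, f x ∈ W)
    (s : smoothSections I' M' V' W) :
    hA.pull hf W U h (deRhamCE I' M' V' W s) = deRhamCE I M V U (hA.pull hf W U h s) := by
  have h1 : ∀ (W : Opens M') (U : Opens M) (h₀ : U ≤ ⊤) (h : ∀ x ∈ U, f x ∈ W) (F hF),
      hA.pull hf W U h (dfn V' W F hF) = deRhamCE I M V U (hA.pull hf W U h (fn V' W F hF)) := by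
    intro W U h₀ h F hF
    rw [hA.pull_dfn, hA.pull_fn, d_fn]
  have h2 : ∀ (W : Opens M') (U : Opens M) (h₀ : U ≤ ⊤) (h : ∀ x ∈ U, f x ∈ W) (ξ),
      hA.pull hf W U h (ceSection I' W ξ) = deRhamCE I M V U (hA.pull hf W U h (lin I' W ξ)) := by
    intro W U h₀ h ξ
    have e1 : (hA.pull hf W U h).toLinearMap ∘ₗ linHom I' W =
        (restrictSections I M V (le_top : U ≤ ⊤)).toLinearMap ∘ₗ hA.lam :=
      LinearMap.ext fun ξ => hA.pull_lin hf W U h ξ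
    rw [ceSection_eq, map_maurerCartan, e1, ← map_maurerCartan, ← hA.d_lam,
      (isDeRhamCE_deRhamCE I M V).res, hA.pull_lin]
  exact FormHom.map_d (isDGManifold_tangentTimes I M V) (pullFormHom hf hA) h1 h2 W s U le_top h

/-- The morphism that is given by a smooth map and a flat form. -/
def DGHom.ofMap {f : M → M'} {A : M → (E × V →ₗ[ℝ] V')} (hf : ContMDiff I I' ∞ f)
    (hA : FlatForm I M V V' A) : DGHom (tangentTimes I M V) (tangentTimes I' M' V') :=
  DGHom.ofFormHom (pullFormHom hf hA) hf.continuous (hA.pull_d hf)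

lemma DGHom.isGivenBy_ofMap {f : M → M'} {A : M → (E × V →ₗ[ℝ] V')} (hf : ContMDiff I I' ∞ f)
    (hA : FlatForm I M V V' A) : IsGivenBy (DGHom.ofMap hf hA) f A :=
  ⟨fun _ => rfl, fun _ _ _ _ _ => rfl⟩

/-- The underlying point of `M` of a point of `T[1]M × V[1]`. -/
def DGHom.point {S : DGSpace.{u}} {E : Type u} [NormedAddCommGroup E] [NormedSpace ℝ E]
    {H : Type u} [TopologicalSpace H] {I : ModelWithCorners ℝ E H}
    {M : Type u} [TopologicalSpace M] [ChartedSpace H M] [I.Boundaryless] [IsManifold I ∞ M]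
    {V : Type u} [AddCommGroup V] [Module ℝ V] [Module.Finite ℝ V] [Bracket V V]
    (Φ : DGHom S (tangentTimes I M V)) : FunPoint I M S :=
  ⟨Φ.toBase, Φ.continuous_toBase, Φ.funHom⟩

lemma DGHom.point_comp_ofMap {f : M → M'} {A : M → (E × V →ₗ[ℝ] V')} (hf : ContMDiff I I' ∞ f)
    (hA : FlatForm I M V V' A) (Φ : DGHom S (tangentTimes I M V)) :
    (Φ ⋙ᵈ DGHom.ofMap hf hA).point = Φ.point.map hf := by
  refine FunPoint.ext (fun _ => rfl) fun N U h h' a => ?_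
  obtain ⟨F, hF, rfl⟩ := exists_mkFn a
  refine congrArg (Φ.formHom.sharp (N.comap ⟨f, hf.continuous⟩) U le_top h) ?_
  exact hA.pull_fn hf N _ (fun _ hx => hx) F hF

lemma DGHom.lam_comp_ofMap {f : M → M'} {A : M → (E × V →ₗ[ℝ] V')} (hf : ContMDiff I I' ∞ f)
    (hA : FlatForm I M V V' A) (Φ : DGHom S (tangentTimes I M V)) (ξ : Module.Dual ℝ V') :
    (Φ ⋙ᵈ DGHom.ofMap hf hA).lam ξ =
      Φ.formHom.sharp ⊤ ⊤ le_top (fun _ _ => trivial) (hA.lam ξ) :=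
  congrArg (Φ.formHom.sharp ⊤ ⊤ le_top fun _ _ => trivial)
    (hA.pull_lin hf ⊤ ⊤ (fun _ _ => trivial) ξ)

lemma DGHom.ext_point {Φ Ψ : DGHom S (tangentTimes I M V)} (hS : IsDGManifold S)
    (hp : Φ.point = Ψ.point) (hl : ∀ ξ, Φ.lam ξ = Ψ.lam ξ) : Φ = Ψ :=
  DGHom.ext_tangentTimes hS (FunPoint.congr_base hp)
    (fun N U h h' a => FunPoint.congr_hom hp N U h h' a) hl

lemma DGHom.exists_of_point (hS : IsDGManifold S) (γ : FunPoint I M S)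
    (lam : Module.Dual ℝ V →ₗ[ℝ] S.O ⊤) (lam_mem : ∀ ξ, lam ξ ∈ S.deg ⊤ 1)
    (d_lam : ∀ ξ, S.d ⊤ (lam ξ) = maurerCartan lam ξ) :
    ∃ Φ : DGHom S (tangentTimes I M V), Φ.point = γ ∧ ∀ ξ, Φ.lam ξ = lam ξ := by
  obtain ⟨Φ, h1, h2, h3⟩ := exists_dgHom hS γ.cont γ.hom lam lam_mem d_lam
  exact ⟨Φ, FunPoint.ext h1 h2, h3⟩

end OfMap

section Generalities

/-- The identity of a dg-manifold. -/
def DGHom.identity {X : DGSpace.{u}} (hX : IsDGManifold X) : DGHom X X where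
  base := ContinuousMap.id _
  sharp V U h := X.res (show U ≤ V from h)
  sharp_res hV hU h h' a := (X.res_res _ _ a).trans (X.res_res _ _ a).symm
  sharp_mem V U h k a ha := hX.res_mem _ k a ha
  sharp_d V U h a := hX.res_d _ a

lemma DGHom.comp_assoc {X Y Z W : DGSpace.{u}} (a : DGHom X Y) (b : DGHom Y Z) (c : DGHom Z W) :
    (a ⋙ᵈ b) ⋙ᵈ c = a ⋙ᵈ b ⋙ᵈ c := rfl

/-- Composition with an involution preserves surjective submersions. -/
lemma IsSurjectiveSubmersion.involution_comp {X Y : DGSpace.{u}} {φ : DGHom X Y}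
    (hφ : IsSurjectiveSubmersion φ) (hX : IsDGManifold X) {K : DGHom X X}
    (hK : K ⋙ᵈ K = DGHom.identity hX) : IsSurjectiveSubmersion (K ⋙ᵈ φ) := by
  have hb : ∀ x, K.base (K.base x) = x := fun x =>
    DFunLike.congr_fun (congrArg DGHom.base hK) x
  have hs : ∀ (L : DGHom X X) (hL : L = DGHom.identity hX) W U h (a : X.O W),
      ∃ hU : U ≤ W, L.sharp W U h a = X.res hU a := by
    rintro _ rfl W U h a
    exact ⟨h, rfl⟩
  constructor
  · intro y
    obtain ⟨x, hx⟩ := hφ.1 y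
    exact ⟨K.base x, (congrArg φ.base (hb x)).trans hx⟩
  · intro x k v
    obtain ⟨u, hu⟩ := hφ.2 (K.base x) k v
    have hmem : ∀ {U : Opens X.body}, x ∈ U → K.base x ∈ U.comap K.base := fun {U} hx => by
      change K.base (K.base x) ∈ U
      rwa [hb]
    refine ⟨{ ev := fun U hU => (u.ev (U.comap K.base) (hmem hU)).comp (K.sharp U _ fun _ h => h)
              ev_res := ?_
              ev_deg := fun U hU j a ha hj => u.ev_deg _ _ j _ (K.sharp_mem _ _ _ j a ha) hj
              vec := fun U hU => (u.vec (U.comap K.base) (hmem hU)) ∘ₗ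
                (K.sharp U _ fun _ h => h).toLinearMap
              vec_res := ?_
              vec_deg := fun U hU j a ha hj => u.vec_deg _ _ j _ (K.sharp_mem _ _ _ j a ha) hj
              vec_mul := ?_ }, ?_⟩
    · intro U W h hU hW a
      have hc : W.comap K.base ≤ U.comap K.base := fun y hy => h hy
      have := K.sharp_res h hc (fun _ h => h) (fun _ h => h) a
      change u.ev _ _ (K.sharp W _ _ (X.res h a)) = u.ev _ _ (K.sharp U _ _ a)
      rw [← this, u.ev_res hc (hmem hU)]
    · intro U W h hU hW a
      have hc : W.comap K.base ≤ U.comap K.base := fun y hy => h hy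
      have := K.sharp_res h hc (fun _ h => h) (fun _ h => h) a
      change u.vec _ _ (K.sharp W _ _ (X.res h a)) = u.vec _ _ (K.sharp U _ _ a)
      rw [← this, u.vec_res hc (hmem hU)]
    · intro U hU a b
      change u.vec _ _ (K.sharp U _ _ (a * b)) = _
      rw [map_mul, u.vec_mul]
      rfl
    · intro V hV a
      obtain ⟨hU, e⟩ := hs _ hK (V.comap φ.base) ((V.comap φ.base).comap (K ⋙ᵈ K).base)
        (fun _ h => h) (φ.sharp V _ (fun _ h => h) a)
      refine (congrArg (u.vec _ _) e).trans ?_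
      exact (u.vec_res hU (show K.base x ∈ V.comap φ.base from hV) _ _).trans (hu V hV a)

/-- Composites in a groupoid are unique. -/
lemma DGLieGroupoid.comp_unique {G₀ G₁ G₂ S : DGSpace.{u}} (𝒢 : DGLieGroupoid G₀ G₁ G₂)
    (hS : IsDGManifold S) {a b c c' : DGHom S G₁} (h : 𝒢.Comp a b c) (h' : 𝒢.Comp a b c') : c = c' := by
  obtain ⟨z, hz₁, hz₂, rfl⟩ := h
  obtain ⟨z', hz₁', hz₂', rfl⟩ := h'
  have hab : a ⋙ᵈ 𝒢.src = b ⋙ᵈ 𝒢.tgt := by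
    rw [← hz₁, ← hz₂, DGHom.comp_assoc, DGHom.comp_assoc, 𝒢.isPullback.1]
  rw [(𝒢.isPullback.2 S hS a b hab).unique ⟨hz₁, hz₂⟩ ⟨hz₁', hz₂'⟩]

/-- A square of groupoids is a pullback if it is a pullback on objects and on morphisms. -/
theorem isGroupoidPullback_of_isPullback {P₀ P₁ P₂ A₀ A₁ A₂ B₀ B₁ B₂ C₀ C₁ C₂ : DGSpace.{u}}
    {𝒬 : DGLieGroupoid P₀ P₁ P₂} {𝒜 : DGLieGroupoid A₀ A₁ A₂}
    {ℬ : DGLieGroupoid B₀ B₁ B₂} {𝒞 : DGLieGroupoid C₀ C₁ C₂}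
    {p : DGFunctor 𝒬 𝒜} {q : DGFunctor 𝒬 ℬ} {f : DGFunctor 𝒜 𝒞} {g : DGFunctor ℬ 𝒞}
    (hobj : IsPullback p.obj q.obj f.obj g.obj) (hmor : IsPullback p.mor q.mor f.mor g.mor) :
    IsGroupoidPullback p q f g := by
  refine ⟨⟨hobj.1, hmor.1⟩, fun S₀ S₁ S₂ 𝒮 Ψ Φ h₀ h₁ => ?_⟩
  obtain ⟨o, ⟨ho₁, ho₂⟩, ho⟩ := hobj.2 S₀ 𝒮.isDGManifold₀ Ψ.obj Φ.obj h₀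
  obtain ⟨m, ⟨hm₁, hm₂⟩, hm⟩ := hmor.2 S₁ 𝒮.isDGManifold₁ Ψ.mor Φ.mor h₁
  have ext₀ : ∀ {S : DGSpace.{u}} (_ : IsDGManifold S) {a b : DGHom S P₀}, a ⋙ᵈ p.obj = b ⋙ᵈ p.obj →
      a ⋙ᵈ q.obj = b ⋙ᵈ q.obj → a = b := fun {S} hS {a b} e₁ e₂ =>
    (hobj.2 S hS (b ⋙ᵈ p.obj) (b ⋙ᵈ q.obj) (by
      rw [DGHom.comp_assoc, hobj.1, DGHom.comp_assoc])).unique ⟨e₁, e₂⟩ ⟨rfl, rfl⟩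
  have ext₁ : ∀ {S : DGSpace.{u}} (_ : IsDGManifold S) {a b : DGHom S P₁}, a ⋙ᵈ p.mor = b ⋙ᵈ p.mor →
      a ⋙ᵈ q.mor = b ⋙ᵈ q.mor → a = b := fun {S} hS {a b} e₁ e₂ =>
    (hmor.2 S hS (b ⋙ᵈ p.mor) (b ⋙ᵈ q.mor) (by
      rw [DGHom.comp_assoc, hmor.1, DGHom.comp_assoc])).unique ⟨e₁, e₂⟩ ⟨rfl, rfl⟩
  have hsrc : m ⋙ᵈ 𝒬.src = 𝒮.src ⋙ᵈ o := by
    refine ext₀ 𝒮.isDGManifold₁ ?_ ?_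
    · rw [DGHom.comp_assoc, ← p.map_src, ← DGHom.comp_assoc, hm₁, Ψ.map_src, DGHom.comp_assoc, ho₁]
    · rw [DGHom.comp_assoc, ← q.map_src, ← DGHom.comp_assoc, hm₂, Φ.map_src, DGHom.comp_assoc, ho₂]
  have htgt : m ⋙ᵈ 𝒬.tgt = 𝒮.tgt ⋙ᵈ o := by
    refine ext₀ 𝒮.isDGManifold₁ ?_ ?_
    · rw [DGHom.comp_assoc, ← p.map_tgt, ← DGHom.comp_assoc, hm₁, Ψ.map_tgt, DGHom.comp_assoc, ho₁]
    · rw [DGHom.comp_assoc, ← q.map_tgt, ← DGHom.comp_assoc, hm₂, Φ.map_tgt, DGHom.comp_assoc, ho₂]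
  have hone : 𝒮.one ⋙ᵈ m = o ⋙ᵈ 𝒬.one := by
    refine ext₁ 𝒮.isDGManifold₀ ?_ ?_
    · rw [DGHom.comp_assoc, hm₁, Ψ.map_one, DGHom.comp_assoc, p.map_one, ← DGHom.comp_assoc, ho₁]
    · rw [DGHom.comp_assoc, hm₂, Φ.map_one, DGHom.comp_assoc, q.map_one, ← DGHom.comp_assoc, ho₂]
  obtain ⟨z, ⟨hz₁, hz₂⟩, -⟩ := 𝒬.isPullback.2 S₂ 𝒮.isDGManifold₂ (𝒮.fst ⋙ᵈ m) (𝒮.snd ⋙ᵈ m) (by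
    rw [DGHom.comp_assoc, hsrc, DGHom.comp_assoc, htgt, ← DGHom.comp_assoc, 𝒮.isPullback.1,
      DGHom.comp_assoc])
  have hmul : 𝒬.Comp (𝒮.fst ⋙ᵈ m) (𝒮.snd ⋙ᵈ m) (𝒮.mul ⋙ᵈ m) := by
    refine ⟨z, hz₁, hz₂, ext₁ 𝒮.isDGManifold₂ ?_ ?_⟩
    · refine 𝒜.comp_unique 𝒮.isDGManifold₂ (a := 𝒮.fst ⋙ᵈ Ψ.mor) (b := 𝒮.snd ⋙ᵈ Ψ.mor) ?_ ?_
      · obtain ⟨w, hw₁, hw₂, hw₃⟩ := p.map_mul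
        refine ⟨z ⋙ᵈ w, ?_, ?_, ?_⟩
        · rw [DGHom.comp_assoc, hw₁, ← DGHom.comp_assoc, hz₁, DGHom.comp_assoc, hm₁]
        · rw [DGHom.comp_assoc, hw₂, ← DGHom.comp_assoc, hz₂, DGHom.comp_assoc, hm₁]
        · rw [DGHom.comp_assoc, hw₃, DGHom.comp_assoc]
      · rw [DGHom.comp_assoc, hm₁]
        exact Ψ.map_mul
    · refine ℬ.comp_unique 𝒮.isDGManifold₂ (a := 𝒮.fst ⋙ᵈ Φ.mor) (b := 𝒮.snd ⋙ᵈ Φ.mor) ?_ ?_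
      · obtain ⟨w, hw₁, hw₂, hw₃⟩ := q.map_mul
        refine ⟨z ⋙ᵈ w, ?_, ?_, ?_⟩
        · rw [DGHom.comp_assoc, hw₁, ← DGHom.comp_assoc, hz₁, DGHom.comp_assoc, hm₂]
        · rw [DGHom.comp_assoc, hw₂, ← DGHom.comp_assoc, hz₂, DGHom.comp_assoc, hm₂]
        · rw [DGHom.comp_assoc, hw₃, DGHom.comp_assoc]
      · rw [DGHom.comp_assoc, hm₂]
        exact Φ.map_mul
  refine ⟨⟨o, m, hsrc, htgt, hone, hmul⟩, ⟨⟨ho₁, hm₁⟩, ho₂, hm₂⟩, ?_⟩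
  rintro Υ ⟨⟨e₁, e₂⟩, e₃, e₄⟩
  exact DGFunctor.ext (ho _ ⟨e₁, e₃⟩) (hm _ ⟨e₂, e₄⟩)

end Generalities

section FlatForms

open ExteriorAlgebra (ι)

variable {E : Type u} [NormedAddCommGroup E] [NormedSpace ℝ E]
  {H : Type u} [TopologicalSpace H] {I : ModelWithCorners ℝ E H} [I.Boundaryless]
  {M : Type u} [TopologicalSpace M] [ChartedSpace H M] [IsManifold I ∞ M]
  {V : Type u} [AddCommGroup V] [Module ℝ V] [Module.Finite ℝ V] [Bracket V V]
  {E' : Type u} [NormedAddCommGroup E'] [NormedSpace ℝ E']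
  {H' : Type u} [TopologicalSpace H'] {I' : ModelWithCorners ℝ E' H'} [I'.Boundaryless]
  {M' : Type u} [TopologicalSpace M'] [ChartedSpace H' M'] [IsManifold I' ∞ M']
  {V' : Type u} [AddCommGroup V'] [Module ℝ V'] [Module.Finite ℝ V'] [Bracket V' V']
  {V'' : Type u} [AddCommGroup V''] [Module ℝ V''] [Module.Finite ℝ V''] [Bracket V'' V'']
  {S : DGSpace.{u}}
  [FinDimModel E M] [FinDimModel E' M'] [T2Space M] [SecondCountableTopology M] [LieLaws V]

variable (I M V) in
/-- The tautological flat form. -/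
def FlatForm.snd : FlatForm I M V V fun _ => LinearMap.snd ℝ E V where
  lam := linHom I ⊤
  lam_apply _ _ := rfl
  d_lam ξ := by rw [linHom_apply, d_lin, ceSection_eq]

variable (I M V) in
/-- The zero form. -/
def FlatForm.zero : FlatForm I M V PUnit.{u + 1} fun _ => 0 where
  lam := 0
  lam_apply ξ x := by
    rw [LinearMap.comp_zero, map_zero]
    rfl
  d_lam ξ := by simp [maurerCartan]

/-- The pullback of a flat form. -/
def FlatForm.comp {f : M → M'} {A : M → (E × V →ₗ[ℝ] V')} (hA : FlatForm I M V V' A)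
    (hf : ContMDiff I I' ∞ f) {B : M' → (E' × V' →ₗ[ℝ] V'')} (hB : FlatForm I' M' V' V'' B) :
    FlatForm I M V V'' fun x => B (f x) ∘ₗ bundleMap I I' f A x where
  lam := (hA.pull hf ⊤ ⊤ fun _ _ => trivial).toLinearMap ∘ₗ hB.lam
  lam_apply ξ x := by
    refine (hA.pull_apply hf ⊤ ⊤ (fun _ _ => trivial) (hB.lam ξ) x).trans ?_
    rw [hB.lam_apply, ExteriorAlgebra.map_apply_ι]
    rfl
  d_lam ξ := by
    rw [← map_maurerCartan, ← hB.d_lam]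
    exact (hA.pull_d hf ⊤ ⊤ (fun _ _ => trivial) (hB.lam ξ)).symm

/-- The pullback of a flat form along the differential of a map. -/
def FlatForm.along {f : M → M'} (hf : ContMDiff I I' ∞ f) {B : M' → (E' × V →ₗ[ℝ] V'')}
    (hB : FlatForm I' M' V V'' B) : FlatForm I M V V''
      fun x => B (f x) ∘ₗ (tangentMap I I' f x).prodMap LinearMap.id :=
  (FlatForm.snd I M V).comp hf hB

lemma DGHom.lam_comp_snd {f : M → M'} (hf : ContMDiff I I' ∞ f) (Φ : DGHom S (tangentTimes I M V))
    (ξ) : (Φ ⋙ᵈ DGHom.ofMap hf (FlatForm.snd I M V)).lam ξ = Φ.lam ξ :=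
  DGHom.lam_comp_ofMap hf _ Φ ξ

end FlatForms

section Composition

open ExteriorAlgebra (ι)

variable {E : Type u} [NormedAddCommGroup E] [NormedSpace ℝ E]
  {H : Type u} [TopologicalSpace H] {I : ModelWithCorners ℝ E H}
  {M : Type u} [TopologicalSpace M] [ChartedSpace H M]
  {V : Type u} [AddCommGroup V] [Module ℝ V]
  {E' : Type u} [NormedAddCommGroup E'] [NormedSpace ℝ E']
  {H' : Type u} [TopologicalSpace H'] {I' : ModelWithCorners ℝ E' H'}
  {M' : Type u} [TopologicalSpace M'] [ChartedSpace H' M']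
  {V' : Type u} [AddCommGroup V'] [Module ℝ V']
  {E'' : Type u} [NormedAddCommGroup E''] [NormedSpace ℝ E'']
  {H'' : Type u} [TopologicalSpace H''] {I'' : ModelWithCorners ℝ E'' H''}
  {M'' : Type u} [TopologicalSpace M''] [ChartedSpace H'' M'']
  {V'' : Type u} [AddCommGroup V''] [Module ℝ V'']

lemma snd_comp_bundleMap (f : M → M') (A : M → (E × V →ₗ[ℝ] V')) (x : M) :
    LinearMap.snd ℝ E' V' ∘ₗ bundleMap I I' f A x = A x := rfl

lemma bundleMap_comp {f : M → M'} {f' : M' → M''} (A : M → (E × V →ₗ[ℝ] V'))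
    (B : M' → (E' × V' →ₗ[ℝ] V'')) {x : M} (hf' : MDifferentiableAt I' I'' f' (f x))
    (hf : MDifferentiableAt I I' f x) :
    bundleMap I I'' (f' ∘ f) (fun x => B (f x) ∘ₗ bundleMap I I' f A x) x =
      bundleMap I' I'' f' B (f x) ∘ₗ bundleMap I I' f A x := by
  rw [bundleMap, tangentMap_comp hf' hf]
  rfl

lemma bundleMap_snd_comp {f : M → M'} {f' : M' → M''} {x : M}
    (hf' : MDifferentiableAt I' I'' f' (f x)) (hf : MDifferentiableAt I I' f x) :
    bundleMap I I'' (f' ∘ f) (fun _ => LinearMap.snd ℝ E V) x =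
      bundleMap I' I'' f' (fun _ => LinearMap.snd ℝ E' V) (f x) ∘ₗ
        bundleMap I I' f (fun _ => LinearMap.snd ℝ E V) x :=
  bundleMap_comp (fun _ => LinearMap.snd ℝ E V) (fun _ => LinearMap.snd ℝ E' V) hf' hf

lemma bundleMap_id {f : M → M} {x : M} (h : f =ᶠ[𝓝 x] fun y => y) :
    bundleMap I I f (fun _ => LinearMap.snd ℝ E V) x = LinearMap.id := by
  rw [bundleMap, tangentMap_congr h, tangentMap_id]
  rfl

lemma map_dualMap_id (a : Fibre E V) :
    ExteriorAlgebra.map (LinearMap.id : E × V →ₗ[ℝ] E × V).dualMap a = a := by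
  rw [LinearMap.dualMap_id, ExteriorAlgebra.map_id]
  rfl

lemma map_dualMap_comp (A : E × V →ₗ[ℝ] E' × V') (B : E' × V' →ₗ[ℝ] E'' × V'') (a : Fibre E'' V'') :
    ExteriorAlgebra.map A.dualMap (ExteriorAlgebra.map B.dualMap a) =
      ExteriorAlgebra.map (B ∘ₗ A).dualMap a := by
  rw [← LinearMap.dualMap_comp_dualMap, ← ExteriorAlgebra.map_comp_map]
  rfl

variable [I.Boundaryless] [IsManifold I ∞ M] [Module.Finite ℝ V] [Bracket V V]
  [I'.Boundaryless] [IsManifold I' ∞ M'] [Module.Finite ℝ V'] [Bracket V' V']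
  [I''.Boundaryless] [IsManifold I'' ∞ M''] [Module.Finite ℝ V''] [Bracket V'' V'']
  [FinDimModel E M] [FinDimModel E' M'] [FinDimModel E'' M'']
  [T2Space M] [SecondCountableTopology M] [LieLaws V]

lemma DGHom.ofMap_congr {f f' : M → M'} {A A' : M → (E × V →ₗ[ℝ] V')} (hf : ContMDiff I I' ∞ f)
    (hf' : ContMDiff I I' ∞ f') (hA : FlatForm I M V V' A) (hA' : FlatForm I M V V' A')
    (h : ∀ x, f x = f' x) (h' : ∀ x, A x = A' x) : DGHom.ofMap hf hA = DGHom.ofMap hf' hA' := by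
  obtain rfl : f = f' := funext h
  obtain rfl : A = A' := funext h'
  rfl

variable [T2Space M'] [SecondCountableTopology M'] [LieLaws V']

lemma DGHom.ofMap_comp_ofMap {f : M → M'} {A : M → (E × V →ₗ[ℝ] V')} (hf : ContMDiff I I' ∞ f)
    (hA : FlatForm I M V V' A) {f' : M' → M''} {B : M' → (E' × V' →ₗ[ℝ] V'')}
    (hf' : ContMDiff I' I'' ∞ f') (hB : FlatForm I' M' V' V'' B) :
    DGHom.ofMap hf hA ⋙ᵈ DGHom.ofMap hf' hB = DGHom.ofMap (hf'.comp hf) (hA.comp hf hB) := by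
  refine DGHom.ext rfl (heq_of_eq ?_)
  funext W U h
  refine AlgHom.ext fun a => section_ext (I := I) (M := M) (V := V) fun x => ?_
  refine (map_dualMap_comp _ _ _).trans ?_
  rw [← bundleMap_comp A B (hf'.mdifferentiableAt (by simp)) (hf.mdifferentiableAt (by simp))]
  rfl

lemma DGHom.ofMap_snd_comp_ofMap_snd {f : M → M'} (hf : ContMDiff I I' ∞ f) {f' : M' → M''}
    (hf' : ContMDiff I' I'' ∞ f') :
    DGHom.ofMap hf (FlatForm.snd I M V) ⋙ᵈ DGHom.ofMap hf' (FlatForm.snd I' M' V) =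
      DGHom.ofMap (hf'.comp hf) (FlatForm.snd I M V) := by
  rw [DGHom.ofMap_comp_ofMap]
  exact DGHom.ofMap_congr _ _ _ _ (fun _ => rfl) fun _ => rfl

lemma DGHom.ofMap_eq_identity {f : M → M} (hf : ContMDiff I I ∞ f) {A : M → (E × V →ₗ[ℝ] V)}
    (hA : FlatForm I M V V A) (h : ∀ x, f x = x) (h' : ∀ x, A x = LinearMap.snd ℝ E V) :
    DGHom.ofMap hf hA = DGHom.identity (isDGManifold_tangentTimes I M V) := by
  obtain rfl : f = fun x => x := funext h
  obtain rfl : A = fun _ => LinearMap.snd ℝ E V := funext h'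
  refine DGHom.ext rfl (heq_of_eq ?_)
  funext W U h
  refine AlgHom.ext fun a => section_ext (I := I) (M := M) (V := V) fun x => ?_
  refine Eq.trans ?_ (map_dualMap_id _)
  rw [← bundleMap_id (I := I) (f := fun y : M => y) (x := (x : M)) Filter.EventuallyEq.rfl]
  rfl

lemma DGHom.comp_ofMap_identity {S : DGSpace.{u}} (hS : IsDGManifold S)
    (Φ : DGHom S (tangentTimes I M V)) {f : M → M} (hf : ContMDiff I I ∞ f)
    {A : M → (E × V →ₗ[ℝ] V)} (hA : FlatForm I M V V A) (h : ∀ x, f x = x)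
    (h' : ∀ x, A x = LinearMap.snd ℝ E V) : Φ ⋙ᵈ DGHom.ofMap hf hA = Φ := by
  rw [DGHom.ofMap_congr hf hf hA (FlatForm.snd I M V) (fun _ => rfl) h']
  refine DGHom.ext_point hS ?_ fun ξ => DGHom.lam_comp_snd hf Φ ξ
  rw [DGHom.point_comp_ofMap, FunPoint.map_id _ hf h]

/-- A map with smooth local sections through every point induces a submersion. -/
lemma isSurjectiveSubmersion_ofMap {f : M → M'} (hf : ContMDiff I I' ∞ f)
    (hsurj : Function.Surjective f)
    (hsec : ∀ x, ∃ (N : Opens M') (r : M' → M), f x ∈ N ∧ ContMDiffOn I' I ∞ r N ∧ r (f x) = x ∧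
      ∀ y ∈ N, f (r y) = y) :
    IsSurjectiveSubmersion (DGHom.ofMap hf (FlatForm.snd I M V)) := by
  refine ⟨hsurj, fun x k v => ?_⟩
  obtain ⟨N, r, hxN, hr, hrx, hfr⟩ := hsec x
  have hA : ∀ ξ : Module.Dual ℝ V, (fun _ : N => ι ℝ (ξ ∘ₗ LinearMap.snd ℝ E' V)) ∈
      smoothSections I' M' V N := fun ξ => (lin I' N ξ).2
  let D : Opens M → Opens M' := fun U => ⟨N ∩ r ⁻¹' U, hr.continuousOn.isOpen_inter_preimage N.2 U.2⟩
  let DD : Opens (tangentTimes I M V).body → Opens (tangentTimes I' M' V).body := D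
  have hD : ∀ {U : Opens M}, x ∈ U → f x ∈ D U := fun {U} hU => by
    refine ⟨hxN, ?_⟩
    change r (f x) ∈ U
    rwa [hrx]
  have hDmono : ∀ {U W : Opens M}, W ≤ U → D W ≤ D U := fun h y hy => ⟨hy.1, h hy.2⟩
  let P : ∀ U : Opens (tangentTimes I M V).body,
      (tangentTimes I M V).O U →ₐ[ℝ] (tangentTimes I' M' V).O (DD U) := fun U =>
    pullSection (A := fun _ => LinearMap.snd ℝ E' V) hr hA U (D U) (fun y hy => hy.1) fun y hy => hy.2
  have hP : ∀ U j a, a ∈ (tangentTimes I M V).deg U j → P U a ∈ (tangentTimes I' M' V).deg (DD U) j :=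
    fun U j a ha => pullSection_mem (A := fun _ => LinearMap.snd ℝ E' V) hr hA U (D U) _ _ ha
  refine ⟨{ ev := fun U hU => (v.ev (DD U) (hD hU)).comp (P U)
            ev_res := fun {U W} h hU hW a => v.ev_res (hDmono h) (hD hU) (hD hW) (P U a)
            ev_deg := fun U hU j a ha hj => v.ev_deg _ _ j _ (hP U j a ha) hj
            vec := fun U hU => v.vec (DD U) (hD hU) ∘ₗ (P U).toLinearMap
            vec_res := fun {U W} h hU hW a => v.vec_res (hDmono h) (hD hU) (hD hW) (P U a)
            vec_deg := fun U hU j a ha hj => v.vec_deg _ _ j _ (hP U j a ha) hj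
            vec_mul := fun U hU a b => (congrArg (v.vec (DD U) (hD hU)) (map_mul (P U) a b)).trans
              (v.vec_mul _ _ _ _) }, fun W hW a => ?_⟩
  let W' : Opens M' := W
  let fW : Opens M := W'.comap ⟨f, hf.continuous⟩
  have hDW : D fW ≤ W' := fun y hy => by
    have : f (r y) ∈ W' := hy.2
    rwa [hfr y hy.1] at this
  have key : P fW ((FlatForm.snd I M V).pull hf W' fW (fun _ h => h) a) =
      restrictSections I' M' V hDW a := by
    refine section_ext (I := I') (M := M') (V := V) (U := D fW) fun y =>
      (map_dualMap_comp (E := E') (E' := E) (E'' := E') _ _ _).trans ?_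
    have hyN : (y : M') ∈ N := y.2.1
    have hrd : MDifferentiableAt I' I r y := hr.mdifferentiableAt_of_mem (by simp) N.2 hyN
    have hid : f ∘ r =ᶠ[𝓝 (y : M')] fun z => z := by
      filter_upwards [N.2.mem_nhds hyN] with z hz using hfr z hz
    rw [← bundleMap_snd_comp (hf.mdifferentiableAt (by simp)) hrd, bundleMap_id (I := I') hid,
      map_dualMap_id]
    exact congrArg (show smoothSections I' M' V W' from a).1 (Subtype.ext (hfr y hyN))
  exact (congrArg (v.vec (DD fW) (hD hW)) key).trans (v.vec_res hDW hW _ a)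

/-- `T[1]M × V[1]` is the fibre product of `T[1]M` and `T[1]M' × V[1]` over `T[1]M'`. -/
theorem isPullback_tangentTimes {f : M → M'} (hf : ContMDiff I I' ∞ f)
    {i : M → M} (hi : ContMDiff I I ∞ i) (hi' : ∀ x, i x = x)
    {j : M' → M'} (hj : ContMDiff I' I' ∞ j) (hj' : ∀ x, j x = x) :
    IsPullback (DGHom.ofMap hi (FlatForm.zero I M V)) (DGHom.ofMap hf (FlatForm.snd I M V))
      (DGHom.ofMap hf (FlatForm.zero I M PUnit.{u + 1}))
      (DGHom.ofMap hj (FlatForm.zero I' M' V)) := by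
  have triv : ∀ {S : DGSpace.{u}} (hS : IsDGManifold S) {F : Type u} [NormedAddCommGroup F]
      [NormedSpace ℝ F] {K : Type u} [TopologicalSpace K] {J : ModelWithCorners ℝ F K} {N : Type u}
      [TopologicalSpace N] [ChartedSpace K N] [J.Boundaryless] [IsManifold J ∞ N] [FinDimModel F N]
      [T2Space N] [SecondCountableTopology N]
      {Φ Ψ : DGHom S (shiftedTangent J N)}, Φ.point = Ψ.point → Φ = Ψ := by
    intro S hS F _ _ K _ J N _ _ _ _ _ _ _ Φ Ψ h
    refine DGHom.ext_point hS h fun ξ => ?_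
    rw [Subsingleton.elim ξ 0, map_zero, map_zero]
  constructor
  · rw [DGHom.ofMap_comp_ofMap, DGHom.ofMap_comp_ofMap]
    exact DGHom.ofMap_congr _ _ _ _ (fun x => by simp [hi', hj']) fun _ => rfl
  · intro S hS a b hab
    have hab' : a.point.map hf = b.point := by
      rw [← DGHom.point_comp_ofMap hf (FlatForm.zero I M PUnit.{u + 1}), hab,
        DGHom.point_comp_ofMap, FunPoint.map_id _ hj hj']
    obtain ⟨c, hc, hcl⟩ := DGHom.exists_of_point hS a.point b.lam b.lam_mem b.d_lam
    refine ⟨c, ⟨triv hS ?_, DGHom.ext_point hS ?_ fun ξ => ?_⟩, ?_⟩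
    · rw [DGHom.point_comp_ofMap, FunPoint.map_id _ hi hi', hc]
    · rw [DGHom.point_comp_ofMap, hc, hab']
    · rw [DGHom.lam_comp_snd, hcl]
    · rintro c' ⟨rfl, rfl⟩
      refine DGHom.ext_point hS ?_ fun ξ => ?_
      · rw [hc, DGHom.point_comp_ofMap, FunPoint.map_id _ hi hi']
      · rw [hcl, DGHom.lam_comp_snd]

end Composition

section SmoothGroupoids

variable {E₀ : Type u} [NormedAddCommGroup E₀] [NormedSpace ℝ E₀]
  {H₀ : Type u} [TopologicalSpace H₀] (I₀ : ModelWithCorners ℝ E₀ H₀)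
  (M₀ : Type u) [TopologicalSpace M₀] [ChartedSpace H₀ M₀]
  {E₁ : Type u} [NormedAddCommGroup E₁] [NormedSpace ℝ E₁]
  {H₁ : Type u} [TopologicalSpace H₁] (I₁ : ModelWithCorners ℝ E₁ H₁)
  (M₁ : Type u) [TopologicalSpace M₁] [ChartedSpace H₁ M₁]
  {E₂ : Type u} [NormedAddCommGroup E₂] [NormedSpace ℝ E₂]
  {H₂ : Type u} [TopologicalSpace H₂] (I₂ : ModelWithCorners ℝ E₂ H₂)
  (M₂ : Type u) [TopologicalSpace M₂] [ChartedSpace H₂ M₂]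

/-- A groupoid in manifolds, with the laws for points with values in the functions on dg-manifolds.
`p`, `q` and `m` are the projections and the composition of composable pairs. -/
structure SmoothGroupoid where
  s : M₁ → M₀
  t : M₁ → M₀
  e : M₀ → M₁
  i : M₁ → M₁
  p : M₂ → M₁
  q : M₂ → M₁
  m : M₂ → M₁
  hs : ContMDiff I₁ I₀ ∞ s
  ht : ContMDiff I₁ I₀ ∞ t
  he : ContMDiff I₀ I₁ ∞ e
  hi : ContMDiff I₁ I₁ ∞ i
  hp : ContMDiff I₂ I₁ ∞ p
  hq : ContMDiff I₂ I₁ ∞ q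
  hm : ContMDiff I₂ I₁ ∞ m
  s_p : ∀ z, s (p z) = t (q z)
  t_m : ∀ z, t (m z) = t (p z)
  s_m : ∀ z, s (m z) = s (q z)
  t_e : ∀ x, t (e x) = x
  s_e : ∀ x, s (e x) = x
  t_i : ∀ x, t (i x) = s x
  s_i : ∀ x, s (i x) = t x
  i_i : ∀ x, i (i x) = x
  local_section : ∀ x, ∃ (N : Opens M₀) (r : M₀ → M₁), t x ∈ N ∧ ContMDiffOn I₀ I₁ ∞ r N ∧
    r (t x) = x ∧ ∀ y ∈ N, t (r y) = y
  pair : ∀ {S : DGSpace.{u}}, IsDGManifold S → ∀ a b : FunPoint I₁ M₁ S, a.map hs = b.map ht →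
    ∃! c : FunPoint I₂ M₂ S, c.map hp = a ∧ c.map hq = b
  one_mul : ∀ {S : DGSpace.{u}}, IsDGManifold S → ∀ (c : FunPoint I₂ M₂ S),
    c.map hp = (c.map hq).map (he.comp ht) → c.map hm = c.map hq
  mul_one : ∀ {S : DGSpace.{u}}, IsDGManifold S → ∀ (c : FunPoint I₂ M₂ S),
    c.map hq = (c.map hp).map (he.comp hs) → c.map hm = c.map hp
  mul_inv : ∀ {S : DGSpace.{u}}, IsDGManifold S → ∀ (c : FunPoint I₂ M₂ S),
    c.map hq = (c.map hp).map hi → c.map hm = (c.map hp).map (he.comp ht)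
  inv_mul : ∀ {S : DGSpace.{u}}, IsDGManifold S → ∀ (c : FunPoint I₂ M₂ S),
    c.map hp = (c.map hq).map hi → c.map hm = (c.map hq).map (he.comp hs)
  assoc : ∀ {S : DGSpace.{u}}, IsDGManifold S → ∀ (ab bc ab_c a_bc : FunPoint I₂ M₂ S),
    ab.map hq = bc.map hp → ab_c.map hp = ab.map hm → ab_c.map hq = bc.map hq →
    a_bc.map hp = ab.map hp → a_bc.map hq = bc.map hm → ab_c.map hm = a_bc.map hm

variable {I₀ M₀ I₁ M₁ I₂ M₂}
  [I₀.Boundaryless] [IsManifold I₀ ∞ M₀] [FinDimModel E₀ M₀] [T2Space M₀] [SecondCountableTopology M₀]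
  [I₁.Boundaryless] [IsManifold I₁ ∞ M₁] [FinDimModel E₁ M₁] [T2Space M₁] [SecondCountableTopology M₁]
  [I₂.Boundaryless] [IsManifold I₂ ∞ M₂] [FinDimModel E₂ M₂] [T2Space M₂] [SecondCountableTopology M₂]
  {V : Type u} [AddCommGroup V] [Module ℝ V] [Module.Finite ℝ V] [Bracket V V] [LieLaws V]

namespace SmoothGroupoid

variable (Γ : SmoothGroupoid I₀ M₀ I₁ M₁ I₂ M₂)

/-- A flat form on the morphisms of a groupoid that is an action of the groupoid. -/
structure ActionForm (A : M₁ → (E₁ × V →ₗ[ℝ] V)) where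
  flat : FlatForm I₁ M₁ V V A
  one : ∀ x, A (Γ.e x) ∘ₗ bundleMap I₀ I₁ Γ.e (fun _ => LinearMap.snd ℝ E₀ V) x =
    LinearMap.snd ℝ E₀ V
  inv : ∀ x, A (Γ.i x) ∘ₗ bundleMap I₁ I₁ Γ.i A x = LinearMap.snd ℝ E₁ V
  mul : ∀ z, A (Γ.m z) ∘ₗ bundleMap I₂ I₁ Γ.m (fun _ => LinearMap.snd ℝ E₂ V) z =
    A (Γ.q z) ∘ₗ bundleMap I₂ I₁ Γ.q
      (fun z => A (Γ.p z) ∘ₗ bundleMap I₂ I₁ Γ.p (fun _ => LinearMap.snd ℝ E₂ V) z) z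

variable {Γ} {A : M₁ → (E₁ × V →ₗ[ℝ] V)}

/-- The structure maps of the groupoid `T[1]M₁ × V[1] ⇉ T[1]M₀ × V[1]`. -/
def ActionForm.data (hA : Γ.ActionForm A) :
    GroupoidData (tangentTimes I₀ M₀ V) (tangentTimes I₁ M₁ V) (tangentTimes I₂ M₂ V) where
  src := DGHom.ofMap Γ.hs hA.flat
  tgt := DGHom.ofMap Γ.ht (FlatForm.snd I₁ M₁ V)
  one := DGHom.ofMap Γ.he (FlatForm.snd I₀ M₀ V)
  inv := DGHom.ofMap Γ.hi hA.flat
  fst := DGHom.ofMap Γ.hp (FlatForm.snd I₂ M₂ V)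
  snd := DGHom.ofMap Γ.hq (hA.flat.along Γ.hp)
  mul := DGHom.ofMap Γ.hm (FlatForm.snd I₂ M₂ V)

lemma ActionForm.one_tgt (hA : Γ.ActionForm A) {S : DGSpace.{u}} (hS : IsDGManifold S)
    (x : DGHom S (tangentTimes I₀ M₀ V)) : x ⋙ᵈ hA.data.one ⋙ᵈ hA.data.tgt = x := by
  refine (congrArg (x ⋙ᵈ ·) (DGHom.ofMap_comp_ofMap _ _ _ _)).trans ?_
  exact DGHom.comp_ofMap_identity hS x _ _ Γ.t_e fun _ => rfl

lemma ActionForm.one_src (hA : Γ.ActionForm A) {S : DGSpace.{u}} (hS : IsDGManifold S)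
    (x : DGHom S (tangentTimes I₀ M₀ V)) : x ⋙ᵈ hA.data.one ⋙ᵈ hA.data.src = x := by
  refine (congrArg (x ⋙ᵈ ·) (DGHom.ofMap_comp_ofMap _ _ _ _)).trans ?_
  exact DGHom.comp_ofMap_identity hS x _ _ Γ.s_e hA.one

lemma ActionForm.inv_tgt (hA : Γ.ActionForm A) : hA.data.inv ⋙ᵈ hA.data.tgt = hA.data.src :=
  (DGHom.ofMap_comp_ofMap _ _ _ _).trans (DGHom.ofMap_congr _ _ _ _ Γ.t_i fun _ => rfl)

lemma ActionForm.inv_src (hA : Γ.ActionForm A) : hA.data.inv ⋙ᵈ hA.data.src = hA.data.tgt :=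
  (DGHom.ofMap_comp_ofMap _ _ _ _).trans (DGHom.ofMap_congr _ _ _ _ Γ.s_i hA.inv)

lemma ActionForm.inv_inv (hA : Γ.ActionForm A) :
    hA.data.inv ⋙ᵈ hA.data.inv = DGHom.identity (isDGManifold_tangentTimes I₁ M₁ V) :=
  (DGHom.ofMap_comp_ofMap _ _ _ _).trans (DGHom.ofMap_eq_identity _ _ Γ.i_i hA.inv)

lemma ActionForm.mul_tgt (hA : Γ.ActionForm A) :
    hA.data.mul ⋙ᵈ hA.data.tgt = hA.data.fst ⋙ᵈ hA.data.tgt :=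
  (DGHom.ofMap_snd_comp_ofMap_snd Γ.hm Γ.ht).trans ((DGHom.ofMap_congr _ _ _ _ Γ.t_m
    fun _ => rfl).trans (DGHom.ofMap_snd_comp_ofMap_snd Γ.hp Γ.ht).symm)

lemma ActionForm.mul_src (hA : Γ.ActionForm A) :
    hA.data.mul ⋙ᵈ hA.data.src = hA.data.snd ⋙ᵈ hA.data.src :=
  (DGHom.ofMap_comp_ofMap _ _ _ _).trans ((DGHom.ofMap_congr _ _ _ _ Γ.s_m hA.mul).trans
    (DGHom.ofMap_comp_ofMap _ _ _ _).symm)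

lemma ActionForm.fst_src (hA : Γ.ActionForm A) :
    hA.data.fst ⋙ᵈ hA.data.src = hA.data.snd ⋙ᵈ hA.data.tgt :=
  (DGHom.ofMap_comp_ofMap Γ.hp (FlatForm.snd I₂ M₂ V) Γ.hs hA.flat).trans
    ((DGHom.ofMap_congr _ _ _ _ Γ.s_p fun z => (snd_comp_bundleMap Γ.q
      (fun z => A (Γ.p z) ∘ₗ bundleMap I₂ I₁ Γ.p (fun _ => LinearMap.snd ℝ E₂ V) z) z).symm).trans
    (DGHom.ofMap_comp_ofMap Γ.hq (hA.flat.along Γ.hp) Γ.ht (FlatForm.snd I₁ M₁ V)).symm)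

lemma ActionForm.tgt_submersion (hA : Γ.ActionForm A) : IsSurjectiveSubmersion hA.data.tgt :=
  isSurjectiveSubmersion_ofMap Γ.ht (fun x => ⟨Γ.e x, Γ.t_e x⟩) Γ.local_section

lemma ActionForm.src_submersion (hA : Γ.ActionForm A) : IsSurjectiveSubmersion hA.data.src := by
  rw [← hA.inv_tgt]
  exact hA.tgt_submersion.involution_comp _ hA.inv_inv

section Points

variable (hA : Γ.ActionForm A) {S : DGSpace.{u}} (a : DGHom S (tangentTimes I₁ M₁ V))
  (z : DGHom S (tangentTimes I₂ M₂ V)) (x : DGHom S (tangentTimes I₀ M₀ V))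

lemma ActionForm.point_src : (a ⋙ᵈ hA.data.src).point = a.point.map Γ.hs :=
  DGHom.point_comp_ofMap _ _ a

lemma ActionForm.point_tgt : (a ⋙ᵈ hA.data.tgt).point = a.point.map Γ.ht :=
  DGHom.point_comp_ofMap _ _ a

lemma ActionForm.point_one : (x ⋙ᵈ hA.data.one).point = x.point.map Γ.he :=
  DGHom.point_comp_ofMap _ _ x

lemma ActionForm.point_inv : (a ⋙ᵈ hA.data.inv).point = a.point.map Γ.hi :=
  DGHom.point_comp_ofMap _ _ a

lemma ActionForm.point_fst : (z ⋙ᵈ hA.data.fst).point = z.point.map Γ.hp :=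
  DGHom.point_comp_ofMap _ _ z

lemma ActionForm.point_snd : (z ⋙ᵈ hA.data.snd).point = z.point.map Γ.hq :=
  DGHom.point_comp_ofMap _ _ z

lemma ActionForm.point_mul : (z ⋙ᵈ hA.data.mul).point = z.point.map Γ.hm :=
  DGHom.point_comp_ofMap _ _ z

lemma ActionForm.lam_tgt (ξ) : (a ⋙ᵈ hA.data.tgt).lam ξ = a.lam ξ := DGHom.lam_comp_snd _ a ξ

lemma ActionForm.lam_one (ξ) : (x ⋙ᵈ hA.data.one).lam ξ = x.lam ξ := DGHom.lam_comp_snd _ x ξ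

lemma ActionForm.lam_inv (ξ) : (a ⋙ᵈ hA.data.inv).lam ξ = (a ⋙ᵈ hA.data.src).lam ξ := by
  rw [← hA.inv_tgt, ← DGHom.comp_assoc, hA.lam_tgt]

lemma ActionForm.lam_mul (ξ) : (z ⋙ᵈ hA.data.mul).lam ξ = z.lam ξ := DGHom.lam_comp_snd _ z ξ

lemma ActionForm.lam_fst (ξ) : (z ⋙ᵈ hA.data.fst).lam ξ = z.lam ξ := DGHom.lam_comp_snd _ z ξ

end Points

lemma ActionForm.isPullback (hA : Γ.ActionForm A) :
    IsPullback hA.data.fst hA.data.snd hA.data.src hA.data.tgt := by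
  refine ⟨hA.fst_src, fun S hS a b hab => ?_⟩
  have hp := congrArg DGHom.point hab
  rw [hA.point_src, hA.point_tgt] at hp
  obtain ⟨γ, ⟨h₁, h₂⟩, hγ⟩ := Γ.pair hS a.point b.point hp
  obtain ⟨z, hz, hzl⟩ := DGHom.exists_of_point (I := I₂) hS γ a.lam a.lam_mem a.d_lam
  have e₁ : z ⋙ᵈ hA.data.fst = a := by
    refine DGHom.ext_point hS ?_ fun ξ => ?_
    · rw [hA.point_fst, hz, h₁]
    · rw [hA.lam_fst, hzl]
  refine ⟨z, ⟨e₁, DGHom.ext_point hS ?_ fun ξ => ?_⟩, ?_⟩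
  · rw [hA.point_snd, hz, h₂]
  · rw [← hA.lam_tgt, DGHom.comp_assoc, ← hA.fst_src, ← DGHom.comp_assoc, e₁, hab, hA.lam_tgt]
  · rintro z' ⟨k₁, k₂⟩
    refine DGHom.ext_point hS ?_ fun ξ => ?_
    · rw [hz]
      refine hγ _ ⟨?_, ?_⟩
      · rw [← hA.point_fst, k₁]
      · rw [← hA.point_snd, k₂]
    · rw [hzl, ← hA.lam_fst, k₁]

/-- The groupoid `T[1]M₁ × V[1] ⇉ T[1]M₀ × V[1]`. -/
def ActionForm.groupoid (hA : Γ.ActionForm A) :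
    DGLieGroupoid (tangentTimes I₀ M₀ V) (tangentTimes I₁ M₁ V) (tangentTimes I₂ M₂ V) where
  toGroupoidData := hA.data
  isDGManifold₀ := isDGManifold_tangentTimes I₀ M₀ V
  isDGManifold₁ := isDGManifold_tangentTimes I₁ M₁ V
  isDGManifold₂ := isDGManifold_tangentTimes I₂ M₂ V
  src_submersion := hA.src_submersion
  tgt_submersion := hA.tgt_submersion
  isPullback := hA.isPullback
  mul_tgt := hA.mul_tgt
  mul_src := hA.mul_src
  one_tgt hS x := hA.one_tgt hS x
  one_src hS x := hA.one_src hS x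
  inv_tgt := hA.inv_tgt
  inv_src := hA.inv_src
  one_mul {S} hS a := by
    obtain ⟨z, ⟨h₁, h₂⟩, -⟩ := hA.isPullback.2 S hS (a ⋙ᵈ hA.data.tgt ⋙ᵈ hA.data.one) a
      (hA.one_src hS (a ⋙ᵈ hA.data.tgt))
    refine ⟨z, h₁, h₂, DGHom.ext_point hS ?_ fun ξ => ?_⟩
    · rw [hA.point_mul, Γ.one_mul hS, ← hA.point_snd, h₂]
      rw [← hA.point_fst, ← hA.point_snd, h₁, h₂, ← DGHom.comp_assoc, hA.point_one, hA.point_tgt,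
        FunPoint.map_map]
    · rw [hA.lam_mul, ← hA.lam_fst, h₁, ← DGHom.comp_assoc, hA.lam_one, hA.lam_tgt]
  mul_one {S} hS a := by
    obtain ⟨z, ⟨h₁, h₂⟩, -⟩ := hA.isPullback.2 S hS a (a ⋙ᵈ hA.data.src ⋙ᵈ hA.data.one)
      (hA.one_tgt hS (a ⋙ᵈ hA.data.src)).symm
    refine ⟨z, h₁, h₂, DGHom.ext_point hS ?_ fun ξ => ?_⟩
    · rw [hA.point_mul, Γ.mul_one hS, ← hA.point_fst, h₁]
      rw [← hA.point_fst, ← hA.point_snd, h₁, h₂, ← DGHom.comp_assoc, hA.point_one, hA.point_src,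
        FunPoint.map_map]
    · rw [hA.lam_mul, ← hA.lam_fst, h₁]
  mul_inv {S} hS a := by
    obtain ⟨z, ⟨h₁, h₂⟩, -⟩ := hA.isPullback.2 S hS a (a ⋙ᵈ hA.data.inv)
      (by rw [DGHom.comp_assoc, hA.inv_tgt])
    refine ⟨z, h₁, h₂, DGHom.ext_point hS ?_ fun ξ => ?_⟩
    · rw [hA.point_mul, Γ.mul_inv hS, ← hA.point_fst, h₁, ← DGHom.comp_assoc, hA.point_one,
        hA.point_tgt, FunPoint.map_map]
      rw [← hA.point_fst, ← hA.point_snd, h₁, h₂, hA.point_inv]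
    · rw [hA.lam_mul, ← hA.lam_fst, h₁, ← DGHom.comp_assoc, hA.lam_one, hA.lam_tgt]
  inv_mul {S} hS a := by
    obtain ⟨z, ⟨h₁, h₂⟩, -⟩ := hA.isPullback.2 S hS (a ⋙ᵈ hA.data.inv) a
      (by rw [DGHom.comp_assoc, hA.inv_src])
    refine ⟨z, h₁, h₂, DGHom.ext_point hS ?_ fun ξ => ?_⟩
    · rw [hA.point_mul, Γ.inv_mul hS, ← hA.point_snd, h₂, ← DGHom.comp_assoc, hA.point_one,
        hA.point_src, FunPoint.map_map]
      rw [← hA.point_fst, ← hA.point_snd, h₁, h₂, hA.point_inv]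
    · rw [hA.lam_mul, ← hA.lam_fst, h₁, ← DGHom.comp_assoc, hA.lam_one, hA.lam_inv]
  assoc {S} hS a b c ab bc x y := by
    rintro ⟨z₁, rfl, rfl, rfl⟩ ⟨z₂, h₂, rfl, rfl⟩ ⟨z₃, h₃, h₃', rfl⟩ ⟨z₄, h₄, h₄', rfl⟩
    refine DGHom.ext_point hS ?_ fun ξ => ?_
    · rw [hA.point_mul, hA.point_mul]
      refine Γ.assoc hS z₁.point z₂.point z₃.point z₄.point ?_ ?_ ?_ ?_ ?_
      · rw [← hA.point_snd, ← hA.point_fst, h₂]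
      · rw [← hA.point_fst, ← hA.point_mul, h₃]
      · rw [← hA.point_snd, ← hA.point_snd, h₃']
      · rw [← hA.point_fst, ← hA.point_fst, h₄]
      · rw [← hA.point_snd, ← hA.point_mul, h₄']
    · rw [hA.lam_mul, hA.lam_mul, ← hA.lam_fst, ← hA.lam_fst, h₃, h₄, hA.lam_mul, hA.lam_fst]

variable (Γ) in
/-- The zero form, for the tangent groupoid `T[1]M₁ ⇉ T[1]M₀`. -/
def zeroForm : Γ.ActionForm (V := PUnit.{u + 1}) fun _ => 0 where
  flat := FlatForm.zero I₁ M₁ PUnit.{u + 1}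
  one _ := Subsingleton.elim _ _
  inv _ := Subsingleton.elim _ _
  mul _ := Subsingleton.elim _ _

end SmoothGroupoid

end SmoothGroupoids

section FibreProductManifold

variable {EX EY EZ X Y Z : Type u}
  [NormedAddCommGroup EX] [NormedSpace ℝ EX] [TopologicalSpace X] [ChartedSpace EX X]
  [NormedAddCommGroup EY] [NormedSpace ℝ EY] [TopologicalSpace Y] [ChartedSpace EY Y]
  [NormedAddCommGroup EZ] [NormedSpace ℝ EZ] [TopologicalSpace Z] [ChartedSpace EZ Z]
  {f : Z → X} {σ : Y → X}

namespace FibreProduct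

variable (hf : Continuous f) {hσ : Manifold.IsSubmersion 𝓘(ℝ, EY) 𝓘(ℝ, EX) ∞ σ}

instance [T2Space Z] [T2Space Y] : T2Space (FibreProduct hf hσ) :=
  T2Space.of_injective_continuous (f := fun p : FibreProduct hf hσ => (p.fst, p.snd))
    (fun _ _ h => FibreProduct.ext (congrArg Prod.fst h) (congrArg Prod.snd h))
    (isInducing hf hσ).continuous

instance [SecondCountableTopology Z] [SecondCountableTopology Y] :
    SecondCountableTopology (FibreProduct hf hσ) :=
  (isInducing hf hσ).secondCountableTopology

instance [FinDimModel EZ Z] [FiniteDimensional ℝ EY] :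
    FinDimModel (EZ × hσ.complement) (FibreProduct hf hσ) := by
  refine ⟨fun ⟨p⟩ => ?_⟩
  have := FinDimModel.finiteDimensional (E := EZ) (M := Z) ⟨p.fst⟩
  let h := hσ.isSubmersionOfComplement_complement p.snd
  have : FiniteDimensional ℝ hσ.complement :=
    FiniteDimensional.of_surjective (LinearMap.snd ℝ EX hσ.complement ∘ₗ
      (h.equiv : EY →ₗ[ℝ] EX × hσ.complement)) fun w => ⟨h.equiv.symm (0, w), by simp⟩
  infer_instance

variable {hf}

lemma fst_chart_symm (p : FibreProduct hf hσ) {a : EZ × hσ.complement}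
    (ha : a ∈ (chart (EZ := EZ) hf hσ p).target) :
    ((chart (EZ := EZ) hf hσ p).symm a).fst = (chartAt EZ p.fst).symm a.1 := by
  exact congrArg FibreProduct.fst (dif_pos (codChart_inverse hσ _ ha.2.1 ha.2.2))

lemma snd_chart_symm (p : FibreProduct hf hσ) {a : EZ × hσ.complement}
    (ha : a ∈ (chart (EZ := EZ) hf hσ p).target) :
    ((chart (EZ := EZ) hf hσ p).symm a).snd = (hσ.isSubmersionOfComplement_complement p.snd).domChart.symm
      ((hσ.isSubmersionOfComplement_complement p.snd).equiv.symm
        ((hσ.isSubmersionOfComplement_complement p.snd).codChart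
          (f ((chartAt EZ p.fst).symm a.1)), a.2)) := by
  exact congrArg FibreProduct.snd (dif_pos (codChart_inverse hσ _ ha.2.1 ha.2.2))

variable [IsManifold 𝓘(ℝ, EX) ∞ X] [IsManifold 𝓘(ℝ, EY) ∞ Y] [IsManifold 𝓘(ℝ, EZ) ∞ Z]

lemma contMDiffOn_fst_chart_symm (p : FibreProduct hf hσ) :
    ContMDiffOn 𝓘(ℝ, EZ × hσ.complement) 𝓘(ℝ, EZ) ∞
      (fun a => ((chart (EZ := EZ) hf hσ p).symm a).fst) (chart (EZ := EZ) hf hσ p).target := by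
  refine ContMDiffOn.congr ?_ fun a ha => fst_chart_symm p ha
  exact (contMDiffOn_chart_symm (I := 𝓘(ℝ, EZ))).comp contDiff_fst.contMDiff.contMDiffOn
    fun a ha => ha.1

lemma contMDiffOn_snd_chart_symm (hf' : ContMDiff 𝓘(ℝ, EZ) 𝓘(ℝ, EX) ∞ f) (p : FibreProduct hf hσ) :
    ContMDiffOn 𝓘(ℝ, EZ × hσ.complement) 𝓘(ℝ, EY) ∞
      (fun a => ((chart (EZ := EZ) hf hσ p).symm a).snd) (chart (EZ := EZ) hf hσ p).target := by
  refine ContMDiffOn.congr ?_ fun a ha => snd_chart_symm p ha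
  set h := hσ.isSubmersionOfComplement_complement p.snd
  have h₁ : ContMDiffOn 𝓘(ℝ, EZ × hσ.complement) 𝓘(ℝ, EX) ∞
      (fun a => f ((chartAt EZ p.fst).symm a.1)) (chart (EZ := EZ) hf hσ p).target :=
    hf'.comp_contMDiffOn ((contMDiffOn_chart_symm (I := 𝓘(ℝ, EZ))).comp
      contDiff_fst.contMDiff.contMDiffOn fun a ha => ha.1)
  have h₂ : ContMDiffOn 𝓘(ℝ, EZ × hσ.complement) 𝓘(ℝ, EX) ∞
      (fun a => h.codChart (f ((chartAt EZ p.fst).symm a.1))) (chart (EZ := EZ) hf hσ p).target :=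
    (contMDiffOn_of_mem_maximalAtlas h.codChart_mem_maximalAtlas).comp h₁ fun a ha => ha.2.1
  have h₃ : ContMDiffOn 𝓘(ℝ, EZ × hσ.complement) 𝓘(ℝ, EX × hσ.complement) ∞
      (fun a => (h.codChart (f ((chartAt EZ p.fst).symm a.1)), a.2)) (chart (EZ := EZ) hf hσ p).target :=
    h₂.prodMk_space contDiff_snd.contMDiff.contMDiffOn
  exact (contMDiffOn_symm_of_mem_maximalAtlas h.domChart_mem_maximalAtlas).comp
    (h.equiv.symm.contDiff.contMDiff.comp_contMDiffOn h₃) fun a ha => ha.2.2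

lemma contMDiffOn_complementCoord (y : Y) : ContMDiffOn 𝓘(ℝ, EY) 𝓘(ℝ, hσ.complement) ∞
    (fun y' => ((hσ.isSubmersionOfComplement_complement y).equiv
      ((hσ.isSubmersionOfComplement_complement y).domChart y')).2)
    (hσ.isSubmersionOfComplement_complement y).domChart.source :=
  (contDiff_snd.comp (ContinuousLinearEquiv.contDiff _)).contMDiff.comp_contMDiffOn
    (contMDiffOn_of_mem_maximalAtlas
      (hσ.isSubmersionOfComplement_complement y).domChart_mem_maximalAtlas)

variable (hf) in
lemma isManifold (hf' : ContMDiff 𝓘(ℝ, EZ) 𝓘(ℝ, EX) ∞ f) :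
    IsManifold 𝓘(ℝ, EZ × hσ.complement) ∞ (FibreProduct hf hσ) := by
  refine isManifold_of_contDiffOn _ _ _ ?_
  rintro _ _ ⟨p, rfl⟩ ⟨q, rfl⟩
  rw [← contMDiffOn_iff_contDiffOn]
  have hsub : ∀ a ∈ (𝓘(ℝ, EZ × hσ.complement)).symm ⁻¹'
      ((chart (EZ := EZ) hf hσ p).symm ≫ₕ chart (EZ := EZ) hf hσ q).source ∩ Set.range 𝓘(ℝ, EZ × hσ.complement),
      a ∈ (chart (EZ := EZ) hf hσ p).target ∧ (chart (EZ := EZ) hf hσ p).symm a ∈ (chart (EZ := EZ) hf hσ q).source :=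
    fun a ha => by simpa using ha.1
  exact ((contMDiffOn_chart (I := 𝓘(ℝ, EZ))).comp ((contMDiffOn_fst_chart_symm p).mono
    fun a ha => (hsub a ha).1) fun a ha => (hsub a ha).2.1).prodMk_space
    ((contMDiffOn_complementCoord q.snd).comp ((contMDiffOn_snd_chart_symm hf' p).mono
      fun a ha => (hsub a ha).1) fun a ha => (hsub a ha).2.2)

lemma contMDiff_of_chart_symm {E' M' : Type u} [NormedAddCommGroup E'] [NormedSpace ℝ E']
    [TopologicalSpace M'] [ChartedSpace E' M'] [IsManifold 𝓘(ℝ, EZ × hσ.complement) ∞ (FibreProduct hf hσ)]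
    {k : FibreProduct hf hσ → M'}
    (hk : ∀ p, ContMDiffOn 𝓘(ℝ, EZ × hσ.complement) 𝓘(ℝ, E') ∞ (fun a => k ((chart (EZ := EZ) hf hσ p).symm a))
      (chart (EZ := EZ) hf hσ p).target) : ContMDiff 𝓘(ℝ, EZ × hσ.complement) 𝓘(ℝ, E') ∞ k := by
  intro p
  have h := (hk p).comp (contMDiffOn_chart (I := 𝓘(ℝ, EZ × hσ.complement)) (x := p) (n := ∞))
    fun x hx => (chart (EZ := EZ) hf hσ p).map_source hx
  refine (h.congr fun x hx => ?_).contMDiffAt ((chart (EZ := EZ) hf hσ p).open_source.mem_nhds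
    (mem_chart_source (EZ × hσ.complement) p))
  exact congrArg k ((chart (EZ := EZ) hf hσ p).left_inv hx).symm

variable [IsManifold 𝓘(ℝ, EZ × hσ.complement) ∞ (FibreProduct hf hσ)]

lemma contMDiff_fst : ContMDiff 𝓘(ℝ, EZ × hσ.complement) 𝓘(ℝ, EZ) ∞
    (fun p : FibreProduct hf hσ => p.fst) :=
  contMDiff_of_chart_symm contMDiffOn_fst_chart_symm

lemma contMDiff_snd (hf' : ContMDiff 𝓘(ℝ, EZ) 𝓘(ℝ, EX) ∞ f) :
    ContMDiff 𝓘(ℝ, EZ × hσ.complement) 𝓘(ℝ, EY) ∞ (fun p : FibreProduct hf hσ => p.snd) :=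
  contMDiff_of_chart_symm (contMDiffOn_snd_chart_symm hf')

lemma contMDiff_iff {E' H' M' : Type u} [NormedAddCommGroup E'] [NormedSpace ℝ E']
    [TopologicalSpace H'] {I' : ModelWithCorners ℝ E' H'} [TopologicalSpace M'] [ChartedSpace H' M']
    {c : M' → FibreProduct hf hσ} (h₁ : ContMDiff I' 𝓘(ℝ, EZ) ∞ fun x => (c x).fst)
    (h₂ : ContMDiff I' 𝓘(ℝ, EY) ∞ fun x => (c x).snd) :
    ContMDiff I' 𝓘(ℝ, EZ × hσ.complement) ∞ c := by
  have hc : Continuous c := (isInducing hf hσ).continuous_iff.2 (h₁.continuous.prodMk h₂.continuous)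
  intro x
  refine contMDiffAt_iff_target.2 ⟨hc.continuousAt, ?_⟩
  have hx := (chart (EZ := EZ) hf hσ (c x)).open_source.preimage hc
  refine ContMDiffOn.contMDiffAt (s := c ⁻¹' (chart (EZ := EZ) hf hσ (c x)).source) ?_
    (hx.mem_nhds (mem_chart_source (EZ × hσ.complement) (c x)))
  exact ((contMDiffOn_chart (I := 𝓘(ℝ, EZ))).comp h₁.contMDiffOn fun a ha => ha.1).prodMk_space
    ((contMDiffOn_complementCoord (c x).snd).comp h₂.contMDiffOn fun a ha => ha.2)

lemma exists_local_section (p : FibreProduct hf hσ) :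
    ∃ (N : Opens Z) (r : Z → FibreProduct hf hσ), p.fst ∈ N ∧
      ContMDiffOn 𝓘(ℝ, EZ) 𝓘(ℝ, EZ × hσ.complement) ∞ r N ∧ r p.fst = p ∧ ∀ z ∈ N, (r z).fst = z := by
  let w : Z → EZ × hσ.complement := fun z => (chartAt EZ p.fst z, (chart (EZ := EZ) hf hσ p p).2)
  have hw : ContMDiffOn 𝓘(ℝ, EZ) 𝓘(ℝ, EZ × hσ.complement) ∞ w (chartAt EZ p.fst).source :=
    (contMDiffOn_chart (I := 𝓘(ℝ, EZ))).prodMk_space contMDiffOn_const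
  have hp := mem_chart_source (EZ × hσ.complement) p
  refine ⟨⟨_, hw.continuousOn.isOpen_inter_preimage (chartAt EZ p.fst).open_source
    (chart (EZ := EZ) hf hσ p).open_target⟩, fun z => (chart (EZ := EZ) hf hσ p).symm (w z), ⟨hp.1, ?_⟩, ?_, ?_, ?_⟩
  · exact (chart (EZ := EZ) hf hσ p).map_source hp
  · exact (contMDiffOn_chart_symm (I := 𝓘(ℝ, EZ × hσ.complement)) (x := p)).comp
      (hw.mono Set.inter_subset_left) fun z hz => hz.2
  · exact (chart (EZ := EZ) hf hσ p).left_inv hp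
  · rintro z ⟨hz, hz'⟩
    rw [fst_chart_symm p hz']
    exact (chartAt EZ p.fst).left_inv hz

/-- The chart of a fibre product. -/
def pullbackChart (p : FibreProduct hf hσ) : PullbackChart 𝓘(ℝ, EZ × hσ.complement) 𝓘(ℝ, EZ)
    𝓘(ℝ, EY) 𝓘(ℝ, EX) (fun x => x.fst) (fun x => x.snd) σ p :=
  let h := hσ.isSubmersionOfComplement_complement p.snd
  { N₂ := ⟨h.domChart.source, h.domChart.open_source⟩
    NX := ⟨h.codChart.source, h.codChart.open_source⟩
    c₁ := fun z => (chartAt EZ p.fst z, 0)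
    c₂ := fun y => (0, (h.equiv (h.domChart y)).2)
    c₁_smooth := (contMDiffOn_chart (I := 𝓘(ℝ, EZ))).prodMk_space contMDiffOn_const
    c₂_smooth := contMDiffOn_const.prodMk_space (contMDiffOn_complementCoord p.snd)
    maps₁ := fun x hx => hx.1
    maps₂ := fun x hx => hx.2
    mapsX := fun y hy => h.source_subset_preimage_source hy
    chart_eq := fun x hx => by
      change (chartAt EZ p.fst x.fst, (h.equiv (h.domChart x.snd)).2) = _
      simp
    A := LinearMap.fst ℝ _ _
    A_c₁ := fun z hz => rfl
    A_c₂ := fun y hy => rfl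
    d := h.domChart
    d_smooth := contMDiffOn_of_mem_maximalAtlas h.domChart_mem_maximalAtlas
    dInv := h.domChart.symm
    Ω := ⟨h.domChart.target, h.domChart.open_target⟩
    dInv_smooth := contMDiffOn_symm_of_mem_maximalAtlas h.domChart_mem_maximalAtlas
    d_mem := fun y hy => h.domChart.map_source hy
    dInv_d := fun y hy => h.domChart.left_inv hy
    e := fun x => h.equiv.symm (h.codChart x, 0)
    e_smooth := h.equiv.symm.contDiff.contMDiff.comp_contMDiffOn
      ((contMDiffOn_of_mem_maximalAtlas h.codChart_mem_maximalAtlas).prodMk_space contMDiffOn_const)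
    B := (h.equiv.symm : EX × hσ.complement →ₗ[ℝ] EY) ∘ₗ LinearMap.inr ℝ EX hσ.complement ∘ₗ
      LinearMap.snd ℝ EZ hσ.complement
    B_c₁ := fun z hz => by simp
    d_eq := fun y hy => by
      change _ = h.equiv.symm (0, (h.equiv (h.domChart y)).2) + _
      rw [← map_add, Prod.mk_add_mk, zero_add, add_zero, codChart_apply hσ h hy]
      simp }

theorem existsUnique_point [FinDimModel EZ Z] [FiniteDimensional ℝ EY] {S : DGSpace.{u}}
    (hS : IsDGManifold S) (hf' : ContMDiff 𝓘(ℝ, EZ) 𝓘(ℝ, EX) ∞ f)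
    (α : FunPoint 𝓘(ℝ, EZ) Z S) (β : FunPoint 𝓘(ℝ, EY) Y S) (h : α.map hf' = β.map hσ.contMDiff) :
    ∃! γ : FunPoint 𝓘(ℝ, EZ × hσ.complement) (FibreProduct hf hσ) S,
      γ.map contMDiff_fst = α ∧ γ.map (contMDiff_snd hf') = β :=
  existsUnique_funPoint hS pullbackChart contMDiff_fst (contMDiff_snd hf') hf' hσ.contMDiff
    (fun x => x.comm) (fun x x' h₁ h₂ => FibreProduct.ext h₁ h₂)
    (fun a b ha hb hab => ⟨fun y => ⟨a y, b y, hab y⟩,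
      (isInducing hf hσ).continuous_iff.2 (ha.prodMk hb), fun y => ⟨rfl, rfl⟩⟩) α β h

end FibreProduct

end FibreProductManifold

section Products

variable {E : Type u} [NormedAddCommGroup E] [NormedSpace ℝ E]
  {H : Type u} [TopologicalSpace H] {I : ModelWithCorners ℝ E H} [I.Boundaryless]
  {M : Type u} [TopologicalSpace M] [ChartedSpace H M] [IsManifold I ∞ M]
  {E' : Type u} [NormedAddCommGroup E'] [NormedSpace ℝ E']
  {H' : Type u} [TopologicalSpace H'] {I' : ModelWithCorners ℝ E' H'} [I'.Boundaryless]
  {M' : Type u} [TopologicalSpace M'] [ChartedSpace H' M'] [IsManifold I' ∞ M']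
  {S : DGSpace.{u}}

/-- The one-point manifold has one point. -/
lemma FunPoint.eq_of_pt (hS : IsDGManifold S) (a b : FunPoint modelPt Pt.{u} S) : a = b := by
  obtain ⟨f, hf, φ⟩ := a
  obtain ⟨f', hf', ψ⟩ := b
  obtain rfl : f' = f := Subsingleton.elim _ _
  refine FunPoint.ext (fun _ => rfl) fun N U h h' a => ?_
  refine FunHom.eq_of_coord (E' := PUnit.{u + 1}) hS φ ψ (fun y _ => ⟨extChartAt modelPt (f' y),
    hadamardAt_extChartAt (mem_chartDomain _), ⊤, trivial, fun i => ?_⟩) N U le_top h a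
  exact absurd i.2 (by simp [Module.finrank_zero_of_subsingleton])

/-- The chart of a product. -/
def prodPullbackChart (p : M × M') : PullbackChart (I.prod I') I I' modelPt.{u}
    Prod.fst Prod.snd (fun _ : M' => PUnit.unit) p where
  N₂ := chartDomain H' p.2
  NX := ⊤
  c₁ z := (extChartAt I p.1 z, 0)
  c₂ y := (0, extChartAt I' p.2 y)
  c₁_smooth := contMDiffOn_extChartAt.prodMk_space contMDiffOn_const
  c₂_smooth := contMDiffOn_const.prodMk_space contMDiffOn_extChartAt
  maps₁ x hx := (show x ∈ (chartAt H p.1).source ×ˢ (chartAt H' p.2).source from hx).1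
  maps₂ x hx := (show x ∈ (chartAt H p.1).source ×ˢ (chartAt H' p.2).source from hx).2
  mapsX _ _ := trivial
  chart_eq x hx := by
    rw [extChartAt_prod]
    simp
  A := LinearMap.fst ℝ _ _
  A_c₁ _ _ := rfl
  A_c₂ _ _ := rfl
  d := extChartAt I' p.2
  d_smooth := contMDiffOn_extChartAt
  dInv := (extChartAt I' p.2).symm
  Ω := ⟨(extChartAt I' p.2).target, isOpen_extChartAt_target _⟩
  dInv_smooth := contMDiffOn_extChartAt_symm _
  d_mem y hy := (extChartAt I' p.2).map_source (by rwa [extChartAt_source])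
  dInv_d y hy := (extChartAt I' p.2).left_inv (by rwa [extChartAt_source])
  e _ := 0
  e_smooth := contMDiffOn_const
  B := LinearMap.snd ℝ _ _
  B_c₁ _ _ := rfl
  d_eq _ _ := (add_zero _).symm

theorem existsUnique_prod_point [FinDimModel E M] [FinDimModel E' M'] (hS : IsDGManifold S)
    (α : FunPoint I M S) (β : FunPoint I' M' S) : ∃! γ : FunPoint (I.prod I') (M × M') S,
      γ.map contMDiff_fst = α ∧ γ.map contMDiff_snd = β := by
  have : FinDimModel (E × E') (M × M') := ⟨fun ⟨p⟩ => by
    have := FinDimModel.finiteDimensional (E := E) (M := M) ⟨p.1⟩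
    have := FinDimModel.finiteDimensional (E := E') (M := M') ⟨p.2⟩
    infer_instance⟩
  exact existsUnique_funPoint hS prodPullbackChart contMDiff_fst contMDiff_snd
    (contMDiff_const (c := PUnit.unit)) contMDiff_const (fun _ => rfl) (fun _ _ => Prod.ext)
    (fun a b ha hb _ => ⟨fun y => (a y, b y), ha.prodMk hb, fun _ => ⟨rfl, rfl⟩⟩) α β
    (FunPoint.eq_of_pt hS _ _)

lemma FunPoint.prod_ext [FinDimModel E M] [FinDimModel E' M'] (hS : IsDGManifold S)
    {γ γ' : FunPoint (I.prod I') (M × M') S}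
    (h₁ : γ.map contMDiff_fst = γ'.map contMDiff_fst)
    (h₂ : γ.map contMDiff_snd = γ'.map contMDiff_snd) : γ = γ' :=
  (existsUnique_prod_point hS _ _).unique ⟨h₁, h₂⟩ ⟨rfl, rfl⟩

end Products

section CechGroupoid

variable {EX EY X Y : Type u}
  [NormedAddCommGroup EX] [NormedSpace ℝ EX] [TopologicalSpace X] [ChartedSpace EX X]
  [NormedAddCommGroup EY] [NormedSpace ℝ EY] [TopologicalSpace Y] [ChartedSpace EY Y]
  {σ : Y → X} (hσ : Manifold.IsSubmersion 𝓘(ℝ, EY) 𝓘(ℝ, EX) ∞ σ)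
  [IsManifold 𝓘(ℝ, EX) ∞ X] [IsManifold 𝓘(ℝ, EY) ∞ Y]

instance : IsManifold (model₂ hσ) ∞ (CechPairs hσ) := FibreProduct.isManifold _ hσ.contMDiff

lemma cech_tgt_smooth : ContMDiff (model₂ hσ) 𝓘(ℝ, EY) ∞ fun z : CechPairs hσ => z.fst :=
  FibreProduct.contMDiff_fst

lemma cech_src_smooth : ContMDiff (model₂ hσ) 𝓘(ℝ, EY) ∞ fun z : CechPairs hσ => z.snd :=
  FibreProduct.contMDiff_snd hσ.contMDiff

instance : IsManifold (model₃ hσ) ∞ (CechTriples hσ) :=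
  FibreProduct.isManifold _ (hσ.contMDiff.comp (cech_src_smooth hσ))

lemma cechFst_smooth : ContMDiff (model₃ hσ) (model₂ hσ) ∞ (cechFst (hσ := hσ)) :=
  FibreProduct.contMDiff_fst

lemma cech_third_smooth : ContMDiff (model₃ hσ) 𝓘(ℝ, EY) ∞ fun t : CechTriples hσ => t.snd :=
  FibreProduct.contMDiff_snd (hσ.contMDiff.comp (cech_src_smooth hσ))

lemma cechSnd_smooth : ContMDiff (model₃ hσ) (model₂ hσ) ∞ (cechSnd (hσ := hσ)) :=
  FibreProduct.contMDiff_iff ((cech_src_smooth hσ).comp (cechFst_smooth hσ)) (cech_third_smooth hσ)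

lemma cechMul_smooth : ContMDiff (model₃ hσ) (model₂ hσ) ∞ (cechMul (hσ := hσ)) :=
  have h : ContMDiff (model₃ hσ) 𝓘(ℝ, EY) ∞ fun t : CechTriples hσ => t.fst.fst :=
    (cech_tgt_smooth hσ).comp (cechFst_smooth hσ)
  FibreProduct.contMDiff_iff h (cech_third_smooth hσ)

lemma cechOne_smooth : ContMDiff 𝓘(ℝ, EY) (model₂ hσ) ∞ (cechOne (hσ := hσ)) :=
  FibreProduct.contMDiff_iff contMDiff_id contMDiff_id

lemma cechInv_smooth : ContMDiff (model₂ hσ) (model₂ hσ) ∞ (cechInv (hσ := hσ)) :=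
  FibreProduct.contMDiff_iff (cech_src_smooth hσ) (cech_tgt_smooth hσ)

variable [FiniteDimensional ℝ EY]

lemma FunPoint.cech_ext {S : DGSpace.{u}} (hS : IsDGManifold S)
    {a b : FunPoint (model₂ hσ) (CechPairs hσ) S}
    (h₁ : a.map (cech_tgt_smooth hσ) = b.map (cech_tgt_smooth hσ))
    (h₂ : a.map (cech_src_smooth hσ) = b.map (cech_src_smooth hσ)) : a = b :=
  (FibreProduct.existsUnique_point hS hσ.contMDiff (b.map (cech_tgt_smooth hσ))
    (b.map (cech_src_smooth hσ)) (by
      rw [FunPoint.map_map, FunPoint.map_map]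
      exact FunPoint.map_congr _ _ _ fun z => z.comm)).unique ⟨h₁, h₂⟩ ⟨rfl, rfl⟩

/-- The Čech groupoid. -/
def cechGroupoid :
    SmoothGroupoid 𝓘(ℝ, EY) Y (model₂ hσ) (CechPairs hσ) (model₃ hσ) (CechTriples hσ) where
  s z := z.snd
  t z := z.fst
  e := cechOne
  i := cechInv
  p := cechFst
  q := cechSnd
  m := cechMul
  hs := cech_src_smooth hσ
  ht := cech_tgt_smooth hσ
  he := cechOne_smooth hσ
  hi := cechInv_smooth hσ
  hp := cechFst_smooth hσ
  hq := cechSnd_smooth hσ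
  hm := cechMul_smooth hσ
  s_p _ := rfl
  t_m _ := rfl
  s_m _ := rfl
  t_e _ := rfl
  s_e _ := rfl
  t_i _ := rfl
  s_i _ := rfl
  i_i _ := rfl
  local_section := FibreProduct.exists_local_section
  pair {S} hS a b hab := by
    obtain ⟨c, ⟨h₁, h₂⟩, hc⟩ := FibreProduct.existsUnique_point (Z := CechPairs hσ) hS
      (hσ.contMDiff.comp (cech_src_smooth hσ)) a (b.map (cech_src_smooth hσ)) (by
        rw [← FunPoint.map_map _ (cech_src_smooth hσ) hσ.contMDiff, hab, FunPoint.map_map,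
          FunPoint.map_map]
        exact FunPoint.map_congr _ _ _ fun z => z.comm)
    refine ⟨c, ⟨h₁, FunPoint.cech_ext hσ hS ?_ ?_⟩, ?_⟩
    · rw [← hab, ← h₁, FunPoint.map_map, FunPoint.map_map]
      rfl
    · rw [← h₂, FunPoint.map_map]
      rfl
    · rintro c' ⟨k₁, k₂⟩
      refine hc c' ⟨k₁, ?_⟩
      rw [← k₂, FunPoint.map_map]
      rfl
  one_mul hS c h := by
    refine FunPoint.cech_ext hσ hS ?_ ?_
    · have := congrArg (FunPoint.map · (cech_tgt_smooth hσ)) h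
      simp only [FunPoint.map_map] at this ⊢
      exact this
    · simp only [FunPoint.map_map]
      rfl
  mul_one hS c h := by
    refine FunPoint.cech_ext hσ hS ?_ ?_
    · simp only [FunPoint.map_map]
      rfl
    · have := congrArg (FunPoint.map · (cech_src_smooth hσ)) h
      simp only [FunPoint.map_map] at this ⊢
      exact this
  mul_inv hS c h := by
    refine FunPoint.cech_ext hσ hS ?_ ?_
    · simp only [FunPoint.map_map]
      rfl
    · have := congrArg (FunPoint.map · (cech_src_smooth hσ)) h
      simp only [FunPoint.map_map] at this ⊢
      exact this
  inv_mul hS c h := by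
    refine FunPoint.cech_ext hσ hS ?_ ?_
    · have := congrArg (FunPoint.map · (cech_tgt_smooth hσ)) h
      simp only [FunPoint.map_map] at this ⊢
      exact this
    · simp only [FunPoint.map_map]
      rfl
  assoc hS ab bc ab_c a_bc h₁ h₂ h₃ h₄ h₅ := by
    refine FunPoint.cech_ext hσ hS ?_ ?_
    · have h₂' := congrArg (FunPoint.map · (cech_tgt_smooth hσ)) h₂
      have h₄' := congrArg (FunPoint.map · (cech_tgt_smooth hσ)) h₄
      simp only [FunPoint.map_map] at h₂' h₄' ⊢
      exact h₂'.trans h₄'.symm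
    · have h₃' := congrArg (FunPoint.map · (cech_src_smooth hσ)) h₃
      have h₅' := congrArg (FunPoint.map · (cech_src_smooth hσ)) h₅
      simp only [FunPoint.map_map] at h₃' h₅' ⊢
      exact h₃'.trans h₅'.symm

end CechGroupoid

section Delooping

section ProdMk

variable {E : Type u} [NormedAddCommGroup E] [NormedSpace ℝ E]
  {H : Type u} [TopologicalSpace H] {I : ModelWithCorners ℝ E H}
  {M : Type u} [TopologicalSpace M] [ChartedSpace H M]
  {E₁ : Type u} [NormedAddCommGroup E₁] [NormedSpace ℝ E₁]
  {H₁ : Type u} [TopologicalSpace H₁] {I₁ : ModelWithCorners ℝ E₁ H₁}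
  {M₁ : Type u} [TopologicalSpace M₁] [ChartedSpace H₁ M₁]
  {E₂ : Type u} [NormedAddCommGroup E₂] [NormedSpace ℝ E₂]
  {H₂ : Type u} [TopologicalSpace H₂] {I₂ : ModelWithCorners ℝ E₂ H₂}
  {M₂ : Type u} [TopologicalSpace M₂] [ChartedSpace H₂ M₂]
  {S : DGSpace.{u}} (w : FunPoint I M S) {f : M → M₁} {f' : M → M₂}
  (hf : ContMDiff I I₁ ∞ f) (hf' : ContMDiff I I₂ ∞ f')

lemma FunPoint.map_prodMk_fst : (w.map (hf.prodMk hf')).map contMDiff_fst = w.map hf :=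
  FunPoint.map_map _ _ _

lemma FunPoint.map_prodMk_snd : (w.map (hf.prodMk hf')).map contMDiff_snd = w.map hf' :=
  FunPoint.map_map _ _ _

end ProdMk

variable (EG G : Type u) [NormedAddCommGroup EG] [NormedSpace ℝ EG] [FiniteDimensional ℝ EG]
  [TopologicalSpace G] [ChartedSpace EG G] [Group G] [LieGroup 𝓘(ℝ, EG) ∞ G]

variable {EG G} in
lemma FunPoint.mul_assoc {S : DGSpace.{u}} (hS : IsDGManifold S)
    (ab bc ab_c a_bc : FunPoint (𝓘(ℝ, EG).prod 𝓘(ℝ, EG)) (G × G) S)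
    (h₁ : ab.map contMDiff_snd = bc.map contMDiff_fst)
    (h₂ : ab_c.map contMDiff_fst = ab.map (contMDiff_mul 𝓘(ℝ, EG) ∞))
    (h₃ : ab_c.map contMDiff_snd = bc.map contMDiff_snd)
    (h₄ : a_bc.map contMDiff_fst = ab.map contMDiff_fst)
    (h₅ : a_bc.map contMDiff_snd = bc.map (contMDiff_mul 𝓘(ℝ, EG) ∞)) :
    ab_c.map (contMDiff_mul 𝓘(ℝ, EG) ∞) = a_bc.map (contMDiff_mul 𝓘(ℝ, EG) ∞) := by
  obtain ⟨w, ⟨k₁, k₂⟩, -⟩ := existsUnique_prod_point hS (ab.map contMDiff_fst) bc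
  have s₁ : ContMDiff (𝓘(ℝ, EG).prod (𝓘(ℝ, EG).prod 𝓘(ℝ, EG))) 𝓘(ℝ, EG) ∞
    fun x : G × G × G => x.1 := contMDiff_fst
  have s₂ : ContMDiff (𝓘(ℝ, EG).prod (𝓘(ℝ, EG).prod 𝓘(ℝ, EG))) 𝓘(ℝ, EG) ∞
    fun x : G × G × G => x.2.1 := contMDiff_fst.comp contMDiff_snd
  have s₃ : ContMDiff (𝓘(ℝ, EG).prod (𝓘(ℝ, EG).prod 𝓘(ℝ, EG))) 𝓘(ℝ, EG) ∞
    fun x : G × G × G => x.2.2 := contMDiff_snd.comp contMDiff_snd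
  have e₀ : bc = w.map (s₂.prodMk s₃) := k₂.symm
  have e₁ : ab = w.map (s₁.prodMk s₂) := FunPoint.prod_ext hS
    (k₁.symm.trans (FunPoint.map_prodMk_fst w s₁ s₂).symm)
    (by rw [h₁, e₀, FunPoint.map_prodMk_fst w s₂ s₃, FunPoint.map_prodMk_snd w s₁ s₂])
  have e₂ : ab_c = w.map ((s₁.mul s₂).prodMk s₃) := FunPoint.prod_ext hS
    (by rw [h₂, FunPoint.map_prodMk_fst w (s₁.mul s₂) s₃, e₁, FunPoint.map_map])
    (by rw [h₃, e₀, FunPoint.map_prodMk_snd w s₂ s₃, FunPoint.map_prodMk_snd w (s₁.mul s₂) s₃])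
  have e₃ : a_bc = w.map (s₁.prodMk (s₂.mul s₃)) := FunPoint.prod_ext hS
    (by rw [h₄, e₁, FunPoint.map_prodMk_fst w s₁ s₂, FunPoint.map_prodMk_fst w s₁ (s₂.mul s₃)])
    (by rw [h₅, FunPoint.map_prodMk_snd w s₁ (s₂.mul s₃), e₀, FunPoint.map_map])
  rw [e₂, e₃, FunPoint.map_map, FunPoint.map_map]
  exact FunPoint.map_congr _ _ _ fun x => _root_.mul_assoc _ _ _

/-- The one-object groupoid of a Lie group. -/
def delooping :
    SmoothGroupoid modelPt Pt.{u} 𝓘(ℝ, EG) G (𝓘(ℝ, EG).prod 𝓘(ℝ, EG)) (G × G) where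
  s _ := PUnit.unit
  t _ := PUnit.unit
  e _ := 1
  i h := h⁻¹
  p x := x.1
  q x := x.2
  m x := x.1 * x.2
  hs := contMDiff_const
  ht := contMDiff_const
  he := contMDiff_const
  hi := contMDiff_inv 𝓘(ℝ, EG) ∞
  hp := contMDiff_fst
  hq := contMDiff_snd
  hm := contMDiff_mul 𝓘(ℝ, EG) ∞
  s_p _ := rfl
  t_m _ := rfl
  s_m _ := rfl
  t_e _ := rfl
  s_e _ := rfl
  t_i _ := rfl
  s_i _ := rfl
  i_i := inv_inv
  local_section x := ⟨⊤, fun _ => x, trivial, contMDiffOn_const, rfl, fun _ _ => rfl⟩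
  pair hS a b _ := existsUnique_prod_point hS a b
  one_mul hS c h := by
    have hl : ContMDiff 𝓘(ℝ, EG) (𝓘(ℝ, EG).prod 𝓘(ℝ, EG)) ∞ fun x : G => ((1 : G), x) :=
      contMDiff_const.prodMk contMDiff_id
    have hc : c = (c.map contMDiff_snd).map hl := FunPoint.prod_ext hS h
      ((FunPoint.map_id _ (contMDiff_snd.comp hl) fun _ => rfl).symm.trans
        (FunPoint.map_map _ _ _).symm)
    generalize c.map contMDiff_snd = b at hc ⊢
    subst hc
    exact (FunPoint.map_map _ _ _).trans (FunPoint.map_id _ _ fun x => one_mul x)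
  mul_one hS c h := by
    have hl : ContMDiff 𝓘(ℝ, EG) (𝓘(ℝ, EG).prod 𝓘(ℝ, EG)) ∞ fun x : G => (x, (1 : G)) :=
      contMDiff_id.prodMk contMDiff_const
    have hc : c = (c.map contMDiff_fst).map hl := FunPoint.prod_ext hS
      ((FunPoint.map_id _ (contMDiff_fst.comp hl) fun _ => rfl).symm.trans
        (FunPoint.map_map _ _ _).symm) h
    generalize c.map contMDiff_fst = b at hc ⊢
    subst hc
    exact (FunPoint.map_map _ _ _).trans (FunPoint.map_id _ _ fun x => mul_one x)
  mul_inv hS c h := by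
    have hl : ContMDiff 𝓘(ℝ, EG) (𝓘(ℝ, EG).prod 𝓘(ℝ, EG)) ∞ fun x : G => (x, x⁻¹) :=
      contMDiff_id.prodMk (contMDiff_inv 𝓘(ℝ, EG) ∞)
    have hc : c = (c.map contMDiff_fst).map hl := FunPoint.prod_ext hS
      ((FunPoint.map_id _ (contMDiff_fst.comp hl) fun _ => rfl).symm.trans
        (FunPoint.map_map _ _ _).symm) h
    generalize c.map contMDiff_fst = b at hc ⊢
    subst hc
    exact (FunPoint.map_map _ _ _).trans (FunPoint.map_congr _ _ _ fun x => mul_inv_cancel x)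
  inv_mul hS c h := by
    have hl : ContMDiff 𝓘(ℝ, EG) (𝓘(ℝ, EG).prod 𝓘(ℝ, EG)) ∞ fun x : G => (x⁻¹, x) :=
      (contMDiff_inv 𝓘(ℝ, EG) ∞).prodMk contMDiff_id
    have hc : c = (c.map contMDiff_snd).map hl := FunPoint.prod_ext hS h
      ((FunPoint.map_id _ (contMDiff_snd.comp hl) fun _ => rfl).symm.trans
        (FunPoint.map_map _ _ _).symm)
    generalize c.map contMDiff_snd = b at hc ⊢
    subst hc
    exact (FunPoint.map_map _ _ _).trans (FunPoint.map_congr _ _ _ fun x => inv_mul_cancel x)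
  assoc hS ab bc ab_c a_bc h₁ h₂ h₃ h₄ h₅ :=
    FunPoint.mul_assoc hS ab bc ab_c a_bc h₁ h₂ h₃ h₄ h₅

end Delooping

section PartialDerivatives

variable {E : Type u} [NormedAddCommGroup E] [NormedSpace ℝ E]
  {H : Type u} [TopologicalSpace H] {I : ModelWithCorners ℝ E H}
  {M : Type u} [TopologicalSpace M] [ChartedSpace H M] [IsManifold I ∞ M]
  {E' : Type u} [NormedAddCommGroup E'] [NormedSpace ℝ E']
  {H' : Type u} [TopologicalSpace H'] {I' : ModelWithCorners ℝ E' H'} [I'.Boundaryless]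
  {M' : Type u} [TopologicalSpace M'] [ChartedSpace H' M'] [IsManifold I' ∞ M']
  {E'' : Type u} [NormedAddCommGroup E''] [NormedSpace ℝ E'']
  {H'' : Type u} [TopologicalSpace H''] {I'' : ModelWithCorners ℝ E'' H''} [I''.Boundaryless]
  {M'' : Type u} [TopologicalSpace M''] [ChartedSpace H'' M''] [IsManifold I'' ∞ M'']

variable (I' I'') in
/-- The derivative of `p` at `y` in the coordinates of the preferred chart at `y₀`. -/
def frameDeriv (p : M' → M'') (y₀ y : M') : E' →L[ℝ] E'' :=
  (show E' →L[ℝ] E'' from mfderiv I' I'' p y).comp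
    (show E' →L[ℝ] E' from mfderiv 𝓘(ℝ, E') I' (extChartAt I' y₀).symm (extChartAt I' y₀ y))

/-- The partial derivative of a smooth map depends smoothly on parameters. -/
lemma contMDiffOn_frameDeriv {P : M → M' → M''} (hP : ContMDiff (I.prod I') I'' ∞ (Function.uncurry P))
    {k : M → M'} (hk : ContMDiff I I' ∞ k) {z₀ : M''} (hz : ∀ x, P x (k x) = z₀) (y₀ : M')
    {N : Opens M} (hN : ∀ x ∈ N, k x ∈ chartDomain H' y₀) :
    ContMDiffOn I 𝓘(ℝ, E' →L[ℝ] E'') ∞ (fun x => frameDeriv I' I'' (P x) y₀ (k x)) N := by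
  intro x₁ hx₁
  have hsrc : ∀ {x}, x ∈ N → k x ∈ (extChartAt I' y₀).source := fun hx => by
    rw [extChartAt_source]
    exact hN _ hx
  have hleft : ∀ {x}, x ∈ N → (extChartAt I' y₀).symm (extChartAt I' y₀ (k x)) = k x := fun hx =>
    (extChartAt I' y₀).left_inv (hsrc hx)
  let Q : M → E' → E'' := fun x v => extChartAt I'' z₀ (P x ((extChartAt I' y₀).symm v))
  have hQ : ContMDiffAt (I.prod 𝓘(ℝ, E')) 𝓘(ℝ, E'') ∞ (Function.uncurry Q)
      (x₁, extChartAt I' y₀ (k x₁)) := by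
    have h₁ : ContMDiffAt (I.prod 𝓘(ℝ, E')) I' ∞
        (fun p : M × E' => (extChartAt I' y₀).symm p.2) (x₁, extChartAt I' y₀ (k x₁)) :=
      ContMDiffAt.comp (x₁, extChartAt I' y₀ (k x₁))
        ((contMDiffOn_extChartAt_symm (I := I') (n := ∞) y₀).contMDiffAt
        ((isOpen_extChartAt_target y₀).mem_nhds ((extChartAt I' y₀).map_source (hsrc hx₁))))
        contMDiffAt_snd
    have h₂ : ContMDiffAt (I.prod 𝓘(ℝ, E')) I'' ∞
        (fun p : M × E' => P p.1 ((extChartAt I' y₀).symm p.2)) (x₁, extChartAt I' y₀ (k x₁)) :=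
      hP.contMDiffAt.comp (x₁, extChartAt I' y₀ (k x₁)) (contMDiffAt_fst.prodMk h₁)
    have h₃ : ContMDiffAt I'' 𝓘(ℝ, E'') ∞ (extChartAt I'' z₀)
        (P x₁ ((extChartAt I' y₀).symm (extChartAt I' y₀ (k x₁)))) := by
      rw [hleft hx₁, hz]
      exact contMDiffAt_extChartAt
    exact ContMDiffAt.comp (x₁, extChartAt I' y₀ (k x₁)) (g := extChartAt I'' z₀)
      (f := fun p : M × E' => P p.1 ((extChartAt I' y₀).symm p.2)) h₃ h₂
  have hk' : ContMDiffAt I 𝓘(ℝ, E') ∞ (fun x => extChartAt I' y₀ (k x)) x₁ :=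
    (contMDiffOn_extChartAt.contMDiffAt ((chartDomain H' y₀).2.mem_nhds (hN x₁ hx₁))).comp x₁
      hk.contMDiffAt
  have key := ContMDiffAt.mfderiv (n := ∞) (m := ∞) Q (fun x => extChartAt I' y₀ (k x)) hQ hk' le_rfl
  have key' : ContMDiffAt I 𝓘(ℝ, E' →L[ℝ] E'') ∞ (fun x => show E' →L[ℝ] E'' from
      mfderiv 𝓘(ℝ, E') 𝓘(ℝ, E'') (Q x) (extChartAt I' y₀ (k x))) x₁ := by
    have e := inTangentCoordinates_model_space (I := 𝓘(ℝ, E')) (I' := 𝓘(ℝ, E''))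
      (fun x => extChartAt I' y₀ (k x)) (fun x => Q x (extChartAt I' y₀ (k x)))
      (fun x => show E' →L[ℝ] E'' from
        mfderiv 𝓘(ℝ, E') 𝓘(ℝ, E'') (Q x) (extChartAt I' y₀ (k x))) x₁
    rw [← e]
    exact key
  refine (key'.congr_of_eventuallyEq ?_).contMDiffWithinAt
  filter_upwards [N.2.mem_nhds hx₁] with x hx
  have hd : MDifferentiableAt 𝓘(ℝ, E') I' (extChartAt I' y₀).symm (extChartAt I' y₀ (k x)) :=
    mdifferentiableAt_extChartAt_symm ((extChartAt I' y₀).map_source (hsrc hx))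
  have hPx : MDifferentiableAt I' I'' (P x) ((extChartAt I' y₀).symm (extChartAt I' y₀ (k x))) :=
    (hP.comp (contMDiff_const.prodMk contMDiff_id)).mdifferentiableAt (by simp)
  have hz' : P x ((extChartAt I' y₀).symm (extChartAt I' y₀ (k x))) = z₀ := by rw [hleft hx, hz]
  have he : MDifferentiableAt I'' 𝓘(ℝ, E'') (extChartAt I'' z₀)
      ((P x ∘ (extChartAt I' y₀).symm) (extChartAt I' y₀ (k x))) := by
    rw [Function.comp_apply, hz']
    exact mdifferentiableAt_extChartAt (mem_chartDomain _)
  have e₁ : tangentMap 𝓘(ℝ, E') 𝓘(ℝ, E'') (Q x) (extChartAt I' y₀ (k x)) =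
      tangentMap I' I'' (P x) (k x) ∘ₗ
        tangentMap 𝓘(ℝ, E') I' (extChartAt I' y₀).symm (extChartAt I' y₀ (k x)) := by
    refine (tangentMap_comp he (hPx.comp _ hd)).trans ?_
    rw [tangentMap_comp hPx hd, Function.comp_apply, hz', tangentMap_extChartAt_self,
      LinearMap.id_comp, hleft hx]
  exact ContinuousLinearMap.ext fun v => (DFunLike.congr_fun e₁ v).symm

end PartialDerivatives

section OneForms

open ExteriorAlgebra (ι)

variable {E : Type u} [NormedAddCommGroup E] [NormedSpace ℝ E] [FiniteDimensional ℝ E]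
  {H : Type u} [TopologicalSpace H] {I : ModelWithCorners ℝ E H} [I.Boundaryless]
  {M : Type u} [TopologicalSpace M] [ChartedSpace H M] [IsManifold I ∞ M]
  (V : Type u) [AddCommGroup V] [Module ℝ V]
  {η : M → Module.Dual ℝ E}

/-- The value of a form on a coordinate vector field. -/
def oneFormCoef (I : ModelWithCorners ℝ E H) (η : M → Module.Dual ℝ E) (x₀ : M) (v : E) (x : M) : ℝ :=
  η x (tangentMap 𝓘(ℝ, E) I (extChartAt I x₀).symm (extChartAt I x₀ x) v)

/-- A differential form in the coordinates of a chart. -/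
def localOneForm (hη : ∀ x₀ v, ContMDiffOn I 𝓘(ℝ, ℝ) ∞ (oneFormCoef I η x₀ v) (chartDomain H x₀))
    (x₀ : M) {κ : Type*} [Fintype κ] (b : Module.Basis κ ℝ E) :
    smoothSections I M V (chartDomain H x₀) :=
  ∑ c, fn V _ _ (hη x₀ (b c)) * dfn V _ _ (contMDiffOn_chartCoord x₀ (b.coord c))

lemma localOneForm_apply
    (hη : ∀ x₀ v, ContMDiffOn I 𝓘(ℝ, ℝ) ∞ (oneFormCoef I η x₀ v) (chartDomain H x₀))
    (x₀ : M) {κ : Type*} [Fintype κ] (b : Module.Basis κ ℝ E) (x : chartDomain H x₀) :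
    (localOneForm V hη x₀ b).1 x = ι ℝ (η x ∘ₗ LinearMap.fst ℝ E V) := by
  rw [localOneForm, sum_apply]
  simp only [mul_apply, fn_apply, dfn_apply, dAt_chartCoord x.2, ← Algebra.smul_def, ← map_smul,
    ← map_sum]
  congr 1
  refine LinearMap.ext fun p => ?_
  have h := DFunLike.congr_fun (tangentMap_symm_comp_chart (I := I) x.2) p.1
  simp only [LinearMap.sum_apply, LinearMap.smul_apply, LinearMap.comp_apply, LinearMap.fst_apply,
    LinearMap.id_apply, smul_eq_mul, oneFormCoef] at h ⊢
  conv_rhs => rw [← h, ← b.sum_repr (tangentMap I 𝓘(ℝ, E) (extChartAt I x₀) x p.1)]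
  simp only [map_sum, map_smul, smul_eq_mul, Module.Basis.coord_apply]
  exact Finset.sum_congr rfl fun c _ => mul_comm _ _

/-- A smooth differential form of degree `1` as a section. -/
def oneForm (hη : ∀ x₀ v, ContMDiffOn I 𝓘(ℝ, ℝ) ∞ (oneFormCoef I η x₀ v) (chartDomain H x₀)) :
    smoothSections I M V ⊤ :=
  ⟨fun x => ι ℝ (η x ∘ₗ LinearMap.fst ℝ E V), smoothSections_of_locally fun x _ => by
    refine ⟨chartDomain H x, le_top, mem_chartDomain _, ?_⟩
    have h : (fun y : chartDomain H x => ι ℝ (η y ∘ₗ LinearMap.fst ℝ E V)) =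
        (localOneForm V hη x (Module.finBasis ℝ E)).1 :=
      funext fun y => (localOneForm_apply V hη x _ y).symm
    exact h ▸ (localOneForm V hη x (Module.finBasis ℝ E)).2⟩

lemma d_oneForm_apply [Module.Finite ℝ V] [Bracket V V]
    (hη : ∀ x₀ v, ContMDiffOn I 𝓘(ℝ, ℝ) ∞ (oneFormCoef I η x₀ v) (chartDomain H x₀))
    (x₀ : M) {κ : Type*} [Fintype κ] (b : Module.Basis κ ℝ E) :
    (deRhamCE I M V ⊤ (oneForm V hη)).1 ⟨x₀, trivial⟩ =
      ∑ c, ι ℝ (dAt I (oneFormCoef I η x₀ (b c)) x₀ ∘ₗ LinearMap.fst ℝ E V) *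
        ι ℝ (b.coord c ∘ₗ LinearMap.fst ℝ E V) := by
  have h₁ : restrictSections I M V le_top (oneForm V hη) = localOneForm V hη x₀ b :=
    section_ext fun y => (localOneForm_apply V hη x₀ b y).symm
  have h₂ := (isDeRhamCE_deRhamCE I M V).res (le_top : chartDomain H x₀ ≤ ⊤) (oneForm V hη)
  rw [h₁] at h₂
  have h₃ := congrArg (fun s => s.1 ⟨x₀, mem_chartDomain _⟩) h₂
  refine h₃.trans ?_
  simp only [localOneForm, map_sum, d_fn_mul, d_dfn, mul_zero, add_zero]
  rw [sum_apply]
  refine Finset.sum_congr rfl fun c _ => ?_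
  rw [mul_apply, dfn_apply, dfn_apply, dAt_chartCoord (mem_chartDomain _),
    tangentMap_extChartAt_self, LinearMap.comp_id]

end OneForms

section LieGroups

open ExteriorAlgebra (ι)

variable {EG G : Type u} [NormedAddCommGroup EG] [NormedSpace ℝ EG] [FiniteDimensional ℝ EG]
  [TopologicalSpace G] [ChartedSpace EG G] [Group G] [LieGroup 𝓘(ℝ, EG) ∞ G]

variable (EG G) in
lemma lieGroup_minSmoothness : LieGroup 𝓘(ℝ, EG) (minSmoothness ℝ 3) G :=
  LieGroup.of_le (n := ∞) (by
    rw [minSmoothness_of_isRCLikeNormedField]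
    exact WithTop.coe_le_coe.2 (le_top : (3 : ℕ∞) ≤ ⊤))

instance : LieLaws (LieAlg EG G) := by
  have := lieGroup_minSmoothness EG G
  have := FiniteDimensional.complete ℝ EG
  refine ⟨add_lie, fun r x y => smul_lie r x y, fun x y => (lie_skew x y).symm, fun x y z => ?_⟩
  have h := lie_jacobi z x y
  rw [← lie_skew ⁅x, y⁆ z, ← lie_skew ⁅y, z⁆ x, ← lie_skew ⁅z, x⁆ y]
  rw [← neg_eq_zero, neg_add_rev, neg_add_rev, neg_neg, neg_neg, neg_neg]
  rw [← h]
  abel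

lemma mdifferentiableAt_mul_left' (a x : G) : MDifferentiableAt 𝓘(ℝ, EG) 𝓘(ℝ, EG) (fun y => a * y) x :=
  (contMDiff_mul_left (I := 𝓘(ℝ, EG)) (n := ∞)).mdifferentiableAt (by simp)

lemma mdifferentiableAt_mul_right' (a x : G) : MDifferentiableAt 𝓘(ℝ, EG) 𝓘(ℝ, EG) (fun y => y * a) x :=
  (contMDiff_mul_right (I := 𝓘(ℝ, EG)) (n := ∞)).mdifferentiableAt (by simp)

/-- The value at `x` of the left-invariant vector field with value `v` at `1`. -/
def leftField (v : LieAlg EG G) (x : G) : EG :=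
  tangentMap 𝓘(ℝ, EG) 𝓘(ℝ, EG) (fun y : G => x * y) 1 v

lemma leftTranslate_leftField (v : LieAlg EG G) (x : G) : leftTranslate EG x (leftField v x) = v := by
  have h := tangentMap_comp (I := 𝓘(ℝ, EG)) (I' := 𝓘(ℝ, EG)) (I'' := 𝓘(ℝ, EG)) (g := fun y : G => x⁻¹ * y)
    (f := fun y : G => x * y) (x := 1)
    (mdifferentiableAt_mul_left' _ _) (mdifferentiableAt_mul_left' _ _)
  rw [show (fun y : G => x⁻¹ * y) ∘ (fun y : G => x * y) = fun y => y from
    funext fun y => inv_mul_cancel_left x y, tangentMap_id, mul_one] at h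
  exact (DFunLike.congr_fun h v).symm

/-- Left translation of tangent vectors to the identity, in the coordinates of a chart. -/
def leftFrame (x₀ x : G) : EG →L[ℝ] EG :=
  frameDeriv 𝓘(ℝ, EG) 𝓘(ℝ, EG) (fun y : G => x⁻¹ * y) x₀ x

lemma contMDiffOn_leftFrame (x₀ : G) :
    ContMDiffOn 𝓘(ℝ, EG) 𝓘(ℝ, EG →L[ℝ] EG) ∞ (leftFrame (EG := EG) x₀) (chartDomain EG x₀) :=
  contMDiffOn_frameDeriv (P := fun x y : G => x⁻¹ * y) (z₀ := 1) (k := fun x => x)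
    ((contMDiff_fst.inv).mul contMDiff_snd) contMDiff_id inv_mul_cancel x₀ fun _ hx => hx

lemma leftFrame_apply (x₀ x : G) (v : EG) : leftFrame x₀ x v = leftTranslate EG x
    (tangentMap 𝓘(ℝ, EG) 𝓘(ℝ, EG) (extChartAt 𝓘(ℝ, EG) x₀).symm (extChartAt 𝓘(ℝ, EG) x₀ x) v) := rfl

lemma leftFrame_self (x : G) (v : EG) : leftFrame x x v = leftTranslate EG x v := by
  rw [leftFrame_apply, tangentMap_extChartAt_symm_self]
  rfl

lemma contMDiffAt_extChartAt_symm_self (x₀ : G) :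
    ContMDiffAt 𝓘(ℝ, EG) 𝓘(ℝ, EG) ∞ (extChartAt 𝓘(ℝ, EG) x₀).symm (extChartAt 𝓘(ℝ, EG) x₀ x₀) := by
  exact (contMDiffOn_extChartAt_symm (I := 𝓘(ℝ, EG)) (n := ∞) x₀).contMDiffAt
    ((isOpen_extChartAt_target x₀).mem_nhds (mem_extChartAt_target x₀))

lemma differentiableAt_leftFrame (x₀ : G) :
    DifferentiableAt ℝ (fun u => leftFrame (EG := EG) x₀ ((extChartAt 𝓘(ℝ, EG) x₀).symm u))
      (extChartAt 𝓘(ℝ, EG) x₀ x₀) := by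
  have h₁ : ContMDiffAt 𝓘(ℝ, EG) 𝓘(ℝ, EG →L[ℝ] EG) ∞ (leftFrame (EG := EG) x₀)
      ((extChartAt 𝓘(ℝ, EG) x₀).symm (extChartAt 𝓘(ℝ, EG) x₀ x₀)) := by
    rw [extChartAt_to_inv]
    exact (contMDiffOn_leftFrame x₀).contMDiffAt ((chartDomain EG x₀).2.mem_nhds (mem_chartDomain _))
  exact ((h₁.comp _ (contMDiffAt_extChartAt_symm_self x₀)).mdifferentiableAt (by simp)).differentiableAt

/-- The left-invariant vector field in the coordinates of a chart. -/
def chartField (x₀ : G) (v : LieAlg EG G) : EG → EG :=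
  VectorField.mpullbackWithin 𝓘(ℝ, EG) 𝓘(ℝ, EG) (extChartAt 𝓘(ℝ, EG) x₀).symm
    (mulInvariantVectorField v) (Set.range 𝓘(ℝ, EG))

lemma tangentMap_chartField (x₀ : G) (v : LieAlg EG G) {u : EG}
    (hu : u ∈ (extChartAt 𝓘(ℝ, EG) x₀).target) :
    tangentMap 𝓘(ℝ, EG) 𝓘(ℝ, EG) (extChartAt 𝓘(ℝ, EG) x₀).symm u (chartField x₀ v u) =
      leftField v ((extChartAt 𝓘(ℝ, EG) x₀).symm u) := by
  have : IsManifold 𝓘(ℝ, EG) 1 G := IsManifold.of_le (n := ∞) (by simp)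
  have h := isInvertible_mfderivWithin_extChartAt_symm (I := 𝓘(ℝ, EG)) hu
  have h' := h.self_apply_inverse (mulInvariantVectorField (I := 𝓘(ℝ, EG)) v ((extChartAt 𝓘(ℝ, EG) x₀).symm u))
  have e : mfderivWithin 𝓘(ℝ, EG) 𝓘(ℝ, EG) (extChartAt 𝓘(ℝ, EG) x₀).symm (Set.range 𝓘(ℝ, EG)) u =
      mfderiv 𝓘(ℝ, EG) 𝓘(ℝ, EG) (extChartAt 𝓘(ℝ, EG) x₀).symm u := by
    rw [show Set.range 𝓘(ℝ, EG) = Set.univ from Set.range_id, mfderivWithin_univ]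
  refine Eq.trans ?_ h'
  exact congrArg (fun L : EG →L[ℝ] EG => L (chartField x₀ v u)) e.symm

lemma leftFrame_chartField (x₀ : G) (v : LieAlg EG G) {u : EG}
    (hu : u ∈ (extChartAt 𝓘(ℝ, EG) x₀).target) :
    leftFrame x₀ ((extChartAt 𝓘(ℝ, EG) x₀).symm u) (chartField x₀ v u) = v := by
  rw [leftFrame_apply, (extChartAt 𝓘(ℝ, EG) x₀).right_inv hu, tangentMap_chartField x₀ v hu,
    leftTranslate_leftField]

lemma chartField_self (x₀ : G) (v : LieAlg EG G) :
    chartField x₀ v (extChartAt 𝓘(ℝ, EG) x₀ x₀) = leftField v x₀ := by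
  have h := tangentMap_chartField x₀ v (mem_extChartAt_target x₀)
  rwa [tangentMap_extChartAt_symm_self, extChartAt_to_inv] at h

lemma differentiableAt_chartField (x₀ : G) (v : LieAlg EG G) :
    DifferentiableAt ℝ (chartField x₀ v) (extChartAt 𝓘(ℝ, EG) x₀ x₀) := by
  have := lieGroup_minSmoothness EG G
  have := FiniteDimensional.complete ℝ EG
  have : IsManifold 𝓘(ℝ, EG) 2 G := IsManifold.of_le (n := ∞) (WithTop.coe_le_coe.2 (le_top : (2 : ℕ∞) ≤ ⊤))
  have h := (mdifferentiableAt_mulInvariantVectorField (I := 𝓘(ℝ, EG)) v (g := x₀)).mdifferentiableWithinAt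
    (s := Set.univ)
  have h' := h.differentiableWithinAt_mpullbackWithin_vectorField
  rw [Set.preimage_univ, Set.univ_inter, show Set.range 𝓘(ℝ, EG) = Set.univ from Set.range_id] at h'
  rw [chartField, show Set.range 𝓘(ℝ, EG) = Set.univ from Set.range_id]
  exact differentiableWithinAt_univ.1 h'

lemma lieBracket_chartField (x₀ : G) (v w : LieAlg EG G) :
    fderiv ℝ (chartField x₀ w) (extChartAt 𝓘(ℝ, EG) x₀ x₀) (leftField v x₀) -
      fderiv ℝ (chartField x₀ v) (extChartAt 𝓘(ℝ, EG) x₀ x₀) (leftField w x₀) =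
      leftField ⁅v, w⁆ x₀ := by
  have := lieGroup_minSmoothness EG G
  have := FiniteDimensional.complete ℝ EG
  have h₁ := congrFun (mulInvariantVector_mlieBracket (I := 𝓘(ℝ, EG)) v w) x₀
  have h₂ : VectorField.mlieBracket 𝓘(ℝ, EG) (mulInvariantVectorField v) (mulInvariantVectorField w) x₀ =
      VectorField.lieBracket ℝ (chartField x₀ v) (chartField x₀ w) (extChartAt 𝓘(ℝ, EG) x₀ x₀) := by
    rw [← VectorField.mlieBracketWithin_univ, VectorField.mlieBracketWithin_apply, mfderiv_extChartAt_self,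
      Set.preimage_univ, Set.univ_inter]
    refine (congrArg (fun L : EG →L[ℝ] EG => L _) ContinuousLinearMap.inverse_id).trans ?_
    rw [← VectorField.lieBracketWithin_univ]
    refine congrArg (fun s => VectorField.lieBracketWithin ℝ (chartField x₀ v) (chartField x₀ w) s _) ?_
    exact Set.range_id
  rw [← chartField_self, ← chartField_self]
  exact (h₁.trans h₂).symm

/-- The structure equation for left translation to the identity. -/
lemma fderiv_leftFrame (x₀ : G) (v w : LieAlg EG G) :
    fderiv ℝ (fun u => leftFrame x₀ ((extChartAt 𝓘(ℝ, EG) x₀).symm u)) (extChartAt 𝓘(ℝ, EG) x₀ x₀)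
        (leftField v x₀) (leftField w x₀) -
      fderiv ℝ (fun u => leftFrame x₀ ((extChartAt 𝓘(ℝ, EG) x₀).symm u)) (extChartAt 𝓘(ℝ, EG) x₀ x₀)
        (leftField w x₀) (leftField v x₀) = -⁅v, w⁆ := by
  have key : ∀ (v : LieAlg EG G) (h : EG),
      (show EG from leftTranslate EG x₀ (fderiv ℝ (chartField x₀ v) (extChartAt 𝓘(ℝ, EG) x₀ x₀) h)) +
      fderiv ℝ (fun u => leftFrame x₀ ((extChartAt 𝓘(ℝ, EG) x₀).symm u)) (extChartAt 𝓘(ℝ, EG) x₀ x₀)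
        h (leftField v x₀) = (0 : EG) := fun v h => by
    have h₁ := (differentiableAt_leftFrame x₀).hasFDerivAt.clm_apply
      (differentiableAt_chartField x₀ v).hasFDerivAt
    have h₂ : HasFDerivAt (fun u => leftFrame x₀ ((extChartAt 𝓘(ℝ, EG) x₀).symm u) (chartField x₀ v u))
        (0 : EG →L[ℝ] EG) (extChartAt 𝓘(ℝ, EG) x₀ x₀) := by
      refine (hasFDerivAt_const (show EG from v) _).congr_of_eventuallyEq ?_
      filter_upwards [(isOpen_extChartAt_target x₀).mem_nhds (mem_extChartAt_target x₀)] with u hu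
      exact leftFrame_chartField x₀ v hu
    have h₃ := DFunLike.congr_fun (h₁.unique h₂) h
    rw [_root_.add_apply, ContinuousLinearMap.comp_apply, ContinuousLinearMap.flip_apply,
      extChartAt_to_inv, leftFrame_self, chartField_self] at h₃
    exact h₃
  have h := congrArg (leftTranslate EG x₀) (lieBracket_chartField x₀ v w)
  rw [leftTranslate_leftField, map_sub] at h
  have e₁ := eq_neg_of_add_eq_zero_right (key v (leftField w x₀))
  have e₂ := eq_neg_of_add_eq_zero_right (key w (leftField v x₀))
  rw [e₁, e₂, ← h]
  exact neg_sub_neg _ _ |>.trans (neg_sub _ _).symm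

end LieGroups

section MaurerCartanForm

open ExteriorAlgebra (ι)

variable {EG G : Type u} [NormedAddCommGroup EG] [NormedSpace ℝ EG] [FiniteDimensional ℝ EG]
  [TopologicalSpace G] [ChartedSpace EG G] [Group G] [LieGroup 𝓘(ℝ, EG) ∞ G]

lemma sum_sum_smul_mul_antisymm {A : Type*} [Ring A] [Algebra ℝ A] {κ : Type*} [Fintype κ]
    (T : κ → κ → ℝ) (x : κ → A) (hx : ∀ a c, x a * x c = -(x c * x a)) :
    ∑ a, ∑ c, T a c • (x a * x c) = (1 / 2 : ℝ) • ∑ a, ∑ c, (T a c - T c a) • (x a * x c) := by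
  have h : ∑ a, ∑ c, T c a • (x a * x c) = -∑ a, ∑ c, T a c • (x a * x c) := by
    rw [Finset.sum_comm, ← Finset.sum_neg_distrib]
    refine Finset.sum_congr rfl fun a _ => ?_
    rw [← Finset.sum_neg_distrib]
    exact Finset.sum_congr rfl fun c _ => by rw [hx c a, smul_neg]
  simp only [sub_smul, Finset.sum_sub_distrib]
  rw [h, sub_neg_eq_add, ← two_smul ℝ, smul_smul]
  norm_num

lemma leftField_leftTranslate (γ : EG) (x : G) : leftField (leftTranslate EG x γ) x = γ := by
  have h := tangentMap_comp (I := 𝓘(ℝ, EG)) (I' := 𝓘(ℝ, EG)) (I'' := 𝓘(ℝ, EG)) (g := fun y : G => x * y)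
    (f := fun y : G => x⁻¹ * y) (x := x)
    (mdifferentiableAt_mul_left' _ _) (mdifferentiableAt_mul_left' _ _)
  rw [show (fun y : G => x * y) ∘ (fun y : G => x⁻¹ * y) = fun y => y from
    funext fun y => mul_inv_cancel_left x y, tangentMap_id, inv_mul_cancel] at h
  exact (DFunLike.congr_fun h γ).symm

variable (EG) in
/-- Left translation of tangent vectors to the identity. -/
def leftEquiv (x : G) : EG ≃ₗ[ℝ] LieAlg EG G where
  __ := leftTranslate EG x
  invFun v := leftField v x
  left_inv γ := leftField_leftTranslate γ x
  right_inv v := leftTranslate_leftField v x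

/-- The components of the Maurer–Cartan form. -/
def mcComponent (ξ : Module.Dual ℝ (LieAlg EG G)) (x : G) : Module.Dual ℝ EG :=
  ξ ∘ₗ leftTranslate EG x

/-- A linear form on the Lie algebra as a continuous linear form on the model space. -/
def dualCLM (ξ : Module.Dual ℝ (LieAlg EG G)) : EG →L[ℝ] ℝ :=
  LinearMap.toContinuousLinearMap (show EG →ₗ[ℝ] ℝ from ξ)

lemma contMDiffOn_mcComponent (ξ : Module.Dual ℝ (LieAlg EG G)) (x₀ : G) (v : EG) :
    ContMDiffOn 𝓘(ℝ, EG) 𝓘(ℝ, ℝ) ∞ (oneFormCoef 𝓘(ℝ, EG) (mcComponent ξ) x₀ v) (chartDomain EG x₀) :=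
  (dualCLM ξ).contMDiff.comp_contMDiffOn ((contMDiffOn_leftFrame x₀).clm_apply contMDiffOn_const)

lemma dAt_mcComponent (ξ : Module.Dual ℝ (LieAlg EG G)) (x₀ : G) (v h : EG) :
    dAt 𝓘(ℝ, EG) (oneFormCoef 𝓘(ℝ, EG) (mcComponent ξ) x₀ v) x₀ h =
      dualCLM ξ (fderiv ℝ (fun u => leftFrame x₀ ((extChartAt 𝓘(ℝ, EG) x₀).symm u))
        (extChartAt 𝓘(ℝ, EG) x₀ x₀) h v) := by
  rw [dAt_self ((contMDiffOn_mcComponent ξ x₀ v).mdifferentiableAt_of_mem (by simp)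
    (chartDomain EG x₀).2 (mem_chartDomain _)), chartDeriv]
  have h₁ := (differentiableAt_leftFrame (EG := EG) x₀).hasFDerivAt.clm_apply
    (hasFDerivAt_const v (extChartAt 𝓘(ℝ, EG) x₀ x₀))
  have h₂ := ((dualCLM ξ).hasFDerivAt.comp _ h₁).fderiv
  refine (DFunLike.congr_fun h₂ h).trans ?_
  simp

/-- The Maurer–Cartan form. -/
def mcForm : FlatForm 𝓘(ℝ, EG) G PUnit.{u + 1} (LieAlg EG G)
    (fun x => leftTranslate EG x ∘ₗ LinearMap.fst ℝ EG PUnit.{u + 1}) where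
  lam :=
    { toFun := fun ξ => oneForm PUnit.{u + 1} (contMDiffOn_mcComponent ξ)
      map_add' := fun ξ ζ => section_ext fun x => (map_add (ι ℝ) (mcComponent ξ x ∘ₗ LinearMap.fst ℝ EG PUnit.{u + 1})
        (mcComponent ζ x ∘ₗ LinearMap.fst ℝ EG PUnit.{u + 1}))
      map_smul' := fun r ξ => section_ext fun x => (map_smul (ι ℝ) r (mcComponent ξ x ∘ₗ LinearMap.fst ℝ EG PUnit.{u + 1})) }
  lam_apply ξ x := rfl
  d_lam ξ := section_ext fun x => by
    let b : Module.Basis _ ℝ EG := (Module.finBasis ℝ (LieAlg EG G)).map (leftEquiv EG (x : G)).symm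
    have hb : ∀ c, b c = leftField (Module.finBasis ℝ (LieAlg EG G) c) (x : G) := fun c => rfl
    have hc : ∀ c, b.coord c = (Module.finBasis ℝ (LieAlg EG G)).coord c ∘ₗ leftTranslate EG (x : G) :=
      fun c => rfl
    refine (d_oneForm_apply PUnit.{u + 1} (contMDiffOn_mcComponent ξ) (x : G) b).trans ?_
    let y : Fin (Module.finrank ℝ (LieAlg EG G)) → Fibre EG PUnit.{u + 1} := fun c =>
      ι ℝ (b.coord c ∘ₗ LinearMap.fst ℝ EG PUnit.{u + 1})
    let T : Fin (Module.finrank ℝ (LieAlg EG G)) → Fin (Module.finrank ℝ (LieAlg EG G)) → ℝ := fun a c =>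
      dAt 𝓘(ℝ, EG) (oneFormCoef 𝓘(ℝ, EG) (mcComponent ξ) (x : G) (b c)) x (b a)
    have h₁ : ∀ c, ι ℝ (dAt 𝓘(ℝ, EG) (oneFormCoef 𝓘(ℝ, EG) (mcComponent ξ) (x : G) (b c)) x ∘ₗ
        LinearMap.fst ℝ EG PUnit.{u + 1}) = ∑ a, T a c • y a := fun c => by
      simp only [y, ← map_smul, ← map_sum]
      congr 1
      refine LinearMap.ext fun p => ?_
      simp only [LinearMap.comp_apply, LinearMap.fst_apply, LinearMap.sum_apply, LinearMap.smul_apply,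
        smul_eq_mul]
      conv_lhs => rw [← b.sum_repr p.1]
      simp only [map_sum, map_smul, smul_eq_mul, Module.Basis.coord_apply]
      exact Finset.sum_congr rfl fun a _ => mul_comm _ _
    have h₂ : ∀ a c, T a c - T c a =
        -ξ ⁅Module.finBasis ℝ (LieAlg EG G) a, Module.finBasis ℝ (LieAlg EG G) c⁆ := fun a c => by
      simp only [T, dAt_mcComponent, hb]
      rw [← map_sub, fderiv_leftFrame]
      exact map_neg ξ _
    have h₃ : ∀ a c, y a * y c = -(y c * y a) := fun a c => covector_anticomm _ _
    simp_rw [h₁, Finset.sum_mul, smul_mul_assoc]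
    rw [Finset.sum_comm]
    refine (sum_sum_smul_mul_antisymm T y h₃).trans ?_
    simp only [h₂]
    rw [maurerCartan, smul_apply, sum_apply]
    simp only [sum_apply, smul_apply, mul_apply, neg_smul, Finset.sum_neg_distrib, smul_neg]
    rfl

end MaurerCartanForm

section GaugeAction

open ExteriorAlgebra (ι)

variable {EG G : Type u} [NormedAddCommGroup EG] [NormedSpace ℝ EG] [FiniteDimensional ℝ EG]
  [TopologicalSpace G] [ChartedSpace EG G] [Group G] [LieGroup 𝓘(ℝ, EG) ∞ G]

lemma contMDiff_conj : ContMDiff (𝓘(ℝ, EG).prod 𝓘(ℝ, EG)) 𝓘(ℝ, EG) ∞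
    (Function.uncurry fun x y : G => x⁻¹ * y * x) :=
  (contMDiff_fst.inv.mul contMDiff_snd).mul contMDiff_fst

lemma mdifferentiableAt_conj (x y : G) :
    MDifferentiableAt 𝓘(ℝ, EG) 𝓘(ℝ, EG) (fun y : G => x⁻¹ * y * x) y :=
  (contMDiff_conj.comp (contMDiff_const.prodMk contMDiff_id)).mdifferentiableAt (by simp)

lemma adInv_one (ν : LieAlg EG G) : adInv EG (1 : G) ν = ν := by
  have h := tangentMap_id (I := 𝓘(ℝ, EG)) (1 : G)
  rw [show (fun y : G => y) = fun y => 1⁻¹ * y * 1 from funext fun y => by simp] at h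
  exact DFunLike.congr_fun h ν

lemma adInv_mul (k x : G) (ν : LieAlg EG G) : adInv EG (k * x) ν = adInv EG x (adInv EG k ν) := by
  have h := tangentMap_comp (I := 𝓘(ℝ, EG)) (I' := 𝓘(ℝ, EG)) (I'' := 𝓘(ℝ, EG))
    (g := fun y : G => x⁻¹ * y * x) (f := fun y : G => k⁻¹ * y * k) (x := 1)
    (mdifferentiableAt_conj _ _) (mdifferentiableAt_conj _ _)
  rw [show (fun y : G => x⁻¹ * y * x) ∘ (fun y : G => k⁻¹ * y * k) =
    fun y => (k * x)⁻¹ * y * (k * x) from funext fun y => by simp [mul_assoc],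
    show k⁻¹ * 1 * k = 1 by simp] at h
  exact DFunLike.congr_fun h ν

lemma leftTranslate_tangentMap_mul (k x : G) (w : EG × EG) :
    leftTranslate EG (k * x) (tangentMap (𝓘(ℝ, EG).prod 𝓘(ℝ, EG)) 𝓘(ℝ, EG)
      (fun p : G × G => p.1 * p.2) (k, x) w) =
    adInv EG x (leftTranslate EG k w.1) + leftTranslate EG x w.2 := by
  have h₁ : tangentMap (𝓘(ℝ, EG).prod 𝓘(ℝ, EG)) 𝓘(ℝ, EG) (fun p : G × G => p.1 * p.2) (k, x) w =
      tangentMap 𝓘(ℝ, EG) 𝓘(ℝ, EG) (fun y : G => y * x) k w.1 +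
        tangentMap 𝓘(ℝ, EG) 𝓘(ℝ, EG) (fun y : G => k * y) x w.2 :=
    mfderiv_prod_eq_add_apply (I := 𝓘(ℝ, EG)) (I' := 𝓘(ℝ, EG)) (I'' := 𝓘(ℝ, EG))
      (f := fun p : G × G => p.1 * p.2) (p := (k, x)) (v := w)
      ((contMDiff_mul 𝓘(ℝ, EG) ∞).mdifferentiableAt (by simp))
  have h₂ := tangentMap_comp (I := 𝓘(ℝ, EG)) (I' := 𝓘(ℝ, EG)) (I'' := 𝓘(ℝ, EG))
    (g := fun y : G => (k * x)⁻¹ * y) (f := fun y : G => k * y) (x := x)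
    (mdifferentiableAt_mul_left' _ _) (mdifferentiableAt_mul_left' _ _)
  rw [show (fun y : G => (k * x)⁻¹ * y) ∘ (fun y : G => k * y) = fun y => x⁻¹ * y from
    funext fun y => by simp [mul_assoc]] at h₂
  have h₃ := tangentMap_comp (I := 𝓘(ℝ, EG)) (I' := 𝓘(ℝ, EG)) (I'' := 𝓘(ℝ, EG))
    (g := fun y : G => (k * x)⁻¹ * y) (f := fun y : G => y * x) (x := k)
    (mdifferentiableAt_mul_left' _ _) (mdifferentiableAt_mul_right' _ _)
  have h₄ := tangentMap_comp (I := 𝓘(ℝ, EG)) (I' := 𝓘(ℝ, EG)) (I'' := 𝓘(ℝ, EG))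
    (g := fun y : G => x⁻¹ * y * x) (f := fun y : G => k⁻¹ * y) (x := k)
    (mdifferentiableAt_conj _ _) (mdifferentiableAt_mul_left' _ _)
  rw [show (fun y : G => x⁻¹ * y * x) ∘ (fun y : G => k⁻¹ * y) =
    (fun y : G => (k * x)⁻¹ * y) ∘ (fun y : G => y * x) from
    funext fun y => by simp [mul_assoc], inv_mul_cancel] at h₄
  rw [h₁, map_add]
  exact congrArg₂ (· + ·) (DFunLike.congr_fun (h₃.symm.trans h₄) w.1) (DFunLike.congr_fun h₂ w.2).symm

lemma gauge_apply (x : G) (γ : EG) (ν : LieAlg EG G) :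
    gauge EG x (γ, ν) = adInv EG x ν + leftTranslate EG x γ := rfl

lemma gauge_mul (k x : G) (w : EG × EG) (ν : LieAlg EG G) :
    gauge EG (k * x) (tangentMap (𝓘(ℝ, EG).prod 𝓘(ℝ, EG)) 𝓘(ℝ, EG)
      (fun p : G × G => p.1 * p.2) (k, x) w, ν) = gauge EG x (w.2, gauge EG k (w.1, ν)) := by
  rw [gauge_apply, leftTranslate_tangentMap_mul, gauge_apply, gauge_apply, adInv_mul, map_add, add_assoc]

lemma gauge_one (ν : LieAlg EG G) : gauge EG (1 : G) (0, ν) = ν := by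
  rw [gauge_apply, adInv_one, map_zero, add_zero]

lemma gauge_inv (x : G) (γ : EG) (ν : LieAlg EG G) :
    gauge EG x⁻¹ (tangentMap 𝓘(ℝ, EG) 𝓘(ℝ, EG) (fun y : G => y⁻¹) x γ, gauge EG x (γ, ν)) = ν := by
  have hi : MDifferentiableAt 𝓘(ℝ, EG) 𝓘(ℝ, EG) (fun y : G => y⁻¹) x :=
    (contMDiff_inv 𝓘(ℝ, EG) ∞).mdifferentiableAt (by simp)
  have h₁ : tangentMap 𝓘(ℝ, EG) (𝓘(ℝ, EG).prod 𝓘(ℝ, EG)) (fun y : G => (y, y⁻¹)) x γ =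
      (γ, tangentMap 𝓘(ℝ, EG) 𝓘(ℝ, EG) (fun y : G => y⁻¹) x γ) := by
    refine (DFunLike.congr_fun (mfderiv_prodMk mdifferentiableAt_id hi) γ).trans ?_
    rw [mfderiv_id]
    rfl
  have h₂ := tangentMap_comp (I := 𝓘(ℝ, EG)) (I' := 𝓘(ℝ, EG).prod 𝓘(ℝ, EG)) (I'' := 𝓘(ℝ, EG))
    (g := fun p : G × G => p.1 * p.2) (f := fun y : G => (y, y⁻¹)) (x := x)
    ((contMDiff_mul 𝓘(ℝ, EG) ∞).mdifferentiableAt (by simp)) (mdifferentiableAt_id.prodMk hi)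
  rw [show (fun p : G × G => p.1 * p.2) ∘ (fun y : G => (y, y⁻¹)) = fun _ => 1 from
    funext fun y => mul_inv_cancel y, tangentMap_const] at h₂
  have h₃ := DFunLike.congr_fun h₂ γ
  rw [LinearMap.comp_apply, h₁, LinearMap.zero_apply] at h₃
  have h₄ := gauge_mul x x⁻¹ (γ, tangentMap 𝓘(ℝ, EG) 𝓘(ℝ, EG) (fun y : G => y⁻¹) x γ) ν
  rw [← h₃, mul_inv_cancel, gauge_one] at h₄
  exact h₄.symm

lemma contMDiff_adInv (ξ : Module.Dual ℝ (LieAlg EG G)) (ν : LieAlg EG G) :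
    ContMDiffOn 𝓘(ℝ, EG) 𝓘(ℝ, ℝ) ∞ (fun x : G => ξ (adInv EG x ν)) (⊤ : Opens G) := by
  have h := contMDiffOn_frameDeriv (I := 𝓘(ℝ, EG)) (I' := 𝓘(ℝ, EG)) (I'' := 𝓘(ℝ, EG))
    (P := fun x y : G => x⁻¹ * y * x) (z₀ := 1) (k := fun _ : G => (1 : G)) contMDiff_conj
    contMDiff_const (fun x => by simp) 1 (N := ⊤) fun _ _ => mem_chartDomain _
  refine ((dualCLM ξ).contMDiff.comp_contMDiffOn (h.clm_apply
    (contMDiffOn_const (c := (show EG from ν))))).congr fun x _ => ?_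
  refine congrArg (fun v => ξ (adInv EG x v)) ?_
  exact (DFunLike.congr_fun (tangentMap_extChartAt_symm_self (I := 𝓘(ℝ, EG)) (1 : G)) ν).symm

/-- The components of the gauge action, as sections. -/
def gaugeSection (ξ : Module.Dual ℝ (LieAlg EG G)) :
    smoothSections 𝓘(ℝ, EG) G (LieAlg EG G) ⊤ :=
  (∑ b, fn (LieAlg EG G) _ _ (contMDiff_adInv ξ (Module.finBasis ℝ (LieAlg EG G) b)) *
    lin 𝓘(ℝ, EG) ⊤ ((Module.finBasis ℝ (LieAlg EG G)).coord b)) +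
  oneForm (LieAlg EG G) (contMDiffOn_mcComponent ξ)

lemma gaugeSection_apply (ξ : Module.Dual ℝ (LieAlg EG G)) (x : (⊤ : Opens G)) :
    (gaugeSection ξ).1 x = ι ℝ (ξ ∘ₗ gauge EG (x : G)) := by
  rw [gaugeSection, add_apply, sum_apply]
  simp only [mul_apply, fn_apply, lin_apply, ← Algebra.smul_def, ← map_smul, ← map_sum]
  refine (map_add (ι ℝ) _ _).symm.trans (congrArg (ι ℝ) (LinearMap.ext fun p => ?_))
  obtain ⟨γ, ν⟩ := p
  simp only [LinearMap.add_apply, LinearMap.sum_apply, LinearMap.smul_apply, LinearMap.comp_apply,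
    LinearMap.fst_apply, LinearMap.snd_apply, gauge_apply, map_add, smul_eq_mul]
  refine congrArg₂ (· + ·) ?_ rfl
  conv_rhs => rw [← (Module.finBasis ℝ (LieAlg EG G)).sum_repr ν]
  simp only [map_sum, map_smul, smul_eq_mul, Module.Basis.coord_apply]
  exact Finset.sum_congr rfl fun a _ => mul_comm _ _

lemma tangentMap_fst (p : G × G) :
    tangentMap (𝓘(ℝ, EG).prod 𝓘(ℝ, EG)) 𝓘(ℝ, EG) (fun p : G × G => p.1) p = LinearMap.fst ℝ EG EG := by
  ext v <;> exact DFunLike.congr_fun (mfderiv_fst (I := 𝓘(ℝ, EG)) (I' := 𝓘(ℝ, EG)) (x := p)) _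

lemma tangentMap_snd (p : G × G) :
    tangentMap (𝓘(ℝ, EG).prod 𝓘(ℝ, EG)) 𝓘(ℝ, EG) (fun p : G × G => p.2) p = LinearMap.snd ℝ EG EG := by
  ext v <;> exact DFunLike.congr_fun (mfderiv_snd (I := 𝓘(ℝ, EG)) (I' := 𝓘(ℝ, EG)) (x := p)) _

variable [T2Space G] [SecondCountableTopology G]

/-- Sections on `G` as differential forms on `G × G`, where the linear forms on the Lie algebra
become the Maurer–Cartan form of the first factor. -/
def toProduct : smoothSections 𝓘(ℝ, EG) G (LieAlg EG G) ⊤ →ₐ[ℝ]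
    smoothSections (𝓘(ℝ, EG).prod 𝓘(ℝ, EG)) (G × G) PUnit.{u + 1} ⊤ :=
  (mcForm.along (contMDiff_fst (I := 𝓘(ℝ, EG)) (J := 𝓘(ℝ, EG)) (M := G) (N := G) (n := ∞))).pull
    (contMDiff_snd (I := 𝓘(ℝ, EG)) (J := 𝓘(ℝ, EG)) (M := G) (N := G) (n := ∞)) ⊤ ⊤ fun _ _ => trivial

lemma toProduct_d (s : smoothSections 𝓘(ℝ, EG) G (LieAlg EG G) ⊤) :
    toProduct (deRhamCE 𝓘(ℝ, EG) G (LieAlg EG G) ⊤ s) =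
      deRhamCE (𝓘(ℝ, EG).prod 𝓘(ℝ, EG)) (G × G) PUnit.{u + 1} ⊤ (toProduct s) :=
  FlatForm.pull_d _ _ _ _ _ s

/-- The fibrewise linear map that defines `toProduct`. -/
def toProductMap (p : G × G) : (EG × EG) × PUnit.{u + 1} →ₗ[ℝ] EG × LieAlg EG G :=
  bundleMap (𝓘(ℝ, EG).prod 𝓘(ℝ, EG)) 𝓘(ℝ, EG) (fun p : G × G => p.2) (fun p => (leftTranslate EG p.1 ∘ₗ
    LinearMap.fst ℝ EG PUnit.{u + 1}) ∘ₗ (tangentMap (𝓘(ℝ, EG).prod 𝓘(ℝ, EG)) 𝓘(ℝ, EG)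
      (fun p : G × G => p.1) p).prodMap LinearMap.id) p

lemma toProductMap_apply (p : G × G) (w : (EG × EG) × PUnit.{u + 1}) :
    toProductMap p w = (w.1.2, leftTranslate EG p.1 w.1.1) := by
  have h₁ := DFunLike.congr_fun (tangentMap_fst (EG := EG) p) w.1
  have h₂ := DFunLike.congr_fun (tangentMap_snd (EG := EG) p) w.1
  exact Prod.ext h₂ (congrArg (leftTranslate EG p.1) h₁)

lemma toProduct_apply (s : smoothSections 𝓘(ℝ, EG) G (LieAlg EG G) ⊤) (p : (⊤ : Opens (G × G))) :
    (toProduct s).1 p = ExteriorAlgebra.map (toProductMap (p : G × G)).dualMap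
      (s.1 ⟨(p : G × G).2, trivial⟩) := rfl

lemma toProduct_injective : Function.Injective (toProduct (EG := EG) (G := G)) := fun s t h => by
  refine section_ext fun x => ?_
  have h₁ := congrArg (fun r => r.1 ⟨((1 : G), (x : G)), trivial⟩) h
  simp only [toProduct_apply] at h₁
  let R : EG × LieAlg EG G →ₗ[ℝ] (EG × EG) × PUnit.{u + 1} :=
    ((((leftEquiv EG (1 : G)).symm.toLinearMap ∘ₗ LinearMap.snd ℝ EG (LieAlg EG G)).prod
      (LinearMap.fst ℝ EG (LieAlg EG G))).prod 0)
  have hR : toProductMap ((1 : G), (x : G)) ∘ₗ R = LinearMap.id := LinearMap.ext fun p => by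
    rw [LinearMap.comp_apply, toProductMap_apply]
    exact Prod.ext rfl ((leftEquiv EG (1 : G)).apply_symm_apply p.2)
  have h₂ := congrArg (ExteriorAlgebra.map R.dualMap) h₁
  rw [map_dualMap_comp, map_dualMap_comp, hR, map_dualMap_id, map_dualMap_id] at h₂
  exact h₂

lemma toProduct_gaugeSection (ξ : Module.Dual ℝ (LieAlg EG G)) : toProduct (gaugeSection ξ) =
    (mcForm.along (contMDiff_mul 𝓘(ℝ, EG) ∞ (G := G))).lam ξ := by
  refine section_ext fun p => ?_
  rw [toProduct_apply, gaugeSection_apply, FlatForm.lam_apply, ExteriorAlgebra.map_apply_ι]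
  refine congrArg (ι ℝ) (LinearMap.ext fun w => congrArg ξ ?_)
  rw [toProductMap_apply]
  exact (leftTranslate_tangentMap_mul _ _ w.1).symm

/-- The gauge action is flat. -/
def gaugeForm : FlatForm 𝓘(ℝ, EG) G (LieAlg EG G) (LieAlg EG G) (gauge EG) where
  lam :=
    { toFun := gaugeSection
      map_add' := fun ξ ζ => section_ext fun x => by
        rw [add_apply, gaugeSection_apply, gaugeSection_apply, gaugeSection_apply, LinearMap.add_comp,
          map_add]
      map_smul' := fun r ξ => section_ext fun x => by
        rw [smul_apply, gaugeSection_apply, gaugeSection_apply, LinearMap.smul_comp, map_smul]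
        rfl }
  lam_apply ξ x := gaugeSection_apply ξ x
  d_lam ξ := by
    apply toProduct_injective
    rw [map_maurerCartan]
    refine (toProduct_d (gaugeSection ξ)).trans ?_
    rw [toProduct_gaugeSection, FlatForm.d_lam]
    exact congrArg (fun l => maurerCartan l ξ) (LinearMap.ext fun ζ => (toProduct_gaugeSection ζ).symm)

variable (EG G) in
/-- The gauge action of the one-object groupoid. -/
def gaugeAction : (delooping EG G).ActionForm (gauge EG) where
  flat := gaugeForm
  one x := LinearMap.ext fun p => by
    have h : tangentMap modelPt 𝓘(ℝ, EG) (fun _ : Pt.{u} => (1 : G)) x p.1 = 0 := by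
      rw [tangentMap_const]
      rfl
    exact (congrArg (fun γ => gauge EG (1 : G) (γ, p.2)) h).trans (gauge_one p.2)
  inv x := LinearMap.ext fun p => gauge_inv x p.1 p.2
  mul z := LinearMap.ext fun p => by
    have h₁ := DFunLike.congr_fun (tangentMap_fst (EG := EG) z) p.1
    have h₂ := DFunLike.congr_fun (tangentMap_snd (EG := EG) z) p.1
    refine (gauge_mul z.1 z.2 p.1 p.2).trans ?_
    exact (congrArg₂ (fun a b => gauge EG z.2 (a, gauge EG z.1 (b, p.2))) h₂ h₁).symm

end GaugeAction

section SmoothFunctors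

variable {E₀ : Type u} [NormedAddCommGroup E₀] [NormedSpace ℝ E₀]
  {H₀ : Type u} [TopologicalSpace H₀] {I₀ : ModelWithCorners ℝ E₀ H₀}
  {M₀ : Type u} [TopologicalSpace M₀] [ChartedSpace H₀ M₀]
  {E₁ : Type u} [NormedAddCommGroup E₁] [NormedSpace ℝ E₁]
  {H₁ : Type u} [TopologicalSpace H₁] {I₁ : ModelWithCorners ℝ E₁ H₁}
  {M₁ : Type u} [TopologicalSpace M₁] [ChartedSpace H₁ M₁]
  {E₂ : Type u} [NormedAddCommGroup E₂] [NormedSpace ℝ E₂]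
  {H₂ : Type u} [TopologicalSpace H₂] {I₂ : ModelWithCorners ℝ E₂ H₂}
  {M₂ : Type u} [TopologicalSpace M₂] [ChartedSpace H₂ M₂]
  {F₀ : Type u} [NormedAddCommGroup F₀] [NormedSpace ℝ F₀]
  {K₀ : Type u} [TopologicalSpace K₀] {J₀ : ModelWithCorners ℝ F₀ K₀}
  {N₀ : Type u} [TopologicalSpace N₀] [ChartedSpace K₀ N₀]
  {F₁ : Type u} [NormedAddCommGroup F₁] [NormedSpace ℝ F₁]
  {K₁ : Type u} [TopologicalSpace K₁] {J₁ : ModelWithCorners ℝ F₁ K₁}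
  {N₁ : Type u} [TopologicalSpace N₁] [ChartedSpace K₁ N₁]
  {F₂ : Type u} [NormedAddCommGroup F₂] [NormedSpace ℝ F₂]
  {K₂ : Type u} [TopologicalSpace K₂] {J₂ : ModelWithCorners ℝ F₂ K₂}
  {N₂ : Type u} [TopologicalSpace N₂] [ChartedSpace K₂ N₂]

/-- Smooth functors between smooth groupoids. -/
structure SmoothFunctor (Γ : SmoothGroupoid I₀ M₀ I₁ M₁ I₂ M₂) (Δ : SmoothGroupoid J₀ N₀ J₁ N₁ J₂ N₂) where
  obj : M₀ → N₀
  mor : M₁ → N₁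
  comp : M₂ → N₂
  smooth_obj : ContMDiff I₀ J₀ ∞ obj
  smooth_mor : ContMDiff I₁ J₁ ∞ mor
  smooth_comp : ContMDiff I₂ J₂ ∞ comp
  map_s : ∀ x, Δ.s (mor x) = obj (Γ.s x)
  map_t : ∀ x, Δ.t (mor x) = obj (Γ.t x)
  map_e : ∀ x, mor (Γ.e x) = Δ.e (obj x)
  map_i : ∀ x, mor (Γ.i x) = Δ.i (mor x)
  map_p : ∀ z, mor (Γ.p z) = Δ.p (comp z)
  map_q : ∀ z, mor (Γ.q z) = Δ.q (comp z)
  map_m : ∀ z, mor (Γ.m z) = Δ.m (comp z)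

namespace SmoothFunctor

/-- The identity functor. -/
def id (Γ : SmoothGroupoid I₀ M₀ I₁ M₁ I₂ M₂) : SmoothFunctor Γ Γ where
  obj x := x
  mor x := x
  comp x := x
  smooth_obj := contMDiff_id
  smooth_mor := contMDiff_id
  smooth_comp := contMDiff_id
  map_s _ := rfl
  map_t _ := rfl
  map_e _ := rfl
  map_i _ := rfl
  map_p _ := rfl
  map_q _ := rfl
  map_m _ := rfl

variable
  [I₀.Boundaryless] [IsManifold I₀ ∞ M₀] [FinDimModel E₀ M₀] [T2Space M₀] [SecondCountableTopology M₀]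
  [I₁.Boundaryless] [IsManifold I₁ ∞ M₁] [FinDimModel E₁ M₁] [T2Space M₁] [SecondCountableTopology M₁]
  [I₂.Boundaryless] [IsManifold I₂ ∞ M₂] [FinDimModel E₂ M₂] [T2Space M₂] [SecondCountableTopology M₂]
  [J₀.Boundaryless] [IsManifold J₀ ∞ N₀] [FinDimModel F₀ N₀] [T2Space N₀] [SecondCountableTopology N₀]
  [J₁.Boundaryless] [IsManifold J₁ ∞ N₁] [FinDimModel F₁ N₁] [T2Space N₁] [SecondCountableTopology N₁]
  [J₂.Boundaryless] [IsManifold J₂ ∞ N₂] [FinDimModel F₂ N₂] [T2Space N₂] [SecondCountableTopology N₂]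
  {V : Type u} [AddCommGroup V] [Module ℝ V] [Module.Finite ℝ V] [Bracket V V] [LieLaws V]
  {Γ : SmoothGroupoid I₀ M₀ I₁ M₁ I₂ M₂} {Δ : SmoothGroupoid J₀ N₀ J₁ N₁ J₂ N₂} (F : SmoothFunctor Γ Δ)

/-- The pullback of an action form along a functor. -/
def pullForm (B : N₁ → (F₁ × V →ₗ[ℝ] V)) (x : M₁) : E₁ × V →ₗ[ℝ] V :=
  B (F.mor x) ∘ₗ (tangentMap I₁ J₁ F.mor x).prodMap LinearMap.id

lemma pullForm_eq (B : N₁ → (F₁ × V →ₗ[ℝ] V)) (x : M₁) : F.pullForm B x =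
    B (F.mor x) ∘ₗ bundleMap I₁ J₁ F.mor (fun _ => LinearMap.snd ℝ E₁ V) x := rfl

lemma pullForm_comp_fst (B : N₁ → (F₁ × V →ₗ[ℝ] V)) (z : M₂) :
    F.pullForm B (Γ.p z) ∘ₗ bundleMap I₂ I₁ Γ.p (fun _ => LinearMap.snd ℝ E₂ V) z =
      (B (Δ.p (F.comp z)) ∘ₗ bundleMap J₂ J₁ Δ.p (fun _ => LinearMap.snd ℝ F₂ V) (F.comp z)) ∘ₗ
        bundleMap I₂ J₂ F.comp (fun _ => LinearMap.snd ℝ E₂ V) z := by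
  have h : F.mor ∘ Γ.p = Δ.p ∘ F.comp := funext F.map_p
  rw [pullForm_eq, LinearMap.comp_assoc, LinearMap.comp_assoc,
    ← bundleMap_snd_comp (F.smooth_mor.mdifferentiableAt (by simp)) (Γ.hp.mdifferentiableAt (by simp)),
    ← bundleMap_snd_comp (Δ.hp.mdifferentiableAt (by simp)) (F.smooth_comp.mdifferentiableAt (by simp)),
    h, F.map_p]

/-- The pullback of an action along a functor. -/
def comap {B : N₁ → (F₁ × V →ₗ[ℝ] V)} (hB : Δ.ActionForm B) : Γ.ActionForm (F.pullForm B) where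
  flat := hB.flat.along F.smooth_mor
  one x := by
    have h : F.mor ∘ Γ.e = Δ.e ∘ F.obj := funext F.map_e
    rw [pullForm_eq, LinearMap.comp_assoc,
      ← bundleMap_snd_comp (F.smooth_mor.mdifferentiableAt (by simp)) (Γ.he.mdifferentiableAt (by simp)),
      h, bundleMap_snd_comp (Δ.he.mdifferentiableAt (by simp)) (F.smooth_obj.mdifferentiableAt (by simp)),
      F.map_e, ← LinearMap.comp_assoc, hB.one]
    rfl
  inv x := by
    have h : F.mor ∘ Γ.i = Δ.i ∘ F.mor := funext F.map_i
    have h₁ : bundleMap I₁ J₁ (F.mor ∘ Γ.i) (F.pullForm B) x =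
        bundleMap I₁ J₁ F.mor (fun _ => LinearMap.snd ℝ E₁ V) (Γ.i x) ∘ₗ
          bundleMap I₁ I₁ Γ.i (F.pullForm B) x :=
      bundleMap_comp (F.pullForm B) (fun _ => LinearMap.snd ℝ E₁ V)
        (F.smooth_mor.mdifferentiableAt (by simp)) (Γ.hi.mdifferentiableAt (by simp))
    have h₂ : bundleMap I₁ J₁ (Δ.i ∘ F.mor) (F.pullForm B) x =
        bundleMap J₁ J₁ Δ.i B (F.mor x) ∘ₗ
          bundleMap I₁ J₁ F.mor (fun _ => LinearMap.snd ℝ E₁ V) x :=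
      bundleMap_comp (fun _ => LinearMap.snd ℝ E₁ V) B
        (Δ.hi.mdifferentiableAt (by simp)) (F.smooth_mor.mdifferentiableAt (by simp))
    rw [pullForm_eq, LinearMap.comp_assoc, ← h₁, h, h₂, F.map_i, ← LinearMap.comp_assoc, hB.inv]
    rfl
  mul z := by
    have h : F.mor ∘ Γ.m = Δ.m ∘ F.comp := funext F.map_m
    have h' : F.mor ∘ Γ.q = Δ.q ∘ F.comp := funext F.map_q
    let C : N₂ → (F₂ × V →ₗ[ℝ] V) := fun z =>
      B (Δ.p z) ∘ₗ bundleMap J₂ J₁ Δ.p (fun _ => LinearMap.snd ℝ F₂ V) z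
    have h₁ : bundleMap I₂ J₁ (Δ.q ∘ F.comp)
        (fun z => C (F.comp z) ∘ₗ bundleMap I₂ J₂ F.comp (fun _ => LinearMap.snd ℝ E₂ V) z) z =
        bundleMap J₂ J₁ Δ.q C (F.comp z) ∘ₗ bundleMap I₂ J₂ F.comp (fun _ => LinearMap.snd ℝ E₂ V) z :=
      bundleMap_comp (fun _ => LinearMap.snd ℝ E₂ V) C
        (Δ.hq.mdifferentiableAt (by simp)) (F.smooth_comp.mdifferentiableAt (by simp))
    have h₂ : bundleMap I₂ J₁ (F.mor ∘ Γ.q)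
        (fun z => F.pullForm B (Γ.p z) ∘ₗ bundleMap I₂ I₁ Γ.p (fun _ => LinearMap.snd ℝ E₂ V) z) z =
        bundleMap I₁ J₁ F.mor (fun _ => LinearMap.snd ℝ E₁ V) (Γ.q z) ∘ₗ bundleMap I₂ I₁ Γ.q
          (fun z => F.pullForm B (Γ.p z) ∘ₗ bundleMap I₂ I₁ Γ.p (fun _ => LinearMap.snd ℝ E₂ V) z) z :=
      bundleMap_comp (fun z => F.pullForm B (Γ.p z) ∘ₗ
          bundleMap I₂ I₁ Γ.p (fun _ => LinearMap.snd ℝ E₂ V) z) (fun _ => LinearMap.snd ℝ E₁ V)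
        (F.smooth_mor.mdifferentiableAt (by simp)) (Γ.hq.mdifferentiableAt (by simp))
    rw [pullForm_eq, LinearMap.comp_assoc,
      ← bundleMap_snd_comp (F.smooth_mor.mdifferentiableAt (by simp)) (Γ.hm.mdifferentiableAt (by simp)),
      h, bundleMap_snd_comp (Δ.hm.mdifferentiableAt (by simp)) (F.smooth_comp.mdifferentiableAt (by simp)),
      F.map_m, ← LinearMap.comp_assoc, hB.mul, pullForm_eq, LinearMap.comp_assoc, LinearMap.comp_assoc,
      ← h₂, h', funext (F.pullForm_comp_fst B), F.map_q]
    exact congrArg (B (Δ.q (F.comp z)) ∘ₗ ·) h₁.symm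

/-- The functor from the pullback of an action to the action. -/
def lift {B : N₁ → (F₁ × V →ₗ[ℝ] V)} (hB : Δ.ActionForm B) :
    DGFunctor (F.comap hB).groupoid hB.groupoid where
  obj := DGHom.ofMap F.smooth_obj (FlatForm.snd I₀ M₀ V)
  mor := DGHom.ofMap F.smooth_mor (FlatForm.snd I₁ M₁ V)
  map_src := (DGHom.ofMap_comp_ofMap _ _ _ _).trans ((DGHom.ofMap_congr _ _ _ _ F.map_s
    fun _ => rfl).trans (DGHom.ofMap_comp_ofMap Γ.hs (F.comap hB).flat F.smooth_obj
      (FlatForm.snd I₀ M₀ V) (A := F.pullForm B)).symm)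
  map_tgt := (DGHom.ofMap_snd_comp_ofMap_snd F.smooth_mor Δ.ht).trans ((DGHom.ofMap_congr _ _ _ _
    F.map_t fun _ => rfl).trans (DGHom.ofMap_snd_comp_ofMap_snd Γ.ht F.smooth_obj).symm)
  map_one := (DGHom.ofMap_snd_comp_ofMap_snd Γ.he F.smooth_mor).trans ((DGHom.ofMap_congr _ _ _ _
    F.map_e fun _ => rfl).trans (DGHom.ofMap_snd_comp_ofMap_snd F.smooth_obj Δ.he).symm)
  map_mul := ⟨DGHom.ofMap F.smooth_comp (FlatForm.snd I₂ M₂ V),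
    (DGHom.ofMap_snd_comp_ofMap_snd F.smooth_comp Δ.hp).trans ((DGHom.ofMap_congr _ _ _ _
      (fun z => (F.map_p z).symm) fun _ => rfl).trans
      (DGHom.ofMap_snd_comp_ofMap_snd Γ.hp F.smooth_mor).symm),
    (DGHom.ofMap_comp_ofMap F.smooth_comp (FlatForm.snd I₂ M₂ V) Δ.hq (hB.flat.along Δ.hp)).trans
      ((DGHom.ofMap_congr _ _ _ _ (fun z => (F.map_q z).symm)
        fun z => (F.pullForm_comp_fst B z).symm).trans
      (DGHom.ofMap_comp_ofMap Γ.hq ((F.comap hB).flat.along Γ.hp) F.smooth_mor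
        (FlatForm.snd I₁ M₁ V)).symm),
    (DGHom.ofMap_snd_comp_ofMap_snd F.smooth_comp Δ.hm).trans ((DGHom.ofMap_congr _ _ _ _
      (fun z => (F.map_m z).symm) fun _ => rfl).trans
      (DGHom.ofMap_snd_comp_ofMap_snd Γ.hm F.smooth_mor).symm)⟩

/-- The functor from an action to the tangent groupoid of the target of a functor. -/
def tangent {A : M₁ → (E₁ × V →ₗ[ℝ] V)} (hA : Γ.ActionForm A) :
    DGFunctor hA.groupoid Δ.zeroForm.groupoid where
  obj := DGHom.ofMap F.smooth_obj (FlatForm.zero I₀ M₀ V)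
  mor := DGHom.ofMap F.smooth_mor (FlatForm.zero I₁ M₁ V)
  map_src := (DGHom.ofMap_comp_ofMap _ _ _ _).trans ((DGHom.ofMap_congr _ _ _ _ F.map_s
    fun _ => Subsingleton.elim _ _).trans (DGHom.ofMap_comp_ofMap _ _ _ _).symm)
  map_tgt := (DGHom.ofMap_comp_ofMap _ _ _ _).trans ((DGHom.ofMap_congr _ _ _ _ F.map_t
    fun _ => Subsingleton.elim _ _).trans (DGHom.ofMap_comp_ofMap _ _ _ _).symm)
  map_one := (DGHom.ofMap_comp_ofMap _ _ _ _).trans ((DGHom.ofMap_congr _ _ _ _ F.map_e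
    fun _ => Subsingleton.elim _ _).trans (DGHom.ofMap_comp_ofMap _ _ _ _).symm)
  map_mul := ⟨DGHom.ofMap F.smooth_comp (FlatForm.zero I₂ M₂ V),
    (DGHom.ofMap_comp_ofMap _ _ _ _).trans ((DGHom.ofMap_congr _ _ _ _ (fun z => (F.map_p z).symm)
      fun _ => Subsingleton.elim _ _).trans (DGHom.ofMap_comp_ofMap _ _ _ _).symm),
    (DGHom.ofMap_comp_ofMap _ _ _ _).trans ((DGHom.ofMap_congr _ _ _ _ (fun z => (F.map_q z).symm)
      fun _ => Subsingleton.elim _ _).trans (DGHom.ofMap_comp_ofMap _ _ _ _).symm),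
    (DGHom.ofMap_comp_ofMap _ _ _ _).trans ((DGHom.ofMap_congr _ _ _ _ (fun z => (F.map_m z).symm)
      fun _ => Subsingleton.elim _ _).trans (DGHom.ofMap_comp_ofMap _ _ _ _).symm)⟩

lemma isGroupoidPullback {B : N₁ → (F₁ × V →ₗ[ℝ] V)} (hB : Δ.ActionForm B) :
    IsGroupoidPullback ((id Γ).tangent (F.comap hB)) (F.lift hB) (F.tangent Γ.zeroForm)
      ((id Δ).tangent hB) :=
  isGroupoidPullback_of_isPullback
    (isPullback_tangentTimes F.smooth_obj (id Γ).smooth_obj (fun _ => rfl) (id Δ).smooth_obj fun _ => rfl)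
    (isPullback_tangentTimes F.smooth_mor (id Γ).smooth_mor (fun _ => rfl) (id Δ).smooth_mor fun _ => rfl)

end SmoothFunctor

end SmoothFunctors

section TransitionFunctor

variable {EX EY EG X Y G : Type u}
  [NormedAddCommGroup EX] [NormedSpace ℝ EX] [FiniteDimensional ℝ EX]
  [TopologicalSpace X] [ChartedSpace EX X] [IsManifold 𝓘(ℝ, EX) ∞ X]
  [NormedAddCommGroup EY] [NormedSpace ℝ EY] [FiniteDimensional ℝ EY]
  [TopologicalSpace Y] [ChartedSpace EY Y] [IsManifold 𝓘(ℝ, EY) ∞ Y]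
  [NormedAddCommGroup EG] [NormedSpace ℝ EG] [FiniteDimensional ℝ EG]
  [TopologicalSpace G] [ChartedSpace EG G] [Group G] [LieGroup 𝓘(ℝ, EG) ∞ G]
  {σ : Y → X} {hσ : Manifold.IsSubmersion 𝓘(ℝ, EY) 𝓘(ℝ, EX) ∞ σ} {g : CechPairs hσ → G}

lemma IsTransitionFunction.map_one (hg : IsTransitionFunction hσ EG g) (y : Y) : g (cechOne y) = 1 :=
  mul_eq_left.1 (hg.cocycle ⟨cechOne y, y, rfl⟩)

lemma IsTransitionFunction.map_inv (hg : IsTransitionFunction hσ EG g) (z : CechPairs hσ) :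
    g (cechInv z) = (g z)⁻¹ :=
  eq_inv_of_mul_eq_one_right ((hg.cocycle ⟨z, z.fst, z.comm.symm⟩).trans (hg.map_one z.fst))

/-- Transition functions as a functor from the Čech groupoid. -/
def IsTransitionFunction.functor (hg : IsTransitionFunction hσ EG g) :
    SmoothFunctor (cechGroupoid hσ) (delooping EG G) where
  obj _ := PUnit.unit
  mor := g
  comp t := (g (cechFst t), g (cechSnd t))
  smooth_obj := contMDiff_const
  smooth_mor := hg.smooth
  smooth_comp := (hg.smooth.comp (cechFst_smooth hσ)).prodMk (hg.smooth.comp (cechSnd_smooth hσ))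
  map_s _ := rfl
  map_t _ := rfl
  map_e := hg.map_one
  map_i := hg.map_inv
  map_p _ := rfl
  map_q _ := rfl
  map_m t := (hg.cocycle t).symm

end TransitionFunctor

end DGAtiyah

end

theorem mainTheorem4
    {EX EY EG X Y G : Type u}
    [NormedAddCommGroup EX] [NormedSpace ℝ EX] [FiniteDimensional ℝ EX]
    [TopologicalSpace X] [T2Space X] [SecondCountableTopology X]
    [ChartedSpace EX X] [IsManifold 𝓘(ℝ, EX) ∞ X]
    [NormedAddCommGroup EY] [NormedSpace ℝ EY] [FiniteDimensional ℝ EY]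
    [TopologicalSpace Y] [T2Space Y] [SecondCountableTopology Y]
    [ChartedSpace EY Y] [IsManifold 𝓘(ℝ, EY) ∞ Y]
    [NormedAddCommGroup EG] [NormedSpace ℝ EG] [FiniteDimensional ℝ EG]
    [TopologicalSpace G] [T2Space G] [SecondCountableTopology G]
    [ChartedSpace EG G] [Group G] [LieGroup 𝓘(ℝ, EG) ∞ G]
    {σ : Y → X} (hσ : Manifold.IsSubmersion 𝓘(ℝ, EY) 𝓘(ℝ, EX) ∞ σ)
    (hsurj : Function.Surjective σ)
    (g : CechPairs hσ → G) (hg : IsTransitionFunction hσ EG g) :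
    ∃ (ℛ : AtiyahLike hσ EG G) (𝒜 : InnerActionLike EG G)
      (𝒞 : CechLike hσ) (ℬ : DeloopingLike EG G)
      (ρ : DGFunctor ℛ 𝒞) (ghat : DGFunctor ℛ 𝒜) (ϱ : DGFunctor 𝒜 ℬ) (dg : DGFunctor 𝒞 ℬ),
      IsResolvedAtiyah g ℛ ∧ IsInnerAction 𝒜 ∧ IsTangentCech 𝒞 ∧ IsTangentDelooping ℬ ∧
      IsAnchor ρ ∧ IsLiftOfTransition g ghat ∧ IsInnerProjection ϱ ∧
      IsDifferentialOfTransition g dg ∧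
      IsGroupoidPullback ρ ghat dg ϱ := by
  let F := hg.functor
  let hA := gaugeAction EG G
  refine ⟨(F.comap hA).groupoid, hA.groupoid, (cechGroupoid hσ).zeroForm.groupoid,
    (delooping EG G).zeroForm.groupoid, (SmoothFunctor.id _).tangent _, F.lift hA,
    (SmoothFunctor.id _).tangent _, F.tangent _, ?_, ?_, ?_, ?_, ?_, ?_, ?_, ?_, F.isGroupoidPullback hA⟩
  · exact ⟨isDeRhamCE_deRhamCE _ _ _, isDeRhamCE_deRhamCE _ _ _, isDeRhamCE_deRhamCE _ _ _,
      DGHom.isGivenBy_ofMap _ _, DGHom.isGivenBy_ofMap _ _, DGHom.isGivenBy_ofMap _ _, DGHom.isGivenBy_ofMap _ _,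
      DGHom.isGivenBy_ofMap _ _, DGHom.isGivenBy_ofMap _ _, DGHom.isGivenBy_ofMap _ _⟩
  · refine ⟨isDeRhamCE_deRhamCE _ _ _, isDeRhamCE_deRhamCE _ _ _, isDeRhamCE_deRhamCE _ _ _,
      DGHom.isGivenBy_ofMap _ _, DGHom.isGivenBy_ofMap _ _, DGHom.isGivenBy_ofMap _ _, DGHom.isGivenBy_ofMap _ _,
      DGHom.isGivenBy_ofMap _ _, ?_, DGHom.isGivenBy_ofMap _ _⟩
    have h : (fun p : G × G => gauge EG p.1 ∘ₗ (LinearMap.fst ℝ EG EG).prodMap LinearMap.id) =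
        fun p : G × G => gauge EG p.1 ∘ₗ (tangentMap (𝓘(ℝ, EG).prod 𝓘(ℝ, EG)) 𝓘(ℝ, EG)
          (fun p : G × G => p.1) p).prodMap LinearMap.id :=
      funext fun p => by rw [tangentMap_fst]
    rw [h]
    exact DGHom.isGivenBy_ofMap _ _
  · exact ⟨isDeRhamCE_deRhamCE _ _ _, isDeRhamCE_deRhamCE _ _ _, isDeRhamCE_deRhamCE _ _ _,
      DGHom.isGivenBy_ofMap _ _, DGHom.isGivenBy_ofMap _ _, DGHom.isGivenBy_ofMap _ _, DGHom.isGivenBy_ofMap _ _,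
      DGHom.isGivenBy_ofMap _ _, DGHom.isGivenBy_ofMap _ _, DGHom.isGivenBy_ofMap _ _⟩
  · exact ⟨isDeRhamCE_deRhamCE _ _ _, isDeRhamCE_deRhamCE _ _ _, isDeRhamCE_deRhamCE _ _ _,
      DGHom.isGivenBy_ofMap _ _, DGHom.isGivenBy_ofMap _ _, DGHom.isGivenBy_ofMap _ _, DGHom.isGivenBy_ofMap _ _,
      DGHom.isGivenBy_ofMap _ _, DGHom.isGivenBy_ofMap _ _, DGHom.isGivenBy_ofMap _ _⟩
  · exact ⟨DGHom.isGivenBy_ofMap _ _, DGHom.isGivenBy_ofMap _ _⟩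
  · exact ⟨DGHom.isGivenBy_ofMap _ _, DGHom.isGivenBy_ofMap _ _⟩
  · exact ⟨DGHom.isGivenBy_ofMap _ _, DGHom.isGivenBy_ofMap _ _⟩
  · exact ⟨DGHom.isGivenBy_ofMap _ _, DGHom.isGivenBy_ofMap _ _⟩
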